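/- Notation. Let $\mathcal H$ be the upper half plane, $q=e^{2\pi i\tau}$, $\overline{\mathbb Q}$ the algebraic closure of $\mathbb Q$ in $\mathbb C$, $\mathbb Q^{\mathrm{cycl}}\subset\overline{\mathbb Q}$ the field generated by all roots of unity, and $\mathbb Q\otimes\hat{\mathbb Z}$ the ring of finite adeles of $\mathbb Q$. *Modular units.* A modular function of weight $0$ for a finite index subgroup $\Gamma\subset\mathrm{SL}_2(\mathbb Z)$ is a $\Gamma$-invariant holomorphic function on $\mathcal H$ which is meromorphic at all cusps. For a subfield $K$ of $\mathbb C$, $\mathcal U(K)$ is the group of units, over all $\Gamma$, of the rings of modular functions of weight $0$, whose $q$-expansion (in fractional powers of $q$) has coefficients in $K$. *Siegel units.* Put $\theta(\tau,z)=q^{1/12}(q_z^{1/2}-q_z^{-1/2})\prod_{n\ge1}(1-q^nq_z)(1-q^nq_z^{-1})$ with $q_z=e^{2\pi iz}$. For $(\alpha,\beta)\in\mathbb Q^2-\mathbb Z^2$, $N\ge1$ with $N\alpha,N\beta\in\mathbb Z$ and an integer $c>2$ with $(c,6)=1$ and $c\equiv1\bmod N$, the function $g_{c,\alpha,\beta}(\tau)=\theta(\tau,\alpha\tau+\beta)^{c^2}/\theta(\tau,c(\alpha\tau+\beta))$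 belongs to $\mathcal U(\mathbb Q^{\mathrm{cycl}})$, and $g_{\alpha,\beta}=g_{c,\alpha,\beta}^{1/(c^2-1)}\in\mathbb Q\otimes\mathcal U(\mathbb Q^{\mathrm{cycl}})$ does not depend on $N$ and $c$. *The group $\Pi'_{\mathbb Q}$.* Let $\mathcal M_k(K)$ be the union over the finite index subgroups $\Gamma\subset\mathrm{SL}_2(\mathbb Z)$ of the spaces $\mathcal M_k(\Gamma,K)$ of modular forms of weight $k$ for $\Gamma$ with $q$-expansion coefficients in $K$, and $\mathcal M(K)=\bigoplus_{k\ge0}\mathcal M_k(K)$; define $\mathcal M(\mathrm{SL}_2(\mathbb Z),K)$ in the same way with $\Gamma=\mathrm{SL}_2(\mathbb Z)$ only. Let $\Pi_{\mathbb Q}$ be the group of automorphisms of the ring $\mathcal M(\overline{\mathbb Q})$ which fix $\mathcal M(\mathrm{SL}_2(\mathbb Z),\mathbb Q)$ pointwise, and let $\Pi'_{\mathbb Q}$ be the group of automorphisms of $\mathcal M(\overline{\mathbb Q})$ generated by $\Pi_{\mathbb Q}$ and by $\mathrm{GL}_2(\mathbb Q)_+$, where $\gamma=\begin{pmatrix}a&b\\c&d\end{pmatrix}$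 acts on $f$ of weight $k$ by $(f*\gamma)(\tau)=(\det\gamma)^{1-k}(f|_k\gamma)(\tau)=(c\tau+d)^{-k}f\bigl(\tfrac{a\tau+b}{c\tau+d}\bigr)$. All these groups act on the right. They act on $\mathcal U(\overline{\mathbb Q})$ by $u*\sigma=(F*\sigma)/(G*\sigma)$ if $u=F/G$ with $F,G\in\mathcal M(\overline{\mathbb Q})$. *The action of $\Pi'_{\mathbb Q}$ on $(\mathbb Q\otimes\hat{\mathbb Z})^2$.* The group $\Pi'_{\mathbb Q}$ acts on row vectors by right multiplication through $\mathrm{GL}_2(\mathbb Q\otimes\hat{\mathbb Z})$: $\gamma\in\mathrm{GL}_2(\mathbb Q)_+$ is sent to its diagonal image, and $\sigma\in\Pi_{\mathbb Q}$ is sent to the $h\in\mathrm{GL}_2(\hat{\mathbb Z})$ as which it acts on the forms for congruence subgroups with coefficients in $\mathbb Q^{\mathrm{cycl}}$. That is, write $h=\gamma_0\begin{pmatrix}1&0\\0&u\end{pmatrix}$ with $\gamma_0\in\mathrm{SL}_2(\hat{\mathbb Z})$, $u=\det h$, and let $\sigma_u$ be the automorphism of $\mathbb Q^{\mathrm{cycl}}$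 raising roots of unity to the power $u$; then for every $N\ge1$, every $f\in\mathcal M_k(\Gamma_N,\mathbb Q^{\mathrm{cycl}})$ with $\Gamma_N$ the principal congruence subgroup of level $N$, and every $\gamma\in\mathrm{SL}_2(\mathbb Z)$ congruent to $\gamma_0$ modulo $N$, the $q$-expansion of $f*\sigma$ is obtained by applying $\sigma_u$ to the coefficients of that of $f|_k\gamma$. *Distributions.* For a locally profinite space $X$ and an abelian group $V$, an algebraic distribution on $X$ with values in $V$ is a $\mathbb Z$-linear map $\mu:\phi\mapsto\int_X\phi\,\mu$ to $V$ from the group of locally constant functions $X\to\mathbb Z$ with compact support. If a group $G$ acts on the right on $X$ and $V$, put $(\phi*g)(x)=\phi(x*g^{-1})$ and $\int_X\phi\,(\mu*g)=\bigl(\int_X(\phi*g^{-1})\,\mu\bigr)*g$. **Theorem.** There is an algebraic distribution $z_{\mathrm{Siegel}}$ on $(\mathbb Q\otimes\hat{\mathbb Z})^2-\{(0,0)\}$ with values in $\mathbb Q\otimes\mathcal U(\mathbb Q^{\mathrm{cycl}})$ such that, for all $r\in\mathbb Q^*$ and all $(a,b)\in\mathbb Q^2$ with $(a,b)\notin r\mathbb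 Z\times r\mathbb Z$, $$\int_{(a+r\hat{\mathbb Z})\times(b+r\hat{\mathbb Z})}z_{\mathrm{Siegel}}=g_{r^{-1}a,\,r^{-1}b}.$$ Moreover the actions of $\Pi'_{\mathbb Q}$ described above exist, i.e. every $\sigma\in\Pi'_{\mathbb Q}$ acts on $\mathcal U(\overline{\mathbb Q})$ and has an image in $\mathrm{GL}_2(\mathbb Q\otimes\hat{\mathbb Z})$, and $z_{\mathrm{Siegel}}$, seen as a distribution with values in $\mathbb Q\otimes\mathcal U(\overline{\mathbb Q})$, is invariant: $z_{\mathrm{Siegel}}*\sigma=z_{\mathrm{Siegel}}$ for all $\sigma\in\Pi'_{\mathbb Q}$. -/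

import Mathlib

open scoped MatrixGroups ModularForm TensorProduct Manifold UpperHalfPlane

noncomputable section

namespace SiegelDistribution

/-! ### Coefficient fields -/

/-- The algebraic closure of `ℚ` in `ℂ`. -/
abbrev Qbar : IntermediateField ℚ ℂ := algebraicClosure ℚ ℂ

/-- The maximal cyclotomic extension of `ℚ` in `ℂ`, generated by all roots of unity. -/
abbrev Qcycl : IntermediateField ℚ ℂ :=
  IntermediateField.adjoin ℚ {ζ : ℂ | ∃ n : ℕ, 0 < n ∧ ζ ^ n = 1}

/-- The field `ℚ` inside `ℂ`. -/
abbrev Q0 : IntermediateField ℚ ℂ := ⊥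

theorem Qcycl_le_Qbar : Qcycl ≤ Qbar := by
  rw [IntermediateField.adjoin_le_iff]
  rintro ζ ⟨n, hn, hζ⟩
  have : IsIntegral ℚ ζ := by
    refine ⟨Polynomial.X ^ n - 1, Polynomial.monic_X_pow_sub_C 1 hn.ne', ?_⟩
    simp [hζ]
  exact (mem_algebraicClosure_iff).2 this.isAlgebraic

/-! ### `q`-expansions -/

/-- `f` has the Laurent expansion `f(τ) = ∑_{n ≥ 0} a n * q ^ ((n - m) / h)` on the upper half
plane, where `q ^ (1 / h) = exp (2 π i τ / h)`. For `m = 0` this is an ordinary `q`-expansion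
without negative terms. -/
def HasQExp (h m : ℕ) (a : ℕ → ℂ) (f : ℍ → ℂ) : Prop :=
  ∀ τ : ℍ, HasSum (fun n : ℕ => a n * Function.Periodic.qParam h τ ^ n)
    (Function.Periodic.qParam h τ ^ m * f τ)

/-- `f` has a `q`-expansion with finitely many negative terms and with coefficients in `K`. -/
def HasLaurentOver (K : IntermediateField ℚ ℂ) (f : ℍ → ℂ) : Prop :=
  ∃ (h m : ℕ) (a : ℕ → ℂ), 0 < h ∧ (∀ n, a n ∈ K) ∧ HasQExp h m a f

theorem hasSum_of_eq {u v : ℕ → ℂ} {x : ℂ} (h : HasSum u x) (e : ∀ n, v n = u n) :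
    HasSum v x := by
  rwa [show v = u from funext e]

theorem HasLaurentOver.mono {K L : IntermediateField ℚ ℂ} (hKL : K ≤ L) {f : ℍ → ℂ}
    (hf : HasLaurentOver K f) : HasLaurentOver L f := by
  obtain ⟨h, m, a, hh, ha, H⟩ := hf
  exact ⟨h, m, a, hh, fun n => hKL (ha n), H⟩

theorem HasQExp.rescale {h m : ℕ} {a : ℕ → ℂ} {f : ℍ → ℂ} (hh : 0 < h) (H : HasQExp h m a f)
    {K : IntermediateField ℚ ℂ} (ha : ∀ n, a n ∈ K) {d : ℕ} (hd : 0 < d) :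
    ∃ b : ℕ → ℂ, (∀ n, b n ∈ K) ∧ HasQExp (h * d) (m * d) b f := by
  classical
  have key : ∀ τ : ℍ, Function.Periodic.qParam ((h * d : ℕ) : ℝ) τ ^ d
      = Function.Periodic.qParam h τ := by
    intro τ
    have h0 : (h : ℂ) ≠ 0 := by exact_mod_cast hh.ne'
    have d0 : (d : ℂ) ≠ 0 := by exact_mod_cast hd.ne'
    simp only [Function.Periodic.qParam]
    rw [← Complex.exp_nat_mul]
    congr 1
    push_cast
    field_simp
  have inj : Function.Injective (fun n : ℕ => n * d) := fun x y hxy =>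
    Nat.eq_of_mul_eq_mul_right hd hxy
  refine ⟨fun n => if d ∣ n then a (n / d) else 0, fun n => ?_, fun τ => ?_⟩
  · dsimp only
    split_ifs
    · exact ha _
    · exact K.zero_mem
  · have := H τ
    rw [← key τ, ← pow_mul, mul_comm d m] at this
    rw [← inj.hasSum_iff]
    · convert this using 2 with n
      simp [Nat.mul_div_cancel _ hd, ← pow_mul, mul_comm d]
    · intro n hn
      have : ¬ d ∣ n := by
        rintro ⟨c, rfl⟩
        exact hn ⟨c, mul_comm _ _⟩
      simp [this]

theorem HasQExp.shift {h m : ℕ} {a : ℕ → ℂ} {f : ℍ → ℂ} (H : HasQExp h m a f)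
    {K : IntermediateField ℚ ℂ} (ha : ∀ n, a n ∈ K) (d : ℕ) :
    ∃ b : ℕ → ℂ, (∀ n, b n ∈ K) ∧ HasQExp h (m + d) b f := by
  classical
  have inj : Function.Injective (fun n : ℕ => n + d) := fun x y hxy =>
    Nat.add_right_cancel hxy
  refine ⟨fun n => if d ≤ n then a (n - d) else 0, fun n => ?_, fun τ => ?_⟩
  · dsimp only
    split_ifs
    · exact ha _
    · exact K.zero_mem
  · have := (H τ).mul_left (Function.Periodic.qParam h τ ^ d)
    rw [← inj.hasSum_iff]
    · have e1 : Function.Periodic.qParam h τ ^ (m + d) * f τ =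
          Function.Periodic.qParam h τ ^ d * (Function.Periodic.qParam h τ ^ m * f τ) := by
        rw [pow_add]
        ring
      rw [e1]
      refine hasSum_of_eq this fun n => ?_
      simp only [Function.comp_apply, Nat.le_add_left, if_true, Nat.add_sub_cancel, pow_add]
      ring
    · intro n hn
      have : ¬ d ≤ n := fun hdn => hn ⟨n - d, Nat.sub_add_cancel hdn⟩
      simp [this]

theorem HasLaurentOver.common {K : IntermediateField ℚ ℂ} {f g : ℍ → ℂ}
    (hf : HasLaurentOver K f) (hg : HasLaurentOver K g) :
    ∃ (h m : ℕ) (a b : ℕ → ℂ), 0 < h ∧ (∀ n, a n ∈ K) ∧ (∀ n, b n ∈ K) ∧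
      HasQExp h m a f ∧ HasQExp h m b g := by
  obtain ⟨h₁, m₁, a, hh₁, ha, Ha⟩ := hf
  obtain ⟨h₂, m₂, b, hh₂, hb, Hb⟩ := hg
  obtain ⟨a', ha', Ha'⟩ := Ha.rescale hh₁ ha hh₂
  obtain ⟨b', hb', Hb'⟩ := Hb.rescale hh₂ hb hh₁
  obtain ⟨a'', ha'', Ha''⟩ := Ha'.shift ha' (m₂ * h₁)
  obtain ⟨b'', hb'', Hb''⟩ := Hb'.shift hb' (m₁ * h₂)
  refine ⟨h₁ * h₂, m₁ * h₂ + m₂ * h₁, a'', b'', Nat.mul_pos hh₁ hh₂, ha'', hb'', Ha'', ?_⟩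
  rwa [mul_comm h₁ h₂, add_comm]

theorem HasLaurentOver.add {K : IntermediateField ℚ ℂ} {f g : ℍ → ℂ}
    (hf : HasLaurentOver K f) (hg : HasLaurentOver K g) : HasLaurentOver K (f + g) := by
  obtain ⟨h, m, a, b, hh, ha, hb, Ha, Hb⟩ := hf.common hg
  refine ⟨h, m, a + b, hh, fun n => K.add_mem (ha n) (hb n), fun τ => ?_⟩
  convert (Ha τ).add (Hb τ) using 1
  · funext n
    simp [add_mul]
  · simp [mul_add]

theorem HasLaurentOver.mul {K : IntermediateField ℚ ℂ} {f g : ℍ → ℂ}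
    (hf : HasLaurentOver K f) (hg : HasLaurentOver K g) : HasLaurentOver K (f * g) := by
  obtain ⟨h, m, a, b, hh, ha, hb, Ha, Hb⟩ := hf.common hg
  refine ⟨h, m + m, fun n => ∑ p ∈ Finset.HasAntidiagonal.antidiagonal n, a p.1 * b p.2, hh,
    fun n => K.sum_mem fun p _ => K.mul_mem (ha _) (hb _), fun τ => ?_⟩
  have h1 := (Ha τ).summable.norm
  have h2 := (Hb τ).summable.norm
  have hs := (summable_norm_sum_mul_antidiagonal_of_summable_norm h1 h2).of_norm.hasSum
  rw [← tsum_mul_tsum_eq_tsum_sum_antidiagonal_of_summable_norm h1 h2, (Ha τ).tsum_eq,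
    (Hb τ).tsum_eq] at hs
  have e1 : Function.Periodic.qParam h τ ^ (m + m) * (f * g) τ =
      Function.Periodic.qParam h τ ^ m * f τ * (Function.Periodic.qParam h τ ^ m * g τ) := by
    simp only [Pi.mul_apply, pow_add]
    ring
  rw [e1]
  refine hasSum_of_eq hs fun n => ?_
  rw [Finset.sum_mul]
  refine Finset.sum_congr rfl fun p hp => ?_
  rw [← Finset.HasAntidiagonal.mem_antidiagonal.1 hp, pow_add]
  ring

theorem HasLaurentOver.const {K : IntermediateField ℚ ℂ} {c : ℂ} (hc : c ∈ K) :
    HasLaurentOver K (fun _ => c) := by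
  refine ⟨1, 0, Pi.single 0 c, one_pos, fun n => ?_, fun τ => ?_⟩
  · by_cases hn : n = 0
    · subst hn
      simpa using hc
    · simp [hn]
  · convert hasSum_single (f := fun n : ℕ =>
      (Pi.single 0 c : ℕ → ℂ) n * Function.Periodic.qParam ((1 : ℕ) : ℝ) τ ^ n) 0 ?_ using 1
    · simp
    · intro n hn
      simp [hn]

theorem HasLaurentOver.neg {K : IntermediateField ℚ ℂ} {f : ℍ → ℂ}
    (hf : HasLaurentOver K f) : HasLaurentOver K (-f) := by
  have := (HasLaurentOver.const (K := K) (K.neg_mem K.one_mem)).mul hf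
  convert this using 1
  funext τ
  simp

/-! ### Modular functions of weight `0` and modular units -/

/-- Modular functions of weight `0` for `Γ`: holomorphic on the upper half plane, `Γ`-invariant,
and meromorphic at all cusps. -/
structure IsModularFunction (Γ : Subgroup SL(2, ℤ)) (f : ℍ → ℂ) : Prop where
  holo : MDiff f
  invariant : ∀ γ ∈ Γ, ∀ τ : ℍ, f (γ • τ) = f τ
  merom : ∀ γ : SL(2, ℤ), HasLaurentOver ⊤ (fun τ => f (γ • τ))

/-- The ring of modular functions of weight `0`, for some finite index subgroup of `SL(2, ℤ)`,
whose `q`-expansion has coefficients in `K`. -/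
def modularFunctions (K : IntermediateField ℚ ℂ) : Subring (ℍ → ℂ) where
  carrier := {f | (∃ Γ : Subgroup SL(2, ℤ), Γ.FiniteIndex ∧ IsModularFunction Γ f) ∧
    HasLaurentOver K f}
  mul_mem' := by
    rintro f g ⟨⟨Γ, hΓ, hf⟩, hfK⟩ ⟨⟨Γ', hΓ', hg⟩, hgK⟩
    refine ⟨⟨Γ ⊓ Γ', inferInstance, ⟨hf.holo.mul hg.holo, ?_, ?_⟩⟩, hfK.mul hgK⟩
    · intro γ hγ τ
      simp only [Pi.mul_apply, hf.invariant γ hγ.1 τ, hg.invariant γ hγ.2 τ]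
    · exact fun γ => (hf.merom γ).mul (hg.merom γ)
  add_mem' := by
    rintro f g ⟨⟨Γ, hΓ, hf⟩, hfK⟩ ⟨⟨Γ', hΓ', hg⟩, hgK⟩
    refine ⟨⟨Γ ⊓ Γ', inferInstance, ⟨hf.holo.add hg.holo, ?_, ?_⟩⟩, hfK.add hgK⟩
    · intro γ hγ τ
      simp only [Pi.add_apply, hf.invariant γ hγ.1 τ, hg.invariant γ hγ.2 τ]
    · exact fun γ => (hf.merom γ).add (hg.merom γ)
  neg_mem' := by
    rintro f ⟨⟨Γ, hΓ, hf⟩, hfK⟩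
    refine ⟨⟨Γ, hΓ, ⟨hf.holo.neg, ?_, ?_⟩⟩, hfK.neg⟩
    · intro γ hγ τ
      simp only [Pi.neg_apply, hf.invariant γ hγ τ]
    · exact fun γ => (hf.merom γ).neg
  zero_mem' := ⟨⟨⊤, inferInstance, ⟨mdifferentiable_const, fun _ _ _ => rfl,
    fun _ => HasLaurentOver.const (IntermediateField.zero_mem _)⟩⟩,
      HasLaurentOver.const (IntermediateField.zero_mem _)⟩
  one_mem' := ⟨⟨⊤, inferInstance, ⟨mdifferentiable_const, fun _ _ _ => rfl,
    fun _ => HasLaurentOver.const (IntermediateField.one_mem _)⟩⟩,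
      HasLaurentOver.const (IntermediateField.one_mem _)⟩

theorem modularFunctions_mono {K L : IntermediateField ℚ ℂ} (h : K ≤ L) :
    modularFunctions K ≤ modularFunctions L :=
  fun _ hf => ⟨hf.1, hf.2.mono h⟩

/-- The group `𝒰(K)` of modular units whose `q`-expansion has coefficients in `K`. (If a modular
unit has coefficients in `K`, so has its inverse, because `K` is a field.) -/
abbrev ModularUnits (K : IntermediateField ℚ ℂ) : Type := (modularFunctions K)ˣ

/-- The `ℚ`-vector space `ℚ ⊗ 𝒰(K)`. -/
abbrev QModularUnits (K : IntermediateField ℚ ℂ) : Type := ℚ ⊗[ℤ] Additive (ModularUnits K)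

/-- The linear map on `ℚ ⊗ 𝒰` induced by a homomorphism of groups of units. -/
def QModularUnits.map {K L : IntermediateField ℚ ℂ} (A : ModularUnits K →* ModularUnits L) :
    QModularUnits K →ₗ[ℤ] QModularUnits L :=
  (MonoidHom.toAdditive A).toIntLinearMap.lTensor ℚ

/-- The inclusion of `𝒰(ℚ^cycl)` in `𝒰(ℚbar)`. -/
def unitsInclusion : ModularUnits Qcycl →* ModularUnits Qbar :=
  Units.map (Subring.inclusion (modularFunctions_mono Qcycl_le_Qbar)).toMonoidHom

/-! ### Siegel units -/

/-- The theta function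
`θ(τ, z) = q^(1/12) (q_z^(1/2) - q_z^(-1/2)) ∏_{n ≥ 1} (1 - q^n q_z) (1 - q^n q_z⁻¹)`,
with `q = exp (2 π i τ)` and `q_z = exp (2 π i z)`. -/
def theta (τ : ℍ) (z : ℂ) : ℂ :=
  Complex.exp (2 * Real.pi * Complex.I * τ / 12) *
    (Complex.exp (Real.pi * Complex.I * z) - Complex.exp (-(Real.pi * Complex.I * z))) *
    ∏' n : ℕ, ((1 - Complex.exp (2 * Real.pi * Complex.I * ((n + 1) * τ + z))) *
      (1 - Complex.exp (2 * Real.pi * Complex.I * ((n + 1) * τ - z))))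

/-- The function `g_{c, α, β}(τ) = θ(τ, α τ + β) ^ (c ^ 2) / θ(τ, c (α τ + β))`. -/
def siegelFunction (c : ℕ) (α β : ℚ) (τ : ℍ) : ℂ :=
  theta τ (α * τ + β) ^ (c ^ 2) / theta τ (c * (α * τ + β))

/-- `x` is the Siegel unit `g_{α, β} = g_{c, α, β} ^ (1 / (c ^ 2 - 1))` of `ℚ ⊗ 𝒰(ℚ^cycl)`:
for all `N ≥ 1` with `N α, N β ∈ ℤ` and all integers `c > 2` prime to `6` with `c ≡ 1 mod N`, the
function `g_{c, α, β}` is an element of `𝒰(ℚ^cycl)` and `x` is its `(c ^ 2 - 1)`-th root. -/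
def IsSiegelUnit (α β : ℚ) (x : QModularUnits Qcycl) : Prop :=
  ∀ N c : ℕ, 0 < N → (∃ m : ℤ, N * α = m) → (∃ m : ℤ, N * β = m) →
    2 < c → c.Coprime 6 → c ≡ 1 [MOD N] →
    ∃ u : ModularUnits Qcycl, (∀ τ : ℍ, (u : modularFunctions Qcycl).1 τ = siegelFunction c α β τ) ∧
      x = (1 / ((c : ℚ) ^ 2 - 1)) ⊗ₜ[ℤ] Additive.ofMul u

/-! ### The algebra of modular forms -/

/-- `ℳ_k(Γ, K)`: modular forms of weight `k` for `Γ` with `q`-expansion coefficients in `K`. -/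
def modularForms (k : ℕ) (Γ : Subgroup SL(2, ℤ)) (K : IntermediateField ℚ ℂ) : Set (ℍ → ℂ) :=
  {f | (∃ F : ModularForm (Γ.map (Matrix.SpecialLinearGroup.mapGL ℝ)) k, ⇑F = f) ∧
    ∃ (h : ℕ) (a : ℕ → ℂ), 0 < h ∧ (∀ n, a n ∈ K) ∧ HasQExp h 0 a f}

/-- `ℳ_k(K)`: the union of the `ℳ_k(Γ, K)` over all finite index subgroups `Γ`. -/
def allModularForms (k : ℕ) (K : IntermediateField ℚ ℂ) : Set (ℍ → ℂ) :=
  {f | ∃ Γ : Subgroup SL(2, ℤ), Γ.FiniteIndex ∧ f ∈ modularForms k Γ K}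

/-- `ℳ(SL(2, ℤ), K)`: the ring of functions generated by the `ℳ_k(SL(2, ℤ), K)`, `k ≥ 0`; it is
their direct sum, as functions. -/
def levelOneRing (K : IntermediateField ℚ ℂ) : Subring (ℍ → ℂ) :=
  Subring.closure {f | ∃ k : ℕ, f ∈ modularForms k ⊤ K}

/-- `ℳ(K)`: the ring of functions generated by the `ℳ_k(K)`, `k ≥ 0`; it is their direct sum, as
functions. -/
def modularFormRing (K : IntermediateField ℚ ℂ) : Subring (ℍ → ℂ) :=
  Subring.closure {f | ∃ k : ℕ, f ∈ allModularForms k K}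

/-- The ring automorphisms of `ℳ(ℚbar)`. A group of automorphisms acts on the right on `ℳ(ℚbar)`
by `f * σ = σ f`; thus the product `σ₁ σ₂` for the right action is the composition `σ₂ ∘ σ₁`. -/
abbrev AutM : Type := RingAut (modularFormRing Qbar)

/-- `Π_ℚ`: the automorphisms of `ℳ(ℚbar)` over `ℳ(SL(2, ℤ), ℚ)`. -/
def PiQ : Subgroup AutM where
  carrier := {σ | ∀ F : modularFormRing Qbar, (F : ℍ → ℂ) ∈ levelOneRing Q0 → σ F = F}
  mul_mem' := by
    intro σ τ hσ hτ F hF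
    rw [RingAut.mul_apply, hτ F hF, hσ F hF]
  one_mem' := fun _ _ => rfl
  inv_mem' := by
    intro σ hσ F hF
    conv_lhs => rw [← hσ F hF]
    exact σ.symm_apply_apply F

/-- The right action `f * γ = (det γ) ^ (1 - k) f|_k γ` of `γ ∈ GL(2, ℚ)⁺` in weight `k`. -/
def starAction (k : ℕ) (f : ℍ → ℂ) (γ : GL(2, ℚ)⁺) : ℍ → ℂ :=
  (((Matrix.GeneralLinearGroup.det (γ : GL (Fin 2) ℚ) : ℚ) : ℂ) ^ (1 - (k : ℤ))) •
    (f ∣[(k : ℤ)] Matrix.GeneralLinearGroup.map (algebraMap ℚ ℝ) (γ : GL (Fin 2) ℚ))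

/-- The automorphism `σ` of `ℳ(ℚbar)` is the action of `γ ∈ GL(2, ℚ)⁺`. -/
def IsStarAction (σ : AutM) (γ : GL(2, ℚ)⁺) : Prop :=
  ∀ (k : ℕ) (F : modularFormRing Qbar), (F : ℍ → ℂ) ∈ allModularForms k Qbar →
    (σ F : ℍ → ℂ) = starAction k F γ

/-- `Π'_ℚ`: the group of automorphisms of `ℳ(ℚbar)` generated by `Π_ℚ` and `GL(2, ℚ)⁺`. -/
def PiQ' : Subgroup AutM :=
  Subgroup.closure ({σ | σ ∈ PiQ} ∪ {σ | ∃ γ : GL(2, ℚ)⁺, IsStarAction σ γ})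

/-- `A` is the action of `σ` on `𝒰(ℚbar)`: if `u = F / G` with `F, G ∈ ℳ(ℚbar)`, then
`A u = (σ F) / (σ G)`. -/
def IsUnitAction (σ : AutM) (A : ModularUnits Qbar →* ModularUnits Qbar) : Prop :=
  ∀ (u : ModularUnits Qbar) (F G : modularFormRing Qbar),
    (F : ℍ → ℂ) = (u : modularFunctions Qbar).1 * (G : ℍ → ℂ) →
    (σ F : ℍ → ℂ) = (A u : modularFunctions Qbar).1 * (σ G : ℍ → ℂ)

/-! ### Adeles, and the map from `Π'_ℚ` to `GL₂(ℚ ⊗ ℤ^)` -/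

/-- `ℚ ⊗ ℤ^`, the ring of finite adeles of `ℚ`. -/
abbrev Af : Type := IsDedekindDomain.FiniteAdeleRing ℤ ℚ

/-- The elements of `ℤ^` inside the ring of finite adeles. -/
def IsIntegralAdele (x : Af) : Prop :=
  ∀ v : IsDedekindDomain.HeightOneSpectrum ℤ, x v ∈ v.adicCompletionIntegers ℚ

/-- `x ≡ y` modulo `r ℤ^`. -/
def AdeleCong (r : ℚ) (x y : Af) : Prop :=
  ∃ t : Af, IsIntegralAdele t ∧ x = y + algebraMap ℚ Af r * t

/-- The elements of `GL₂(ℤ^)` inside `GL₂(ℚ ⊗ ℤ^)`. -/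
def IsIntegralGL (g : GL (Fin 2) Af) : Prop :=
  (∀ i j, IsIntegralAdele (g.1 i j)) ∧ ∀ i j, IsIntegralAdele ((g⁻¹).1 i j)

/-- The automorphism `σ` acts on the forms for congruence subgroups with coefficients in `ℚ^cycl`
as `h = γ₀ · diag(1, u) ∈ GL₂(ℤ^)`, with `γ₀ ∈ SL₂(ℤ^)` and `u = det h`: if `s = σ_u` is the
automorphism of `ℚ^cycl` raising roots of unity to the power `u`, and if `γ ∈ SL(2, ℤ)` is
congruent to `γ₀` modulo `N`, then for `f` of level `N` the `q`-expansion of `f * σ` is obtained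
by applying `s` to the coefficients of that of `f|_k γ`. -/
def ActsAs (σ : AutM) (h : GL (Fin 2) Af) : Prop :=
  IsIntegralGL h ∧ ∃ s : Qcycl ≃ₐ[ℚ] Qcycl,
    (∀ (m : ℕ) (j : ℤ), 0 < m → AdeleCong m (h.1.det) (j : Af) →
      ∀ ζ : Qcycl, ζ ^ m = 1 → s ζ = ζ ^ j) ∧
    ∀ (N : ℕ) (γ : SL(2, ℤ)), 0 < N →
      (∀ i j, AdeleCong N (((γ.1.map (Int.cast : ℤ → Af)) * Matrix.diagonal ![1, h.1.det]) i j)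
        (h.1 i j)) →
      ∀ (k : ℕ) (F : modularFormRing Qbar),
        (F : ℍ → ℂ) ∈ modularForms k (CongruenceSubgroup.Gamma N) Qcycl →
        ∃ (w : ℕ) (a : ℕ → Qcycl), 0 < w ∧
          HasQExp w 0 (fun n => (a n : ℂ)) ((F : ℍ → ℂ) ∣[(k : ℤ)] γ) ∧
          HasQExp w 0 (fun n => (s (a n) : ℂ)) (σ F : ℍ → ℂ)

/-- The map from `Π'_ℚ` to `GL₂(ℚ ⊗ ℤ^)`, as a set of pairs `(σ, g)`: it is the subgroup generated
by the pairs `(σ, γ)`, where `σ` is the action of `γ ∈ GL(2, ℚ)⁺`, and the pairs `(σ, h)`, where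
`σ ∈ Π_ℚ` acts as `h ∈ GL₂(ℤ^)` on the forms for congruence subgroups with coefficients in
`ℚ^cycl`. The second factor is opposite because automorphisms are composed as left actions. -/
def adelicGraph : Subgroup (AutM × (GL (Fin 2) Af)ᵐᵒᵖ) :=
  Subgroup.closure
    ({p | ∃ γ : GL(2, ℚ)⁺, IsStarAction p.1 γ ∧
        p.2 = MulOpposite.op
          (Matrix.GeneralLinearGroup.map (algebraMap ℚ Af) (γ : GL (Fin 2) ℚ))} ∪
      {p | p.1 ∈ PiQ ∧ ActsAs p.1 p.2.unop})

/-! ### Algebraic distributions -/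

/-- Locally constant functions with compact support and integral values. -/
def LCc (X : Type*) [TopologicalSpace X] : Submodule ℤ (X → ℤ) where
  carrier := {φ | IsLocallyConstant φ ∧ HasCompactSupport φ}
  add_mem' := fun hf hg => ⟨hf.1.add hg.1, hf.2.add hg.2⟩
  zero_mem' := ⟨IsLocallyConstant.const 0, HasCompactSupport.zero⟩
  smul_mem' := fun c _ hf => ⟨hf.1.comp (fun n => c • n),
    hf.2.comp_left (g := fun n : ℤ => c • n) (smul_zero c)⟩

/-- Algebraic distributions on `X` with values in `V`. -/
abbrev AlgDistribution (X : Type*) [TopologicalSpace X] (V : Type*) [AddCommGroup V] : Type _ :=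
  LCc X →ₗ[ℤ] V

/-- Composition of test functions with a homeomorphism. -/
def LCc.comp {X : Type*} [TopologicalSpace X] (e : X ≃ₜ X) : LCc X →ₗ[ℤ] LCc X where
  toFun φ := ⟨φ.1 ∘ e, φ.2.1.comp_continuous e.continuous,
    φ.2.2.comp_isClosedEmbedding e.isClosedEmbedding⟩
  map_add' _ _ := rfl
  map_smul' _ _ := rfl

/-- The space `(ℚ ⊗ ℤ^)² - (0, 0)` of nonzero row vectors. -/
abbrev X1 : Type := {x : Fin 2 → Af // x ≠ 0}

theorem vecMul_vecMul_inv (g : GL (Fin 2) Af) (x : Fin 2 → Af) :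
    Matrix.vecMul (Matrix.vecMul x g.1) (g⁻¹).1 = x := by
  rw [Matrix.vecMul_vecMul, ← Units.val_mul, mul_inv_cancel, Units.val_one, Matrix.vecMul_one]

theorem vecMul_inv_vecMul (g : GL (Fin 2) Af) (x : Fin 2 → Af) :
    Matrix.vecMul (Matrix.vecMul x (g⁻¹).1) g.1 = x := by
  rw [Matrix.vecMul_vecMul, ← Units.val_mul, inv_mul_cancel, Units.val_one, Matrix.vecMul_one]

theorem vecMul_ne_zero (g : GL (Fin 2) Af) {x : Fin 2 → Af} (hx : x ≠ 0) :
    Matrix.vecMul x g.1 ≠ 0 := fun h => hx (by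
  rw [← vecMul_vecMul_inv g x, h, Matrix.zero_vecMul])

/-- The right action `x * g` of `GL₂(ℚ ⊗ ℤ^)` on `(ℚ ⊗ ℤ^)² - (0, 0)`. -/
def rightMul (g : GL (Fin 2) Af) : X1 ≃ₜ X1 where
  toFun x := ⟨Matrix.vecMul x.1 g.1, vecMul_ne_zero g x.2⟩
  invFun x := ⟨Matrix.vecMul x.1 (g⁻¹).1, vecMul_ne_zero g⁻¹ x.2⟩
  left_inv x := Subtype.ext (vecMul_vecMul_inv g x.1)
  right_inv x := Subtype.ext (vecMul_inv_vecMul g x.1)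
  continuous_toFun :=
    (Continuous.matrix_vecMul continuous_subtype_val continuous_const).subtype_mk _
  continuous_invFun :=
    (Continuous.matrix_vecMul continuous_subtype_val continuous_const).subtype_mk _

/-- The right action on test functions: `(φ * g)(x) = φ(x * g⁻¹)`. -/
def LCc.act (φ : LCc X1) (g : GL (Fin 2) Af) : LCc X1 := LCc.comp (rightMul g⁻¹) φ

/-- The right action `∫ φ (μ * g) = (∫ (φ * g⁻¹) μ) * g` on distributions with values in `V`,
where `A` is the action of `g` on `V`. -/
def AlgDistribution.act {V : Type*} [AddCommGroup V] (μ : AlgDistribution X1 V)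
    (g : GL (Fin 2) Af) (A : V →ₗ[ℤ] V) : AlgDistribution X1 V where
  toFun φ := A (μ (LCc.act φ g⁻¹))
  map_add' φ ψ := by simp [LCc.act]
  map_smul' c φ := by simp [LCc.act]

/-! ### Boxes -/

theorem isCompact_integralAdele : IsCompact {x : Af | IsIntegralAdele x} := by
  have hc (v : IsDedekindDomain.HeightOneSpectrum ℤ) :
      CompactSpace (v.adicCompletionIntegers ℚ) := by
    have : Fact (Rat.HeightOneSpectrum.primesEquiv v).1.Prime :=
      ⟨(Rat.HeightOneSpectrum.primesEquiv v).2⟩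
    have hS : IsCompact (PadicInt.subring (Rat.HeightOneSpectrum.primesEquiv v).1 :
        Set ℚ_[(Rat.HeightOneSpectrum.primesEquiv v).1]) :=
      isCompact_iff_compactSpace.2 (PadicInt.compactSpace _)
    have hB := Rat.HeightOneSpectrum.adicCompletion.padicEquiv_bijOn v
    refine isCompact_iff_compactSpace.1 ?_
    have hpre : (v.adicCompletionIntegers ℚ : Set (v.adicCompletion ℚ)) =
        (Rat.HeightOneSpectrum.adicCompletion.padicEquiv v).toHomeomorph ⁻¹'
          (PadicInt.subring (Rat.HeightOneSpectrum.primesEquiv v).1 :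
        Set ℚ_[(Rat.HeightOneSpectrum.primesEquiv v).1]) := by
      ext x
      refine ⟨fun hx => hB.mapsTo hx, fun hx => ?_⟩
      obtain ⟨y, hy, hyx⟩ := hB.surjOn hx
      rwa [← (Rat.HeightOneSpectrum.adicCompletion.padicEquiv v).injective hyx]
    rw [hpre]
    exact (Homeomorph.isCompact_preimage _).2 hS
  have key : {x : Af | IsIntegralAdele x} = Set.range (RestrictedProduct.structureMap
      (fun v : IsDedekindDomain.HeightOneSpectrum ℤ => v.adicCompletion ℚ)
      (fun v => (v.adicCompletionIntegers ℚ : Set (v.adicCompletion ℚ))) Filter.cofinite) := by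
    ext x
    constructor
    · intro hx
      exact ⟨fun v => ⟨x v, hx v⟩, rfl⟩
    · rintro ⟨y, rfl⟩ v
      exact (y v).2
  rw [key]
  exact isCompact_range RestrictedProduct.isEmbedding_structureMap.continuous

theorem isOpen_integralAdele : IsOpen {x : Af | IsIntegralAdele x} :=
  RestrictedProduct.isOpen_forall_mem
    (R := fun v : IsDedekindDomain.HeightOneSpectrum ℤ => v.adicCompletion ℚ)
    (A := fun v => (v.adicCompletionIntegers ℚ : Set (v.adicCompletion ℚ)))
    (fun _ => Valued.isOpen_valuationSubring _)

/-- A rational number which is an integral adele is an integer. -/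
theorem exists_int_of_isIntegralAdele {q : ℚ} (hq : IsIntegralAdele (algebraMap ℚ Af q)) :
    ∃ m : ℤ, q = m := by
  obtain ⟨m, hm⟩ := IsDedekindDomain.HeightOneSpectrum.mem_integers_of_valuation_le_one
    (R := ℤ) ℚ q (fun v => by
      have := hq v
      rw [IsDedekindDomain.HeightOneSpectrum.mem_adicCompletionIntegers,
        IsDedekindDomain.FiniteAdeleRing.algebraMap_apply,
        IsDedekindDomain.HeightOneSpectrum.valuedAdicCompletion_eq_valuation'] at this
      exact this)
  exact ⟨m, by rw [← hm]; rfl⟩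

/-- The homeomorphism `t ↦ a + r t` of the finite adeles. -/
def affine (a r : ℚ) (hr : r ≠ 0) : Af ≃ₜ Af where
  toFun t := algebraMap ℚ Af a + algebraMap ℚ Af r * t
  invFun x := algebraMap ℚ Af r⁻¹ * (x - algebraMap ℚ Af a)
  left_inv t := by
    simp only [add_sub_cancel_left, ← mul_assoc, ← map_mul, inv_mul_cancel₀ hr, map_one, one_mul]
  right_inv x := by
    simp only [← mul_assoc, ← map_mul, mul_inv_cancel₀ hr, map_one, one_mul, add_sub_cancel]
  continuous_toFun := by fun_prop
  continuous_invFun := by fun_prop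

/-- The set `a + r ℤ^`. -/
def coset (a r : ℚ) : Set Af := {x | AdeleCong r x (algebraMap ℚ Af a)}

theorem coset_eq (a r : ℚ) (hr : r ≠ 0) :
    coset a r = affine a r hr '' {t | IsIntegralAdele t} := by
  ext x
  constructor
  · rintro ⟨t, ht, rfl⟩
    exact ⟨t, ht, rfl⟩
  · rintro ⟨t, ht, rfl⟩
    exact ⟨t, ht, rfl⟩

/-- The box `(a + r ℤ^) × (b + r ℤ^)` in `(ℚ ⊗ ℤ^)²`. -/
def box (r a b : ℚ) : Set (Fin 2 → Af) := {x | x 0 ∈ coset a r ∧ x 1 ∈ coset b r}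

theorem box_eq_pi (r a b : ℚ) :
    box r a b = Set.pi Set.univ (![coset a r, coset b r] : Fin 2 → Set Af) := by
  ext x
  simp [box, Set.mem_pi, Fin.forall_fin_two]

theorem isOpen_box (r a b : ℚ) (hr : r ≠ 0) : IsOpen (box r a b) := by
  rw [box_eq_pi]
  refine isOpen_set_pi Set.finite_univ fun i _ => ?_
  fin_cases i
  · simpa [coset_eq _ _ hr] using isOpen_integralAdele
  · simpa [coset_eq _ _ hr] using isOpen_integralAdele

theorem isCompact_box (r a b : ℚ) (hr : r ≠ 0) : IsCompact (box r a b) := by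
  rw [box_eq_pi]
  refine isCompact_univ_pi fun i => ?_
  fin_cases i
  · simpa [coset_eq _ _ hr] using isCompact_integralAdele
  · simpa [coset_eq _ _ hr] using isCompact_integralAdele

theorem exists_int_of_zero_mem_coset {a r : ℚ} (hr : r ≠ 0) (h : (0 : Af) ∈ coset a r) :
    ∃ m : ℤ, a = r * m := by
  obtain ⟨t, ht, h0⟩ := h
  have : t = algebraMap ℚ Af (-(r⁻¹ * a)) := by
    have h1 : algebraMap ℚ Af r⁻¹ * algebraMap ℚ Af r = 1 := by
      rw [← map_mul, inv_mul_cancel₀ hr, map_one]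
    rw [map_neg, map_mul]
    linear_combination (-t) * h1 - algebraMap ℚ Af r⁻¹ * h0
  rw [this] at ht
  obtain ⟨m, hm⟩ := exists_int_of_isIntegralAdele ht
  refine ⟨-m, ?_⟩
  push_cast
  rw [← hm]
  field_simp

/-- The characteristic function of the box `(a + r ℤ^) × (b + r ℤ^)`, for `(a, b)` not in
`(r ℤ, r ℤ)`, as a test function on `(ℚ ⊗ ℤ^)² - (0, 0)`. -/
def boxIndicator (r a b : ℚ) (hr : r ≠ 0)
    (hab : ¬ ((∃ m : ℤ, a = r * m) ∧ ∃ m : ℤ, b = r * m)) : LCc X1 :=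
  ⟨Set.indicator (Subtype.val ⁻¹' box r a b) 1, by
    have h0 : (0 : Fin 2 → Af) ∉ box r a b := fun h => hab
      ⟨exists_int_of_zero_mem_coset hr h.1, exists_int_of_zero_mem_coset hr h.2⟩
    have : T2Space Af := inferInstanceAs (T2Space (RestrictedProduct
      (fun v : IsDedekindDomain.HeightOneSpectrum ℤ => v.adicCompletion ℚ)
      (fun v => (v.adicCompletionIntegers ℚ : Set (v.adicCompletion ℚ))) Filter.cofinite))
    have hcpt : IsCompact ((Subtype.val : X1 → Fin 2 → Af) ⁻¹' box r a b) := by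
      rw [Subtype.isCompact_iff]
      convert isCompact_box r a b hr using 1
      ext x
      constructor
      · rintro ⟨y, hy, rfl⟩
        exact hy
      · exact fun h => ⟨⟨x, fun hx => h0 (hx ▸ h)⟩, h, rfl⟩
    have hclopen : IsClopen ((Subtype.val : X1 → Fin 2 → Af) ⁻¹' box r a b) :=
      ⟨hcpt.isClosed, (isOpen_box r a b hr).preimage continuous_subtype_val⟩
    refine ⟨?_, HasCompactSupport.intro hcpt fun x hx => Set.indicator_of_notMem hx _⟩
    rw [IsLocallyConstant.iff_continuous]
    exact (continuous_const (y := (1 : ℤ))).indicator (fun a ha => by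
      simp [hclopen.frontier_eq] at ha)⟩

end SiegelDistribution

end

/-!
# The Siegel distribution and its invariance

*The image of `Π_ℚ` in `GL₂(ℤ^)`.* Which matrix an automorphism `σ ∈ Π_ℚ` acts as is read off from
the forms `x_v = η⁶ θ(2z) / θ(z)⁴`, `z = v₀ τ + v₁`, of weight `3` attached to `v ∈ ℚ² / ℤ²`
(`xv`). They satisfy `x_v ∣ δ = x_{v δ}` (`xv_slash`), and conjugating their coefficients amounts to
multiplying `v` by `diag(1, u)`. Hence, for a rational combination `y` of the `e(k / N) x_{a / N}`,
the elementary symmetric functions of its conjugates under `GL₂(ℤ / N)` are forms of level one with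
rational coefficients, and `σ` maps `y` to one of the conjugates (`PiQ_divComb`). As a vector space
over `ℚ` is not a finite union of proper subspaces, one matrix serves for all `y` (`PiQ_divX`). It
is unique (`faithful_xv`), so the matrices for the various `N` are compatible and come from an adelic
one (`exists_adelic_GL`).

That `σ` acts through the same matrix on all forms of level `M` follows by interpolation. A generic
`y` has stabilizer `Γ(M)` (`exists_divComb_stabilizer`), so a form `F` of level `M`, multiplied by
the product of the differences `y - y'` over the other `SL₂(ℤ)`-conjugates `y'` of `y`, is a
combination of powers of `y` with coefficients of level one (`exists_levelOne_coeffs`). The latter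
are combinations of rational forms of level one, which `σ` fixes, and the action of `σ` on `y` is
known (`conj_of_divAct`, `exists_actsAs`). Here `σ` preserves the weight, since a form is integral
over the forms of level one by a homogeneous equation (`PiQ_weight`).

*Modular units.* A modular function times a power of the discriminant `Δ` is a form
(`IsModularFunction.exists_isForm`). For `σ ∈ Π_ℚ` this makes `u * σ` holomorphic on `ℍ`, as `σ`
fixes `Δ`, and for a rational matrix it reduces the action to composition of functions
(`unitActs_of_mem_PiQ'`).

*Siegel units.* Put `s_v(τ) = e(v₀² τ / 2) θ(τ, v₀ τ + v₁)` (`sv`). Up to roots of unity, `s_v`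
depends only on `v` modulo `ℤ²`, is mapped to `s_{v δ}` by `δ ∈ SL₂(ℤ)`, and has the power
`s_v ^ (c² - 1)` equal to `g_{c, v}` (`siegelFun_rootEquiv`). As roots of unity vanish in
`ℚ ⊗ 𝒰`, the element `g_v` does not depend on `c`, and identities between the `g_v` reduce to
identities between the functions `s_v` up to roots of unity (`Rep`, `Rep.unique`). The product
formula for `θ` gives the two relations that are needed, the distribution relation
`∏_{j, k < d} s_{((x + j) / d, (y + k) / d)} ∼ s_{(x, y)}` (`prod_prod_sv`) and
`∏_{j < d} s_{((x + j) / d, y)}(d τ) ∼ s_{(x, y)}(τ)` (`prod_sv_scale`).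

*The distribution.* A test function `φ` is determined by its values on `ℚ²`, and there it is
supported in `(1 / m) ℤ²` and periodic modulo `(K / m) ℤ²` for suitable `m` and `K`. Its value is
`∑ φ(a / m) g_{a / K}` over `a ∈ (ℤ / K)²` (`siegelSum`). By the distribution relation this does not
depend on `m` and `K`; the term for `a = 0` vanishes, as `φ` is zero near the origin.

*Invariance.* An element of `Π_ℚ` acting as `h` maps `g_v` to `g_{v h}` (`rep_map_siegelG`), and
invariance is a change of variables in the sum (`siegelDistribution_actsAs`). The group `GL₂(ℚ)⁺` is
generated by `SL₂(ℤ)`, the scalar matrices and the matrices `diag(d, 1)`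
(`siegelStabilizer_eq_top`): the first case is again a change of variables, scalars change only `m`,
and `diag(d, 1)` is the second relation above. Finally, the pairs of an automorphism and a matrix
with a compatible action on units and the distribution are closed under composition
(`invariantPairs`), so they contain the whole graph of the action of `Π'_ℚ`
(`adelicGraph_le_invariantPairs`), and the graph reaches every `σ ∈ Π'_ℚ`
(`exists_mem_adelicGraph`).
-/

noncomputable section

namespace SiegelDistribution

section

/-! ### Power series in a fractional power of `q` -/

open Function.Periodic (qParam)
open PowerSeries (coeff constantCoeff expand)

/-- `f(τ) = p(q ^ (1 / w))` on the upper half plane, with convergence. -/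
def HasPS (w : ℕ) (p : PowerSeries ℂ) (f : ℍ → ℂ) : Prop :=
  ∀ τ : ℍ, HasSum (fun n : ℕ => coeff n p * qParam w τ ^ n) (f τ)

theorem hasQExp_iff_hasPS {w m : ℕ} {a : ℕ → ℂ} {f : ℍ → ℂ} :
    HasQExp w m a f ↔ HasPS w (PowerSeries.mk a) (fun τ => qParam w τ ^ m * f τ) := by
  simp [HasQExp, HasPS]

theorem hasQExp_zero_iff_hasPS {w : ℕ} {a : ℕ → ℂ} {f : ℍ → ℂ} :
    HasQExp w 0 a f ↔ HasPS w (PowerSeries.mk a) f := by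
  simp [HasQExp, HasPS]

namespace HasPS

variable {w : ℕ} {p r : PowerSeries ℂ} {f g : ℍ → ℂ}

theorem const (w : ℕ) (c : ℂ) : HasPS w (PowerSeries.C c) (fun _ => c) := by
  intro τ
  convert hasSum_single (f := fun n : ℕ =>
      coeff n (PowerSeries.C c : PowerSeries ℂ) * qParam w τ ^ n) 0 ?_ using 1
  · simp
  · intro n hn
    simp [PowerSeries.coeff_C, hn]

theorem X_pow (w m : ℕ) : HasPS w (PowerSeries.X ^ m) (fun τ => qParam w τ ^ m) := by
  intro τ
  convert hasSum_single (f := fun n : ℕ =>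
      coeff n (PowerSeries.X ^ m : PowerSeries ℂ) * qParam w τ ^ n) m ?_ using 1
  · simp
  · intro n hn
    simp [PowerSeries.coeff_X_pow, hn]

theorem add (hf : HasPS w p f) (hg : HasPS w r g) : HasPS w (p + r) (fun τ => f τ + g τ) := by
  intro τ
  convert (hf τ).add (hg τ) using 1
  funext n
  simp [add_mul]

theorem neg (hf : HasPS w p f) : HasPS w (-p) (fun τ => -f τ) := by
  intro τ
  exact hasSum_of_eq (hf τ).neg fun n => by simp

theorem mul (hf : HasPS w p f) (hg : HasPS w r g) : HasPS w (p * r) (fun τ => f τ * g τ) := by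
  intro τ
  have h1 := (hf τ).summable.norm
  have h2 := (hg τ).summable.norm
  have hs := (summable_norm_sum_mul_antidiagonal_of_summable_norm h1 h2).of_norm.hasSum
  rw [← tsum_mul_tsum_eq_tsum_sum_antidiagonal_of_summable_norm h1 h2, (hf τ).tsum_eq,
    (hg τ).tsum_eq] at hs
  refine hasSum_of_eq hs fun n => ?_
  rw [PowerSeries.coeff_mul, Finset.sum_mul]
  refine Finset.sum_congr rfl fun x hx => ?_
  rw [← Finset.HasAntidiagonal.mem_antidiagonal.1 hx, pow_add]
  ring

theorem pow (hf : HasPS w p f) (n : ℕ) : HasPS w (p ^ n) (fun τ => f τ ^ n) := by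
  induction n with
  | zero => simpa using const w 1
  | succ n ih => simpa [pow_succ] using ih.mul hf

theorem sum {ι : Type*} (s : Finset ι) {p : ι → PowerSeries ℂ} {f : ι → ℍ → ℂ}
    (h : ∀ i ∈ s, HasPS w (p i) (f i)) : HasPS w (∑ i ∈ s, p i) (fun τ => ∑ i ∈ s, f i τ) := by
  classical
  induction s using Finset.induction_on with
  | empty => simpa using const w 0
  | insert i s hi ih =>
    simp only [Finset.sum_insert hi]
    exact (h i (by simp)).add (ih fun j hj => h j (by simp [hj]))

theorem congr_fun (hf : HasPS w p f) (h : ∀ τ, g τ = f τ) : HasPS w p g := by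
  rwa [show g = f from funext h]

theorem eq_fun (hf : HasPS w p f) (hg : HasPS w p g) : f = g :=
  funext fun τ => (hf τ).unique (hg τ)

theorem qParam_mul_pow {d : ℕ} (hw : 0 < w) (hd : 0 < d) (τ : ℂ) :
    qParam ((w * d : ℕ) : ℝ) τ ^ d = qParam w τ := by
  have h0 : (w : ℂ) ≠ 0 := by exact_mod_cast hw.ne'
  have d0 : (d : ℂ) ≠ 0 := by exact_mod_cast hd.ne'
  simp only [qParam]
  rw [← Complex.exp_nat_mul]
  congr 1
  push_cast
  field_simp

/-- Passing from `q ^ (1 / w)` to `q ^ (1 / (w d))` substitutes `X ^ d` for `X`. -/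
theorem expand_iff {d : ℕ} (hw : 0 < w) (hd : 0 < d) :
    HasPS (w * d) (expand d hd.ne' p) f ↔ HasPS w p f := by
  have inj : Function.Injective (fun n : ℕ => d * n) := fun x y hxy =>
    Nat.eq_of_mul_eq_mul_left hd hxy
  refine forall_congr' fun τ => ?_
  rw [← inj.hasSum_iff]
  · refine iff_of_eq ?_
    congr 1
    funext n
    simp only [Function.comp_apply, PowerSeries.coeff_expand_mul, pow_mul,
      qParam_mul_pow hw hd]
  · intro n hn
    rw [PowerSeries.coeff_expand_of_not_dvd _ _ _ (fun ⟨c, hc⟩ => hn ⟨c, hc.symm⟩), zero_mul]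

/-- The sum of a `q`-expansion, as a function of the local parameter on the unit disc. -/
def disc (p : PowerSeries ℂ) (x : ℂ) : ℂ := ∑' n : ℕ, coeff n p * x ^ n

theorem exists_qParam_eq (hw : 0 < w) {x : ℂ} (hx : ‖x‖ < 1) (hx0 : x ≠ 0) :
    ∃ τ : ℍ, qParam w τ = x := by
  have hw' : (0 : ℝ) < w := by exact_mod_cast hw
  exact ⟨⟨Function.Periodic.invQParam w x,
    Function.Periodic.im_invQParam_pos_of_norm_lt_one hw' hx hx0⟩,
    Function.Periodic.qParam_right_inv hw'.ne' hx0⟩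

theorem norm_qParam_lt (hw : 0 < w) (τ : ℍ) : ‖qParam w τ‖ < 1 :=
  Function.Periodic.norm_qParam_lt_one (by exact_mod_cast hw) τ.im_pos

theorem hasSum_disc (hw : 0 < w) (hf : HasPS w p f) {x : ℂ} (hx : ‖x‖ < 1) :
    HasSum (fun n : ℕ => coeff n p * x ^ n) (disc p x) := by
  rcases eq_or_ne x 0 with rfl | hx0
  · refine (summable_of_ne_finset_zero (s := {0}) fun n hn => ?_).hasSum
    have : n ≠ 0 := by simpa using hn
    simp [this]
  · obtain ⟨τ, rfl⟩ := exists_qParam_eq hw hx hx0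
    exact (hf τ).summable.hasSum

theorem disc_qParam (hf : HasPS w p f) (τ : ℍ) : disc p (qParam w τ) = f τ := (hf τ).tsum_eq

theorem disc_zero (p : PowerSeries ℂ) : disc p 0 = constantCoeff p := by
  rw [disc, tsum_eq_single 0 (fun n hn => by simp [hn])]
  simp

theorem hasFPowerSeriesOnBall (hw : 0 < w) (hf : HasPS w p f) :
    HasFPowerSeriesOnBall (disc p) (.ofScalars ℂ fun n => coeff n p) 0 1 := by
  constructor
  · refine le_of_forall_lt_imp_le_of_dense fun r hr ↦ ?_
    lift r to NNReal using hr.ne_top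
    apply FormalMultilinearSeries.le_radius_of_summable
    have hr' : ‖((r : ℝ) : ℂ)‖ < 1 := by simpa using hr
    have := (hasSum_disc hw hf hr').summable.norm
    simpa [FormalMultilinearSeries.ofScalars_norm] using this
  · simp
  · intro y hy
    have hy' : ‖y‖ < 1 := by
      rwa [← ENNReal.coe_one, Metric.eball_coe, NNReal.coe_one, mem_ball_zero_iff] at hy
    simpa [FormalMultilinearSeries.ofScalars_apply_eq, mul_comm] using hasSum_disc hw hf hy'

theorem eq_series (hw : 0 < w) (hp : HasPS w p f) (hr : HasPS w r f) : p = r := by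
  have h1 := (hasFPowerSeriesOnBall hw hp).hasFPowerSeriesAt
  have h2 := (hasFPowerSeriesOnBall hw hr).hasFPowerSeriesAt
  have hne : ∀ᶠ x in nhdsWithin (0 : ℂ) {0}ᶜ, disc p x = disc r x := by
    filter_upwards [self_mem_nhdsWithin,
      mem_nhdsWithin_of_mem_nhds (Metric.ball_mem_nhds (0 : ℂ) one_pos)] with x hx hx1
    obtain ⟨τ, rfl⟩ := exists_qParam_eq hw (by simpa using hx1) hx
    rw [disc_qParam hp, disc_qParam hr]
  have heq := (h1.continuousAt.eventuallyEq_nhds_iff_eventuallyEq_nhdsNE h2.continuousAt).1 hne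
  have := (h1.congr heq).eq_formalMultilinearSeries h2
  ext n
  simpa using congr_arg (FormalMultilinearSeries.coeff · n) this

theorem differentiableOn_disc (hw : 0 < w) (hf : HasPS w p f) :
    DifferentiableOn ℂ (disc p) (Metric.ball 0 1) := by
  have := (hasFPowerSeriesOnBall hw hf).differentiableOn
  rwa [← ENNReal.coe_one, Metric.eball_coe] at this

theorem mdifferentiable (hw : 0 < w) (hf : HasPS w p f) : MDiff f := by
  rw [UpperHalfPlane.mdifferentiable_iff]
  have h1 : DifferentiableOn ℂ (fun z => disc p (qParam w z)) {z | 0 < z.im} := by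
    refine (differentiableOn_disc hw hf).comp
      (Function.Periodic.differentiable_qParam).differentiableOn fun z hz => ?_
    simpa using norm_qParam_lt hw ⟨z, hz⟩
  refine h1.congr fun z hz => ?_
  rw [Function.comp_apply, UpperHalfPlane.ofComplex_apply_of_im_pos hz, ← disc_qParam hf]

theorem tendsto_atImInfty (hw : 0 < w) (hf : HasPS w p f) :
    Filter.Tendsto f UpperHalfPlane.atImInfty (nhds (constantCoeff p)) := by
  have h := (hasFPowerSeriesOnBall hw hf).hasFPowerSeriesAt.continuousAt.tendsto.comp
    (UpperHalfPlane.qParam_tendsto_atImInfty (h := w) (by exact_mod_cast hw))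
  rw [disc_zero] at h
  exact h.congr fun τ => disc_qParam hf τ

/-- A convergent power series without zeros in the unit disc has a convergent inverse. -/
theorem inv (hw : 0 < w) (hf : HasPS w p f) (h0 : constantCoeff p ≠ 0) (hne : ∀ τ, f τ ≠ 0) :
    HasPS w p⁻¹ (fun τ => (f τ)⁻¹) := by
  have hd : DifferentiableOn ℂ (fun x => (disc p x)⁻¹) (Metric.ball 0 1) := by
    refine (differentiableOn_disc hw hf).inv fun x hx => ?_
    rcases eq_or_ne x 0 with rfl | hx0
    · rwa [disc_zero]
    · obtain ⟨τ, rfl⟩ := exists_qParam_eq hw (by simpa using hx) hx0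
      rw [disc_qParam hf]
      exact hne τ
  have key : ∃ r, HasPS w r (fun τ => (f τ)⁻¹) := by
    refine ⟨PowerSeries.mk fun n => (n.factorial : ℂ)⁻¹ *
      iteratedDeriv n (fun x => (disc p x)⁻¹) 0, fun τ => ?_⟩
    have := Complex.hasSum_taylorSeries_on_ball (r := 1)
      (by simpa using hd) (z := qParam w τ) (by simpa using norm_qParam_lt hw τ)
    rw [disc_qParam hf] at this
    refine hasSum_of_eq this fun n => ?_
    simp only [PowerSeries.coeff_mk, sub_zero, smul_eq_mul]
    ring
  obtain ⟨r, hr⟩ := key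
  have h1 : p * r = 1 := by
    have := hf.mul hr
    refine eq_series hw this ?_
    exact (const w 1).congr_fun fun τ => mul_inv_cancel₀ (hne τ)
  have h2 : r = p⁻¹ := by
    rw [PowerSeries.eq_inv_iff_mul_eq_one h0, mul_comm, h1]
  rwa [← h2]

end HasPS

/-! ### Conjugation of `q`-expansions -/

section Conj

variable {K : IntermediateField ℚ ℂ} (s : K →+* ℂ)

/-- `f` has a Laurent expansion with coefficients in `K`, and applying the embedding `s` to the
coefficients gives the expansion of `f'`. -/
def Conj (f f' : ℍ → ℂ) : Prop :=
  ∃ (w m : ℕ) (p : PowerSeries K), 0 < w ∧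
    HasPS w (p.map (algebraMap K ℂ)) (fun τ => qParam w τ ^ m * f τ) ∧
    HasPS w (p.map s) (fun τ => qParam w τ ^ m * f' τ)

variable {s}

theorem hasPS_raise {R : Type*} [CommRing R] (t : R →+* ℂ) {w m : ℕ} {p : PowerSeries R}
    {f : ℍ → ℂ} (hw : 0 < w)
    (h : HasPS w (p.map t) (fun τ => qParam w τ ^ m * f τ)) {d : ℕ} (hd : 0 < d) (e : ℕ) :
    HasPS (w * d) ((PowerSeries.X ^ e * expand d hd.ne' p).map t)
      (fun τ => qParam ((w * d : ℕ) : ℝ) τ ^ (m * d + e) * f τ) := by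
  have h1 := (HasPS.expand_iff hw hd).2 h
  rw [map_mul, map_pow, PowerSeries.map_X, PowerSeries.map_expand]
  refine ((HasPS.X_pow (w * d) e).mul h1).congr_fun fun τ => ?_
  rw [← HasPS.qParam_mul_pow hw hd, ← pow_mul, pow_add, mul_comm d m]
  ring

theorem Conj.common {f f' g g' : ℍ → ℂ} (hf : Conj s f f') (hg : Conj s g g') :
    ∃ (w m : ℕ) (p r : PowerSeries K), 0 < w ∧
      HasPS w (p.map (algebraMap K ℂ)) (fun τ => qParam w τ ^ m * f τ) ∧
      HasPS w (p.map s) (fun τ => qParam w τ ^ m * f' τ) ∧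
      HasPS w (r.map (algebraMap K ℂ)) (fun τ => qParam w τ ^ m * g τ) ∧
      HasPS w (r.map s) (fun τ => qParam w τ ^ m * g' τ) := by
  obtain ⟨w₁, m₁, p, hw₁, h1, h2⟩ := hf
  obtain ⟨w₂, m₂, r, hw₂, h3, h4⟩ := hg
  refine ⟨w₁ * w₂, m₁ * w₂ + m₂ * w₁, _,
    PowerSeries.X ^ (m₁ * w₂) * expand w₁ hw₁.ne' r, Nat.mul_pos hw₁ hw₂,
    hasPS_raise _ hw₁ h1 hw₂ (m₂ * w₁), hasPS_raise _ hw₁ h2 hw₂ (m₂ * w₁), ?_, ?_⟩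
  · rw [mul_comm w₁ w₂, add_comm]
    exact hasPS_raise _ hw₂ h3 hw₁ (m₁ * w₂)
  · rw [mul_comm w₁ w₂, add_comm]
    exact hasPS_raise _ hw₂ h4 hw₁ (m₁ * w₂)

theorem Conj.add {f f' g g' : ℍ → ℂ} (hf : Conj s f f') (hg : Conj s g g') :
    Conj s (f + g) (f' + g') := by
  obtain ⟨w, m, p, r, hw, h1, h2, h3, h4⟩ := hf.common hg
  refine ⟨w, m, p + r, hw, ?_, ?_⟩
  · rw [map_add]
    exact (h1.add h3).congr_fun fun τ => by simp [mul_add]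
  · rw [map_add]
    exact (h2.add h4).congr_fun fun τ => by simp [mul_add]

theorem Conj.mul {f f' g g' : ℍ → ℂ} (hf : Conj s f f') (hg : Conj s g g') :
    Conj s (f * g) (f' * g') := by
  obtain ⟨w, m, p, r, hw, h1, h2, h3, h4⟩ := hf.common hg
  refine ⟨w, m + m, p * r, hw, ?_, ?_⟩
  · rw [map_mul]
    exact (h1.mul h3).congr_fun fun τ => by simp only [Pi.mul_apply, pow_add]; ring
  · rw [map_mul]
    exact (h2.mul h4).congr_fun fun τ => by simp only [Pi.mul_apply, pow_add]; ring

theorem Conj.const (c : K) : Conj s (fun _ => (c : ℂ)) (fun _ => s c) :=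
  ⟨1, 0, PowerSeries.C c, one_pos,
    by rw [PowerSeries.map_C]; exact (HasPS.const 1 _).congr_fun fun τ => by simp,
    by rw [PowerSeries.map_C]; exact (HasPS.const 1 _).congr_fun fun τ => by simp⟩

theorem Conj.neg {f f' : ℍ → ℂ} (hf : Conj s f f') : Conj s (-f) (-f') := by
  obtain ⟨w, m, p, hw, h1, h2⟩ := hf
  refine ⟨w, m, -p, hw, ?_, ?_⟩
  · rw [map_neg]
    exact h1.neg.congr_fun fun τ => by simp
  · rw [map_neg]
    exact h2.neg.congr_fun fun τ => by simp

variable (s) in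
/-- The ring of pairs of functions whose Laurent expansions correspond to each other under the
embedding `s` of the field of coefficients. -/
def conjRing : Subring ((ℍ → ℂ) × (ℍ → ℂ)) where
  carrier := {x | Conj s x.1 x.2}
  mul_mem' hf hg := Conj.mul hf hg
  add_mem' hf hg := Conj.add hf hg
  neg_mem' hf := Conj.neg hf
  zero_mem' := by
    have := Conj.const (s := s) 0
    simp only [ZeroMemClass.coe_zero, map_zero] at this
    exact this
  one_mem' := by
    have := Conj.const (s := s) 1
    simp only [OneMemClass.coe_one, map_one] at this
    exact this

theorem Conj.pow {f f' : ℍ → ℂ} (hf : Conj s f f') (n : ℕ) : Conj s (f ^ n) (f' ^ n) :=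
  (conjRing s).pow_mem (x := (f, f')) hf n

theorem Conj.hasLaurentOver {f f' : ℍ → ℂ} (hf : Conj s f f') : HasLaurentOver K f := by
  obtain ⟨w, m, p, hw, h1, h2⟩ := hf
  refine ⟨w, m, fun n => (coeff n p : K), hw, fun n => (coeff n p).2, ?_⟩
  rw [hasQExp_iff_hasPS]
  convert h1
  ext n
  simp

theorem HasLaurentOver.conj {f : ℍ → ℂ} (hf : HasLaurentOver K f) :
    Conj (algebraMap K ℂ) f f := by
  obtain ⟨w, m, a, hw, ha, h⟩ := hf
  rw [hasQExp_iff_hasPS] at h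
  have : HasPS w ((PowerSeries.mk fun n => (⟨a n, ha n⟩ : K)).map (algebraMap K ℂ))
      (fun τ => qParam w τ ^ m * f τ) := by
    convert h
    ext n
    simp
  exact ⟨w, m, _, hw, this, this⟩

theorem HasLaurentOver.exists_hasPS {f : ℍ → ℂ} (hf : HasLaurentOver K f) :
    ∃ (w m : ℕ) (p : PowerSeries ℂ), 0 < w ∧ HasPS w p (fun τ => qParam w τ ^ m * f τ) := by
  obtain ⟨w, m, p, hw, h1, h2⟩ := hf.conj
  exact ⟨w, m, _, hw, h1⟩

theorem hasLaurentOver_top {f : ℍ → ℂ} {w m : ℕ} {p : PowerSeries ℂ} (hw : 0 < w)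
    (h : HasPS w p (fun τ => qParam w τ ^ m * f τ)) : HasLaurentOver ⊤ f := by
  refine ⟨w, m, fun n => coeff n p, hw, fun n => IntermediateField.mem_top, ?_⟩
  rw [hasQExp_iff_hasPS]
  convert h
  ext n
  simp

theorem HasLaurentOver.mdifferentiable {f : ℍ → ℂ} (hf : HasLaurentOver K f) : MDiff f := by
  obtain ⟨w, m, p, hw, h⟩ := hf.exists_hasPS
  have h1 := h.mdifferentiable hw
  have h2 := (HasPS.X_pow w m).mdifferentiable hw
  rw [UpperHalfPlane.mdifferentiable_iff] at h1 h2 ⊢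
  refine (h1.div h2 fun z hz => ?_).congr fun z hz => ?_
  · exact pow_ne_zero _ (Function.Periodic.qParam_ne_zero _)
  · simp only [Pi.div_apply, Function.comp_apply]
    rw [mul_div_cancel_left₀]
    exact pow_ne_zero _ (Function.Periodic.qParam_ne_zero _)

theorem HasLaurentOver.eq_zero_or_eq_zero {f g : ℍ → ℂ} (hf : HasLaurentOver K f)
    (hg : HasLaurentOver K g) (h : f * g = 0) : f = 0 ∨ g = 0 := by
  obtain ⟨w, m, p, r, hw, h1, -, h3, -⟩ := hf.conj.common hg.conj
  have hz : ∀ {u : ℍ → ℂ}, HasPS w 0 (fun τ => qParam w τ ^ m * u τ) → u = 0 := by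
    intro u hu
    funext τ
    have h6 : HasPS w 0 (fun _ => 0) := by simpa using HasPS.const w 0
    have := congrFun (hu.eq_fun h6) τ
    simpa [Function.Periodic.qParam_ne_zero] using this
  have h5 := h1.mul h3
  have h0 : HasPS w 0 (fun τ => qParam w τ ^ m * f τ * (qParam w τ ^ m * g τ)) := by
    have h6 : HasPS w 0 (fun _ => 0) := by simpa using HasPS.const w 0
    refine h6.congr_fun fun τ => ?_
    have := congrFun h τ
    simp only [Pi.mul_apply, Pi.zero_apply] at this
    linear_combination (qParam w τ ^ m * qParam w τ ^ m) * this
  rcases mul_eq_zero.1 (HasPS.eq_series hw h5 h0) with h | h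
  · rw [h] at h1
    exact Or.inl (hz h1)
  · rw [h] at h3
    exact Or.inr (hz h3)

end Conj

end

section

open Function.Periodic (qParam)
open PowerSeries (coeff constantCoeff expand)

section Conj

variable {K : IntermediateField ℚ ℂ} {s : K →+* ℂ}

theorem exists_X_pow_mul_eq {F : Type*} [Field F] {p : PowerSeries F} (hp : p ≠ 0) :
    ∃ (e : ℕ) (u : PowerSeries F), constantCoeff u ≠ 0 ∧ p = PowerSeries.X ^ e * u := by
  refine ⟨p.order.toNat, p.divXPowOrder, ?_, PowerSeries.X_pow_order_mul_divXPowOrder.symm⟩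
  rw [PowerSeries.constantCoeff_divXPowOrder]
  exact PowerSeries.coeff_order hp

theorem HasPS.eq_zero_iff {w m : ℕ} {p : PowerSeries ℂ} {f : ℍ → ℂ} (hw : 0 < w)
    (h : HasPS w p (fun τ => qParam w τ ^ m * f τ)) : p = 0 ↔ f = 0 := by
  have h6 : HasPS w 0 (fun _ => 0) := by simpa using HasPS.const w 0
  constructor
  · rintro rfl
    funext τ
    have := congrFun (h.eq_fun h6) τ
    simpa [Function.Periodic.qParam_ne_zero] using this
  · rintro rfl
    exact h.eq_series hw (h6.congr_fun fun τ => by simp)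

theorem Conj.eq_zero_iff {f f' : ℍ → ℂ} (h : Conj s f f') : f = 0 ↔ f' = 0 := by
  obtain ⟨w, m, p, hw, h1, h2⟩ := h
  rw [← h1.eq_zero_iff hw, ← h2.eq_zero_iff hw]
  have i1 := PowerSeries.map_injective (algebraMap K ℂ) (algebraMap K ℂ).injective
  have i2 := PowerSeries.map_injective s s.injective
  rw [map_eq_zero_iff _ i1, map_eq_zero_iff _ i2]

/-- The conjugate function is determined by the function. -/
theorem Conj.unique {f f' f'' : ℍ → ℂ} (h : Conj s f f') (h' : Conj s f f'') : f' = f'' := by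
  have := (Conj.add h h'.neg).eq_zero_iff.1 (by simp)
  rwa [← sub_eq_add_neg, sub_eq_zero] at this

/-- If `f h` and `h` have coefficients in `K`, so has `f`, compatibly with conjugation. -/
theorem Conj.of_mul {f f' h h' : ℍ → ℂ} (hf : HasLaurentOver ⊤ f) (hf' : HasLaurentOver ⊤ f')
    (hP : Conj s (f * h) (f' * h')) (hh : Conj s h h') (hne : h ≠ 0) : Conj s f f' := by
  classical
  obtain ⟨w₁, m₁, P, H, hw₁, p1, p2, q1, q2⟩ := hP.common hh
  obtain ⟨w₂, m₂, F, F', hw₂, f1, -, f2, -⟩ := hf.conj.common hf'.conj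
  -- a common denominator and a common order of the pole
  set w := w₁ * w₂ with hw
  have hw0 : 0 < w := Nat.mul_pos hw₁ hw₂
  have p1 := hasPS_raise (algebraMap K ℂ) hw₁ p1 hw₂ 0
  have p2 := hasPS_raise s hw₁ p2 hw₂ 0
  have q1 := hasPS_raise (algebraMap K ℂ) hw₁ q1 hw₂ 0
  have q2 := hasPS_raise s hw₁ q2 hw₂ 0
  have f1 := hasPS_raise (algebraMap _ ℂ) hw₂ f1 hw₁ 0
  have f2 := hasPS_raise (algebraMap _ ℂ) hw₂ f2 hw₁ 0
  rw [← hw] at p1 p2 q1 q2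
  rw [mul_comm w₂ w₁, ← hw] at f1 f2
  simp only [add_zero] at p1 p2 q1 q2 f1 f2
  generalize PowerSeries.X ^ 0 * expand w₂ _ P = P at p1 p2
  generalize PowerSeries.X ^ 0 * expand w₂ _ H = H at q1 q2
  set a := m₁ * w₂
  set b := m₂ * w₁
  replace f1 : ∃ F : PowerSeries ℂ, HasPS w F (fun τ => qParam w τ ^ b * f τ) := ⟨_, f1⟩
  replace f2 : ∃ F : PowerSeries ℂ, HasPS w F (fun τ => qParam w τ ^ b * f' τ) := ⟨_, f2⟩
  obtain ⟨F, f1⟩ := f1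
  obtain ⟨F', f2⟩ := f2
  have e1 : F * H.map (algebraMap K ℂ) = PowerSeries.X ^ b * P.map (algebraMap K ℂ) := by
    refine (f1.mul q1).eq_series hw0 (((HasPS.X_pow w b).mul p1).congr_fun fun τ => ?_)
    simp only [Pi.mul_apply]
    ring
  have e2 : F' * H.map s = PowerSeries.X ^ b * P.map s := by
    refine (f2.mul q2).eq_series hw0 (((HasPS.X_pow w b).mul p2).congr_fun fun τ => ?_)
    simp only [Pi.mul_apply]
    ring
  have hH : H ≠ 0 := by
    rintro rfl
    exact hne ((q1.eq_zero_iff hw0).1 (by simp))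
  obtain ⟨e, u, hu, rfl⟩ := exists_X_pow_mul_eq hH
  set R := PowerSeries.X ^ b * P * u⁻¹ with hR
  have huu : u * u⁻¹ = 1 := PowerSeries.mul_inv_cancel u hu
  have e3 : PowerSeries.X ^ e * F = R.map (algebraMap K ℂ) := by
    have h1 : u.map (algebraMap K ℂ) * u⁻¹.map (algebraMap K ℂ) = 1 := by
      rw [← map_mul, huu, map_one]
    simp only [map_mul, map_pow, PowerSeries.map_X, hR] at e1 ⊢
    linear_combination (u⁻¹.map (algebraMap K ℂ)) * e1 - (PowerSeries.X ^ e * F) * h1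
  have e4 : PowerSeries.X ^ e * F' = R.map s := by
    have h1 : u.map s * u⁻¹.map s = 1 := by
      rw [← map_mul, huu, map_one]
    simp only [map_mul, map_pow, PowerSeries.map_X, hR] at e2 ⊢
    linear_combination (u⁻¹.map s) * e2 - (PowerSeries.X ^ e * F') * h1
  have e5 : PowerSeries.X ^ e ∣ R := by
    rw [PowerSeries.X_pow_dvd_iff]
    intro i hi
    have := congrArg (coeff i) e3
    rw [PowerSeries.X_pow_dvd_iff.1 (Dvd.intro _ rfl) i hi, PowerSeries.coeff_map] at this
    exact (map_eq_zero _).1 this.symm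
  obtain ⟨F0, hF0⟩ := e5
  have hX : (PowerSeries.X : PowerSeries ℂ) ^ e ≠ 0 := pow_ne_zero _ PowerSeries.X_ne_zero
  have e6 : F = F0.map (algebraMap K ℂ) := by
    refine mul_left_cancel₀ hX ?_
    rw [e3, hF0, map_mul, map_pow, PowerSeries.map_X]
  have e7 : F' = F0.map s := by
    refine mul_left_cancel₀ hX ?_
    rw [e4, hF0, map_mul, map_pow, PowerSeries.map_X]
  exact ⟨w, b, F0, hw0, e6 ▸ f1, e7 ▸ f2⟩

/-- A nowhere vanishing function with a Laurent expansion has an inverse with a Laurent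
expansion. -/
theorem Conj.inv {h h' : ℍ → ℂ} (H : Conj s h h') (h0 : ∀ τ, h τ ≠ 0) (h0' : ∀ τ, h' τ ≠ 0) :
    Conj s h⁻¹ h'⁻¹ := by
  obtain ⟨w, m, p, hw, h1, h2⟩ := H
  have hp : p ≠ 0 := by
    rintro rfl
    have := (h1.eq_zero_iff hw).1 (by simp)
    exact h0 UpperHalfPlane.I (congrFun this _)
  obtain ⟨e, u, hu, rfl⟩ := exists_X_pow_mul_eq hp
  have key : ∀ (t : K →+* ℂ) (g : ℍ → ℂ), (∀ τ, g τ ≠ 0) →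
      HasPS w ((PowerSeries.X ^ e * u).map t) (fun τ => qParam w τ ^ m * g τ) →
      HasPS w ((PowerSeries.X ^ m * u⁻¹).map t) (fun τ => qParam w τ ^ e * g⁻¹ τ) := by
    intro t g hg H
    have hc : constantCoeff (u.map t) ≠ 0 := by
      rw [← PowerSeries.coeff_zero_eq_constantCoeff_apply, PowerSeries.coeff_map]
      simpa using hu
    have hq : ∀ τ : ℍ, qParam w τ ≠ 0 := fun τ => Function.Periodic.qParam_ne_zero _
    have h3 : HasPS w (u.map t) (fun τ => (qParam w τ ^ e)⁻¹ * (qParam w τ ^ m * g τ)) := by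
      intro τ
      have h5 : HasSum (fun n : ℕ => coeff n (u.map t) * qParam w τ ^ n)
          (HasPS.disc (u.map t) (qParam w τ)) := by
        have h4 := (H τ).summable
        rw [map_mul, map_pow, PowerSeries.map_X, ← summable_nat_add_iff e] at h4
        refine Summable.hasSum ((h4.mul_left (qParam w τ ^ e)⁻¹).congr fun n => ?_)
        rw [PowerSeries.coeff_X_pow_mul, pow_add]
        field_simp [hq τ]
      convert h5 using 1
      have h6 := h5.mul_left (qParam w τ ^ e)
      have h7 := H τ
      rw [← (add_left_injective e).hasSum_iff] at h7
      · rw [map_mul, map_pow, PowerSeries.map_X] at h7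
        have := h7.unique (hasSum_of_eq h6 fun n => by
          simp only [Function.comp_apply]
          rw [PowerSeries.coeff_X_pow_mul, pow_add]
          ring)
        simp only at this ⊢
        rw [this, inv_mul_cancel_left₀ (pow_ne_zero _ (hq τ))]
      · intro n hn
        have : n < e := by
          by_contra h
          exact hn ⟨n - e, Nat.sub_add_cancel (not_lt.1 h)⟩
        rw [map_mul, map_pow, PowerSeries.map_X, PowerSeries.coeff_X_pow_mul', if_neg (by omega),
          zero_mul]
    have h4 := h3.inv hw hc fun τ => mul_ne_zero (inv_ne_zero (pow_ne_zero _ (hq τ)))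
      (mul_ne_zero (pow_ne_zero _ (hq τ)) (hg τ))
    have h5 : u⁻¹.map t = (u.map t)⁻¹ := by
      rw [PowerSeries.eq_inv_iff_mul_eq_one hc, ← map_mul, PowerSeries.inv_mul_cancel u hu,
        map_one]
    rw [map_mul, map_pow, PowerSeries.map_X, h5]
    refine ((HasPS.X_pow w m).mul h4).congr_fun fun τ => ?_
    have := hq τ
    have := hg τ
    simp only [Pi.inv_apply]
    field_simp
  exact ⟨w, e, _, hw, key _ h h0 h1, key _ h' h0' h2⟩

/-- Holomorphy at the cusp at infinity. -/
def HolAtInfty (f : ℍ → ℂ) : Prop := ∃ (w : ℕ) (p : PowerSeries ℂ), 0 < w ∧ HasPS w p f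

theorem HolAtInfty.hasLaurentOver {f : ℍ → ℂ} (h : HolAtInfty f) : HasLaurentOver ⊤ f := by
  obtain ⟨w, p, hw, h⟩ := h
  exact hasLaurentOver_top (m := 0) hw (by simpa using h)

theorem HasPS.holAtInfty {w : ℕ} {p : PowerSeries ℂ} {f : ℍ → ℂ} (h : HasPS w p f) (hw : 0 < w) :
    HolAtInfty f := ⟨w, p, hw, h⟩

/-- The ring of functions which are holomorphic at the cusp at infinity. -/
def holRing : Subring (ℍ → ℂ) where
  carrier := {f | HolAtInfty f}
  mul_mem' := by
    rintro f g ⟨w₁, p, hw₁, hp⟩ ⟨w₂, r, hw₂, hr⟩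
    have h2 := (HasPS.expand_iff hw₂ hw₁).2 hr
    rw [mul_comm] at h2
    exact ⟨w₁ * w₂, _, Nat.mul_pos hw₁ hw₂, ((HasPS.expand_iff hw₁ hw₂).2 hp).mul h2⟩
  add_mem' := by
    rintro f g ⟨w₁, p, hw₁, hp⟩ ⟨w₂, r, hw₂, hr⟩
    have h2 := (HasPS.expand_iff hw₂ hw₁).2 hr
    rw [mul_comm] at h2
    exact ⟨w₁ * w₂, _, Nat.mul_pos hw₁ hw₂, ((HasPS.expand_iff hw₁ hw₂).2 hp).add h2⟩
  neg_mem' := by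
    rintro f ⟨w, p, hw, hp⟩
    exact ⟨w, _, hw, hp.neg⟩
  zero_mem' := ⟨1, _, one_pos, HasPS.const 1 0⟩
  one_mem' := ⟨1, _, one_pos, HasPS.const 1 1⟩

theorem mem_holRing {f : ℍ → ℂ} : f ∈ holRing ↔ HolAtInfty f := Iff.rfl

/-- A form holomorphic at infinity needs no negative powers of `q`. -/
theorem HolAtInfty.hasPS_of_laurent {R : Type*} [CommRing R] {t : R →+* ℂ} {w m : ℕ}
    {p : PowerSeries R} {f : ℍ → ℂ} (hf : HolAtInfty f) (hw : 0 < w)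
    (h : HasPS w (p.map t) (fun τ => qParam w τ ^ m * f τ)) :
    ∃ r : PowerSeries ℂ, HasPS w r f ∧ p.map t = PowerSeries.X ^ m * r := by
  obtain ⟨w', r, hw', hr⟩ := hf
  -- compare in the parameter `q ^ (1 / (w w'))`
  have h1 := (HasPS.expand_iff hw hw').2 h
  have h2 := (HasPS.expand_iff hw' hw).2 hr
  rw [mul_comm] at h2
  have h3 : expand w' hw'.ne' (p.map t) = PowerSeries.X ^ (m * w') * expand w hw.ne' r := by
    refine h1.eq_series (Nat.mul_pos hw hw')
      (((HasPS.X_pow (w * w') (m * w')).mul h2).congr_fun fun τ => ?_)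
    rw [mul_comm m w', pow_mul, HasPS.qParam_mul_pow hw hw']
  have h4 : PowerSeries.X ^ m ∣ p.map t := by
    rw [PowerSeries.X_pow_dvd_iff]
    intro i hi
    have h5 := congrArg (coeff (w' * i)) h3
    rw [PowerSeries.coeff_expand_mul, PowerSeries.X_pow_dvd_iff.1 (Dvd.intro _ rfl)] at h5
    · exact h5
    · rw [mul_comm w']
      exact Nat.mul_lt_mul_of_pos_right hi hw'
  obtain ⟨r', hr'⟩ := h4
  refine ⟨r', ?_, hr'⟩
  rw [← HasPS.expand_iff hw hw']
  have h6 : expand w' hw'.ne' r' = expand w hw.ne' r := by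
    have hX : (PowerSeries.X : PowerSeries ℂ) ^ (m * w') ≠ 0 :=
      pow_ne_zero _ PowerSeries.X_ne_zero
    refine mul_left_cancel₀ hX ?_
    rw [← h3, hr', map_mul, map_pow, PowerSeries.expand_X, ← pow_mul, mul_comm w']
  rwa [h6]

theorem Conj.exists_hasPS {f f' : ℍ → ℂ} (h : Conj s f f') (hf : HolAtInfty f)
    (hf' : HolAtInfty f') : ∃ (w : ℕ) (p : PowerSeries K), 0 < w ∧
      HasPS w (p.map (algebraMap K ℂ)) f ∧ HasPS w (p.map s) f' := by
  obtain ⟨w, m, p, hw, h1, h2⟩ := h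
  obtain ⟨r, hr, e1⟩ := hf.hasPS_of_laurent hw h1
  obtain ⟨r', hr', e2⟩ := hf'.hasPS_of_laurent hw h2
  have h4 : PowerSeries.X ^ m ∣ p := by
    rw [PowerSeries.X_pow_dvd_iff]
    intro i hi
    have := congrArg (coeff i) e1
    rw [PowerSeries.X_pow_dvd_iff.1 (Dvd.intro _ rfl) i hi, PowerSeries.coeff_map] at this
    exact (map_eq_zero _).1 this
  obtain ⟨p', rfl⟩ := h4
  have hX : (PowerSeries.X : PowerSeries ℂ) ^ m ≠ 0 := pow_ne_zero _ PowerSeries.X_ne_zero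
  rw [map_mul, map_pow, PowerSeries.map_X] at e1 e2
  refine ⟨w, p', hw, ?_, ?_⟩
  · rwa [mul_left_cancel₀ hX e1]
  · rwa [mul_left_cancel₀ hX e2]

theorem HasLaurentOver.exists_hasPS_of_hol {f : ℍ → ℂ} (h : HasLaurentOver K f)
    (hf : HolAtInfty f) : ∃ (w : ℕ) (p : PowerSeries K), 0 < w ∧
      HasPS w (p.map (algebraMap K ℂ)) f := by
  obtain ⟨w, p, hw, h1, -⟩ := h.conj.exists_hasPS hf hf
  exact ⟨w, p, hw, h1⟩

theorem hasQExp_iff_exists {f : ℍ → ℂ} :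
    (∃ (h : ℕ) (a : ℕ → ℂ), 0 < h ∧ (∀ n, a n ∈ K) ∧ HasQExp h 0 a f) ↔
      HolAtInfty f ∧ HasLaurentOver K f := by
  constructor
  · rintro ⟨w, a, hw, ha, h⟩
    exact ⟨⟨w, _, hw, hasQExp_zero_iff_hasPS.1 h⟩, ⟨w, 0, a, hw, ha, h⟩⟩
  · rintro ⟨h1, h2⟩
    obtain ⟨w, p, hw, h⟩ := h2.exists_hasPS_of_hol h1
    refine ⟨w, fun n => (coeff n p : K), hw, fun n => (coeff n p).2, ?_⟩
    rw [hasQExp_zero_iff_hasPS]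
    convert h
    ext n
    simp

/-- If an expansion over `K` is a linear combination over `ℂ` of expansions over `K`, it is one
over `K`: apply a `K`-linear retraction `ℂ → K` to the coefficients. -/
theorem exists_combination_over {ι : Type*} [Fintype ι] {f : ℍ → ℂ} {g : ι → ℍ → ℂ}
    (hf : HasLaurentOver K f) (hg : ∀ i, HasLaurentOver K (g i)) (c : ι → ℂ)
    (h : f = ∑ i, c i • g i) : ∃ c' : ι → K, f = ∑ i, (c' i : ℂ) • g i := by
  classical
  -- common parameters
  have key : ∀ S : Finset ι, ∃ (w m : ℕ) (p : PowerSeries K) (r : ι → PowerSeries K), 0 < w ∧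
      HasPS w (p.map (algebraMap K ℂ)) (fun τ => qParam w τ ^ m * f τ) ∧
      ∀ i ∈ S, HasPS w ((r i).map (algebraMap K ℂ)) (fun τ => qParam w τ ^ m * g i τ) := by
    intro S
    induction S using Finset.induction_on with
    | empty =>
      obtain ⟨w, m, p, hw, h1, -⟩ := hf.conj
      exact ⟨w, m, p, 0, hw, h1, by simp⟩
    | insert i S hi ih =>
      obtain ⟨w₁, m₁, p, r, hw₁, h1, h2⟩ := ih
      obtain ⟨w₂, m₂, u, hw₂, h3, -⟩ := (hg i).conj
      refine ⟨w₁ * w₂, m₁ * w₂ + m₂ * w₁, PowerSeries.X ^ (m₂ * w₁) * expand w₂ hw₂.ne' p,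
        fun j => if j = i then PowerSeries.X ^ (m₁ * w₂) * expand w₁ hw₁.ne' u else
        PowerSeries.X ^ (m₂ * w₁) * expand w₂ hw₂.ne' (r j), Nat.mul_pos hw₁ hw₂,
        hasPS_raise _ hw₁ h1 hw₂ (m₂ * w₁), ?_⟩
      intro j hj
      rcases Finset.mem_insert.1 hj with rfl | hj
      · simp only [if_true]
        rw [mul_comm w₁ w₂, add_comm]
        exact hasPS_raise _ hw₂ h3 hw₁ (m₁ * w₂)
      · have : j ≠ i := fun h => hi (h ▸ hj)
        simp only [this, if_false]
        exact hasPS_raise _ hw₁ (h2 j hj) hw₂ (m₂ * w₁)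
  obtain ⟨w, m, p, r, hw, h1, h2⟩ := key Finset.univ
  obtain ⟨φ, hφ⟩ := (Algebra.linearMap K ℂ).exists_leftInverse_of_injective
    (LinearMap.ker_eq_bot.2 (algebraMap K ℂ).injective)
  have e1 : p.map (algebraMap K ℂ) = ∑ i, PowerSeries.C (c i) * (r i).map (algebraMap K ℂ) := by
    refine h1.eq_series hw ((HasPS.sum Finset.univ fun i hi =>
      (HasPS.const w (c i)).mul (h2 i hi)).congr_fun fun τ => ?_)
    rw [h]
    simp only [Finset.sum_apply, Pi.smul_apply, smul_eq_mul, Finset.mul_sum]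
    exact Finset.sum_congr rfl fun i _ => by ring
  refine ⟨fun i => φ (c i), ?_⟩
  have e2 : p = ∑ i, PowerSeries.C (φ (c i)) * r i := by
    ext n
    have := congrArg (fun x => φ (coeff n x)) e1
    simp only [PowerSeries.coeff_map, map_sum, PowerSeries.coeff_C_mul] at this ⊢
    have h3 : ∀ x : K, φ (algebraMap K ℂ x) = x := fun x => LinearMap.congr_fun hφ x
    rw [h3] at this
    rw [this]
    congr 1
    refine Finset.sum_congr rfl fun i _ => ?_
    rw [mul_comm, ← Algebra.smul_def, map_smul, smul_eq_mul, mul_comm]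
  have h3 : HasPS w (p.map (algebraMap K ℂ))
      (fun τ => ∑ i, ((φ (c i) : K) : ℂ) * (qParam w τ ^ m * g i τ)) := by
    rw [e2]
    simp only [map_sum, map_mul, PowerSeries.map_C]
    exact HasPS.sum Finset.univ fun i hi => (HasPS.const w _).mul (h2 i hi)
  funext τ
  have h4 := congrFun (h1.eq_fun h3) τ
  have hq : qParam w τ ^ m ≠ 0 := pow_ne_zero _ (Function.Periodic.qParam_ne_zero _)
  refine mul_left_cancel₀ hq ?_
  rw [h4]
  simp only [Finset.sum_apply, Pi.smul_apply, smul_eq_mul, Finset.mul_sum]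
  exact Finset.sum_congr rfl fun i _ => by ring

end Conj

end

section

open Complex (I)

/-! ### The exponential and the infinite product `∏ (1 - e(n t + x))` -/

/-- `e(x) = exp (2 π i x)`. -/
def ee (x : ℂ) : ℂ := Complex.exp (2 * Real.pi * I * x)

theorem ee_add (x y : ℂ) : ee (x + y) = ee x * ee y := by
  simp only [ee, mul_add, Complex.exp_add]

theorem ee_zero : ee 0 = 1 := by simp [ee]

theorem ee_ne_zero (x : ℂ) : ee x ≠ 0 := Complex.exp_ne_zero _

theorem ee_neg (x : ℂ) : ee (-x) = (ee x)⁻¹ := by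
  simp only [ee, mul_neg, Complex.exp_neg]

theorem ee_sub (x y : ℂ) : ee (x - y) = ee x / ee y := by
  rw [sub_eq_add_neg, ee_add, ee_neg, div_eq_mul_inv]

theorem ee_nat_mul (n : ℕ) (x : ℂ) : ee (n * x) = ee x ^ n := by
  simp only [ee, ← Complex.exp_nat_mul]
  ring_nf

theorem ee_eq_one_iff {x : ℂ} : ee x = 1 ↔ ∃ k : ℤ, x = k := by
  rw [ee, Complex.exp_eq_one_iff]
  refine exists_congr fun k => ?_
  rw [mul_comm (k : ℂ), mul_right_inj' Complex.two_pi_I_ne_zero]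

theorem ee_int (k : ℤ) : ee k = 1 := ee_eq_one_iff.2 ⟨k, rfl⟩

theorem ee_half : ee (1 / 2) = -1 := by
  rw [ee, ← Complex.exp_pi_mul_I]; congr 1; ring

theorem ee_add_int (x : ℂ) (k : ℤ) : ee (x + k) = ee x := by rw [ee_add, ee_int, mul_one]

theorem norm_ee (x : ℂ) : ‖ee x‖ = Real.exp (-(2 * Real.pi * x.im)) := by
  rw [ee, Complex.norm_exp]
  congr 1
  simp

theorem norm_ee_lt_one {t : ℂ} (ht : 0 < t.im) : ‖ee t‖ < 1 := by
  rw [norm_ee, Real.exp_lt_one_iff]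
  have := Real.pi_pos
  have : 0 < 2 * Real.pi * t.im := by positivity
  linarith

theorem differentiable_ee : Differentiable ℂ ee := by unfold ee; fun_prop

@[fun_prop]
theorem Differentiable.ee {f : ℂ → ℂ} (hf : Differentiable ℂ f) :
    Differentiable ℂ (fun z => ee (f z)) := differentiable_ee.comp hf

/-- The entire function `W(t, x) = ∏_{n ≥ 0} (1 - e(n t + x))` of `x`. -/
def W (t x : ℂ) : ℂ := ∏' n : ℕ, (1 - ee (n * t + x))

theorem norm_ee_nat_mul_add (n : ℕ) (t x : ℂ) : ‖ee (n * t + x)‖ = ‖ee t‖ ^ n * ‖ee x‖ := by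
  rw [ee_add, ee_nat_mul, norm_mul, norm_pow]

theorem summable_norm_ee {t : ℂ} (ht : 0 < t.im) (x : ℂ) :
    Summable (fun n : ℕ => ‖-ee (n * t + x)‖) := by
  simp only [norm_neg, norm_ee_nat_mul_add]
  exact (summable_geometric_of_lt_one (norm_nonneg _) (norm_ee_lt_one ht)).mul_right _

theorem multipliable_W {t : ℂ} (ht : 0 < t.im) (x : ℂ) :
    Multipliable (fun n : ℕ => 1 - ee (n * t + x)) := by
  simpa only [← sub_eq_add_neg] using multipliable_one_add_of_summable (summable_norm_ee ht x)

theorem hasProd_W {t : ℂ} (ht : 0 < t.im) (x : ℂ) :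
    HasProd (fun n : ℕ => 1 - ee (n * t + x)) (W t x) := (multipliable_W ht x).hasProd

theorem W_eq_mul {t : ℂ} (ht : 0 < t.im) (x : ℂ) : W t x = (1 - ee x) * W t (x + t) := by
  rw [W, W, tprod_eq_zero_mul' ?_]
  · congr 1
    · simp
    · refine tprod_congr fun n => ?_
      congr 2
      push_cast
      ring
  · convert multipliable_W ht (x + t) using 4 with n
    push_cast
    ring

theorem W_add_int (t x : ℂ) (k : ℤ) : W t (x + k) = W t x := by
  simp only [W, ← add_assoc, ee_add_int]

theorem W_ne_zero {t : ℂ} (ht : 0 < t.im) {x : ℂ} (h : ∀ n : ℕ, ee (n * t + x) ≠ 1) :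
    W t x ≠ 0 := by
  have := tprod_one_add_ne_zero_of_summable (f := fun n : ℕ => -ee (n * t + x))
    (fun n => by rw [← sub_eq_add_neg, sub_ne_zero]; exact (h n).symm)
    (summable_norm_ee ht x)
  simpa only [← sub_eq_add_neg, W] using this

theorem W_eq_zero {t : ℂ} {x : ℂ} (n : ℕ) (h : ee (n * t + x) = 1) : W t x = 0 :=
  tprod_of_exists_eq_zero ⟨n, by rw [h, sub_self]⟩

theorem differentiable_W {t : ℂ} (ht : 0 < t.im) : Differentiable ℂ (W t) := by
  have key : HasProdLocallyUniformlyOn (fun (n : ℕ) x => 1 + -ee (n * t + x))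
      (fun x => ∏' n : ℕ, (1 + -ee (n * t + x))) Set.univ := by
    apply hasProdLocallyUniformlyOn_of_forall_compact isOpen_univ
    intro K _ hcK
    obtain ⟨C, hC⟩ := hcK.exists_bound_of_continuousOn (f := ee)
      differentiable_ee.continuous.continuousOn
    refine ((summable_geometric_of_lt_one (norm_nonneg _)
      (norm_ee_lt_one ht)).mul_right C).hasProdUniformlyOn_nat_one_add hcK
      (.of_forall fun n x hx => ?_) (fun n => ?_)
    · rw [norm_neg, norm_ee_nat_mul_add]
      exact mul_le_mul_of_nonneg_left (hC x hx) (by positivity)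
    · exact Continuous.continuousOn (Differentiable.continuous (𝕜 := ℂ) (by fun_prop))
  rw [← differentiableOn_univ]
  have h2 := key.differentiableOn (.of_forall fun s => by
    refine Differentiable.differentiableOn ?_
    simpa [Finset.prod_fn] using Differentiable.finsetProd (fun _ _ => by fun_prop)) isOpen_univ
  refine h2.congr fun x _ => ?_
  simp only [W, sub_eq_add_neg]

/-! ### The theta function -/

theorem theta_eq (τ : ℍ) (z : ℂ) :
    theta τ z = -(ee (τ / 12) * ee (-(z / 2)) * (W τ z * W τ (τ - z))) := by
  have h1 := (multipliable_W τ.im_pos (z + τ)).tprod_mul (multipliable_W τ.im_pos (τ - z))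
  have h2 : ∀ n : ℕ, (1 - Complex.exp (2 * Real.pi * I * ((n + 1) * τ + z))) *
      (1 - Complex.exp (2 * Real.pi * I * ((n + 1) * τ - z))) =
      (1 - ee (n * τ + (z + τ))) * (1 - ee (n * τ + (τ - z))) := by
    intro n
    simp only [ee]
    ring_nf
  have h3 : Complex.exp (Real.pi * I * z) - Complex.exp (-(Real.pi * I * z)) =
      -ee (-(z / 2)) * (1 - ee z) := by
    rw [mul_one_sub, neg_mul, ← ee_add, show -(z / 2) + z = z / 2 by ring]
    simp only [ee]
    ring_nf
  have h4 : Complex.exp (2 * Real.pi * I * τ / 12) = ee (τ / 12) := by simp only [ee]; ring_nf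
  rw [theta, tprod_congr h2, h1, h3, h4, W_eq_mul τ.im_pos z, W, W]
  ring

theorem differentiable_theta (τ : ℍ) : Differentiable ℂ (theta τ) := by
  rw [show theta τ = fun z => _ from funext (theta_eq τ)]
  have h1 := differentiable_W τ.im_pos
  have h2 : Differentiable ℂ fun z : ℂ => W τ (τ - z) :=
    h1.comp ((differentiable_const _).sub differentiable_id)
  fun_prop

theorem theta_add_one (τ : ℍ) (z : ℂ) : theta τ (z + 1) = -theta τ z := by
  have h1 := W_add_int τ z 1
  have h2 := W_add_int τ (τ - (z + 1)) 1
  rw [Int.cast_one] at h1 h2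
  rw [show (τ : ℂ) - (z + 1) + 1 = τ - z by ring] at h2
  have h3 : ee (-((z + 1) / 2)) = - ee (-(z / 2)) := by
    rw [show -((z + 1) / 2) = -(z / 2) + -(1 / 2) by ring, ee_add, ee_neg (1 / 2), ee_half]
    norm_num
  rw [theta_eq, theta_eq, h1, ← h2, h3]
  ring

theorem theta_add_tau (τ : ℍ) (z : ℂ) :
    theta τ (z + τ) = -(ee (-(τ / 2)) * ee (-z)) * theta τ z := by
  have h1 := W_eq_mul τ.im_pos z
  have h2 := W_eq_mul τ.im_pos (-z)
  rw [show -z + (τ : ℂ) = τ - z by ring] at h2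
  rw [theta_eq, theta_eq, h1, show (τ : ℂ) - (z + τ) = -z by ring, h2,
    show -((z + τ) / 2) = -(τ / 2) + -(z / 2) by ring, ee_add]
  have h3 : ee (-z) * ee z = 1 := by rw [← ee_add, neg_add_cancel, ee_zero]
  linear_combination (ee (τ / 12) * ee (-(τ / 2)) * ee (-(z / 2)) * W τ (z + τ) * W τ (τ - z)) * h3

theorem theta_neg (τ : ℍ) (z : ℂ) : theta τ (-z) = -theta τ z := by
  have h1 := W_eq_mul τ.im_pos z
  have h2 := W_eq_mul τ.im_pos (-z)
  rw [show -z + (τ : ℂ) = τ - z by ring] at h2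
  rw [theta_eq, theta_eq, h1, show (τ : ℂ) - -z = z + τ by ring, h2,
    show -(-z / 2) = z + -(z / 2) by ring, ee_add]
  have h3 : ee (-z) * ee z = 1 := by rw [← ee_add, neg_add_cancel, ee_zero]
  linear_combination (ee (τ / 12) * ee (-(z / 2)) * W τ (z + τ) * W τ (τ - z)) * h3

theorem theta_zero (τ : ℍ) : theta τ 0 = 0 := by
  rw [theta_eq, W_eq_zero 0 (by simp [ee_zero])]; simp

/-- The zeros of the theta function are the points of the lattice `ℤ + ℤ τ`. -/
theorem theta_ne_zero {τ : ℍ} {z : ℂ} (h : ∀ m n : ℤ, z ≠ m * τ + n) : theta τ z ≠ 0 := by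
  rw [theta_eq]
  refine neg_ne_zero.2 (mul_ne_zero (mul_ne_zero (ee_ne_zero _) (ee_ne_zero _)) (mul_ne_zero ?_ ?_))
  · refine W_ne_zero τ.im_pos fun n hn => ?_
    obtain ⟨k, hk⟩ := ee_eq_one_iff.1 hn
    refine h (-n) k ?_
    push_cast
    linear_combination hk
  · refine W_ne_zero τ.im_pos fun n hn => ?_
    obtain ⟨k, hk⟩ := ee_eq_one_iff.1 hn
    refine h (n + 1) (-k) ?_
    push_cast
    linear_combination -hk

/-- The quasi-periodicity of the theta function with respect to `ℤ + ℤ τ`. -/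
def QuasiPeriodic (τ : ℍ) (F : ℂ → ℂ) : Prop :=
  (∀ z, F (z + 1) = -F z) ∧ ∀ z, F (z + τ) = -(ee (-(τ / 2)) * ee (-z)) * F z

theorem quasiPeriodic_theta (τ : ℍ) : QuasiPeriodic τ (theta τ) :=
  ⟨theta_add_one τ, theta_add_tau τ⟩

theorem QuasiPeriodic.add_lattice (τ : ℍ) (m n : ℤ) : ∃ c : ℂ → ℂ, (∀ z, c z ≠ 0) ∧
    ∀ F : ℂ → ℂ, QuasiPeriodic τ F → ∀ z, F (z + (m * τ + n)) = c z * F z := by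
  have h1 : ∀ n : ℤ, ∃ c : ℂ, c ≠ 0 ∧ ∀ F : ℂ → ℂ, QuasiPeriodic τ F →
      ∀ z, F (z + n) = c * F z := by
    intro n
    induction n using Int.induction_on with
    | zero => exact ⟨1, one_ne_zero, fun F _ z => by simp⟩
    | succ i ih =>
      obtain ⟨c, hc, h⟩ := ih
      refine ⟨-c, neg_ne_zero.2 hc, fun F hF z => ?_⟩
      have h := h F hF
      push_cast at h ⊢
      rw [← add_assoc, hF.1, h, neg_mul]
    | pred i ih =>
      obtain ⟨c, hc, h⟩ := ih
      refine ⟨-c, neg_ne_zero.2 hc, fun F hF z => ?_⟩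
      have h := h F hF
      have := hF.1 (z + ((-i - 1 : ℤ) : ℂ))
      push_cast at h this ⊢
      rw [show z + (-(i : ℂ) - 1) + 1 = z + -i by ring, h] at this
      rw [neg_mul, this, neg_neg]
  have h2 : ∀ m : ℤ, ∃ c : ℂ → ℂ, (∀ z, c z ≠ 0) ∧
      ∀ F : ℂ → ℂ, QuasiPeriodic τ F → ∀ z, F (z + m * τ) = c z * F z := by
    have e0 : ∀ z : ℂ, -(ee (-((τ : ℂ) / 2)) * ee (-z)) ≠ 0 := fun z =>
      neg_ne_zero.2 (mul_ne_zero (ee_ne_zero _) (ee_ne_zero _))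
    intro m
    induction m using Int.induction_on with
    | zero => exact ⟨fun _ => 1, fun _ => one_ne_zero, fun F _ z => by simp⟩
    | succ i ih =>
      obtain ⟨c, hc, h⟩ := ih
      refine ⟨fun z => -(ee (-((τ : ℂ) / 2)) * ee (-(z + i * τ))) * c z,
        fun z => mul_ne_zero (e0 _) (hc z), fun F hF z => ?_⟩
      have h := h F hF
      push_cast at h ⊢
      rw [add_one_mul, ← add_assoc, hF.2, h, mul_assoc]
    | pred i ih =>
      obtain ⟨c, hc, h⟩ := ih
      refine ⟨fun z => (-(ee (-((τ : ℂ) / 2)) * ee (-(z + (-i - 1) * τ))))⁻¹ * c z,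
        fun z => mul_ne_zero (inv_ne_zero (e0 _)) (hc z), fun F hF z => ?_⟩
      have h := h F hF
      have := hF.2 (z + ((-i - 1 : ℤ) : ℂ) * τ)
      push_cast at h this ⊢
      rw [show z + (-(i : ℂ) - 1) * τ + τ = z + -i * τ by ring, h] at this
      rw [mul_assoc, this, inv_mul_cancel_left₀ (e0 _)]
  obtain ⟨c, hc, h⟩ := h1 n
  obtain ⟨c', hc', h'⟩ := h2 m
  refine ⟨fun z => c * c' z, fun z => mul_ne_zero hc (hc' z), fun F hF z => ?_⟩
  rw [← add_assoc, h F hF, h' F hF, mul_assoc]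

theorem theta_eq_zero_iff {τ : ℍ} {z : ℂ} : theta τ z = 0 ↔ ∃ m n : ℤ, z = m * τ + n := by
  constructor
  · intro h
    by_contra! hh
    exact theta_ne_zero hh h
  · rintro ⟨m, n, rfl⟩
    obtain ⟨c, -, h⟩ := QuasiPeriodic.add_lattice τ m n
    simpa [theta_zero] using h _ (quasiPeriodic_theta τ) 0

theorem eta_eq (τ : ℂ) : ModularForm.eta τ = ee (τ / 24) * W τ τ := by
  rw [ModularForm.eta, W]
  congr 1
  · simp only [ee, Function.Periodic.qParam]
    push_cast
    ring_nf
  · refine tprod_congr fun n => ?_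
    rw [ModularForm.eta_q_eq_cexp]
    simp only [ee]
    ring_nf

theorem hasDerivAt_theta_zero (τ : ℍ) :
    HasDerivAt (theta τ) (2 * Real.pi * I * ModularForm.eta τ ^ 2) 0 := by
  have e1 : theta τ = fun z => (1 - ee z) *
      -(ee (τ / 12) * ee (-(z / 2)) * (W τ (z + τ) * W τ (τ - z))) := by
    funext z
    rw [theta_eq, W_eq_mul τ.im_pos z]
    ring
  have h1 := differentiable_W τ.im_pos
  have h2 : Differentiable ℂ fun z : ℂ => W τ (τ - z) :=
    h1.comp ((differentiable_const _).sub differentiable_id)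
  have h3 : Differentiable ℂ fun z : ℂ => W τ (z + τ) :=
    h1.comp (differentiable_id.add (differentiable_const _))
  have h4 : DifferentiableAt ℂ (fun z : ℂ =>
      -(ee (τ / 12) * ee (-(z / 2)) * (W τ (z + τ) * W τ (τ - z)))) 0 := by
    apply Differentiable.differentiableAt
    fun_prop
  have h5 : HasDerivAt (fun z => 1 - ee z) (-(2 * Real.pi * I)) 0 := by
    have : HasDerivAt (fun z : ℂ => 2 * Real.pi * I * z) (2 * Real.pi * I) 0 := by
      simpa using (hasDerivAt_id (0 : ℂ)).const_mul (2 * Real.pi * I)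
    have := (this.cexp).const_sub 1
    simpa [ee] using this
  have := h5.mul h4.hasDerivAt
  rw [e1]
  refine this.congr_deriv ?_
  rw [eta_eq, show (τ : ℂ) / 12 = τ / 24 + τ / 24 by ring, ee_add]
  simp [ee_zero]
  ring

end

section

open Complex (I)
open Filter Topology

/-- An entire function which vanishes at `0` and is quasi-periodic like the theta function is a
multiple of it: the quotient is entire and elliptic, hence constant. -/
theorem QuasiPeriodic.eq_theta {τ : ℍ} {F : ℂ → ℂ} (hd : Differentiable ℂ F)
    (hF : QuasiPeriodic τ F) (h0 : F 0 = 0) (z : ℂ) :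
    F z = deriv F 0 / deriv (theta τ) 0 * theta τ z := by
  classical
  have hT := quasiPeriodic_theta τ
  have hθd := differentiable_theta τ
  have hθ0 : deriv (theta τ) 0 ≠ 0 := by
    rw [(hasDerivAt_theta_zero τ).deriv]
    exact mul_ne_zero Complex.two_pi_I_ne_zero
      (pow_ne_zero 2 (ModularForm.eta_ne_zero τ.im_pos))
  set R : ℂ → ℂ := fun z => if theta τ z = 0 then deriv F 0 / deriv (theta τ) 0
    else F z / theta τ z with hR
  have hper : ∀ (m n : ℤ) (z : ℂ), R (z + (m * τ + n)) = R z := by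
    intro m n z
    obtain ⟨c, hc, h⟩ := QuasiPeriodic.add_lattice τ m n
    simp only [hR, h F hF, h _ hT, mul_eq_zero, hc z, false_or]
    rw [mul_div_mul_left _ _ (hc z)]
  have hd0 : DifferentiableAt ℂ R 0 := by
    have hds : ∀ {f : ℂ → ℂ}, Differentiable ℂ f → Differentiable ℂ (dslope f 0) := fun hf => by
      rw [← differentiableOn_univ] at hf ⊢
      exact (Complex.differentiableOn_dslope univ_mem).2 hf
    have hne : dslope (theta τ) 0 0 ≠ 0 := by rwa [dslope_same]
    have h1 : ∀ᶠ w in 𝓝 (0 : ℂ), dslope (theta τ) 0 w ≠ 0 :=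
      (hds hθd).continuous.continuousAt.eventually_ne hne
    refine ((hds hd 0).div (hds hθd 0) hne).congr_of_eventuallyEq ?_
    filter_upwards [h1] with w hw
    rcases eq_or_ne w 0 with rfl | hw0
    · simp [hR, theta_zero, dslope_same]
    · have e1 : ∀ f : ℂ → ℂ, f 0 = 0 → f w = w * dslope f 0 w := fun f hf => by
        have := sub_smul_dslope f 0 w
        rw [hf, sub_zero, sub_zero, smul_eq_mul] at this
        exact this.symm
      have e2 := e1 _ (theta_zero τ)
      have e3 := e1 _ h0
      have e4 : theta τ w ≠ 0 := by rw [e2]; exact mul_ne_zero hw0 hw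
      simp only [hR, if_neg e4, Pi.div_apply]
      rw [e2, e3, mul_div_mul_left _ _ hw0]
  have hdR : Differentiable ℂ R := by
    intro z
    by_cases hz : theta τ z = 0
    · obtain ⟨m, n, rfl⟩ := theta_eq_zero_iff.1 hz
      have e1 : R = fun w => R (w - (m * τ + n)) := by
        funext w
        rw [← hper m n (w - (m * τ + n)), sub_add_cancel]
      rw [e1]
      exact DifferentiableAt.comp (g := R) _ (by simpa using hd0) (by fun_prop)
    · refine ((hd z).div (hθd z) hz).congr_of_eventuallyEq ?_
      filter_upwards [hθd.continuous.continuousAt.eventually_ne hz] with w hw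
      simp [hR, hw]
  have hbd : Bornology.IsBounded (Set.range R) := by
    have hK : IsCompact ((fun p : ℝ × ℝ => R (p.2 * τ + p.1)) '' (Set.Icc 0 1 ×ˢ Set.Icc 0 1)) := by
      refine (isCompact_Icc.prod isCompact_Icc).image ?_
      exact hdR.continuous.comp (by fun_prop)
    refine hK.isBounded.subset ?_
    rintro _ ⟨z, rfl⟩
    have him : τ.im ≠ 0 := τ.im_pos.ne'
    set y : ℝ := z.im / τ.im with hy
    set x : ℝ := z.re - y * τ.re with hx
    have hz : z = y * τ + x := by
      apply Complex.ext
      · simp [hx]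
      · simp [hy, him]
    refine ⟨(Int.fract x, Int.fract y), ⟨⟨Int.fract_nonneg _, (Int.fract_lt_one _).le⟩,
      ⟨Int.fract_nonneg _, (Int.fract_lt_one _).le⟩⟩, ?_⟩
    dsimp only
    rw [← hper ⌊y⌋ ⌊x⌋ (((Int.fract y : ℝ) : ℂ) * τ + ((Int.fract x : ℝ) : ℂ))]
    congr 1
    rw [hz]
    have e1 : ((Int.fract y : ℝ) : ℂ) = y - ⌊y⌋ := by
      rw [Int.fract]; push_cast; ring
    have e2 : ((Int.fract x : ℝ) : ℂ) = x - ⌊x⌋ := by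
      rw [Int.fract]; push_cast; ring
    rw [e1, e2]
    ring
  have hconst := hdR.apply_eq_apply_of_bounded hbd z 0
  by_cases hz : theta τ z = 0
  · obtain ⟨m, n, rfl⟩ := theta_eq_zero_iff.1 hz
    obtain ⟨c, hc, h⟩ := QuasiPeriodic.add_lattice τ m n
    have := h F hF 0
    rw [zero_add, h0, mul_zero] at this
    rw [this, hz, mul_zero]
  · simp only [hR, theta_zero, if_true, if_neg hz] at hconst
    rw [← hconst, div_mul_cancel₀ _ hz]

theorem coe_S_smul (τ : ℍ) : ((ModularGroup.S • τ : ℍ) : ℂ) = -1 / τ := by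
  rw [UpperHalfPlane.modular_S_smul]
  simp [neg_div, inv_neg]

theorem coe_T_smul (τ : ℍ) : ((ModularGroup.T • τ : ℍ) : ℂ) = τ + 1 := by
  rw [UpperHalfPlane.modular_T_smul]
  simp [add_comm]

theorem eta_sq_S (τ : ℍ) : ModularForm.eta ((ModularGroup.S • τ : ℍ) : ℂ) ^ 2 =
    -I * τ * ModularForm.eta τ ^ 2 := by
  have h := ModularForm.eta_comp_eq_csqrt_I_inv τ.2
  simp only [Function.comp_apply, Pi.smul_apply, Pi.mul_apply, smul_eq_mul] at h
  have hs : ∀ z : ℂ, Complex.sqrt z ^ 2 = z := fun z => by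
    rw [Complex.sqrt]
    exact_mod_cast Complex.cpow_nat_inv_pow z (two_ne_zero)
  rw [coe_S_smul, show ((τ : ℍ) : ℂ) = τ.1 from rfl, h, mul_pow, mul_pow, inv_pow, hs, hs,
    Complex.inv_I]
  ring

/-- The transformation of the theta function under `τ ↦ -1 / τ`. -/
theorem theta_S (τ : ℍ) (z : ℂ) :
    theta (ModularGroup.S • τ) (z / τ) = -I * ee (z ^ 2 / (2 * τ)) * theta τ z := by
  have hτ : (τ : ℂ) ≠ 0 := τ.ne_zero
  set τ' := ModularGroup.S • τ with hτ'
  have e1 : (τ' : ℂ) = -1 / τ := coe_S_smul τ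
  set F : ℂ → ℂ := fun z => ee (-(z ^ 2 / (2 * τ))) * theta τ' (z / τ) with hFdef
  have hdd : Differentiable ℂ fun z : ℂ => theta τ' (z / τ) :=
    (differentiable_theta τ').comp (by fun_prop)
  have hd : Differentiable ℂ F := by
    have : Differentiable ℂ fun z : ℂ => ee (-(z ^ 2 / (2 * τ))) := by fun_prop
    exact this.mul hdd
  have hQ : QuasiPeriodic τ F := by
    constructor
    · intro z
      have h := theta_add_tau τ' ((z + 1) / τ)
      rw [e1, show (z + 1) / (τ : ℂ) + -1 / τ = z / τ by field_simp; ring] at h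
      have h2 : ee (-((z + 1) ^ 2 / (2 * τ))) = ee (-(z ^ 2 / (2 * τ))) *
          (ee (-(-1 / (τ : ℂ) / 2)) * ee (-((z + 1) / τ))) := by
        rw [← ee_add, ← ee_add]
        congr 1
        field_simp
        ring
      simp only [hFdef, h, h2]
      ring
    · intro z
      have h := theta_add_one τ' (z / τ)
      rw [show z / (τ : ℂ) + 1 = (z + τ) / τ by field_simp] at h
      have h2 : ee (-((z + τ) ^ 2 / (2 * τ))) = ee (-(z ^ 2 / (2 * τ))) *
          (ee (-(τ / 2)) * ee (-z)) := by
        rw [← ee_add, ← ee_add]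
        congr 1
        field_simp
        ring
      simp only [hFdef, h, h2]
      ring
  have h0 : F 0 = 0 := by simp [hFdef, theta_zero]
  have hder : deriv F 0 = 2 * Real.pi * I * ModularForm.eta τ' ^ 2 / τ := by
    have h1 : HasDerivAt (fun z : ℂ => z / (τ : ℂ)) (1 / τ) 0 := (hasDerivAt_id _).div_const _
    have h2 : HasDerivAt (fun z : ℂ => theta τ' (z / τ))
        (2 * Real.pi * I * ModularForm.eta τ' ^ 2 * (1 / τ)) 0 :=
      HasDerivAt.comp (h₂ := theta τ') 0 (by simpa using hasDerivAt_theta_zero τ') h1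
    have h3 : DifferentiableAt ℂ (fun z : ℂ => ee (-(z ^ 2 / (2 * τ)))) 0 := by
      apply Differentiable.differentiableAt
      fun_prop
    have h4 := (h3.hasDerivAt.mul h2).deriv
    have h5 : F = (fun z : ℂ => ee (-(z ^ 2 / (2 * τ)))) * fun z : ℂ => theta τ' (z / τ) := rfl
    rw [h5, h4]
    simp [theta_zero, ee_zero]
    ring
  have hη := ModularForm.eta_ne_zero τ.im_pos
  have key := QuasiPeriodic.eq_theta hd hQ h0 z
  rw [hder, (hasDerivAt_theta_zero τ).deriv, eta_sq_S] at key
  have h6 : 2 * Real.pi * I * (-I * τ * ModularForm.eta τ ^ 2) / τ /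
      (2 * Real.pi * I * ModularForm.eta τ ^ 2) = -I := by
    have hη' : ModularForm.eta (τ : ℂ) ≠ 0 := hη
    have := Complex.two_pi_I_ne_zero
    have hpi : (Real.pi : ℂ) ≠ 0 := by exact_mod_cast Real.pi_ne_zero
    field_simp [Complex.I_ne_zero]
  rw [h6] at key
  have h7 : ee (-(z ^ 2 / (2 * τ))) * ee (z ^ 2 / (2 * τ)) = 1 := by
    rw [← ee_add, neg_add_cancel, ee_zero]
  simp only [hFdef] at key
  linear_combination (ee (z ^ 2 / (2 * τ))) * key - theta τ' (z / τ) * h7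

theorem theta_T (τ : ℍ) (z : ℂ) : theta (ModularGroup.T • τ) z = ee (1 / 12) * theta τ z := by
  have hW : ∀ x : ℂ, W (τ + 1) x = W τ x := fun x => tprod_congr fun n => by
    have := ee_add_int (n * τ + x) n
    push_cast at this
    rw [← this]
    congr 2
    ring
  have hW2 := W_add_int τ (τ - z) 1
  rw [theta_eq, theta_eq, coe_T_smul, hW, hW, show ((τ : ℂ) + 1) / 12 = τ / 12 + 1 / 12 by ring,
    ee_add, show (τ : ℂ) + 1 - z = τ - z + (1 : ℤ) by push_cast; ring, hW2]
  ring

theorem eta_pow_six_S (τ : ℍ) : ModularForm.eta ((ModularGroup.S • τ : ℍ) : ℂ) ^ 6 =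
    I * τ ^ 3 * ModularForm.eta τ ^ 6 := by
  have h := eta_sq_S τ
  rw [show 6 = 2 * 3 from rfl, pow_mul, h]
  have : I ^ 3 = -I := by rw [pow_succ, Complex.I_sq]; ring
  linear_combination (-(τ : ℂ) ^ 3 * ModularForm.eta τ ^ 6) * this

theorem eta_pow_six_T (τ : ℍ) : ModularForm.eta ((ModularGroup.T • τ : ℍ) : ℂ) ^ 6 =
    ee (1 / 4) * ModularForm.eta τ ^ 6 := by
  have hW : ∀ x : ℂ, W (τ + 1) x = W τ x := fun x => tprod_congr fun n => by
    have := ee_add_int (n * τ + x) n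
    push_cast at this
    rw [← this]
    congr 2
    ring
  have hW2 := W_add_int τ τ 1
  rw [Int.cast_one] at hW2
  rw [coe_T_smul, eta_eq, eta_eq, hW, hW2, mul_pow, mul_pow, ← ee_nat_mul, ← ee_nat_mul,
    ← mul_assoc,
    ← ee_add]
  congr 2
  push_cast
  ring

end

section

open Complex (I)
open Filter Topology
open Function.Periodic (qParam)
open PowerSeries (coeff constantCoeff expand)

/-! ### `q`-expansions of the factors of theta functions -/

theorem constantCoeff_map_eq {R S : Type*} [CommRing R] [CommRing S] (t : R →+* S)
    (p : PowerSeries R) : constantCoeff (p.map t) = t (constantCoeff p) := by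
  rw [← PowerSeries.coeff_zero_eq_constantCoeff_apply, PowerSeries.coeff_map,
    PowerSeries.coeff_zero_eq_constantCoeff_apply]

theorem hasSum_fiber {X : Type*} {E : X → ℕ} (f : X → ℂ) {k : ℕ} {s : Finset X}
    (h : ∀ x, E x = k ↔ x ∈ s) : HasSum (fun x : {x // E x = k} => f x) (∑ x ∈ s, f x) := by
  have h5 := s.hasSum f
  exact ((Equiv.subtypeEquivRight h).hasSum_iff (f := f ∘ ((↑) : {x // x ∈ s} → X))).2 h5

section ConjAt

variable {K : IntermediateField ℚ ℂ} {s : K →+* ℂ}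

/-- `f` has a `q`-expansion over `K` without negative powers and with constant term `c`, and the
`q`-expansion of `f'` is obtained by applying `s` to its coefficients. -/
def ConjAt (s : K →+* ℂ) (f f' : ℍ → ℂ) (c : K) : Prop :=
  ∃ (w : ℕ) (p : PowerSeries K), 0 < w ∧ constantCoeff p = c ∧
    HasPS w (p.map (algebraMap K ℂ)) f ∧ HasPS w (p.map s) f'

namespace ConjAt

variable {f f' g g' : ℍ → ℂ} {c d : K}

theorem conj (h : ConjAt s f f' c) : Conj s f f' := by
  obtain ⟨w, p, hw, -, h1, h2⟩ := h
  exact ⟨w, 0, p, hw, by simpa using h1, by simpa using h2⟩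

theorem holAtInfty (h : ConjAt s f f' c) : HolAtInfty f := by
  obtain ⟨w, p, hw, -, h1, h2⟩ := h
  exact h1.holAtInfty hw

theorem tendsto (h : ConjAt s f f' c) : Tendsto f UpperHalfPlane.atImInfty (𝓝 (c : ℂ)) := by
  obtain ⟨w, p, hw, hc, h1, h2⟩ := h
  have := h1.tendsto_atImInfty hw
  rw [← hc]
  rwa [constantCoeff_map_eq] at this

theorem mul (hf : ConjAt s f f' c) (hg : ConjAt s g g' d) :
    ConjAt s (fun τ => f τ * g τ) (fun τ => f' τ * g' τ) (c * d) := by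
  obtain ⟨w₁, p, hw₁, hc, h1, h2⟩ := hf
  obtain ⟨w₂, r, hw₂, hd, h3, h4⟩ := hg
  refine ⟨w₁ * w₂, expand w₂ hw₂.ne' p * expand w₁ hw₁.ne' r, Nat.mul_pos hw₁ hw₂, ?_, ?_, ?_⟩
  · rw [map_mul, PowerSeries.constantCoeff_expand, PowerSeries.constantCoeff_expand, hc, hd]
  · rw [map_mul, PowerSeries.map_expand, PowerSeries.map_expand]
    refine HasPS.mul ((HasPS.expand_iff hw₁ hw₂).2 h1) ?_
    rw [mul_comm w₁]
    exact (HasPS.expand_iff hw₂ hw₁).2 h3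
  · rw [map_mul, PowerSeries.map_expand, PowerSeries.map_expand]
    refine HasPS.mul ((HasPS.expand_iff hw₁ hw₂).2 h2) ?_
    rw [mul_comm w₁]
    exact (HasPS.expand_iff hw₂ hw₁).2 h4

theorem pow (hf : ConjAt s f f' c) (n : ℕ) :
    ConjAt s (fun τ => f τ ^ n) (fun τ => f' τ ^ n) (c ^ n) := by
  obtain ⟨w, p, hw, hc, h1, h2⟩ := hf
  refine ⟨w, p ^ n, hw, by rw [map_pow, hc], ?_, ?_⟩
  · rw [map_pow]; exact h1.pow n
  · rw [map_pow]; exact h2.pow n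

theorem const (c : K) {x : ℂ} (hx : s c = x) : ConjAt s (fun _ => (c : ℂ)) (fun _ => x) c :=
  ⟨1, PowerSeries.C c, one_pos, by simp,
    by rw [PowerSeries.map_C]; exact HasPS.const 1 _,
    by rw [PowerSeries.map_C, hx]; exact HasPS.const 1 _⟩

theorem inv (hf : ConjAt s f f' c) (hc : c ≠ 0) (h0 : ∀ τ, f τ ≠ 0) (h0' : ∀ τ, f' τ ≠ 0) :
    ConjAt s (fun τ => (f τ)⁻¹) (fun τ => (f' τ)⁻¹) c⁻¹ := by
  obtain ⟨w, p, hw, hpc, h1, h2⟩ := hf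
  have hp0 : constantCoeff p ≠ 0 := by rwa [hpc]
  have key : ∀ t : K →+* ℂ, ∀ f : ℍ → ℂ, HasPS w (p.map t) f → (∀ τ, f τ ≠ 0) →
      HasPS w (p⁻¹.map t) (fun τ => (f τ)⁻¹) := by
    intro t f h h0
    have e1 : constantCoeff (p.map t) = t (constantCoeff p) := constantCoeff_map_eq t p
    have e2 : constantCoeff (p.map t) ≠ 0 := by
      rw [e1]
      exact (map_ne_zero t).2 hp0
    have := h.inv hw e2 h0
    have e3 : (p.map t)⁻¹ = p⁻¹.map t := by
      rw [PowerSeries.inv_eq_iff_mul_eq_one e2, ← map_mul, PowerSeries.inv_mul_cancel _ hp0,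
        map_one]
    rwa [e3] at this
  exact ⟨w, p⁻¹, hw, by rw [PowerSeries.constantCoeff_inv, hpc], key _ _ h1 h0, key _ _ h2 h0'⟩

theorem congr {f₁ f₁' : ℍ → ℂ} (hf : ConjAt s f f' c) (h : ∀ τ, f₁ τ = f τ)
    (h' : ∀ τ, f₁' τ = f' τ) :
    ConjAt s f₁ f₁' c := by
  rwa [show f₁ = f from funext h, show f₁' = f' from funext h']

end ConjAt

/-- `q ^ r` for a rational number `r ≥ 0`. -/
theorem conjAt_ee_mul (s : K →+* ℂ) {r : ℚ} (hr : 0 ≤ r) :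
    ConjAt s (fun τ => ee (r * τ)) (fun τ => ee (r * τ)) (if r = 0 then 1 else 0) := by
  have hw : 0 < r.den := r.den_pos
  have key : ∀ τ : ℍ, ee (r * τ) = qParam r.den τ ^ r.num.toNat := by
    intro τ
    have h0 : (r.den : ℂ) ≠ 0 := by exact_mod_cast hw.ne'
    have h1 : ((r.num.toNat : ℕ) : ℂ) = (r.num : ℂ) := by
      exact_mod_cast congrArg (Int.cast (R := ℂ)) (Int.toNat_of_nonneg (Rat.num_nonneg.2 hr))
    have h2 : (r : ℂ) = r.num / r.den := by
      exact_mod_cast congrArg (Rat.cast (K := ℂ)) r.num_div_den.symm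
    simp only [ee, qParam]
    rw [← Complex.exp_nat_mul, h1, h2]
    congr 1
    push_cast
    field_simp
  refine ⟨r.den, PowerSeries.X ^ r.num.toNat, hw, ?_, ?_, ?_⟩
  · rw [map_pow, PowerSeries.constantCoeff_X, zero_pow_eq]
    congr 1
    rw [Int.toNat_eq_zero, eq_iff_iff, ← Rat.num_eq_zero]
    exact ⟨fun h => le_antisymm h (Rat.num_nonneg.2 hr), fun h => h.le⟩
  · rw [map_pow, PowerSeries.map_X]
    exact (HasPS.X_pow _ _).congr_fun key
  · rw [map_pow, PowerSeries.map_X]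
    exact (HasPS.X_pow _ _).congr_fun key

/-- The expansion of `W(τ, α τ + β)` in powers of `q`, from
`∏ (1 + x_n) = ∑_S ∏_{n ∈ S} x_n`. -/
theorem exists_series_W {α : ℚ} (hα : 0 < α) (ζ : K) : ∃ (w : ℕ) (p : PowerSeries K), 0 < w ∧
    constantCoeff p = 1 ∧ ∀ (t : K →+* ℂ) (β : ℂ), t ζ = ee β →
      HasPS w (p.map t) (fun τ => W τ (α * τ + β)) := by
  classical
  have hw : 0 < α.den := α.den_pos
  set w := α.den with hwdef
  set a := α.num.toNat with hadef
  have ha : 0 < a := by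
    have := Rat.num_pos.2 hα
    omega
  set e : ℕ → ℕ := fun n => n * w + a with he
  have hen : ∀ n, n < e n := fun n => by
    have := Nat.le_mul_of_pos_right n hw
    simp only [he]
    omega
  set E : Finset ℕ → ℕ := fun S => ∑ i ∈ S, e i with hE
  set P : ℕ → Finset (Finset ℕ) := fun k =>
    (Finset.range (k + 1)).powerset.filter (fun S => E S = k)
    with hP
  have hmemP : ∀ k S, S ∈ P k ↔ E S = k := by
    intro k S
    simp only [hP, Finset.mem_filter, Finset.mem_powerset, and_iff_right_iff_imp]
    rintro h i hi
    have := Finset.single_le_sum (f := e) (fun i _ => Nat.zero_le _) hi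
    have h2 := hen i
    rw [Finset.mem_range]
    change e i ≤ E S at this
    omega
  refine ⟨w, PowerSeries.mk fun k => ∑ S ∈ P k, (-ζ) ^ S.card, hw, ?_, ?_⟩
  · rw [← PowerSeries.coeff_zero_eq_constantCoeff_apply, PowerSeries.coeff_mk]
    have : P 0 = {∅} := by
      ext S
      rw [hmemP, Finset.mem_singleton]
      constructor
      · intro h
        by_contra hS
        obtain ⟨i, hi⟩ := Finset.nonempty_iff_ne_empty.2 hS
        have h2 := (Finset.sum_eq_zero_iff.1 h) i hi
        have := hen i
        omega
      · rintro rfl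
        simp [hE]
    rw [this]
    simp
  · intro t β hζ τ
    have hq : ∀ n : ℕ, ee (n * τ + (α * τ + β)) = t ζ * qParam w τ ^ e n := by
      intro n
      have h0 : (w : ℂ) ≠ 0 := by exact_mod_cast hw.ne'
      have h1 : ((a : ℕ) : ℂ) = (α.num : ℂ) := by
        exact_mod_cast congrArg (Int.cast (R := ℂ)) (Int.toNat_of_nonneg (Rat.num_nonneg.2 hα.le))
      have h2 : (α : ℂ) = α.num / w := by
        exact_mod_cast congrArg (Rat.cast (K := ℂ)) α.num_div_den.symm
      rw [hζ]
      simp only [ee, qParam]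
      rw [← Complex.exp_nat_mul, ← Complex.exp_add, h2]
      congr 1
      simp only [he]
      push_cast
      rw [h1]
      field_simp
      ring
    have hsum := summable_norm_ee τ.im_pos (α * τ + β)
    have h1 := (summable_finsetProd_of_summable_norm hsum).hasSum
    rw [← tprod_one_add (summable_finsetProd_of_summable_norm hsum)] at h1
    have h2 : ∏' n : ℕ, (1 + -ee (n * τ + (α * τ + β))) = W τ (α * τ + β) := by
      simp only [W, sub_eq_add_neg]
    rw [h2] at h1
    have h3 : ∀ S : Finset ℕ, ∏ n ∈ S, -ee (n * τ + (α * τ + β)) =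
        (-t ζ) ^ S.card * qParam w τ ^ E S := by
      intro S
      simp only [hq, hE, ← neg_mul]
      rw [Finset.prod_mul_distrib, Finset.prod_const, Finset.prod_pow_eq_pow_sum]
    simp only [h3] at h1
    rw [← (Equiv.sigmaFiberEquiv E).hasSum_iff] at h1
    refine h1.sigma fun k => ?_
    have h4 := hasSum_fiber (fun S => (-t ζ) ^ S.card * qParam w τ ^ E S)
      (fun S => (hmemP k S).symm)
    have h6 : coeff k ((PowerSeries.mk fun k => ∑ S ∈ P k, (-ζ) ^ S.card).map t) * qParam w τ ^ k =
        ∑ S ∈ P k, (-t ζ) ^ S.card * qParam w τ ^ E S := ?_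
    · rw [h6]
      exact h4
    rw [PowerSeries.coeff_map, PowerSeries.coeff_mk, map_sum, Finset.sum_mul]
    refine Finset.sum_congr rfl fun S hS => ?_
    rw [(hmemP k S).1 hS]
    simp

theorem conjAt_W (s : K →+* ℂ) {α : ℚ} (hα : 0 ≤ α) {ζ : K} {β β' : ℂ} (h : (ζ : ℂ) = ee β)
    (h' : s ζ = ee β') : ConjAt s (fun τ => W τ (α * τ + β)) (fun τ => W τ (α * τ + β'))
      (if α = 0 then 1 - ζ else 1) := by
  rcases hα.eq_or_lt with rfl | hα
  · have h1 : ConjAt s (fun τ => W τ ((1 : ℚ) * τ + β)) (fun τ => W τ ((1 : ℚ) * τ + β')) 1 := by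
      obtain ⟨w, p, hw, hc, H⟩ := exists_series_W (α := 1) one_pos ζ
      exact ⟨w, p, hw, hc, H _ _ h, H _ _ h'⟩
    have h2 := (ConjAt.const (s := s) (1 - ζ) (x := 1 - ee β') (by simp [h'])).mul h1
    rw [if_pos rfl]
    rw [mul_one] at h2
    refine h2.congr (fun τ => ?_) (fun τ => ?_)
    · have := W_eq_mul τ.im_pos β
      simp only [Rat.cast_zero, zero_mul, zero_add, this, Rat.cast_one, one_mul, add_comm β]
      push_cast
      rw [h]
    · have := W_eq_mul τ.im_pos β'
      simp only [Rat.cast_zero, zero_mul, zero_add, this, Rat.cast_one, one_mul, add_comm β']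
  · obtain ⟨w, p, hw, hc, H⟩ := exists_series_W hα ζ
    rw [if_neg hα.ne']
    exact ⟨w, p, hw, hc, H _ _ h, H _ _ h'⟩

end ConjAt

end

section

open Complex (I)
open Filter Topology
open UpperHalfPlane (atImInfty)

/-! ### Division values: the forms `x_v` of weight `3` and the functions `s_v` -/

/-- The form `x_v(τ) = η(τ)⁶ θ(τ, 2z) / θ(τ, z)⁴` of weight `3`, where `z = v₀ τ + v₁`. It is the
division value of an elliptic function of `z`, namely of `℘'` up to a constant factor. For
`v ∈ ℤ²` it is `0` by the convention on division by `0`. -/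
def xv (v : Fin 2 → ℚ) (τ : ℍ) : ℂ :=
  ModularForm.eta τ ^ 6 * theta τ (2 * (v 0 * τ + v 1)) / theta τ (v 0 * τ + v 1) ^ 4

/-- The function `s_v(τ) = e(v₀² τ / 2) θ(τ, v₀ τ + v₁)`. -/
def sv (v : Fin 2 → ℚ) (τ : ℍ) : ℂ := ee ((v 0 : ℂ) ^ 2 * τ / 2) * theta τ (v 0 * τ + v 1)

/-- The row vector `v γ`. -/
def vmul (v : Fin 2 → ℚ) (γ : Matrix (Fin 2) (Fin 2) ℤ) : Fin 2 → ℚ :=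
  Matrix.vecMul v (γ.map (Int.cast : ℤ → ℚ))

theorem vmul_zero_apply (v : Fin 2 → ℚ) (γ : Matrix (Fin 2) (Fin 2) ℤ) :
    vmul v γ 0 = v 0 * γ 0 0 + v 1 * γ 1 0 := by
  simp [vmul, Matrix.vecMul, dotProduct, Fin.sum_univ_two]

theorem vmul_one_apply (v : Fin 2 → ℚ) (γ : Matrix (Fin 2) (Fin 2) ℤ) :
    vmul v γ 1 = v 0 * γ 0 1 + v 1 * γ 1 1 := by
  simp [vmul, Matrix.vecMul, dotProduct, Fin.sum_univ_two]

theorem vmul_mul (v : Fin 2 → ℚ) (γ δ : Matrix (Fin 2) (Fin 2) ℤ) :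
    vmul v (γ * δ) = vmul (vmul v γ) δ := by
  rw [vmul, vmul, vmul, Matrix.vecMul_vecMul]
  congr 1
  exact Matrix.map_mul (f := Int.castRingHom ℚ)

theorem vmul_one (v : Fin 2 → ℚ) : vmul v 1 = v := by
  rw [vmul, Matrix.map_one _ (by simp) (by simp), Matrix.vecMul_one]

theorem add_int_eq (v : Fin 2 → ℚ) (a : Fin 2 → ℤ) :
    (fun i => v i + (a i : ℚ)) = v + (a 0 • ![1, 0] + a 1 • ![0, 1]) := by
  funext i
  fin_cases i <;> simp

theorem xv_add_int (v : Fin 2 → ℚ) (a : Fin 2 → ℤ) : xv (fun i => v i + (a i : ℚ)) = xv v := by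
  have h0 : Function.Periodic xv ![1, 0] := by
    intro v
    funext τ
    have h1 := theta_add_tau τ (v 0 * τ + v 1)
    have h2 := theta_add_tau τ (2 * (v 0 * τ + v 1))
    have h3 := theta_add_tau τ (2 * (v 0 * τ + v 1) + τ)
    have e1 : ee (-(2 * ((v 0 : ℂ) * τ + v 1))) = ee (-(v 0 * τ + v 1)) ^ 2 := by
      rw [← ee_nat_mul]; congr 1; push_cast; ring
    have e2 : ee (-(2 * ((v 0 : ℂ) * τ + v 1) + τ)) =
        ee (-(v 0 * τ + v 1)) ^ 2 * ee (-(τ / 2)) ^ 2 := by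
      rw [← ee_nat_mul, ← ee_nat_mul, ← ee_add]; congr 1; push_cast; ring
    rw [h2, e1, e2] at h3
    simp only [xv, Pi.add_apply, Matrix.cons_val_zero, Matrix.cons_val_one, Rat.cast_add,
      Rat.cast_one, add_zero]
    rw [show ((v 0 : ℂ) + 1) * τ + v 1 = v 0 * τ + v 1 + τ by ring, h1,
      show 2 * ((v 0 : ℂ) * τ + v 1 + τ) = 2 * (v 0 * τ + v 1) + τ + τ by ring, h3]
    have := ee_ne_zero (-((τ : ℂ) / 2))
    have := ee_ne_zero (-((v 0 : ℂ) * τ + v 1))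
    rw [mul_pow, neg_pow, mul_pow,
      show ModularForm.eta (τ : ℂ) ^ 6 * (-(ee (-((τ : ℂ) / 2)) * (ee (-((v 0 : ℂ) * τ + v 1)) ^ 2 *
          ee (-((τ : ℂ) / 2)) ^ 2)) * (-(ee (-((τ : ℂ) / 2)) * ee (-((v 0 : ℂ) * τ + v 1)) ^ 2) *
          theta τ (2 * ((v 0 : ℂ) * τ + v 1)))) = (ee (-((τ : ℂ) / 2)) ^ 4 *
            ee (-((v 0 : ℂ) * τ + v 1)) ^ 4) * (ModularForm.eta (τ : ℂ) ^ 6 *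
            theta τ (2 * ((v 0 : ℂ) * τ + v 1))) by ring,
      show (-1 : ℂ) ^ 4 = 1 by norm_num, one_mul, mul_div_mul_left]
    positivity
  have h1 : Function.Periodic xv ![0, 1] := by
    intro v
    funext τ
    have h1 := theta_add_one τ (v 0 * τ + v 1)
    have h2 := theta_add_one τ (2 * (v 0 * τ + v 1))
    have h3 := theta_add_one τ (2 * (v 0 * τ + v 1) + 1)
    simp only [xv, Pi.add_apply, Matrix.cons_val_zero, Matrix.cons_val_one, Rat.cast_add,
      Rat.cast_one, add_zero]
    rw [show (v 0 : ℂ) * τ + (v 1 + 1) = v 0 * τ + v 1 + 1 by ring, h1,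
      show 2 * ((v 0 : ℂ) * τ + v 1 + 1) = 2 * (v 0 * τ + v 1) + 1 + 1 by ring, h3, h2, neg_neg]
    ring
  rw [add_int_eq, ← add_assoc]
  rw [(h1.zsmul _), (h0.zsmul _)]

theorem xv_neg (v : Fin 2 → ℚ) : xv (-v) = -xv v := by
  funext τ
  have h1 := theta_neg τ (v 0 * τ + v 1)
  have h2 := theta_neg τ (2 * (v 0 * τ + v 1))
  simp only [xv, Pi.neg_apply, Rat.cast_neg]
  rw [show -(v 0 : ℂ) * τ + -(v 1) = -(v 0 * τ + v 1) by ring, h1, mul_neg, h2]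
  ring

theorem xv_slash (γ : SL(2, ℤ)) (v : Fin 2 → ℚ) : xv v ∣[(3 : ℤ)] γ = xv (vmul v γ.1) := by
  suffices H : ∀ γ ∈ Subgroup.closure {ModularGroup.S, ModularGroup.T},
      ∀ v, xv v ∣[(3 : ℤ)] γ = xv (vmul v γ.1) from
    H γ (by rw [SpecialLinearGroup.SL2Z_generators]; trivial) v
  intro γ hγ
  induction hγ using Subgroup.closure_induction with
  | mem γ hγ =>
    intro v
    rcases hγ with rfl | hγ
    · funext τ
      rw [ModularForm.SL_slash_apply]
      have hτ : (τ : ℂ) ≠ 0 := τ.ne_zero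
      have hd : UpperHalfPlane.denom (ModularGroup.S : GL (Fin 2) ℝ) τ = τ := by
        rw [ModularGroup.denom_S]
      have e0 : vmul v ModularGroup.S.1 0 = v 1 := by
        simp [vmul_zero_apply, ModularGroup.S]
      have e1 : vmul v ModularGroup.S.1 1 = -v 0 := by
        simp [vmul_one_apply, ModularGroup.S]
      set z : ℂ := v 1 * τ - v 0 with hz
      have h1 := theta_S τ z
      have h2 := theta_S τ (2 * z)
      have e2 : ee ((2 * z) ^ 2 / (2 * τ)) = ee (z ^ 2 / (2 * τ)) ^ 4 := by
        rw [← ee_nat_mul]; congr 1; push_cast; ring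
      rw [e2] at h2
      have e3 : (v 0 : ℂ) * ((ModularGroup.S • τ : ℍ) : ℂ) + v 1 = z / τ := by
        rw [coe_S_smul, hz]; field_simp; ring
      simp only [xv, e0, e1, e3, eta_pow_six_S, hd]
      rw [show 2 * (z / (τ : ℂ)) = 2 * z / τ by ring, h1, h2]
      rw [show (v 1 : ℂ) * τ + ((-v 0 : ℚ) : ℂ) = z by rw [hz]; push_cast; ring]
      have hee := ee_ne_zero (z ^ 2 / (2 * τ))
      generalize ee (z ^ 2 / (2 * τ)) = E at hee
      have hI4 : I ^ 4 = 1 := Complex.I_pow_four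
      have hneg : (-3 : ℤ) = -((3 : ℕ) : ℤ) := rfl
      rw [mul_pow, mul_pow, neg_pow, hI4, hneg, zpow_neg, zpow_natCast]
      by_cases ht : theta τ z = 0
      · simp [ht]
      · field_simp
        rw [Complex.I_sq]
        norm_num
    · rw [Set.mem_singleton_iff] at hγ
      subst hγ
      funext τ
      rw [ModularForm.SL_slash_apply]
      have hd : UpperHalfPlane.denom (ModularGroup.T : GL (Fin 2) ℝ) τ = 1 := by
        rw [ModularGroup.denom_apply]
        simp [ModularGroup.T]
      have e0 : vmul v ModularGroup.T.1 0 = v 0 := by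
        simp [vmul_zero_apply, ModularGroup.T]
      have e1 : vmul v ModularGroup.T.1 1 = v 0 + v 1 := by
        simp [vmul_one_apply, ModularGroup.T]
      have e3 : (v 0 : ℂ) * ((ModularGroup.T • τ : ℍ) : ℂ) + v 1 = v 0 * τ + (v 0 + v 1) := by
        rw [coe_T_smul]; ring
      have e4 : ee (1 / 12) ^ 4 = ee (1 / 4) * ee (1 / 12) := by
        rw [← ee_nat_mul, ← ee_add]; congr 1; push_cast; ring
      simp only [xv, e0, e1, e3, eta_pow_six_T, hd, theta_T, one_zpow, mul_one, Rat.cast_add]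
      have := ee_ne_zero (1 / 12)
      have := ee_ne_zero (1 / 4)
      rw [mul_pow, e4, show ∀ a b c d : ℂ, a * b * (c * d) = a * c * (b * d) by intros; ring,
        mul_div_mul_left _ _ (by positivity)]
  | one => intro v; simp [vmul_one]
  | mul γ δ _ _ h1 h2 =>
    intro v
    rw [SlashAction.slash_mul, h1, h2, Matrix.SpecialLinearGroup.coe_mul, vmul_mul]
  | inv γ _ h =>
    intro v
    have h1 := h (vmul v (γ⁻¹).1)
    rw [← vmul_mul, ← Matrix.SpecialLinearGroup.coe_mul, inv_mul_cancel,
      Matrix.SpecialLinearGroup.coe_one, vmul_one] at h1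
    rw [← h1, ← SlashAction.slash_mul, mul_inv_cancel, SlashAction.slash_one]

/-! ### Equality up to a root of unity -/

/-- Equality up to a root of unity. -/
def RootEquiv (f g : ℍ → ℂ) : Prop :=
  ∃ (ζ : ℂ) (n : ℕ), 0 < n ∧ ζ ^ n = 1 ∧ ∀ τ, f τ = ζ * g τ

namespace RootEquiv

variable {f g h f' g' : ℍ → ℂ}

theorem refl (f : ℍ → ℂ) : RootEquiv f f := ⟨1, 1, one_pos, by simp, by simp⟩

theorem of_ee (q : ℚ) (h : ∀ τ, f τ = ee q * g τ) : RootEquiv f g := by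
  refine ⟨ee q, q.den, q.den_pos, ?_, h⟩
  rw [← ee_nat_mul]
  have : ((q.den : ℕ) : ℂ) * q = (q.num : ℤ) := by
    exact_mod_cast congrArg (Rat.cast (K := ℂ)) (Rat.den_mul_eq_num q)
  rw [this, ee_int]

theorem trans (h1 : RootEquiv f g) (h2 : RootEquiv g h) : RootEquiv f h := by
  obtain ⟨ζ, n, hn, hζ, h1⟩ := h1
  obtain ⟨ξ, m, hm, hξ, h2⟩ := h2
  refine ⟨ζ * ξ, n * m, Nat.mul_pos hn hm, ?_, fun τ => by rw [h1, h2, mul_assoc]⟩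
  rw [mul_pow, pow_mul, hζ, one_pow, mul_comm n, pow_mul, hξ, one_pow, mul_one]

theorem symm (h1 : RootEquiv f g) : RootEquiv g f := by
  obtain ⟨ζ, n, hn, hζ, h1⟩ := h1
  have h0 : ζ ≠ 0 := by
    rintro rfl
    simp [zero_pow hn.ne'] at hζ
  exact ⟨ζ⁻¹, n, hn, by rw [inv_pow, hζ, inv_one], fun τ => by rw [h1, inv_mul_cancel_left₀ h0]⟩

theorem mul (h1 : RootEquiv f g) (h2 : RootEquiv f' g') : RootEquiv (f * f') (g * g') := by
  obtain ⟨ζ, n, hn, hζ, h1⟩ := h1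
  obtain ⟨ξ, m, hm, hξ, h2⟩ := h2
  refine ⟨ζ * ξ, n * m, Nat.mul_pos hn hm, ?_, fun τ => ?_⟩
  · rw [mul_pow, pow_mul, hζ, one_pow, mul_comm n, pow_mul, hξ, one_pow, mul_one]
  · simp only [Pi.mul_apply, h1, h2]
    ring

theorem pow (h1 : RootEquiv f g) (m : ℕ) : RootEquiv (f ^ m) (g ^ m) := by
  obtain ⟨ζ, n, hn, hζ, h1⟩ := h1
  refine ⟨ζ ^ m, n, hn, by rw [← pow_mul, mul_comm, pow_mul, hζ, one_pow], fun τ => ?_⟩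
  simp only [Pi.pow_apply, h1, mul_pow]

theorem prod {ι : Type*} (s : Finset ι) {f g : ι → ℍ → ℂ} (h : ∀ i ∈ s, RootEquiv (f i) (g i)) :
    RootEquiv (∏ i ∈ s, f i) (∏ i ∈ s, g i) := by
  classical
  induction s using Finset.induction_on with
  | empty => simpa using refl 1
  | insert a s ha ih =>
    rw [Finset.prod_insert ha, Finset.prod_insert ha]
    exact (h a (by simp)).mul (ih fun i hi => h i (by simp [hi]))

end RootEquiv

theorem sv_neg (v : Fin 2 → ℚ) : RootEquiv (sv (-v)) (sv v) := by
  refine RootEquiv.of_ee (1 / 2) fun τ => ?_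
  have h1 := theta_neg τ (v 0 * τ + v 1)
  have h2 := ee_half
  push_cast
  rw [h2]
  simp only [sv, Pi.neg_apply, Rat.cast_neg]
  rw [show -(v 0 : ℂ) * τ + -(v 1) = -(v 0 * τ + v 1) by ring, h1, neg_sq]
  ring

theorem sv_add_int (v : Fin 2 → ℚ) (a : Fin 2 → ℤ) :
    RootEquiv (sv (fun i => v i + (a i : ℚ))) (sv v) := by
  have h0 : ∀ v : Fin 2 → ℚ, RootEquiv (sv (v + ![1, 0])) (sv v) := by
    intro v
    refine RootEquiv.of_ee (1 / 2 - v 1) fun τ => ?_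
    have h1 := theta_add_tau τ (v 0 * τ + v 1)
    simp only [sv, Pi.add_apply, Matrix.cons_val_zero, Matrix.cons_val_one, Rat.cast_add,
      Rat.cast_one, add_zero]
    rw [show ((v 0 : ℂ) + 1) * τ + v 1 = v 0 * τ + v 1 + τ by ring, h1]
    have e1 : ee (((v 0 : ℂ) + 1) ^ 2 * τ / 2) * (ee (-(τ / 2)) * ee (-(v 0 * τ + v 1))) =
        ee (-v 1) * ee ((v 0 : ℂ) ^ 2 * τ / 2) := by
      rw [← ee_add, ← ee_add, ← ee_add]; congr 1; ring
    have e2 : ee (((1 / 2 - v 1 : ℚ)) : ℂ) = -ee (-v 1) := by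
      push_cast
      rw [sub_eq_add_neg, ee_add, ee_half, neg_one_mul]
    rw [e2]
    linear_combination (-theta τ (v 0 * τ + v 1)) * e1
  have h1 : ∀ v : Fin 2 → ℚ, RootEquiv (sv (v + ![0, 1])) (sv v) := by
    intro v
    refine RootEquiv.of_ee (1 / 2) fun τ => ?_
    have h1 := theta_add_one τ (v 0 * τ + v 1)
    simp only [sv, Pi.add_apply, Matrix.cons_val_zero, Matrix.cons_val_one, Rat.cast_add,
      Rat.cast_one, add_zero]
    push_cast
    rw [show (v 0 : ℂ) * τ + (v 1 + 1) = v 0 * τ + v 1 + 1 by ring, h1, ee_half]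
    ring
  have key : ∀ u : Fin 2 → ℚ, (∀ v, RootEquiv (sv (v + u)) (sv v)) →
      ∀ (n : ℤ) v, RootEquiv (sv (v + n • u)) (sv v) := by
    intro u hu n
    induction n using Int.induction_on with
    | zero => intro v; simpa using RootEquiv.refl _
    | succ i ih =>
      intro v
      rw [add_smul, one_smul, ← add_assoc]
      exact (hu _).trans (ih v)
    | pred i ih =>
      intro v
      have := hu (v + (-(i : ℤ) - 1) • u)
      rw [add_assoc, sub_smul, one_smul, sub_add_cancel] at this
      rw [sub_smul, one_smul]
      exact this.symm.trans (ih v)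
  rw [add_int_eq, ← add_assoc]
  exact (key _ h1 _ _).trans (key _ h0 _ _)

theorem sv_smul (γ : SL(2, ℤ)) (v : Fin 2 → ℚ) :
    RootEquiv (fun τ => sv v (γ • τ)) (sv (vmul v γ.1)) := by
  suffices H : ∀ γ ∈ Subgroup.closure {ModularGroup.S, ModularGroup.T},
      ∀ v, RootEquiv (fun τ => sv v (γ • τ)) (sv (vmul v γ.1)) from
    H γ (by rw [SpecialLinearGroup.SL2Z_generators]; trivial) v
  have hcomp : ∀ {f g : ℍ → ℂ} (γ : SL(2, ℤ)), RootEquiv f g →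
      RootEquiv (fun τ => f (γ • τ)) (fun τ => g (γ • τ)) := by
    rintro f g γ ⟨ζ, n, hn, hζ, h⟩
    exact ⟨ζ, n, hn, hζ, fun τ => h _⟩
  intro γ hγ
  induction hγ using Subgroup.closure_induction with
  | mem γ hγ =>
    intro v
    rcases hγ with rfl | hγ
    · refine RootEquiv.of_ee (-1 / 4 - v 0 * v 1) fun τ => ?_
      have hτ : (τ : ℂ) ≠ 0 := τ.ne_zero
      have e0 : vmul v ModularGroup.S.1 0 = v 1 := by
        simp [vmul_zero_apply, ModularGroup.S]
      have e1 : vmul v ModularGroup.S.1 1 = -v 0 := by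
        simp [vmul_one_apply, ModularGroup.S]
      set z : ℂ := v 1 * τ - v 0 with hz
      have h1 := theta_S τ z
      have e3 : (v 0 : ℂ) * ((ModularGroup.S • τ : ℍ) : ℂ) + v 1 = z / τ := by
        rw [coe_S_smul, hz]; field_simp; ring
      simp only [sv, e0, e1, e3]
      rw [h1, show (v 1 : ℂ) * τ + ((-v 0 : ℚ) : ℂ) = z by rw [hz]; push_cast; ring]
      have e4 : ee (-1 / 4) = -I := by
        rw [ee, ← Complex.exp_neg_pi_div_two_mul_I]
        congr 1
        ring
      have e5 : ee (((-1 / 4 - v 0 * v 1 : ℚ)) : ℂ) = -I * ee (-(v 0 * v 1)) := by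
        push_cast
        rw [sub_eq_add_neg, ee_add, e4]
      have e6 : ee ((v 0 : ℂ) ^ 2 * ((ModularGroup.S • τ : ℍ) : ℂ) / 2) * ee (z ^ 2 / (2 * τ)) =
          ee (-(v 0 * v 1)) * ee ((v 1 : ℂ) ^ 2 * τ / 2) := by
        rw [← ee_add, ← ee_add, coe_S_smul, hz]
        congr 1
        field_simp
        ring
      rw [e5]
      linear_combination (-I * theta τ z) * e6
    · rw [Set.mem_singleton_iff] at hγ
      subst hγ
      refine RootEquiv.of_ee (1 / 12 + v 0 ^ 2 / 2) fun τ => ?_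
      have e0 : vmul v ModularGroup.T.1 0 = v 0 := by
        simp [vmul_zero_apply, ModularGroup.T]
      have e1 : vmul v ModularGroup.T.1 1 = v 0 + v 1 := by
        simp [vmul_one_apply, ModularGroup.T]
      have e3 : (v 0 : ℂ) * ((ModularGroup.T • τ : ℍ) : ℂ) + v 1 = v 0 * τ + (v 0 + v 1) := by
        rw [coe_T_smul]; ring
      simp only [sv, e0, e1, e3, theta_T]
      have e4 : ee ((v 0 : ℂ) ^ 2 * ((ModularGroup.T • τ : ℍ) : ℂ) / 2) =
          ee ((v 0 : ℂ) ^ 2 / 2) * ee ((v 0 : ℂ) ^ 2 * τ / 2) := by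
        rw [← ee_add, coe_T_smul]; congr 1; ring
      rw [e4]
      push_cast
      rw [ee_add]
      ring
  | one => intro v; simpa [vmul_one] using RootEquiv.refl _
  | mul γ δ _ _ h1 h2 =>
    intro v
    rw [Matrix.SpecialLinearGroup.coe_mul, vmul_mul]
    have := hcomp δ (h1 v)
    simp only [mul_smul]
    exact this.trans (h2 _)
  | inv γ _ h =>
    intro v
    have h1 := hcomp γ⁻¹ (h (vmul v (γ⁻¹).1))
    rw [← vmul_mul, ← Matrix.SpecialLinearGroup.coe_mul, inv_mul_cancel,
      Matrix.SpecialLinearGroup.coe_one, vmul_one] at h1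
    simp only [smul_inv_smul] at h1
    exact h1.symm

theorem theta_division_ne_zero {α β : ℚ} (h : ∀ m n : ℤ, ¬ (α = m ∧ β = n)) (τ : ℍ) :
    theta τ (α * τ + β) ≠ 0 := by
  refine theta_ne_zero fun m n hmn => h m n ?_
  have him := congrArg Complex.im hmn
  have e1 : ((α : ℂ) * τ + β).im = α * τ.im := by
    have h1 : (α : ℂ) = ((α : ℝ) : ℂ) := by push_cast; rfl
    have h2 : (β : ℂ) = ((β : ℝ) : ℂ) := by push_cast; rfl
    rw [h1, h2]; simp
  have e2 : ((m : ℂ) * τ + n).im = m * τ.im := by simp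
  rw [e1, e2] at him
  have h1 : (α : ℝ) = m := mul_right_cancel₀ τ.im_pos.ne' him
  have h2 : α = m := by exact_mod_cast h1
  refine ⟨h2, ?_⟩
  subst h2
  have h3 : (β : ℂ) = n := by simpa using hmn
  exact_mod_cast h3

theorem division_identity {E T h H Z a b V₁ V₂ w P Q : ℂ} (hT : T ≠ 0) (hh : h ≠ 0) (hZ : Z ≠ 0)
    (e1 : h ^ 4 * Z ^ 2 = 1) (e2 : H * Z = 1) (e3 : E ^ 6 * T = T ^ 4) (e4 : a * b = Z) :
    (E * w) ^ 6 * -(T * H * (V₁ * V₂)) / (-(T * h * (P * Q))) ^ 4 =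
      a * (-b * (V₁ * V₂ * w ^ 6) * ((P * Q) ^ 4)⁻¹) := by
  by_cases hw : P * Q = 0
  · simp [hw]
  · rw [div_eq_iff (pow_ne_zero _ (neg_ne_zero.2 (mul_ne_zero (mul_ne_zero hT hh) hw))), neg_pow,
      mul_pow (T * h)]
    have h1 : ((P * Q) ^ 4)⁻¹ * (P * Q) ^ 4 = 1 := inv_mul_cancel₀ (pow_ne_zero _ hw)
    have h2 : h ^ 4 * Z = H := by
      apply mul_right_cancel₀ hZ
      linear_combination e1 - e2
    linear_combination (-(w ^ 6 * H * V₁ * V₂)) * e3 +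
      (w ^ 6 * V₁ * V₂ * T ^ 4 * h ^ 4) * e4 + (w ^ 6 * V₁ * V₂ * T ^ 4) * h2 +
      (w ^ 6 * V₁ * V₂ * T ^ 4 * h ^ 4 * a * b) * h1

section Conj

variable {K : IntermediateField ℚ ℂ} {s : K →+* ℂ}

/-- The constant `c` such that `q ^ (-α) x_{(α, β)}` tends to `c` at infinity, for
`0 ≤ α ≤ 1 / 2`, as a function of `α` and of `ζ = e(β)`. -/
def leadCoeff {F : Type*} [Field F] (α : ℚ) (ζ : F) : F :=
  -ζ * ((if 2 * α = 0 then 1 - ζ ^ 2 else 1) * (if 1 - 2 * α = 0 then 1 - (ζ ^ 2)⁻¹ else 1)) *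
    ((if α = 0 then 1 - ζ else 1) ^ 4)⁻¹

theorem conjAt_xv {α β β' : ℚ} (hα : 0 ≤ α) (hα' : α ≤ 1 / 2)
    (h : ∀ m n : ℤ, ¬ (α = m ∧ β = n)) {ζ : K} (hζ : (ζ : ℂ) = ee β) (hζ' : s ζ = ee β') :
    ∃ y y' : ℍ → ℂ, (∀ τ, xv ![α, β] τ = ee (α * τ) * y τ) ∧
      (∀ τ, xv ![α, β'] τ = ee (α * τ) * y' τ) ∧ ConjAt s y y' (leadCoeff α ζ) := by
  have h' : ∀ m n : ℤ, ¬ (α = m ∧ β' = n) := by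
    rintro m n ⟨h1, h2⟩
    subst h2
    rw [Rat.cast_intCast, ee_int, map_eq_one_iff s s.injective] at hζ'
    rw [hζ', OneMemClass.coe_one, eq_comm, ee_eq_one_iff] at hζ
    obtain ⟨k, hk⟩ := hζ
    exact h m k ⟨h1, by exact_mod_cast hk⟩
  set y : ℚ → ℍ → ℂ := fun β τ => -ee β * (W τ ((2 * α : ℚ) * τ + 2 * β) *
    W τ ((1 - 2 * α : ℚ) * τ + -(2 * β)) * W τ ((1 : ℚ) * τ + 0) ^ 6) *
    ((W τ (α * τ + β) * W τ ((1 - α : ℚ) * τ + -β)) ^ 4)⁻¹ with hy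
  have key : ∀ β : ℚ, ∀ τ : ℍ, xv ![α, β] τ = ee (α * τ) * y β τ := by
    intro β τ
    have h1 := theta_eq τ (α * τ + β)
    have h2 := theta_eq τ (2 * (α * τ + β))
    have e1 : ee (-((α * τ + β) / 2)) ^ 4 * ee (α * τ + β) ^ 2 = 1 := by
      rw [← ee_nat_mul, ← ee_nat_mul, ← ee_add, ← ee_zero]; congr 1; push_cast; ring
    have e2 : ee (-(2 * ((α : ℂ) * τ + β) / 2)) * ee (α * τ + β) = 1 := by
      rw [← ee_add, ← ee_zero]; congr 1; ring
    have e3 : ee ((τ : ℂ) / 24) ^ 6 * ee (τ / 12) = ee (τ / 12) ^ 4 := by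
      rw [← ee_nat_mul, ← ee_nat_mul, ← ee_add]; congr 1; push_cast; ring
    have e4 : ee ((α : ℂ) * τ) * ee β = ee (α * τ + β) := (ee_add _ _).symm
    have a1 : (2 * α : ℚ) * (τ : ℂ) + 2 * β = 2 * (α * τ + β) := by push_cast; ring
    have a2 : (1 - 2 * α : ℚ) * (τ : ℂ) + -(2 * β) = τ - 2 * (α * τ + β) := by push_cast; ring
    have a3 : (1 - α : ℚ) * (τ : ℂ) + -β = τ - (α * τ + β) := by push_cast; ring
    have a4 : (1 : ℚ) * (τ : ℂ) + 0 = τ := by push_cast; ring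
    simp only [xv, hy, Matrix.cons_val_zero, Matrix.cons_val_one, h1, h2, eta_eq, a1, a2, a3, a4]
    exact division_identity (ee_ne_zero _) (ee_ne_zero _) (ee_ne_zero _) e1 e2 e3 e4
  refine ⟨y β, y β', key β, key β', ?_⟩
  have hne : ∀ β : ℚ, (∀ m n : ℤ, ¬ (α = m ∧ β = n)) → ∀ τ : ℍ,
      (W τ (α * τ + β) * W τ ((1 - α : ℚ) * τ + -β)) ^ 4 ≠ 0 := by
    intro β h τ
    have := theta_division_ne_zero h τ
    rw [theta_eq] at this
    refine pow_ne_zero _ ?_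
    rw [show (1 - α : ℚ) * (τ : ℂ) + -β = τ - (α * τ + β) by push_cast; ring]
    exact (mul_ne_zero_iff.1 (neg_ne_zero.1 this)).2
  have hc : (if α = 0 then 1 - ζ else 1) ≠ 0 := by
    split_ifs with h0
    · rw [sub_ne_zero]
      rintro h1
      rw [← h1, OneMemClass.coe_one, eq_comm, ee_eq_one_iff] at hζ
      obtain ⟨k, hk⟩ := hζ
      exact h 0 k ⟨by simpa using h0, by exact_mod_cast hk⟩
    · exact one_ne_zero
  have z2 : ((ζ ^ 2 : K) : ℂ) = ee (2 * β) := by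
    rw [show (2 : ℂ) * β = (2 : ℕ) * β by norm_num, ee_nat_mul, ← hζ]; push_cast; rfl
  have z2' : s (ζ ^ 2) = ee (2 * β') := by
    rw [show (2 : ℂ) * β' = (2 : ℕ) * β' by norm_num, ee_nat_mul, ← hζ', map_pow]
  have z3 : (((ζ ^ 2)⁻¹ : K) : ℂ) = ee (-(2 * β)) := by rw [ee_neg, ← z2]; push_cast; rfl
  have z3' : s ((ζ ^ 2)⁻¹) = ee (-(2 * β')) := by rw [ee_neg, ← z2', map_inv₀]
  have z4 : ((ζ⁻¹ : K) : ℂ) = ee (-β) := by rw [ee_neg, ← hζ]; push_cast; rfl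
  have z4' : s (ζ⁻¹) = ee (-β') := by rw [ee_neg, ← hζ', map_inv₀]
  have b1 := conjAt_W s (α := 2 * α) (by linarith) z2 z2'
  have b2 := conjAt_W s (α := 1 - 2 * α) (by linarith) z3 z3'
  have b3 := (conjAt_W s (α := 1) (by norm_num) (ζ := 1) (β := 0) (β' := 0) (by simp [ee_zero])
    (by simp [ee_zero])).pow 6
  have b4 := conjAt_W s hα hζ hζ'
  have b5 := conjAt_W s (α := 1 - α) (by linarith) z4 z4'
  have b6 := ((b4.mul b5).pow 4).inv (by
    rw [if_neg (by linarith : ¬ (1 - α = 0)), mul_one]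
    exact pow_ne_zero _ hc) (hne β h) (hne β' h')
  have b7 := ((ConjAt.const (s := s) (-ζ) (x := -ee β') (by rw [map_neg, hζ'])).mul
    ((b1.mul b2).mul b3)).mul b6
  have hcc : leadCoeff α ζ = -ζ * (((if 2 * α = 0 then 1 - ζ ^ 2 else 1) *
      (if 1 - 2 * α = 0 then 1 - (ζ ^ 2)⁻¹ else 1)) * (if (1 : ℚ) = 0 then 1 - 1 else 1) ^ 6) *
      (((if α = 0 then 1 - ζ else 1) * (if 1 - α = 0 then 1 - ζ⁻¹ else 1)) ^ 4)⁻¹ := by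
    rw [if_neg (by linarith : ¬ (1 - α = 0)), if_neg (one_ne_zero : (1 : ℚ) ≠ 0), leadCoeff]
    simp only [one_pow, mul_one]
  rw [hcc]
  refine b7.congr (fun τ => ?_) (fun τ => ?_)
  · simp only [hy, NegMemClass.coe_neg, hζ]
  · simp only [hy]

theorem xv_of_int {v : Fin 2 → ℚ} {m n : ℤ} (h0 : v 0 = m) (h1 : v 1 = n) : xv v = 0 := by
  funext τ
  have : theta τ (v 0 * τ + v 1) = 0 := theta_eq_zero_iff.2 ⟨m, n, by rw [h0, h1]; simp⟩
  simp [xv, this]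

theorem xv_of_two_mul_int {v : Fin 2 → ℚ} {m n : ℤ} (h0 : 2 * v 0 = m) (h1 : 2 * v 1 = n) :
    xv v = 0 := by
  funext τ
  have : theta τ (2 * (v 0 * τ + v 1)) = 0 := theta_eq_zero_iff.2 ⟨m, n, by
    rw [← Rat.cast_intCast m, ← Rat.cast_intCast n, ← h0, ← h1]; push_cast; ring⟩
  simp [xv, this]

/-- Up to sign and translation by `ℤ²`, the first coordinate lies between `0` and `1 / 2`. -/
theorem exists_reduction (α : ℚ) : ∃ (m : ℤ) (ε : ℤ), (ε = 1 ∨ ε = -1) ∧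
    0 ≤ ε * (α - m) ∧ ε * (α - m) ≤ 1 / 2 := by
  rcases le_total (Int.fract α) (1 / 2) with h | h
  · refine ⟨⌊α⌋, 1, Or.inl rfl, ?_, ?_⟩
    · rw [Int.cast_one, one_mul]; exact Int.fract_nonneg α
    · rw [Int.cast_one, one_mul]; exact h
  · refine ⟨⌊α⌋ + 1, -1, Or.inr rfl, ?_, ?_⟩
    · have := (Int.fract_lt_one α).le
      rw [Int.fract] at this
      push_cast; linarith
    · rw [Int.fract] at h
      push_cast; linarith

theorem xv_reduction {ε : ℤ} (hε : ε = 1 ∨ ε = -1) (α β : ℚ) (m : ℤ) :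
    xv ![α, β] = fun τ => (ε : ℂ) * xv ![ε * (α - m), ε * β] τ := by
  have h1 : xv ![α, β] = xv ![α - m, β] := by
    rw [← xv_add_int ![α - m, β] ![m, 0]]
    congr 1
    funext i
    fin_cases i <;> simp
  rcases hε with rfl | rfl
  · rw [h1]; simp
  · have h2 : xv ![α - m, β] = -xv ![-(α - m), -β] := by
      rw [← xv_neg]
      congr 1
      funext i
      fin_cases i <;> simp
    rw [h1, h2]
    funext τ
    simp

theorem conj_xv {α β β' : ℚ} {ζ : K} (hζ : (ζ : ℂ) = ee β) (hζ' : s ζ = ee β') :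
    Conj s (xv ![α, β]) (xv ![α, β']) ∧ HolAtInfty (xv ![α, β]) := by
  by_cases h : ∀ m n : ℤ, ¬ (α = m ∧ β = n)
  swap
  · push Not at h
    obtain ⟨m, n, rfl, rfl⟩ := h
    rw [Rat.cast_intCast, ee_int] at hζ
    have : ζ = 1 := by exact_mod_cast hζ
    rw [this, map_one, eq_comm, ee_eq_one_iff] at hζ'
    obtain ⟨k, hk⟩ := hζ'
    rw [xv_of_int (v := ![(m : ℚ), (n : ℚ)]) (m := m) (n := n) rfl rfl,
      xv_of_int (v := ![(m : ℚ), β']) (m := m) (n := k) rfl (by simpa using by exact_mod_cast hk)]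
    have h0 := ConjAt.const (s := s) 0 (x := 0) (map_zero s)
    exact ⟨h0.conj, h0.holAtInfty⟩
  obtain ⟨m, ε, hε, h1, h2⟩ := exists_reduction α
  have hee : ∀ x : ℚ, ee ((ε * x : ℚ) : ℂ) = ee x ^ ε := by
    intro x
    rcases hε with rfl | rfl
    · simp
    · simp [ee_neg]
  obtain ⟨y, y', e1, e2, e3⟩ := conjAt_xv (s := s) h1 h2 (β := ε * β) (β' := ε * β') (ζ := ζ ^ ε)
    (by
      rintro k n ⟨hk, hn⟩
      rcases hε with rfl | rfl
      · refine h (k + m) n ⟨?_, ?_⟩ <;> push_cast at * <;> linarith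
      · refine h (-k + m) (-n) ⟨?_, ?_⟩ <;> push_cast at * <;> linarith)
    (by rw [hee, ← hζ]; rfl) (by rw [hee, ← hζ', map_zpow₀])
  have h3 := (ConjAt.const (s := s) (ε : K) (x := (ε : ℂ)) (by simp)).mul
    ((conjAt_ee_mul s h1).mul e3)
  have h4 := h3.congr (f₁ := xv ![α, β]) (f₁' := xv ![α, β'])
    (fun τ => by rw [xv_reduction hε α β m]; simp only [e1]; push_cast; rfl)
    (fun τ => by rw [xv_reduction hε α β' m]; simp only [e2])
  exact ⟨h4.conj, h4.holAtInfty⟩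

end Conj

theorem holAtInfty_xv (v : Fin 2 → ℚ) : HolAtInfty (xv v) := by
  have h : v = ![v 0, v 1] := by funext i; fin_cases i <;> rfl
  rw [h]
  exact (conj_xv (K := ⊤) (s := algebraMap _ ℂ) (ζ := ⟨ee (v 1), trivial⟩) (β' := v 1) rfl rfl).2

theorem ee_rat_mem_Qcycl (q : ℚ) : ee q ∈ Qcycl := by
  refine IntermediateField.subset_adjoin _ _ ⟨q.den, q.den_pos, ?_⟩
  rw [← ee_nat_mul]
  have : ((q.den : ℕ) : ℂ) * q = (q.num : ℤ) := by
    exact_mod_cast congrArg (Rat.cast (K := ℂ)) (Rat.den_mul_eq_num q)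
  rw [this, ee_int]

theorem hasLaurentOver_xv (v : Fin 2 → ℚ) : HasLaurentOver Qcycl (xv v) := by
  have h : v = ![v 0, v 1] := by funext i; fin_cases i <;> rfl
  rw [h]
  exact (conj_xv (K := Qcycl) (s := algebraMap _ ℂ) (ζ := ⟨ee (v 1), ee_rat_mem_Qcycl _⟩)
    (β' := v 1) rfl rfl).1.hasLaurentOver

/-! ### Faithfulness of the action on division values -/

/-- `f` behaves like `c q ^ α` at infinity. -/
def HasLead (f : ℍ → ℂ) (α : ℚ) (c : ℂ) : Prop :=
  ∃ y : ℍ → ℂ, (∀ τ, f τ = ee (α * τ) * y τ) ∧ Tendsto y atImInfty (𝓝 c)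

theorem tendsto_ee_mul {r : ℚ} (hr : 0 < r) :
    Tendsto (fun τ : ℍ => ee (r * τ)) atImInfty (𝓝 0) := by
  have := (conjAt_ee_mul (algebraMap (⊤ : IntermediateField ℚ ℂ) ℂ) hr.le).tendsto
  rw [if_neg hr.ne'] at this
  simpa using this

theorem HasLead.le {f : ℍ → ℂ} {α α' : ℚ} {c c' : ℂ} (h : HasLead f α c) (h' : HasLead f α' c')
    (hc : c ≠ 0) : α' ≤ α := by
  by_contra! hlt
  obtain ⟨y, hy, ht⟩ := h
  obtain ⟨y', hy', ht'⟩ := h'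
  have e : ∀ τ, y τ = ee ((α' - α : ℚ) * τ) * y' τ := by
    intro τ
    have h1 : ee ((α : ℂ) * τ) * y τ = ee (α * τ) * (ee ((α' - α : ℚ) * τ) * y' τ) := by
      rw [← hy, hy', ← mul_assoc, ← ee_add]; congr 2; push_cast; ring
    exact mul_left_cancel₀ (ee_ne_zero _) h1
  have h2 := (tendsto_ee_mul (sub_pos.2 hlt)).mul ht'
  rw [zero_mul] at h2
  rw [show y = _ from funext e] at ht
  exact hc (tendsto_nhds_unique ht h2)

theorem HasLead.unique {f : ℍ → ℂ} {α α' : ℚ} {c c' : ℂ} (h : HasLead f α c)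
    (h' : HasLead f α' c') (hc : c ≠ 0) (hc' : c' ≠ 0) : α = α' ∧ c = c' := by
  have e : α = α' := le_antisymm (h'.le h hc') (h.le h' hc)
  subst e
  obtain ⟨y, hy, ht⟩ := h
  obtain ⟨y', hy', ht'⟩ := h'
  have : y = y' := by
    funext τ
    exact mul_left_cancel₀ (ee_ne_zero _) ((hy τ).symm.trans (hy' τ))
  subst this
  exact ⟨rfl, tendsto_nhds_unique ht ht'⟩

theorem exists_hasLead_xv {α β : ℚ} (h : ∀ m n : ℤ, ¬ (2 * α = m ∧ 2 * β = n)) :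
    ∃ (m : ℤ) (ε : ℤ), (ε = 1 ∨ ε = -1) ∧ leadCoeff (ε * (α - m)) (ee (ε * β)) ≠ 0 ∧
      0 ≤ ε * (α - m) ∧ ε * (α - m) ≤ 1 / 2 ∧
      HasLead (xv ![α, β]) (ε * (α - m)) (ε * leadCoeff (ε * (α - m)) (ee (ε * β))) := by
  obtain ⟨m, ε, hε, h1, h2⟩ := exists_reduction α
  have hn : ∀ k n : ℤ, ¬ (2 * (ε * (α - m)) = k ∧ 2 * (ε * β) = n) := by
    rintro k n ⟨hk, hn⟩
    rcases hε with rfl | rfl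
    · refine h (k + 2 * m) n ⟨?_, ?_⟩ <;> push_cast at * <;> linarith
    · refine h (-k + 2 * m) (-n) ⟨?_, ?_⟩ <;> push_cast at * <;> linarith
  obtain ⟨y, y', e1, -, e3⟩ := conjAt_xv (K := ⊤) (s := algebraMap _ ℂ) h1 h2 (β := ε * β)
    (β' := ε * β) (ζ := ⟨ee ((ε * β : ℚ) : ℂ), trivial⟩)
    (by rintro k n ⟨hk, hn'⟩
        exact hn (2 * k) (2 * n) ⟨by rw [hk]; push_cast; ring, by rw [hn']; push_cast; ring⟩)
    rfl rfl
  have hl : ((leadCoeff (ε * (α - m))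
      (⟨ee ((ε * β : ℚ) : ℂ), trivial⟩ : (⊤ : IntermediateField ℚ ℂ)) :
      (⊤ : IntermediateField ℚ ℂ)) : ℂ) = leadCoeff (ε * (α - m)) (ee (ε * β)) := by
    simp only [leadCoeff]
    split_ifs <;> push_cast <;> rfl
  refine ⟨m, ε, hε, ?_, h1, h2, fun τ => ε * y τ, fun τ => ?_, ?_⟩
  · have hsq : (2 * (ε * (α - m)) = 0 ∨ 1 - 2 * (ε * (α - m)) = 0) → ee (ε * β) ^ 2 ≠ 1 := by
      intro ho he
      rw [← ee_nat_mul, ee_eq_one_iff] at he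
      obtain ⟨n, hn2⟩ := he
      have hn3 : 2 * (ε * β) = n := by
        have : (((2 * (ε * β) : ℚ)) : ℂ) = ((n : ℚ) : ℂ) := by push_cast at hn2 ⊢; exact hn2
        exact_mod_cast this
      rcases ho with ho | ho
      · exact hn 0 n ⟨by simpa using ho, hn3⟩
      · exact hn 1 n ⟨by push_cast; linarith, hn3⟩
    rw [leadCoeff]
    refine mul_ne_zero (mul_ne_zero (neg_ne_zero.2 (ee_ne_zero _)) (mul_ne_zero ?_ ?_))
      (inv_ne_zero (pow_ne_zero _ ?_))
    · split_ifs with h0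
      · rw [sub_ne_zero]; exact (hsq (Or.inl h0)).symm
      · exact one_ne_zero
    · split_ifs with h0
      · rw [sub_ne_zero]
        intro h3
        exact hsq (Or.inr h0) (inv_eq_one.1 h3.symm)
      · exact one_ne_zero
    · split_ifs with h0
      · rw [sub_ne_zero]
        intro h3
        exact hsq (Or.inl (by rw [h0, mul_zero])) (by rw [← h3, one_pow])
      · exact one_ne_zero
  · rw [xv_reduction hε α β m]
    simp only [e1]
    ring
  · have := e3.tendsto
    rw [hl] at this
    exact this.const_mul _

/-- The vector `a / N`. -/
def tors (N : ℕ) (a : Fin 2 → ℤ) : Fin 2 → ℚ := fun i => a i / N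

theorem vmul_tors (N : ℕ) (a : Fin 2 → ℤ) (g : Matrix (Fin 2) (Fin 2) ℤ) :
    vmul (tors N a) g = tors N (Matrix.vecMul a g) := by
  funext i
  fin_cases i <;>
  · simp [vmul, tors, Matrix.vecMul, dotProduct, Fin.sum_univ_two]
    ring

theorem tors_eq (N : ℕ) (a b : ℤ) : tors N ![a, b] = ![(a / N : ℚ), (b / N : ℚ)] := by
  funext i
  fin_cases i <;> rfl

theorem xv_tors_congr {N : ℕ} (hN : 0 < N) {a b : Fin 2 → ℤ} (h : ∀ i, (N : ℤ) ∣ a i - b i) :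
    xv (tors N a) = xv (tors N b) := by
  choose c hc using h
  rw [← xv_add_int (tors N b) c]
  congr 1
  funext i
  have h0 : (N : ℚ) ≠ 0 := by exact_mod_cast hN.ne'
  have : (a i : ℚ) = b i + N * c i := by
    exact_mod_cast congrArg (Int.cast (R := ℚ)) (eq_add_of_sub_eq' (hc i))
  simp only [tors, this]
  field_simp

theorem exists_hasLead_tors {N : ℕ} (hN : 0 < N) {a b : ℤ}
    (h : ¬ ((N : ℤ) ∣ 2 * a ∧ (N : ℤ) ∣ 2 * b)) :
    ∃ (m : ℤ) (ε : ℤ), (ε = 1 ∨ ε = -1) ∧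
      leadCoeff (ε * ((a : ℚ) / N - m)) (ee (ε * ((b : ℂ) / N))) ≠ 0 ∧
      0 ≤ ε * ((a : ℚ) / N - m) ∧
      HasLead (xv (tors N ![a, b])) (ε * ((a : ℚ) / N - m))
        (ε * leadCoeff (ε * ((a : ℚ) / N - m)) (ee (ε * ((b : ℂ) / N)))) := by
  have h0 : (N : ℚ) ≠ 0 := by exact_mod_cast hN.ne'
  obtain ⟨m, ε, hε, h1, h2, -, h3⟩ := exists_hasLead_xv (α := a / N) (β := b / N) (by
    rintro m n ⟨h1, h2⟩
    refine h ⟨⟨m, ?_⟩, ⟨n, ?_⟩⟩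
    · field_simp at h1
      have : (2 * a : ℤ) = m * N := by exact_mod_cast (by linarith : (2 * a : ℚ) = m * N)
      rw [this, mul_comm]
    · field_simp at h2
      have : (2 * b : ℤ) = n * N := by exact_mod_cast (by linarith : (2 * b : ℚ) = n * N)
      rw [this, mul_comm])
  refine ⟨m, ε, hε, ?_, h2, ?_⟩
  · push_cast at h1; exact h1
  · rw [tors_eq]; push_cast at h3; exact h3

theorem leadCoeff_of_pos_of_lt {F : Type*} [Field F] {α : ℚ} (h : 0 < α) (h' : α < 1 / 2) (ζ : F) :
    leadCoeff α ζ = -ζ := by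
  rw [leadCoeff, if_neg (by linarith), if_neg (by linarith), if_neg h.ne']
  simp

/-- A matrix which fixes all `x_v` with `N v ∈ ℤ²` is congruent to `1` modulo `N`. -/
theorem faithful_xv {N : ℕ} (hN : 3 ≤ N) (g : Matrix (Fin 2) (Fin 2) ℤ)
    (h : ∀ a, xv (tors N (Matrix.vecMul a g)) = xv (tors N a)) (i j : Fin 2) :
    (N : ℤ) ∣ g i j - (1 : Matrix (Fin 2) (Fin 2) ℤ) i j := by
  have hN0 : 0 < N := by omega
  have hNQ : (0 : ℚ) < N := by exact_mod_cast hN0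
  have hNC : (N : ℂ) ≠ 0 := by exact_mod_cast hN0.ne'
  have n2 : ¬ (N : ℤ) ∣ 2 := fun hd => by have := Int.le_of_dvd (by norm_num) hd; omega
  have hv : ∀ a b : ℤ, Matrix.vecMul ![a, b] g =
      ![a * g 0 0 + b * g 1 0, a * g 0 1 + b * g 1 1] := by
    intro a b
    funext i
    fin_cases i <;> simp [Matrix.vecMul, dotProduct, Fin.sum_univ_two]
  have heq : ∀ a b : ℤ, xv (tors N ![a * g 0 0 + b * g 1 0, a * g 0 1 + b * g 1 1]) =
      xv (tors N ![a, b]) := fun a b => by rw [← hv, h]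
  -- behaviour of `x_{(1, b) / N}` at infinity
  have hlead : ∀ b : ℤ, HasLead (xv (tors N ![1, b])) (1 / N) (-ee (b / N)) := by
    intro b
    have hlt : (1 : ℚ) / N < 1 / 2 := by
      have : (3 : ℚ) ≤ N := by exact_mod_cast hN
      rw [div_lt_div_iff₀ hNQ (by norm_num)]; linarith
    have hpos : (0 : ℚ) < 1 / N := by positivity
    obtain ⟨y, y', e1, -, e3⟩ := conjAt_xv (K := ⊤) (s := algebraMap _ ℂ) (α := 1 / N)
      (β := b / N) (β' := b / N) hpos.le hlt.le (ζ := ⟨ee ((b / N : ℚ) : ℂ), trivial⟩)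
      (by
        rintro m n ⟨h1, -⟩
        rw [h1] at hpos hlt
        have h2 : (0 : ℤ) < m := by exact_mod_cast hpos
        have h3 : (m : ℚ) < 1 := by linarith
        have h4 : m < 1 := by exact_mod_cast h3
        omega) rfl rfl
    refine ⟨y, fun τ => ?_, ?_⟩
    · rw [tors_eq, ← e1]; simp
    · have := e3.tendsto
      rw [leadCoeff_of_pos_of_lt hpos hlt] at this
      simpa using this
  -- the first column of a fixed vector `(1, b) / N`
  have hrow : ∀ b x y : ℤ, xv (tors N ![x, y]) = xv (tors N ![1, b]) →
      ∃ ε : ℤ, (ε = 1 ∨ ε = -1) ∧ (N : ℤ) ∣ x - ε ∧ ee (b / N) = ε * ee (ε * (y / N)) := by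
    intro b x y hxy
    have h1 := hlead b
    rw [← hxy] at h1
    have hne : ¬ ((N : ℤ) ∣ 2 * x ∧ (N : ℤ) ∣ 2 * y) := by
      rintro ⟨⟨m, hm⟩, ⟨n, hn⟩⟩
      have hm' : (2 * x : ℚ) = N * m := by exact_mod_cast hm
      have hn' : (2 * y : ℚ) = N * n := by exact_mod_cast hn
      have h0 : xv (tors N ![x, y]) = 0 := xv_of_two_mul_int (m := m) (n := n)
        (by simp only [tors, Matrix.cons_val_zero]; field_simp; linarith)
        (by simp only [tors, Matrix.cons_val_one, Matrix.cons_val_fin_one]; field_simp; linarith)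
      rw [h0] at h1
      have h2 : HasLead (0 : ℍ → ℂ) 1 0 :=
        ⟨fun _ => 0, fun τ => by simp, tendsto_const_nhds⟩
      have h3 := h1.le h2 (neg_ne_zero.2 (ee_ne_zero _))
      rw [le_div_iff₀ hNQ] at h3
      have : (3 : ℚ) ≤ N := by exact_mod_cast hN
      linarith
    obtain ⟨m, ε, hε, hc, hα, hl⟩ := exists_hasLead_tors hN0 hne
    have hε0 : (ε : ℂ) ≠ 0 := by rcases hε with rfl | rfl <;> norm_num
    obtain ⟨e1, e2⟩ := h1.unique hl (neg_ne_zero.2 (ee_ne_zero _)) (mul_ne_zero hε0 hc)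
    have hlt : (1 : ℚ) / N < 1 / 2 := by
      have : (3 : ℚ) ≤ N := by exact_mod_cast hN
      rw [div_lt_div_iff₀ hNQ (by norm_num)]; linarith
    rw [← e1, leadCoeff_of_pos_of_lt (by positivity) hlt] at e2
    refine ⟨ε, hε, ⟨m, ?_⟩, by linear_combination -e2⟩
    field_simp at e1
    have e3 : (1 : ℤ) = ε * (x - N * m) := by exact_mod_cast e1
    rcases hε with rfl | rfl <;> linarith
  have hee : ∀ x : ℤ, ee (x / N) = 1 → (N : ℤ) ∣ x := by
    intro x hx
    obtain ⟨k, hk⟩ := ee_eq_one_iff.1 hx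
    rw [div_eq_iff hNC] at hk
    refine ⟨k, ?_⟩
    rw [mul_comm]
    exact_mod_cast hk
  -- behaviour of `x_{(0, 1) / N}` at infinity
  have h01 : ∃ c : ℂ, c ≠ 0 ∧ HasLead (xv (tors N ![0, 1])) 0 c := by
    obtain ⟨m, ε, hε, hc, hα, hl⟩ := exists_hasLead_tors hN0 (a := 0) (b := 1)
      (by rintro ⟨-, h2⟩; exact n2 (by simpa using h2))
    have hε0 : (ε : ℂ) ≠ 0 := by rcases hε with rfl | rfl <;> norm_num
    obtain ⟨y, y', e1, -, e3⟩ := conjAt_xv (K := ⊤) (s := algebraMap _ ℂ) (α := 0)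
      (β := 1 / N) (β' := 1 / N) le_rfl (by norm_num) (ζ := ⟨ee ((1 / N : ℚ) : ℂ), trivial⟩)
      (by
        rintro m n ⟨-, h1⟩
        rw [div_eq_iff hNQ.ne'] at h1
        have h2 : (1 : ℤ) = n * N := by exact_mod_cast h1
        exact n2 ⟨2 * n, by linarith⟩) rfl rfl
    have hlead0 : HasLead (xv (tors N ![0, 1])) 0 _ :=
      ⟨y, fun τ => by rw [tors_eq, ← e1]; simp, e3.tendsto⟩
    refine ⟨_, ?_, hlead0⟩
    intro hz
    set ζ : (⊤ : IntermediateField ℚ ℂ) := ⟨ee ((1 / N : ℚ) : ℂ), trivial⟩ with hζ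
    have hz2 : leadCoeff 0 ζ = 0 := by exact_mod_cast hz
    have hp : ∀ k : ℕ, ζ ^ k = 1 → (N : ℤ) ∣ k := by
      intro k hk
      have hk' := congrArg (fun t : (⊤ : IntermediateField ℚ ℂ) => (t : ℂ)) hk
      simp only [hζ] at hk'
      push_cast at hk'
      rw [← ee_nat_mul] at hk'
      refine hee k ?_
      rw [← hk']
      push_cast
      congr 1
      ring
    have n1 : ¬ (N : ℤ) ∣ 1 := fun hd => n2 (hd.trans (by norm_num))
    rw [leadCoeff] at hz2
    simp only [mul_zero, if_true, sub_zero, one_ne_zero, if_false, mul_one] at hz2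
    have hζ0 : ζ ≠ 0 := fun h0 =>
      ee_ne_zero _ (congrArg (fun t : (⊤ : IntermediateField ℚ ℂ) => (t : ℂ)) h0)
    rcases mul_eq_zero.1 hz2 with h3 | h3
    · rcases mul_eq_zero.1 h3 with h4 | h4
      · exact hζ0 (neg_eq_zero.1 h4)
      · exact n2 (by exact_mod_cast hp 2 (sub_eq_zero.1 h4).symm)
    · exact n1 (by exact_mod_cast hp 1 (by
        rw [pow_one]
        exact (sub_eq_zero.1 (pow_eq_zero_iff (by norm_num) |>.1 (inv_eq_zero.1 h3))).symm))
  obtain ⟨c, hc, hc01⟩ := h01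
  -- the lower left entry
  have hg10 : (N : ℤ) ∣ g 1 0 := by
    have e := heq 0 1
    simp only [zero_mul, one_mul, zero_add] at e
    have h1 := hc01
    rw [← e] at h1
    have hne : ¬ ((N : ℤ) ∣ 2 * g 1 0 ∧ (N : ℤ) ∣ 2 * g 1 1) := by
      rintro ⟨⟨m, hm⟩, ⟨n, hn⟩⟩
      have hm' : (2 * g 1 0 : ℚ) = N * m := by exact_mod_cast hm
      have hn' : (2 * g 1 1 : ℚ) = N * n := by exact_mod_cast hn
      have h0 : xv (tors N ![g 1 0, g 1 1]) = 0 := xv_of_two_mul_int (m := m) (n := n)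
        (by simp only [tors, Matrix.cons_val_zero]; field_simp; linarith)
        (by simp only [tors, Matrix.cons_val_one, Matrix.cons_val_fin_one]; field_simp; linarith)
      rw [h0] at h1
      have h2 : HasLead (0 : ℍ → ℂ) 1 0 :=
        ⟨fun _ => 0, fun τ => by simp, tendsto_const_nhds⟩
      have h3 := h1.le h2 hc
      norm_num at h3
    obtain ⟨m, ε, hε, hc', hα, hl⟩ := exists_hasLead_tors hN0 hne
    have hε0 : (ε : ℂ) ≠ 0 := by rcases hε with rfl | rfl <;> norm_num
    obtain ⟨e1, -⟩ := h1.unique hl hc (mul_ne_zero hε0 hc')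
    refine ⟨m, ?_⟩
    have e2 : ((g 1 0 : ℚ) / N - m) = 0 := by
      have hεQ : (ε : ℚ) ≠ 0 := by rcases hε with rfl | rfl <;> norm_num
      exact (mul_eq_zero.1 e1.symm).resolve_left hεQ
    field_simp at e2
    have e3 : (g 1 0 : ℤ) - N * m = 0 := by exact_mod_cast e2
    linarith
  obtain ⟨ε, hε, hx, hy⟩ := hrow 0 (g 0 0) (g 0 1) (by simpa using heq 1 0)
  obtain ⟨ε', hε', hx', hy'⟩ := hrow 1 (g 0 0 + g 1 0) (g 0 1 + g 1 1) (by simpa using heq 1 1)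
  have hεε : ε' = ε := by
    have h1 : (N : ℤ) ∣ ε' - ε := by
      have := dvd_add (dvd_sub hx hx') hg10
      rwa [show g 0 0 - ε - (g 0 0 + g 1 0 - ε') + g 1 0 = ε' - ε by ring] at this
    rcases hε with rfl | rfl <;> rcases hε' with rfl | rfl
    · rfl
    · exact absurd ((dvd_neg).2 h1) (by norm_num; exact n2)
    · exact absurd h1 (by norm_num; exact n2)
    · rfl
  rw [hεε] at hy'
  rw [Int.cast_zero, zero_div, ee_zero] at hy
  push_cast at hy'
  rw [add_div, mul_add, ee_add, ← mul_assoc, ← hy, one_mul] at hy'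
  rcases hε with rfl | rfl
  · have hb : (N : ℤ) ∣ g 0 1 := hee _ (by simpa using hy.symm)
    have hd : (N : ℤ) ∣ g 1 1 - 1 := hee _ (by
      push_cast
      rw [sub_div, ee_sub, hy']
      simp [ee_ne_zero])
    fin_cases i <;> fin_cases j
    · simpa using hx
    · simpa using hb
    · simpa using hg10
    · simpa using hd
  · exfalso
    have hd : (N : ℤ) ∣ g 1 1 + 1 := hee _ (by
      push_cast
      rw [add_div, ee_add, hy', ← ee_add]
      push_cast
      rw [show (g 1 1 : ℂ) / N + -1 * (g 1 1 / N) = 0 by ring, ee_zero])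
    have e := heq 0 1
    simp only [zero_mul, one_mul, zero_add] at e
    have e2 : xv (tors N ![g 1 0, g 1 1]) = xv (tors N (-![0, 1])) := by
      refine xv_tors_congr hN0 fun i => ?_
      fin_cases i
      · simpa using hg10
      · simpa using hd
    have e3 : tors N (-![0, 1]) = -tors N ![0, 1] := by
      funext i
      fin_cases i <;> simp [tors, neg_div]
    rw [e2, e3, xv_neg] at e
    have e4 : xv (tors N ![0, 1]) = 0 := self_eq_neg.1 e.symm
    rw [e4] at hc01
    have h2 : HasLead (0 : ℍ → ℂ) 1 0 := ⟨fun _ => 0, fun τ => by simp, tendsto_const_nhds⟩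
    have h3 := hc01.le h2 hc
    norm_num at h3

end

section

open Complex (I)
open Filter Topology
open UpperHalfPlane (atImInfty)
open Function.Periodic (qParam)
open PowerSeries (coeff constantCoeff)

/-! ### Modular forms -/

theorem holAtInfty_of_periodic {f : ℍ → ℂ} {w : ℕ} (hw : 0 < w) (hol : MDiff f)
    (hbdd : UpperHalfPlane.IsBoundedAtImInfty f) (hper : ∀ τ : ℍ, f ((w : ℝ) +ᵥ τ) = f τ) :
    HolAtInfty f := by
  have hp : Function.Periodic (f ∘ UpperHalfPlane.ofComplex) ((w : ℝ) : ℂ) := by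
    intro z
    simp only [Function.comp_apply]
    by_cases hz : 0 < z.im
    · have h1 : 0 < (z + ((w : ℝ) : ℂ)).im := by simpa using hz
      rw [UpperHalfPlane.ofComplex_apply_of_im_pos h1, UpperHalfPlane.ofComplex_apply_of_im_pos hz,
        ← hper ⟨z, hz⟩]
      congr 1
      apply UpperHalfPlane.ext
      rw [UpperHalfPlane.coe_vadd]
      exact add_comm _ _
    · have h1 : ¬ 0 < (z + ((w : ℝ) : ℂ)).im := by simpa using hz
      rw [UpperHalfPlane.ofComplex_apply_of_im_nonpos (not_lt.1 h1),
        UpperHalfPlane.ofComplex_apply_of_im_nonpos (not_lt.1 hz)]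
  refine ⟨w, UpperHalfPlane.qExpansion w f, hw, fun τ => ?_⟩
  simpa using UpperHalfPlane.hasSum_qExpansion (by exact_mod_cast hw) hp hol hbdd τ

theorem HolAtInfty.mdifferentiable {f : ℍ → ℂ} (h : HolAtInfty f) : MDiff f := by
  obtain ⟨w, p, hw, h⟩ := h
  exact h.mdifferentiable hw

theorem HolAtInfty.isBoundedAtImInfty {f : ℍ → ℂ} (h : HolAtInfty f) :
    UpperHalfPlane.IsBoundedAtImInfty f := by
  obtain ⟨w, p, hw, h⟩ := h
  exact (h.tendsto_atImInfty hw).isBigO_one ℝ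

/-- Modular forms of weight `k` for `Γ`: invariant, and holomorphic at all cusps. -/
structure IsForm (k : ℕ) (Γ : Subgroup SL(2, ℤ)) (f : ℍ → ℂ) : Prop where
  inv : ∀ γ ∈ Γ, f ∣[(k : ℤ)] γ = f
  hol : ∀ γ : SL(2, ℤ), HolAtInfty (f ∣[(k : ℤ)] γ)

theorem slash_T_pow_apply (k : ℤ) (f : ℍ → ℂ) (n : ℕ) (τ : ℍ) :
    (f ∣[k] (ModularGroup.T ^ n)) τ = f ((n : ℝ) +ᵥ τ) := by
  rw [ModularForm.SL_slash_apply]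
  have h1 : ModularGroup.T ^ n • τ = (n : ℝ) +ᵥ τ := by
    apply UpperHalfPlane.ext
    have := ModularGroup.coe_T_zpow_smul_eq (z := τ) (n := n)
    rw [zpow_natCast] at this
    rw [this, UpperHalfPlane.coe_vadd, add_comm]
    simp
  have h2 : UpperHalfPlane.denom (ModularGroup.T ^ n : SL(2, ℤ)) τ = 1 := by
    rw [ModularGroup.denom_apply]
    have := ModularGroup.coe_T_zpow n
    rw [zpow_natCast] at this
    rw [this]
    simp
  rw [h1, h2]
  simp

theorem ModularForm.isForm {k : ℕ} {Γ : Subgroup SL(2, ℤ)} (hΓ : Γ.FiniteIndex)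
    (F : ModularForm (Γ.map (Matrix.SpecialLinearGroup.mapGL ℝ)) k) : IsForm k Γ F := by
  have hinv : ∀ γ ∈ Γ, ⇑F ∣[(k : ℤ)] γ = F := fun γ hγ =>
    F.slash_action_eq' _ ⟨γ, hγ, rfl⟩
  refine ⟨hinv, fun γ => ?_⟩
  obtain ⟨n, hn, -, hmem⟩ := Subgroup.exists_pow_mem_of_index_ne_zero hΓ.index_ne_zero
    (γ * ModularGroup.T * γ⁻¹)
  refine holAtInfty_of_periodic hn (F.holo'.slash _ _)
    (ModularFormClass.bdd_at_infty_slash γ (f := F)) fun τ => ?_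
  rw [← slash_T_pow_apply k (⇑F ∣[(k : ℤ)] γ), ← SlashAction.slash_mul]
  rw [conj_pow] at hmem
  have : γ * ModularGroup.T ^ n = γ * ModularGroup.T ^ n * γ⁻¹ * γ := by group
  rw [this, SlashAction.slash_mul, hinv _ hmem]

theorem mem_modularForms_iff {k : ℕ} {Γ : Subgroup SL(2, ℤ)} (hΓ : Γ.FiniteIndex)
    {K : IntermediateField ℚ ℂ} {f : ℍ → ℂ} :
    f ∈ modularForms k Γ K ↔ IsForm k Γ f ∧ HasLaurentOver K f := by
  rw [modularForms, Set.mem_ofPred_eq, hasQExp_iff_exists]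
  constructor
  · rintro ⟨⟨F, rfl⟩, -, h⟩
    exact ⟨ModularForm.isForm hΓ F, h⟩
  · rintro ⟨h1, h2⟩
    have h3 : HolAtInfty f := by simpa using h1.hol 1
    let F : ModularForm (Γ.map (Matrix.SpecialLinearGroup.mapGL ℝ)) k :=
      { toFun := f
        slash_action_eq' := ?_
        holo' := h3.mdifferentiable
        bdd_at_cusps' := fun {c} hc => ?_ }
    · exact ⟨⟨F, rfl⟩, h3, h2⟩
    · rintro _ ⟨γ, hγ, rfl⟩
      exact h1.inv γ hγ
    · rw [Subgroup.IsArithmetic.isCusp_iff_isCusp_SL2Z] at hc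
      rw [OnePoint.isBoundedAt_iff_forall_SL2Z hc]
      intro γ _
      exact (h1.hol γ).isBoundedAtImInfty

namespace IsForm

variable {k l : ℕ} {Γ Γ' : Subgroup SL(2, ℤ)} {f g : ℍ → ℂ}

theorem holAtInfty (h : IsForm k Γ f) : HolAtInfty f := by simpa using h.hol 1

theorem mono (h : IsForm k Γ f) (hle : Γ' ≤ Γ) : IsForm k Γ' f :=
  ⟨fun γ hγ => h.inv γ (hle hγ), h.hol⟩

theorem mul (hf : IsForm k Γ f) (hg : IsForm l Γ g) : IsForm (k + l) Γ (f * g) := by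
  refine ⟨fun γ hγ => ?_, fun γ => ?_⟩
  · push_cast
    rw [ModularForm.mul_slash_SL2, hf.inv γ hγ, hg.inv γ hγ]
  · push_cast
    rw [ModularForm.mul_slash_SL2]
    exact holRing.mul_mem (hf.hol γ) (hg.hol γ)

theorem add (hf : IsForm k Γ f) (hg : IsForm k Γ g) : IsForm k Γ (f + g) := by
  refine ⟨fun γ hγ => ?_, fun γ => ?_⟩
  · rw [SlashAction.add_slash, hf.inv γ hγ, hg.inv γ hγ]
  · rw [SlashAction.add_slash]
    exact holRing.add_mem (hf.hol γ) (hg.hol γ)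

theorem zero : IsForm k Γ 0 :=
  ⟨fun γ _ => SlashAction.zero_slash _ _, fun γ => by
    rw [SlashAction.zero_slash]; exact holRing.zero_mem⟩

theorem const_smul (c : ℂ) (hf : IsForm k Γ f) : IsForm k Γ (c • f) := by
  refine ⟨fun γ hγ => ?_, fun γ => ?_⟩
  · rw [ModularForm.SL_smul_slash, hf.inv γ hγ]
  · rw [ModularForm.SL_smul_slash]
    have hc : HolAtInfty (fun _ => c) := ⟨1, _, one_pos, HasPS.const 1 c⟩
    exact holRing.mul_mem hc (hf.hol γ)

theorem const (c : ℂ) : IsForm 0 Γ (fun _ => c) := by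
  have h : ∀ γ : SL(2, ℤ), (fun _ : ℍ => c) ∣[((0 : ℕ) : ℤ)] γ = fun _ => c :=
    fun γ => ModularForm.is_invariant_const γ c
  refine ⟨fun γ _ => h γ, fun γ => ?_⟩
  rw [h]
  exact ⟨1, _, one_pos, HasPS.const 1 c⟩

end IsForm

theorem mem_allModularForms_iff {k : ℕ} {K : IntermediateField ℚ ℂ} {f : ℍ → ℂ} :
    f ∈ allModularForms k K ↔
      (∃ Γ : Subgroup SL(2, ℤ), Γ.FiniteIndex ∧ IsForm k Γ f) ∧ HasLaurentOver K f := by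
  constructor
  · rintro ⟨Γ, hΓ, h⟩
    rw [mem_modularForms_iff hΓ] at h
    exact ⟨⟨Γ, hΓ, h.1⟩, h.2⟩
  · rintro ⟨⟨Γ, hΓ, h1⟩, h2⟩
    exact ⟨Γ, hΓ, (mem_modularForms_iff hΓ).2 ⟨h1, h2⟩⟩

section graded

variable {K : IntermediateField ℚ ℂ}

theorem allModularForms_mul {k l : ℕ} {f g : ℍ → ℂ} (hf : f ∈ allModularForms k K)
    (hg : g ∈ allModularForms l K) : f * g ∈ allModularForms (k + l) K := by
  rw [mem_allModularForms_iff] at *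
  obtain ⟨⟨Γ, hΓ, h1⟩, h2⟩ := hf
  obtain ⟨⟨Γ', hΓ', h1'⟩, h2'⟩ := hg
  exact ⟨⟨Γ ⊓ Γ', inferInstance, (h1.mono inf_le_left).mul (h1'.mono inf_le_right)⟩, h2.mul h2'⟩

theorem allModularForms_add {k : ℕ} {f g : ℍ → ℂ} (hf : f ∈ allModularForms k K)
    (hg : g ∈ allModularForms k K) : f + g ∈ allModularForms k K := by
  rw [mem_allModularForms_iff] at *
  obtain ⟨⟨Γ, hΓ, h1⟩, h2⟩ := hf
  obtain ⟨⟨Γ', hΓ', h1'⟩, h2'⟩ := hg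
  exact ⟨⟨Γ ⊓ Γ', inferInstance, (h1.mono inf_le_left).add (h1'.mono inf_le_right)⟩, h2.add h2'⟩

theorem const_mem_allModularForms {c : ℂ} (hc : c ∈ K) : (fun _ => c) ∈ allModularForms 0 K :=
  mem_allModularForms_iff.2 ⟨⟨⊤, inferInstance, IsForm.const c⟩, HasLaurentOver.const hc⟩

theorem zero_mem_allModularForms (k : ℕ) : 0 ∈ allModularForms k K :=
  mem_allModularForms_iff.2 ⟨⟨⊤, inferInstance, IsForm.zero⟩, HasLaurentOver.const K.zero_mem⟩

theorem neg_mem_allModularForms {k : ℕ} {f : ℍ → ℂ} (hf : f ∈ allModularForms k K) :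
    -f ∈ allModularForms k K := by
  rw [mem_allModularForms_iff] at *
  obtain ⟨⟨Γ, hΓ, h1⟩, h2⟩ := hf
  refine ⟨⟨Γ, hΓ, ?_⟩, h2.neg⟩
  simpa using h1.const_smul (-1)

/-- `allModularForms k K` as an additive group. -/
def formsAddSubgroup (k : ℕ) (K : IntermediateField ℚ ℂ) : AddSubgroup (ℍ → ℂ) where
  carrier := allModularForms k K
  add_mem' := allModularForms_add
  zero_mem' := zero_mem_allModularForms k
  neg_mem' := neg_mem_allModularForms

/-- The graded ring of modular forms, as a ring of polynomials whose coefficient of degree `k` is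
a form of weight `k`. -/
def gradedRing (K : IntermediateField ℚ ℂ) : Subring (Polynomial (ℍ → ℂ)) where
  carrier := {P | ∀ k, P.coeff k ∈ allModularForms k K}
  mul_mem' := by
    intro P Q hP hQ k
    rw [Polynomial.coeff_mul]
    refine (formsAddSubgroup k K).sum_mem fun p hp => ?_
    rw [← Finset.HasAntidiagonal.mem_antidiagonal.1 hp]
    exact allModularForms_mul (hP _) (hQ _)
  add_mem' := by
    intro P Q hP hQ k
    rw [Polynomial.coeff_add]
    exact allModularForms_add (hP k) (hQ k)
  neg_mem' := by
    intro P hP k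
    rw [Polynomial.coeff_neg]
    exact neg_mem_allModularForms (hP k)
  zero_mem' := fun k => by
    rw [Polynomial.coeff_zero]
    exact zero_mem_allModularForms k
  one_mem' := fun k => by
    rw [Polynomial.coeff_one]
    split_ifs with h
    · subst h
      exact const_mem_allModularForms K.one_mem
    · exact zero_mem_allModularForms k

theorem monomial_mem_gradedRing {k : ℕ} {f : ℍ → ℂ} (hf : f ∈ allModularForms k K) :
    Polynomial.monomial k f ∈ gradedRing K := by
  intro l
  rw [Polynomial.coeff_monomial]
  split_ifs with h
  · rwa [← h]
  · exact zero_mem_allModularForms l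

theorem mem_modularFormRing_of_form {k : ℕ} {f : ℍ → ℂ} (hf : f ∈ allModularForms k K) :
    f ∈ modularFormRing K := Subring.subset_closure ⟨k, hf⟩

theorem exists_graded_of_mem {f : ℍ → ℂ} (hf : f ∈ modularFormRing K) :
    ∃ P ∈ gradedRing K, P.eval 1 = f := by
  have h : modularFormRing K ≤ (gradedRing K).map (Polynomial.evalRingHom 1) := by
    refine Subring.closure_le.2 ?_
    rintro f ⟨k, hf⟩
    exact ⟨_, monomial_mem_gradedRing hf, by simp⟩
  exact h hf

theorem gradedRing_mono {L : IntermediateField ℚ ℂ} (h : K ≤ L) : gradedRing K ≤ gradedRing L := by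
  intro P hP k
  obtain ⟨Γ, hΓ, h1⟩ := hP k
  exact ⟨Γ, hΓ, (mem_modularForms_iff hΓ).2
    ⟨((mem_modularForms_iff hΓ).1 h1).1, ((mem_modularForms_iff hΓ).1 h1).2.mono h⟩⟩

end graded

/-- The lower unipotent matrices. -/
def lowerUnipotent (m : ℤ) : SL(2, ℤ) := ⟨!![1, 0; m, 1], by simp [Matrix.det_fin_two]⟩

theorem lowerUnipotent_pow (m : ℤ) (n : ℕ) : lowerUnipotent m ^ n = lowerUnipotent (n * m) := by
  induction n with
  | zero =>
    apply Subtype.ext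
    rw [pow_zero, Matrix.SpecialLinearGroup.coe_one]
    ext i j
    fin_cases i <;> fin_cases j <;> simp [lowerUnipotent]
  | succ n ih =>
    rw [pow_succ, ih]
    apply Subtype.ext
    rw [Matrix.SpecialLinearGroup.coe_mul]
    ext i j
    fin_cases i <;> fin_cases j <;> simp [lowerUnipotent, Matrix.mul_apply, Fin.sum_univ_two]
    ring

/-- Modular forms of different weights are linearly independent. -/
theorem eq_zero_of_eval_one_eq_zero {K : IntermediateField ℚ ℂ} {P : Polynomial (ℍ → ℂ)}
    (hP : P ∈ gradedRing K) (h : P.eval 1 = 0) : P = 0 := by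
  classical
  choose Γ hΓ hf using fun k => (mem_allModularForms_iff.1 (hP k)).1
  -- a lower unipotent matrix in all groups `Γ k`
  have hpow : ∀ k, ∃ n : ℕ, 0 < n ∧ lowerUnipotent n ∈ Γ k := by
    intro k
    obtain ⟨n, hn, -, h⟩ := Subgroup.exists_pow_mem_of_index_ne_zero (hΓ k).index_ne_zero
      (lowerUnipotent 1)
    rw [lowerUnipotent_pow, mul_one] at h
    exact ⟨n, hn, h⟩
  choose n hn hmem using hpow
  set M : ℕ := ∏ k ∈ Finset.range (P.natDegree + 1), n k with hM
  have hM0 : 0 < M := Finset.prod_pos fun k _ => hn k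
  have hMk : ∀ k ∈ Finset.range (P.natDegree + 1), ∀ j : ℕ, lowerUnipotent (j * M) ∈ Γ k := by
    intro k hk j
    obtain ⟨c, hc⟩ := Finset.dvd_prod_of_mem n hk
    rw [← hM] at hc
    have := (Γ k).pow_mem (hmem k) (j * c)
    rw [lowerUnipotent_pow] at this
    convert this using 2
    rw [hc]
    push_cast
    ring
  have key : ∀ τ : ℍ, P.map (Pi.evalRingHom (fun _ : ℍ => ℂ) τ) = 0 := by
    intro τ
    have hτ : (τ : ℂ) ≠ 0 := τ.ne_zero
    have hinj : Function.Injective fun j : ℕ => (j * M : ℂ) * τ + 1 := by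
      intro i j hij
      have h1 : (i * M : ℂ) * τ = (j * M : ℂ) * τ := add_right_cancel hij
      have h2 := mul_right_cancel₀ hτ h1
      have h3 : (M : ℂ) ≠ 0 := by exact_mod_cast hM0.ne'
      exact_mod_cast mul_right_cancel₀ h3 h2
    refine Polynomial.eq_zero_of_infinite_isRoot _ ?_
    refine Set.Infinite.mono ?_ (Set.infinite_range_of_injective hinj)
    rintro _ ⟨j, rfl⟩
    rw [Set.mem_ofPred_eq, Polynomial.IsRoot, Polynomial.eval_map, Polynomial.eval₂_eq_sum_range]
    have h1 := congrFun h (lowerUnipotent (j * M) • τ)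
    rw [Polynomial.eval_eq_sum_range, Finset.sum_apply] at h1
    rw [← Pi.zero_apply (M := fun _ : ℍ => ℂ) (lowerUnipotent (j * M) • τ), ← h1]
    refine Finset.sum_congr rfl fun k hk => ?_
    have h2 := (ModularForm.slash_action_eq'_iff _ _ _ _).1
      (congrFun ((hf k).inv _ (hMk k hk j)) τ)
    rw [one_pow, mul_one, h2, mul_comm]
    simp [lowerUnipotent]
  ext k τ
  have := congrArg (fun p => Polynomial.coeff p k) (key τ)
  simpa using this

/-! ### Modular forms of level one -/

theorem IsForm.exists_modularForm {k : ℕ} {f : ℍ → ℂ} (h : IsForm k ⊤ f) :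
    ∃ F : ModularForm 𝒮ℒ (k : ℤ), ⇑F = f := by
  have h3 : HolAtInfty f := h.holAtInfty
  let F : ModularForm 𝒮ℒ (k : ℤ) :=
    { toFun := f
      slash_action_eq' := ?_
      holo' := h3.mdifferentiable
      bdd_at_cusps' := fun {c} hc => ?_ }
  · exact ⟨F, rfl⟩
  · rintro _ ⟨γ, rfl⟩
    exact h.inv γ trivial
  · rw [OnePoint.isBoundedAt_iff_forall_SL2Z hc]
    intro γ _
    exact (h.hol γ).isBoundedAtImInfty

theorem ModularForm.isForm_top {k : ℕ} (F : ModularForm 𝒮ℒ (k : ℤ)) : IsForm k ⊤ F := by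
  have hinv : ∀ γ : SL(2, ℤ), ⇑F ∣[(k : ℤ)] γ = F := fun γ => F.slash_action_eq' _ ⟨γ, rfl⟩
  refine ⟨fun γ _ => hinv γ, fun γ => ?_⟩
  rw [hinv]
  refine ⟨1, UpperHalfPlane.qExpansion 1 F, one_pos, fun τ => ?_⟩
  have := ModularForm.hasSum_qExpansion F one_pos one_mem_strictPeriods_SL τ
  simpa using this

theorem hasPS_qExpansion {k : ℕ} (F : ModularForm 𝒮ℒ (k : ℤ)) :
    HasPS 1 (UpperHalfPlane.qExpansion 1 F) F := fun τ => by
  have := ModularForm.hasSum_qExpansion F one_pos one_mem_strictPeriods_SL τ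
  simpa using this

theorem rat_mem_Q0 (q : ℚ) : (q : ℂ) ∈ Q0 := IntermediateField.mem_bot.2 ⟨q, by simp⟩

theorem hasLaurentOver_E {k : ℕ} (hk : 3 ≤ k) (hk2 : Even k) :
    HasLaurentOver Q0 (ModularForm.E hk) := by
  refine ⟨1, 0, fun n => coeff n (UpperHalfPlane.qExpansion 1 (ModularForm.E hk)), one_pos,
    fun n => ?_, ?_⟩
  · dsimp only
    rw [EisensteinSeries.E_qExpansion_coeff hk hk2]
    split_ifs
    · exact Q0.one_mem
    · have := rat_mem_Q0 (-(2 * k / bernoulli k : ℚ) * (ArithmeticFunction.sigma (k - 1) n))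
      push_cast at this
      exact this
  · intro τ
    have := hasPS_qExpansion (ModularForm.E hk) τ
    simpa using this

theorem discriminant_eq (τ : ℍ) : ModularForm.discriminant τ =
    ee ((1 : ℚ) * τ) * W τ ((1 : ℚ) * τ + 0) ^ 24 := by
  rw [ModularForm.discriminant, eta_eq, mul_pow, ← ee_nat_mul]
  congr 2
  · push_cast; ring
  · push_cast; ring_nf

theorem hasLaurentOver_discriminant : HasLaurentOver Q0 ModularForm.discriminant := by
  have h := (conjAt_ee_mul (algebraMap Q0 ℂ) (r := 1) zero_le_one).mul
    ((conjAt_W (algebraMap Q0 ℂ) (α := 1) zero_le_one (ζ := 1) (β := 0) (β' := 0)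
      (by simp [ee_zero])
      (by simp [ee_zero])).pow 24)
  exact (h.congr discriminant_eq discriminant_eq).conj.hasLaurentOver

theorem isForm_discriminant : IsForm 12 ⊤ ModularForm.discriminant := by
  have hinv : ∀ γ : SL(2, ℤ), ModularForm.discriminant ∣[((12 : ℕ) : ℤ)] γ =
      ModularForm.discriminant :=
    SlashInvariantForm.slash_action_generators_SL2Z ModularForm.discriminant_S_invariant
      ModularForm.discriminant_T_invariant
  refine ⟨fun γ _ => hinv γ, fun γ => ?_⟩
  rw [hinv]
  have h := (conjAt_ee_mul (algebraMap Q0 ℂ) (r := 1) zero_le_one).mul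
    ((conjAt_W (algebraMap Q0 ℂ) (α := 1) zero_le_one (ζ := 1) (β := 0) (β' := 0)
      (by simp [ee_zero])
      (by simp [ee_zero])).pow 24)
  exact (h.congr discriminant_eq discriminant_eq).holAtInfty

/-- Forms of level one and weight `k` with rational coefficients. -/
def IsRatForm (k : ℕ) (f : ℍ → ℂ) : Prop := IsForm k ⊤ f ∧ HasLaurentOver Q0 f

theorem IsRatForm.mem_levelOneRing {k : ℕ} {f : ℍ → ℂ} (h : IsRatForm k f) :
    f ∈ levelOneRing Q0 :=
  Subring.subset_closure ⟨k, (mem_modularForms_iff inferInstance).2 h⟩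

theorem IsRatForm.mem_allModularForms {k : ℕ} {f : ℍ → ℂ} (h : IsRatForm k f)
    (K : IntermediateField ℚ ℂ) : f ∈ allModularForms k K :=
  mem_allModularForms_iff.2 ⟨⟨⊤, inferInstance, h.1⟩, h.2.mono bot_le⟩

/-- Forms of level one are combinations of forms with rational coefficients. -/
theorem IsForm.exists_combination (k : ℕ) : ∀ {f : ℍ → ℂ}, IsForm k ⊤ f →
    ∃ (n : ℕ) (e : Fin n → ℍ → ℂ) (c : Fin n → ℂ), (∀ i, IsRatForm k (e i)) ∧
      f = ∑ i, c i • e i := by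
  induction k using Nat.strong_induction_on with
  | _ k ih =>
  intro f hf
  have hzero : f = 0 → ∃ (n : ℕ) (e : Fin n → ℍ → ℂ) (c : Fin n → ℂ), (∀ i, IsRatForm k (e i)) ∧
      f = ∑ i, c i • e i := fun h => ⟨0, Fin.elim0, Fin.elim0, fun i => i.elim0, by simpa using h⟩
  obtain ⟨F, rfl⟩ := hf.exists_modularForm
  rcases Nat.even_or_odd k with hk2 | hk2
  swap
  · refine hzero ?_
    rw [ModularForm.levelOne_odd_weight_eq_zero (by exact_mod_cast hk2) F]
    rfl
  rcases lt_or_ge k 3 with hk | hk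
  · rcases (show k = 0 ∨ k = 2 by obtain ⟨r, rfl⟩ := hk2; omega) with rfl | rfl
    · have : ModularFormClass (ModularForm 𝒮ℒ ((0 : ℕ) : ℤ)) 𝒮ℒ 0 :=
        inferInstanceAs (ModularFormClass (ModularForm 𝒮ℒ 0) 𝒮ℒ 0)
      obtain ⟨c, hc⟩ := ModularFormClass.levelOne_weight_zero_const F
      refine ⟨1, fun _ _ => 1, fun _ => c, fun _ => ⟨IsForm.const 1,
        HasLaurentOver.const (IntermediateField.one_mem _)⟩, ?_⟩
      rw [hc]
      funext τ
      simp
    · refine hzero ?_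
      have := rank_zero_iff_forall_zero.1 ModularForm.levelOne_weight_two_rank_zero F
      rw [this]
      rfl
  -- the general case: subtract a multiple of an Eisenstein series and divide by `Δ`
  set E := ModularForm.E hk with hE
  set c := coeff 0 (UpperHalfPlane.qExpansion 1 F) with hc
  obtain ⟨C, hC⟩ := ModularForm.sub_smul_isCuspForm F E
    (EisensteinSeries.E_qExpansion_coeff_zero hk hk2)
  have hC' : ∀ τ, F τ = c * E τ + C τ := by
    intro τ
    have h1 : (F - c • E) τ = C τ := by
      rw [← hC]
      rfl
    have h2 : (F - c • E) τ = F τ - c * E τ := rfl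
    rw [← h1, h2]
    ring
  have hErat : IsRatForm k E := ⟨ModularForm.isForm_top E, hasLaurentOver_E hk hk2⟩
  set g := CuspForm.discriminantEquiv C with hg
  have hg' : ∀ τ, F τ = c * E τ + ModularForm.discriminant τ * g τ := fun τ => by
    rw [hC', hg, ModularForm.discriminant_mul_discriminantEquiv_apply]
  rcases lt_or_ge k 12 with hk12 | hk12
  · have h0 : ⇑g = 0 := ModularFormClass.levelOne_neg_weight_eq_zero (k := (k : ℤ) - 12)
      (by omega) g
    refine ⟨1, fun _ => E, fun _ => c, fun _ => hErat, ?_⟩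
    funext τ
    rw [hg', h0]
    simp
  · obtain ⟨l, rfl⟩ := Nat.exists_eq_add_of_le hk12
    have hl : (((12 + l : ℕ) : ℤ) - 12) = (l : ℤ) := by push_cast; ring
    obtain ⟨n, e, d, he, hd⟩ := ih l (by omega)
      (ModularForm.isForm_top (ModularForm.mcast hl g))
    have hd' : ⇑g = ∑ i, d i • e i := hd
    refine ⟨n + 1, Fin.cons E fun i => ModularForm.discriminant * e i, Fin.cons c d, ?_, ?_⟩
    · intro i
      refine Fin.cases hErat (fun i => ?_) i
      rw [Fin.cons_succ]
      exact ⟨isForm_discriminant.mul (he i).1, hasLaurentOver_discriminant.mul (he i).2⟩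
    · funext τ
      rw [hg', hd', Fin.sum_univ_succ]
      simp only [Fin.cons_zero, Fin.cons_succ, Pi.add_apply, Pi.smul_apply, smul_eq_mul,
        Finset.sum_apply, Pi.mul_apply, Finset.mul_sum]
      congr 1
      refine Finset.sum_congr rfl fun i _ => by ring

/-! ### Automorphy substitutions -/

section starEval

variable (g : ℍ → ℍ) (j : ℍ → ℂ)

/-- The substitution `f ↦ (τ ↦ j(τ)⁻ᵏ f(g(τ)))` on forms of weight `k`, extended to the graded
ring of modular forms. -/
def starEval : Polynomial (ℍ → ℂ) →+* (ℍ → ℂ) :=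
  Polynomial.eval₂RingHom (RingHom.pi fun τ => Pi.evalRingHom (fun _ : ℍ => ℂ) (g τ)) j⁻¹

theorem starEval_monomial (k : ℕ) (f : ℍ → ℂ) :
    starEval g j (Polynomial.monomial k f) = fun τ => f (g τ) * (j τ)⁻¹ ^ k := by
  funext τ
  rw [starEval, Polynomial.coe_eval₂RingHom, Polynomial.eval₂_monomial]
  rfl

/-- The pairs `(f, f')`, where `f'` is obtained from the element `f` of the ring of modular forms
by the substitution `starEval`. -/
def starPairs : Subring ((ℍ → ℂ) × (ℍ → ℂ)) :=
  (gradedRing ⊤).map ((Polynomial.evalRingHom 1).prod (starEval g j))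

variable {g j}

theorem mem_starPairs_of_form {K : IntermediateField ℚ ℂ} {k : ℕ} {f : ℍ → ℂ}
    (hf : f ∈ allModularForms k K) : (f, fun τ => f (g τ) * (j τ)⁻¹ ^ k) ∈ starPairs g j := by
  refine ⟨Polynomial.monomial k f, gradedRing_mono le_top (monomial_mem_gradedRing hf), ?_⟩
  rw [RingHom.prod_apply, starEval_monomial]
  simp

theorem starPairs_zero {f' : ℍ → ℂ} (h : (0, f') ∈ starPairs g j) : f' = 0 := by
  obtain ⟨P, hP, h⟩ := h
  rw [RingHom.prod_apply, Prod.mk.injEq] at h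
  have := eq_zero_of_eval_one_eq_zero hP h.1
  rw [← h.2, this, map_zero]

theorem starPairs_unique {f f' f'' : ℍ → ℂ} (h : (f, f') ∈ starPairs g j)
    (h' : (f, f'') ∈ starPairs g j) : f' = f'' := by
  have := (starPairs g j).sub_mem h h'
  rw [Prod.mk_sub_mk, sub_self] at this
  exact sub_eq_zero.1 (starPairs_zero this)

theorem const_mem_starPairs (c : ℂ) : ((fun _ => c : ℍ → ℂ), (fun _ => c : ℍ → ℂ)) ∈
    starPairs g j := by
  have := mem_starPairs_of_form (g := g) (j := j)
    (const_mem_allModularForms (K := ⊤) (c := c) trivial)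
  simpa using this

end starEval

theorem slash_mem_starPairs {K : IntermediateField ℚ ℂ} {k : ℕ} {f : ℍ → ℂ}
    (hf : f ∈ allModularForms k K) (γ : SL(2, ℤ)) :
    (f, f ∣[(k : ℤ)] γ) ∈ starPairs (fun τ => γ • τ) (fun τ => UpperHalfPlane.denom γ τ) := by
  convert mem_starPairs_of_form hf using 2
  funext τ
  rw [ModularForm.SL_slash_apply, zpow_neg, zpow_natCast, inv_pow]

end

section

open Complex (I)
open Filter Topology

/-! ### Automorphisms of the ring of modular forms -/

/-- The ring of functions with a Laurent expansion over `K`. -/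
def laurentRing (K : IntermediateField ℚ ℂ) : Subring (ℍ → ℂ) where
  carrier := {f | HasLaurentOver K f}
  mul_mem' := fun h h' => h.mul h'
  add_mem' := fun h h' => h.add h'
  neg_mem' := fun h => h.neg
  zero_mem' := HasLaurentOver.const K.zero_mem
  one_mem' := HasLaurentOver.const K.one_mem

theorem modularFormRing_le_laurentRing (K : IntermediateField ℚ ℂ) :
    modularFormRing K ≤ laurentRing K := by
  refine Subring.closure_le.2 ?_
  rintro f ⟨k, hf⟩
  exact (mem_allModularForms_iff.1 hf).2

theorem modularFormRing_hasLaurent {K : IntermediateField ℚ ℂ} {f : ℍ → ℂ}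
    (hf : f ∈ modularFormRing K) : HasLaurentOver K f := modularFormRing_le_laurentRing K hf

instance (K : IntermediateField ℚ ℂ) : NoZeroDivisors (modularFormRing K) where
  eq_zero_or_eq_zero_of_mul_eq_zero := by
    rintro ⟨f, hf⟩ ⟨g, hg⟩ h
    rcases (modularFormRing_hasLaurent hf).eq_zero_or_eq_zero (modularFormRing_hasLaurent hg)
      (congrArg Subtype.val h) with rfl | rfl
    · exact Or.inl rfl
    · exact Or.inr rfl

instance (K : IntermediateField ℚ ℂ) : IsDomain (modularFormRing K) where
  __ := (inferInstance : IsLeftCancelMulZero (modularFormRing K))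
  __ := (inferInstance : IsRightCancelMulZero (modularFormRing K))
  exists_pair_ne := ⟨0, 1, fun h => by
    have := congrFun (congrArg Subtype.val h) UpperHalfPlane.I
    simp at this⟩

/-- Constants as modular forms. -/
def constForm (K : IntermediateField ℚ ℂ) : K →+* modularFormRing K where
  toFun c := ⟨fun _ => c, mem_modularFormRing_of_form (const_mem_allModularForms c.2)⟩
  map_one' := rfl
  map_mul' _ _ := rfl
  map_zero' := rfl
  map_add' _ _ := rfl

theorem constForm_injective (K : IntermediateField ℚ ℂ) : Function.Injective (constForm K) :=
  (constForm K).injective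

theorem isAlgClosed_Qbar : IsAlgClosed Qbar :=
  (algebraicClosure.isAlgClosure ℚ ℂ).isAlgClosed

theorem isIntegral_Qbar (c : Qbar) : IsIntegral ℚ c :=
  (isIntegral_algebraMap_iff (algebraMap Qbar ℂ).injective).1
    (mem_algebraicClosure_iff'.1 c.2)

/-- An automorphism of the ring of modular forms permutes the constants: a constant is a root of a
polynomial with rational coefficients. -/
theorem exists_embedding (σ : AutM) :
    ∃ s : Qbar →+* Qbar, ∀ c, σ (constForm Qbar c) = constForm Qbar (s c) := by
  have key : ∀ c : Qbar, ∃ d : Qbar, σ (constForm Qbar c) = constForm Qbar d := by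
    intro c
    have hint : IsIntegral ℚ c := isIntegral_Qbar c
    have : IsAlgClosed Qbar := isAlgClosed_Qbar
    set p := minpoly ℚ c
    set φ : Qbar →+* modularFormRing Qbar := (σ : modularFormRing Qbar →+* _).comp (constForm Qbar)
    have h1 : (p.map (algebraMap ℚ Qbar)).eval₂ (constForm Qbar) (φ c) = 0 := by
      rw [Polynomial.eval₂_map,
        Subsingleton.elim ((constForm Qbar).comp (algebraMap ℚ Qbar)) (φ.comp (algebraMap ℚ Qbar)),
        ← Polynomial.hom_eval₂, ← Polynomial.aeval_def, minpoly.aeval, map_zero]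
    have h2 := (IsAlgClosed.splits (p.map (algebraMap ℚ Qbar))).eq_prod_roots_of_monic
      ((minpoly.monic hint).map _)
    rw [h2, ← Polynomial.coe_eval₂RingHom, map_multiset_prod, Multiset.prod_eq_zero_iff] at h1
    simp only [Multiset.map_map, Multiset.mem_map, Function.comp_apply] at h1
    obtain ⟨d, -, hd⟩ := h1
    refine ⟨d, ?_⟩
    simp only [Polynomial.coe_eval₂RingHom, Polynomial.eval₂_sub, Polynomial.eval₂_X,
      Polynomial.eval₂_C] at hd
    exact sub_eq_zero.1 hd
  choose s hs using key
  refine ⟨⟨⟨⟨s, ?_⟩, ?_⟩, ?_, ?_⟩, hs⟩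
  · apply constForm_injective
    rw [← hs 1, map_one, map_one]
  · intro x y
    apply constForm_injective
    dsimp only
    rw [← hs, map_mul, map_mul, map_mul, hs, hs]
  · apply constForm_injective
    dsimp only
    rw [← hs 0, map_zero, map_zero]
  · intro x y
    apply constForm_injective
    dsimp only
    rw [← hs, map_add, map_add, map_add, hs, hs]

/-! ### Symmetric functions of orbits -/

/-- The elementary symmetric functions of a finite set of functions. -/
def orbitSymm (O : Finset (ℍ → ℂ)) (i : ℕ) : ℍ → ℂ := ∑ S ∈ O.powersetCard i, ∏ G ∈ S, G

theorem prod_neg_add_eq_orbitSymm (O : Finset (ℍ → ℂ)) (F : ℍ → ℂ) : ∏ G ∈ O, (-G + F) =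
    ∑ i ∈ Finset.range (O.card + 1), (-1) ^ i * orbitSymm O i * F ^ (O.card - i) := by
  classical
  rw [Finset.prod_add, Finset.sum_powerset]
  refine Finset.sum_congr rfl fun i _ => ?_
  rw [orbitSymm, Finset.mul_sum, Finset.sum_mul]
  refine Finset.sum_congr rfl fun S hS => ?_
  obtain ⟨h2, h3⟩ := Finset.mem_powersetCard.1 hS
  rw [Finset.prod_neg, h3, Finset.prod_const, Finset.card_sdiff_of_subset h2, h3]

theorem orbitSymm_relation (O : Finset (ℍ → ℂ)) {F : ℍ → ℂ} (hF : F ∈ O) :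
    F ^ O.card = ∑ i : Fin O.card,
      (-(-1) ^ ((i : ℕ) + 1)) * orbitSymm O (i + 1) * F ^ (O.card - 1 - i) := by
  have h0 : ∏ G ∈ O, (-G + F) = 0 := Finset.prod_eq_zero hF (by simp)
  rw [prod_neg_add_eq_orbitSymm, Finset.sum_range_succ', Finset.sum_range] at h0
  have h2 : orbitSymm O 0 = 1 := by simp [orbitSymm]
  simp only [h2, pow_zero, mul_one, one_mul, Nat.sub_zero] at h0
  rw [eq_neg_of_add_eq_zero_right h0, ← Finset.sum_neg_distrib]
  refine Finset.sum_congr rfl fun i _ => ?_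
  rw [Nat.sub_sub, add_comm 1]
  ring

theorem prod_slash {k : ℕ} (S : Finset (ℍ → ℂ)) (δ : SL(2, ℤ)) :
    (∏ G ∈ S, G) ∣[((k * S.card : ℕ) : ℤ)] δ = ∏ G ∈ S, (G ∣[(k : ℤ)] δ) := by
  classical
  induction S using Finset.induction_on with
  | empty => exact ModularForm.is_invariant_const δ 1
  | insert a S ha ih =>
    rw [Finset.prod_insert ha, Finset.prod_insert ha, Finset.card_insert_of_notMem ha, ← ih,
      ← ModularForm.mul_slash_SL2]
    congr 2
    ring

theorem slash_injective (k : ℤ) (δ : SL(2, ℤ)) :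
    Function.Injective (fun G : ℍ → ℂ => G ∣[k] δ) := by
  intro G G' h
  have := congrArg (fun G : ℍ → ℂ => G ∣[k] δ⁻¹) h
  simpa [← SlashAction.slash_mul] using this

theorem sum_slash {k : ℤ} {ι : Type*} (s : Finset ι) (f : ι → ℍ → ℂ) (δ : SL(2, ℤ)) :
    (∑ i ∈ s, f i) ∣[k] δ = ∑ i ∈ s, (f i ∣[k] δ) := by
  classical
  induction s using Finset.induction_on with
  | empty => simp
  | insert a s ha ih => rw [Finset.sum_insert ha, Finset.sum_insert ha, SlashAction.add_slash, ih]

/-- If an injection maps `O` to itself, the symmetric functions of `O` are invariant. -/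
theorem sum_powersetCard_map (O : Finset (ℍ → ℂ)) (i : ℕ) (e : (ℍ → ℂ) → (ℍ → ℂ))
    (he : Set.InjOn e O) (hO : ∀ G ∈ O, e G ∈ O) :
    ∑ S ∈ O.powersetCard i, ∏ G ∈ S, e G = orbitSymm O i := by
  classical
  have himg : O.image e = O := by
    refine Finset.eq_of_subset_of_card_le (fun G hG => ?_) ?_
    · obtain ⟨G', hG', rfl⟩ := Finset.mem_image.1 hG
      exact hO _ hG'
    · rw [Finset.card_image_of_injOn he]
  have hinj : ∀ S ∈ O.powersetCard i, Set.InjOn e S := fun S hS =>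
    he.mono (by exact_mod_cast (Finset.mem_powersetCard.1 hS).1)
  rw [orbitSymm]
  refine Finset.sum_bij' (fun S _ => S.image e)
    (fun S _ => O.filter fun G => e G ∈ S) ?_ ?_ ?_ ?_ ?_
  · intro S hS
    rw [Finset.mem_powersetCard] at hS ⊢
    exact ⟨fun G hG => himg ▸ Finset.image_subset_image hS.1 hG,
      by rw [Finset.card_image_of_injOn (hinj S (Finset.mem_powersetCard.2 hS)), hS.2]⟩
  · intro S hS
    rw [Finset.mem_powersetCard] at hS ⊢
    refine ⟨Finset.filter_subset _ _, ?_⟩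
    rw [← hS.2, ← Finset.card_image_of_injOn (f := e) (s := O.filter fun G => e G ∈ S)
      (he.mono (by exact_mod_cast Finset.filter_subset _ _))]
    congr 1
    ext G
    simp only [Finset.mem_image, Finset.mem_filter]
    constructor
    · rintro ⟨G', ⟨-, h⟩, rfl⟩
      exact h
    · intro hG
      obtain ⟨G', hG', rfl⟩ := Finset.mem_image.1 (himg.symm ▸ hS.1 hG)
      exact ⟨G', ⟨hG', hG⟩, rfl⟩
  · intro S hS
    ext G
    simp only [Finset.mem_image, Finset.mem_filter]
    have hSO := (Finset.mem_powersetCard.1 hS).1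
    constructor
    · rintro ⟨hG, G', hG', h⟩
      rwa [← he (hSO hG') hG h]
    · exact fun hG => ⟨hSO hG, G, hG, rfl⟩
  · intro S hS
    ext G
    simp only [Finset.mem_image, Finset.mem_filter]
    have hSO := (Finset.mem_powersetCard.1 hS).1
    constructor
    · rintro ⟨G', ⟨-, h⟩, rfl⟩
      exact h
    · intro hG
      obtain ⟨G', hG', rfl⟩ := Finset.mem_image.1 (himg.symm ▸ hSO hG)
      exact ⟨G', ⟨hG', hG⟩, rfl⟩
  · intro S hS
    rw [Finset.prod_image (hinj S hS)]

theorem isForm_orbitSymm {k : ℕ} {O : Finset (ℍ → ℂ)} (hO : ∀ G ∈ O, ∀ δ : SL(2, ℤ),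
    (G ∣[(k : ℤ)] δ) ∈ O) (hol : ∀ G ∈ O, HolAtInfty G) (i : ℕ) :
    IsForm (k * i) ⊤ (orbitSymm O i) := by
  classical
  have hinv : ∀ δ : SL(2, ℤ), orbitSymm O i ∣[((k * i : ℕ) : ℤ)] δ = orbitSymm O i := by
    intro δ
    conv_lhs => rw [orbitSymm]
    rw [sum_slash, ← sum_powersetCard_map O i (fun G => G ∣[(k : ℤ)] δ)
      (slash_injective _ δ).injOn fun G hG => hO G hG δ]
    refine Finset.sum_congr rfl fun S hS => ?_
    rw [← prod_slash, (Finset.mem_powersetCard.1 hS).2]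
  refine ⟨fun δ _ => hinv δ, fun δ => ?_⟩
  rw [hinv]
  refine holRing.sum_mem fun S hS => holRing.prod_mem fun G hG => ?_
  exact hol G ((Finset.mem_powersetCard.1 hS).1 hG)

/-! ### Automorphisms over the forms of level one preserve the weight -/

theorem finite_slash_orbit {k : ℕ} {Γ : Subgroup SL(2, ℤ)} (hΓ : Γ.FiniteIndex) {F : ℍ → ℂ}
    (hF : IsForm k Γ F) : (Set.range fun γ : SL(2, ℤ) => F ∣[(k : ℤ)] γ).Finite := by
  have : Finite (SL(2, ℤ) ⧸ Γ) := Subgroup.finite_quotient_of_finiteIndex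
  refine Set.Finite.subset (Set.finite_range fun q : SL(2, ℤ) ⧸ Γ => F ∣[(k : ℤ)] (q.out)⁻¹) ?_
  rintro _ ⟨γ, rfl⟩
  refine ⟨((γ⁻¹ : SL(2, ℤ)) : SL(2, ℤ) ⧸ Γ), ?_⟩
  obtain ⟨δ, hδ⟩ := QuotientGroup.mk_out_eq_mul Γ γ⁻¹
  dsimp only
  rw [hδ, mul_inv_rev, inv_inv, SlashAction.slash_mul, hF.inv _ (Γ.inv_mem δ.2)]

/-- A polynomial which satisfies a homogeneous equation, where the variable has the weight `k`,
is a monomial of degree `k`. -/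
theorem eq_monomial_of_relation {k d : ℕ} {p : Polynomial ℂ} {ι : Type*} (s : Finset ι)
    (a : ι → ℂ) (m : ι → ℕ) (hm : ∀ i ∈ s, m i < d)
    (h : p ^ d = ∑ i ∈ s, Polynomial.C (a i) * Polynomial.X ^ (k * (m i + 1)) * p ^ (d - 1 - m i)) :
    ∃ r : ℂ, p = Polynomial.C r * Polynomial.X ^ k := by
  classical
  set A := algebraMap (Polynomial ℂ) (RatFunc ℂ) with hA
  have hinj : Function.Injective A := RatFunc.algebraMap_injective ℂ
  have hX : A Polynomial.X ≠ 0 := by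
    rw [Ne, map_eq_zero_iff _ hinj]
    exact Polynomial.X_ne_zero
  set z := A p / A Polynomial.X ^ k with hz
  have hpz : A p = z * A Polynomial.X ^ k := by
    rw [hz, div_mul_cancel₀ _ (pow_ne_zero _ hX)]
  have hint : IsIntegral ℂ z := by
    refine ⟨Polynomial.X ^ d - ∑ i ∈ s, Polynomial.C (a i) * Polynomial.X ^ (d - 1 - m i), ?_, ?_⟩
    · rcases s.eq_empty_or_nonempty with rfl | ⟨i, hi⟩
      · simp [Polynomial.monic_X_pow]
      · refine Polynomial.monic_X_pow_sub ?_
        refine (Polynomial.degree_sum_le _ _).trans_lt ?_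
        refine (Finset.sup_lt_iff (WithBot.bot_lt_coe d)).2 fun j hj => ?_
        refine (Polynomial.degree_C_mul_X_pow_le _ _).trans_lt ?_
        have := hm j hj
        exact WithBot.coe_lt_coe.2 (by omega : d - 1 - m j < d)
    · have h1 := congrArg A h
      simp only [map_pow, map_sum, map_mul, hpz] at h1
      have hXd : (A Polynomial.X ^ k) ^ d ≠ 0 := pow_ne_zero _ (pow_ne_zero _ hX)
      refine mul_right_cancel₀ hXd ?_
      rw [zero_mul, Polynomial.eval₂_sub, Polynomial.eval₂_finsetSum, sub_mul, Finset.sum_mul,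
        Polynomial.eval₂_pow, Polynomial.eval₂_X, ← mul_pow, h1, sub_eq_zero]
      refine Finset.sum_congr rfl fun i hi => ?_
      rw [Polynomial.eval₂_mul, Polynomial.eval₂_C, Polynomial.eval₂_pow, Polynomial.eval₂_X]
      have e1 : (A Polynomial.X ^ k) ^ d =
          A Polynomial.X ^ (k * (m i + 1)) * (A Polynomial.X ^ k) ^ (d - 1 - m i) := by
        rw [pow_mul, ← pow_add]
        congr 1
        have := hm i hi
        omega
      have e2 : A (Polynomial.C (a i)) = algebraMap ℂ (RatFunc ℂ) (a i) := rfl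
      rw [e1, e2, mul_pow]
      ring
  have hdeg : (minpoly ℂ z).degree = 1 :=
    IsAlgClosed.degree_eq_one_of_irreducible ℂ (minpoly.irreducible hint)
  obtain ⟨r, hr⟩ := minpoly.mem_range_of_degree_eq_one ℂ z hdeg
  refine ⟨r, hinj ?_⟩
  rw [map_mul, map_pow, hpz, ← hr]
  rfl

theorem PiQ_rat {σ : AutM} (hσ : σ ∈ PiQ) {k : ℕ} {f : ℍ → ℂ} (hf : IsRatForm k f)
    (F : modularFormRing Qbar) (hF : (F : ℍ → ℂ) = f) : σ F = F :=
  hσ F (hF ▸ hf.mem_levelOneRing)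

/-- An element of `Π_ℚ` maps forms of weight `k` to forms of weight `k`: a form is integral over
the forms of level one, by an equation whose terms all have the same weight, and the conjugate
equation forces the image of the form to have a single homogeneous component. -/
theorem PiQ_weight {σ : AutM} (hσ : σ ∈ PiQ) {k : ℕ} (F : modularFormRing Qbar)
    (hF : (F : ℍ → ℂ) ∈ allModularForms k Qbar) : (σ F : ℍ → ℂ) ∈ allModularForms k Qbar := by
  classical
  obtain ⟨s, hs⟩ := exists_embedding σ
  obtain ⟨⟨Γ, hΓ, hform⟩, hlau⟩ := mem_allModularForms_iff.1 hF
  set O := (finite_slash_orbit hΓ hform).toFinset with hO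
  have hFO : (F : ℍ → ℂ) ∈ O := by
    rw [hO, Set.Finite.mem_toFinset]
    exact ⟨1, SlashAction.slash_one _ _⟩
  have hOs : ∀ G ∈ O, ∀ δ : SL(2, ℤ), (G ∣[(k : ℤ)] δ) ∈ O := by
    intro G hG δ
    rw [hO, Set.Finite.mem_toFinset] at hG ⊢
    obtain ⟨γ, rfl⟩ := hG
    exact ⟨γ * δ, SlashAction.slash_mul _ _ _ _⟩
  have hOh : ∀ G ∈ O, HolAtInfty G := by
    intro G hG
    rw [hO, Set.Finite.mem_toFinset] at hG
    obtain ⟨γ, rfl⟩ := hG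
    exact hform.hol γ
  set d := O.card with hd
  choose n e c he hc using fun i : Fin d =>
    (isForm_orbitSymm hOs hOh ((i : ℕ) + 1)).exists_combination
  -- the equation of `F` over the forms of level one with rational coefficients
  have hrel := orbitSymm_relation O hFO
  rw [← hd] at hrel
  let g : (Σ i : Fin d, Fin (n i)) → modularFormRing Qbar := fun x =>
    ⟨e x.1 x.2, mem_modularFormRing_of_form ((he x.1 x.2).mem_allModularForms Qbar)⟩
  have hg : ∀ x, σ (g x) = g x := fun x => PiQ_rat hσ (he x.1 x.2) _ rfl
  have hrel2 : ((F ^ d : modularFormRing Qbar) : ℍ → ℂ) =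
      ∑ x : (Σ i : Fin d, Fin (n i)), ((-(-1) ^ ((x.1 : ℕ) + 1)) * c x.1 x.2 : ℂ) •
        ((g x * F ^ (d - 1 - x.1) : modularFormRing Qbar) : ℍ → ℂ) := by
    push_cast
    rw [hrel, Fintype.sum_sigma]
    refine Finset.sum_congr rfl fun i _ => ?_
    rw [hc i, Finset.mul_sum, Finset.sum_mul]
    refine Finset.sum_congr rfl fun j _ => ?_
    funext τ
    simp only [Pi.mul_apply, Pi.neg_apply, Pi.pow_apply, Pi.one_apply, Pi.smul_apply,
      smul_eq_mul, g]
    ring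
  obtain ⟨c', hc'⟩ := exists_combination_over (modularFormRing_hasLaurent (Subtype.prop _))
    (fun x => modularFormRing_hasLaurent (Subtype.prop _)) _ hrel2
  have hrel3 : F ^ d = ∑ x : (Σ i : Fin d, Fin (n i)),
      constForm Qbar (c' x) * (g x * F ^ (d - 1 - x.1)) := by
    apply Subtype.ext
    rw [hc']
    push_cast
    rfl
  have hrel4 := congrArg σ hrel3
  simp only [map_pow, map_sum, map_mul, hs, hg] at hrel4
  -- the graded components of `σ F`
  obtain ⟨P, hP, hP1⟩ := exists_graded_of_mem (σ F).2
  set Z : Polynomial (ℍ → ℂ) := P ^ d - ∑ x : (Σ i : Fin d, Fin (n i)),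
    Polynomial.monomial (k * ((x.1 : ℕ) + 1)) ((fun _ => (s (c' x) : ℂ)) * e x.1 x.2) *
      P ^ (d - 1 - x.1) with hZ
  have hZmem : Z ∈ gradedRing Qbar := by
    refine Subring.sub_mem _ (Subring.pow_mem _ hP _) (Subring.sum_mem _ fun x _ =>
      Subring.mul_mem _ (monomial_mem_gradedRing ?_) (Subring.pow_mem _ hP _))
    have := allModularForms_mul (const_mem_allModularForms (K := Qbar) (s (c' x)).2)
      ((he x.1 x.2).mem_allModularForms Qbar)
    rwa [zero_add] at this
  have hZ1 : Z.eval 1 = 0 := by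
    rw [hZ, Polynomial.eval_sub, Polynomial.eval_pow, hP1, Polynomial.eval_finsetSum, sub_eq_zero]
    have := congrArg Subtype.val hrel4
    push_cast at this
    rw [this]
    refine Finset.sum_congr rfl fun x _ => ?_
    rw [Polynomial.eval_mul, Polynomial.eval_pow, hP1, Polynomial.eval_monomial, one_pow, mul_one,
      mul_assoc]
    rfl
  have hZ0 := eq_zero_of_eval_one_eq_zero hZmem hZ1
  have hmon : ∀ l, l ≠ k → P.coeff l = 0 := by
    intro l hl
    funext τ
    set ev := Pi.evalRingHom (fun _ : ℍ => ℂ) τ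
    have h1 := congrArg (Polynomial.map ev) hZ0
    rw [hZ, Polynomial.map_sub, Polynomial.map_zero, sub_eq_zero, Polynomial.map_pow,
      Polynomial.map_sum] at h1
    obtain ⟨r, hr⟩ := eq_monomial_of_relation (k := k) Finset.univ
      (fun x : (Σ i : Fin d, Fin (n i)) => (s (c' x) : ℂ) * e x.1 x.2 τ)
      (fun x => (x.1 : ℕ)) (fun x _ => x.1.2) (h1.trans (Finset.sum_congr rfl fun x _ => by
        rw [Polynomial.map_mul, Polynomial.map_pow, Polynomial.map_monomial,
          ← Polynomial.C_mul_X_pow_eq_monomial]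
        rfl))
    have h2 := congrArg (fun p => Polynomial.coeff p l) hr
    simp only [Polynomial.coeff_map, Polynomial.coeff_C_mul_X_pow, if_neg hl] at h2
    exact h2
  have hPk : P = Polynomial.monomial k (P.coeff k) := by
    ext1 l
    rw [Polynomial.coeff_monomial]
    split_ifs with h
    · rw [h]
    · exact hmon l (Ne.symm h)
  rw [← hP1, hPk, Polynomial.eval_monomial, one_pow, mul_one]
  exact hP k

end

section

open IsDedekindDomain (HeightOneSpectrum)

/-! ### Integral adeles -/

/-- The ring `ℤ^`. -/
def integralAdeles : Subring Af where
  carrier := {x | IsIntegralAdele x}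
  mul_mem' := fun h h' v => mul_mem (h v) (h' v)
  add_mem' := fun h h' v => add_mem (h v) (h' v)
  neg_mem' := fun h v => neg_mem (h v)
  zero_mem' := fun _ => zero_mem _
  one_mem' := fun _ => one_mem _

theorem isIntegralAdele_intCast (n : ℤ) : IsIntegralAdele (n : Af) := intCast_mem integralAdeles n

theorem valued_algebraMap (q : ℚ) (v : HeightOneSpectrum ℤ) :
    Valued.v (algebraMap ℚ Af q v) = v.valuation ℚ q := by
  rw [IsDedekindDomain.FiniteAdeleRing.algebraMap_apply,
    HeightOneSpectrum.valuedAdicCompletion_eq_valuation']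

theorem valuation_intCast (v : HeightOneSpectrum ℤ) (n : ℤ) :
    v.valuation ℚ (n : ℚ) = v.intValuation n := by
  rw [← HeightOneSpectrum.valuation_of_algebraMap (K := ℚ)]
  rfl

theorem exists_int_approx_prime {x : Af} (hx : IsIntegralAdele x) {p : ℕ} (hp : p.Prime) :
    ∃ (j : ℤ) (t : Af), IsIntegralAdele t ∧ x = j + algebraMap ℚ Af p * t := by
  have hp0 : (p : ℚ) ≠ 0 := by exact_mod_cast hp.ne_zero
  have hpz : Prime (p : ℤ) := Nat.prime_iff_prime_int.1 hp
  have hideal : ∀ v : HeightOneSpectrum ℤ, (p : ℤ) ∈ v.asIdeal →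
      v.asIdeal = Ideal.span {(p : ℤ)} := by
    intro v hv
    have h1 : Ideal.span {(p : ℤ)} ≤ v.asIdeal := (Ideal.span_singleton_le_iff_mem _).2 hv
    have h2 : (Ideal.span {(p : ℤ)}).IsMaximal :=
      PrincipalIdealRing.isMaximal_of_irreducible hpz.irreducible
    exact (h2.eq_of_le v.isPrime.ne_top h1).symm
  -- approximation at the place above `p`
  obtain ⟨j, hj⟩ : ∃ j : ℤ, ∀ v : HeightOneSpectrum ℤ, (p : ℤ) ∈ v.asIdeal →
      Valued.v (x v - algebraMap ℚ Af j v) < 1 := by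
    by_cases hv : ∃ v : HeightOneSpectrum ℤ, (p : ℤ) ∈ v.asIdeal
    · obtain ⟨v, hv⟩ := hv
      have hopen : IsOpen {y : v.adicCompletion ℚ | Valued.v (x v - y) < 1} := by
        have h1 : IsOpen {y : v.adicCompletion ℚ | Valued.v y < 1} := by
          have := Valued.isOpen_ball (v.adicCompletion ℚ) 1
          simpa only [Valuation.restrict_lt_one_iff] using this
        exact h1.preimage (continuous_const.sub continuous_id)
      obtain ⟨q, hq⟩ := (HeightOneSpectrum.denseRange_algebraMap (K := ℚ) v).exists_mem_open hopen
        ⟨x v, by simp⟩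
      rw [Set.mem_ofPred_eq] at hq
      have hq1 : v.valuation ℚ q ≤ 1 := by
        have h1 : Valued.v (algebraMap ℚ (v.adicCompletion ℚ) q) ≤ 1 := by
          have h3 : algebraMap ℚ (v.adicCompletion ℚ) q =
            x v - (x v - algebraMap ℚ (v.adicCompletion ℚ) q) := by ring
          rw [h3]
          exact (Valuation.map_sub _ _ _).trans (max_le (hx v) hq.le)
        rwa [HeightOneSpectrum.algebraMap_adicCompletion, Function.comp_apply,
          HeightOneSpectrum.valuedAdicCompletion_eq_valuation'] at h1
      obtain ⟨j, hj⟩ := v.exists_valuation_sub_lt_of_integer hq1 1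
      refine ⟨j, fun v' hv' => ?_⟩
      have hvv : v' = v := HeightOneSpectrum.ext ((hideal v' hv').trans (hideal v hv).symm)
      subst hvv
      have h3 : x v' - algebraMap ℚ Af j v' = (x v' - algebraMap ℚ (v'.adicCompletion ℚ) q) -
          algebraMap ℚ Af ((j : ℚ) - q) v' := by
        have h4 : ∀ q : ℚ, algebraMap ℚ Af q v' = algebraMap ℚ (v'.adicCompletion ℚ) q :=
          fun _ => rfl
        rw [h4, h4, map_sub]
        ring
      rw [h3]
      refine (Valuation.map_sub _ _ _).trans_lt (max_lt hq ?_)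
      rw [valued_algebraMap]
      exact_mod_cast hj
    · push Not at hv
      exact ⟨0, fun v h => absurd h (hv v)⟩
  refine ⟨j, algebraMap ℚ Af (p : ℚ)⁻¹ * (x - j), fun v => ?_, ?_⟩
  · rw [HeightOneSpectrum.mem_adicCompletionIntegers]
    have e : (algebraMap ℚ Af (p : ℚ)⁻¹ * (x - j)) v =
        algebraMap ℚ Af (p : ℚ)⁻¹ v * (x v - algebraMap ℚ Af j v) := by
      rw [map_intCast]
      rfl
    rw [e, map_mul, valued_algebraMap, map_inv₀]
    have hpv : v.valuation ℚ (p : ℚ) = v.intValuation (p : ℤ) := by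
      rw [← valuation_intCast]
      push_cast
      rfl
    rw [hpv]
    by_cases hv : (p : ℤ) ∈ v.asIdeal
    · rw [v.intValuation_singleton hpz.ne_zero (hideal v hv)]
      have h1 := hj v hv
      have h2 : Valued.v (x v - algebraMap ℚ Af j v) ≤ WithZero.exp (-1 : ℤ) := by
        by_cases h0 : Valued.v (x v - algebraMap ℚ Af j v) = 0
        · rw [h0]
          exact zero_le
        · rw [← WithZero.exp_log h0] at h1 ⊢
          rw [← WithZero.exp_zero, WithZero.exp_lt_exp] at h1
          rw [WithZero.exp_le_exp]
          omega
      calc _ ≤ (WithZero.exp (-1 : ℤ))⁻¹ * WithZero.exp (-1 : ℤ) := by gcongr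
        _ = 1 := inv_mul_cancel₀ (by simp)
    · rw [HeightOneSpectrum.intValuation_eq_one_iff.2 hv, inv_one, one_mul]
      have h4 : algebraMap ℚ Af j = ((j : ℤ) : Af) := map_intCast _ _
      exact integralAdeles.sub_mem hx (h4 ▸ isIntegralAdele_intCast j) v
  · rw [← mul_assoc, ← map_mul, mul_inv_cancel₀ hp0, map_one]
    ring

/-- `ℤ^ = ℤ + N ℤ^`. -/
theorem exists_int_approx {N : ℕ} (hN : 0 < N) : ∀ {x : Af}, IsIntegralAdele x →
    ∃ j : ℤ, AdeleCong N x j := by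
  induction N using Nat.recOnMul with
  | zero => omega
  | one => exact fun {x} hx => ⟨0, x, hx, by simp⟩
  | prime p hp =>
    intro x hx
    obtain ⟨j, t, ht, h⟩ := exists_int_approx_prime hx hp
    exact ⟨j, t, ht, h⟩
  | mul a b iha ihb =>
    intro x hx
    obtain ⟨j, t, ht, h⟩ := iha (Nat.pos_of_mul_pos_right hN) hx
    obtain ⟨i, u, hu, h'⟩ := ihb (Nat.pos_of_mul_pos_left hN) ht
    refine ⟨j + a * i, u, hu, ?_⟩
    rw [h, h']
    push_cast
    ring

namespace AdeleCong

variable {r : ℚ} {x y z x' y' : Af}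

theorem refl (r : ℚ) (x : Af) : AdeleCong r x x := ⟨0, integralAdeles.zero_mem, by simp⟩

theorem symm (h : AdeleCong r x y) : AdeleCong r y x := by
  obtain ⟨t, ht, rfl⟩ := h
  exact ⟨-t, integralAdeles.neg_mem ht, by ring⟩

theorem trans (h : AdeleCong r x y) (h' : AdeleCong r y z) : AdeleCong r x z := by
  obtain ⟨t, ht, rfl⟩ := h
  obtain ⟨u, hu, rfl⟩ := h'
  exact ⟨u + t, integralAdeles.add_mem hu ht, by ring⟩

theorem add (h : AdeleCong r x y) (h' : AdeleCong r x' y') : AdeleCong r (x + x') (y + y') := by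
  obtain ⟨t, ht, rfl⟩ := h
  obtain ⟨u, hu, rfl⟩ := h'
  exact ⟨t + u, integralAdeles.add_mem ht hu, by ring⟩

theorem neg (h : AdeleCong r x y) : AdeleCong r (-x) (-y) := by
  obtain ⟨t, ht, rfl⟩ := h
  exact ⟨-t, integralAdeles.neg_mem ht, by ring⟩

theorem sub (h : AdeleCong r x y) (h' : AdeleCong r x' y') : AdeleCong r (x - x') (y - y') := by
  rw [sub_eq_add_neg, sub_eq_add_neg]
  exact h.add h'.neg

theorem mul (h : AdeleCong r x y) (h' : AdeleCong r x' y') (hx : IsIntegralAdele x)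
    (hy' : IsIntegralAdele y') : AdeleCong r (x * x') (y * y') := by
  obtain ⟨t, ht, rfl⟩ := h
  obtain ⟨u, hu, rfl⟩ := h'
  refine ⟨t * y' + (y + algebraMap ℚ Af r * t) * u,
    integralAdeles.add_mem (integralAdeles.mul_mem ht hy') (integralAdeles.mul_mem hx hu), by ring⟩

theorem of_dvd {M N : ℕ} (hd : N ∣ M) (h : AdeleCong M x y) : AdeleCong N x y := by
  obtain ⟨d, rfl⟩ := hd
  obtain ⟨t, ht, rfl⟩ := h
  refine ⟨d * t, integralAdeles.mul_mem (natCast_mem _ _) ht, ?_⟩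
  rw [map_natCast, map_natCast]
  push_cast
  ring

end AdeleCong

theorem adeleCong_int_iff {N : ℕ} (hN : 0 < N) {a b : ℤ} :
    AdeleCong N (a : Af) b ↔ (N : ℤ) ∣ a - b := by
  have hN0 : (N : ℚ) ≠ 0 := by exact_mod_cast hN.ne'
  constructor
  · rintro ⟨t, ht, h⟩
    have h1 : t = algebraMap ℚ Af ((a - b) / N) := by
      have h2 : algebraMap ℚ Af N * t = algebraMap ℚ Af (a - b) := by
        rw [map_sub, map_intCast, map_intCast, h]
        ring
      rw [div_eq_inv_mul, map_mul, ← h2, ← mul_assoc, ← map_mul, inv_mul_cancel₀ hN0, map_one,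
        one_mul]
    rw [h1] at ht
    obtain ⟨m, hm⟩ := exists_int_of_isIntegralAdele ht
    refine ⟨m, ?_⟩
    rw [div_eq_iff hN0] at hm
    have : ((a - b : ℤ) : ℚ) = ((N * m : ℤ) : ℚ) := by
      push_cast
      rw [hm]
      ring
    exact_mod_cast this
  · rintro ⟨c, hc⟩
    refine ⟨c, isIntegralAdele_intCast c, ?_⟩
    rw [map_natCast, eq_add_of_sub_eq' hc]
    push_cast
    ring

theorem valued_natCast (v : HeightOneSpectrum ℤ) (n : ℕ) :
    Valued.v (n : v.adicCompletion ℚ) = v.intValuation (n : ℤ) := by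
  have := valued_algebraMap (n : ℚ) v
  rw [map_natCast] at this
  have h2 := valuation_intCast v n
  rw [Int.cast_natCast] at h2
  rw [← h2, ← this]
  rfl

theorem exists_nat_intValuation_lt (v : HeightOneSpectrum ℤ) :
    ∃ p : ℕ, 0 < p ∧ v.intValuation (p : ℤ) < 1 := by
  obtain ⟨p, hp, hp0⟩ := Submodule.exists_mem_ne_zero_of_ne_bot v.ne_bot
  have hlt : v.intValuation p < 1 := (v.intValuation_lt_one_iff_mem p).2 hp
  refine ⟨p.natAbs, by omega, ?_⟩
  rcases Int.natAbs_eq p with h | h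
  · rwa [← h]
  · have : (p.natAbs : ℤ) = -p := by omega
    rwa [this, Valuation.map_neg]

theorem exists_nat_mul_integral (v : HeightOneSpectrum ℤ) (y : v.adicCompletion ℚ) :
    ∃ n : ℕ, 0 < n ∧ Valued.v ((n : v.adicCompletion ℚ) * y) ≤ 1 := by
  obtain ⟨p, hp, hlt⟩ := exists_nat_intValuation_lt v
  have hne : v.intValuation (p : ℤ) ≠ 0 := v.intValuation_ne_zero _ (by omega)
  obtain ⟨k, hk⟩ := MulArchimedean.arch (Valued.v y) (one_lt_inv_iff₀.2 ⟨zero_lt_iff.2 hne, hlt⟩)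
  refine ⟨p ^ k, pow_pos hp k, ?_⟩
  rw [map_mul, valued_natCast]
  push_cast
  rw [map_pow]
  rw [inv_pow] at hk
  calc _ ≤ v.intValuation (p : ℤ) ^ k * (v.intValuation (p : ℤ) ^ k)⁻¹ := by gcongr
    _ = 1 := mul_inv_cancel₀ (pow_ne_zero _ hne)

/-- `⋂ N ℤ^ = 0`. -/
theorem eq_of_adeleCong {x y : Af} (h : ∀ N : ℕ, 0 < N → AdeleCong N x y) : x = y := by
  refine IsDedekindDomain.FiniteAdeleRing.ext _ fun v => ?_
  by_contra hne
  have hz : x v - y v ≠ 0 := sub_ne_zero.2 hne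
  obtain ⟨n, hn, h1⟩ := exists_nat_mul_integral v (x v - y v)⁻¹
  obtain ⟨p, hp, hlt⟩ := exists_nat_intValuation_lt v
  obtain ⟨t, ht, hxy⟩ := h (n * p) (by positivity)
  have h2 : x v - y v = (n : v.adicCompletion ℚ) * ((p : v.adicCompletion ℚ) * t v) := by
    have h3 : x v = y v + algebraMap ℚ Af ((n * p : ℕ) : ℚ) v * t v := by
      conv_lhs => rw [hxy]
      rfl
    rw [h3, map_natCast]
    have h4 : (((n * p : ℕ) : Af) v) = ((n * p : ℕ) : v.adicCompletion ℚ) := rfl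
    rw [h4]
    push_cast
    ring
  have h3 : (1 : v.adicCompletion ℚ) =
      (n * (x v - y v)⁻¹) * ((p : v.adicCompletion ℚ) * t v) := by
    rw [mul_right_comm, ← h2, mul_inv_cancel₀ hz]
  have h4 := congrArg Valued.v h3
  rw [map_one, map_mul, map_mul _ (p : v.adicCompletion ℚ), valued_natCast] at h4
  have h5 : v.intValuation (p : ℤ) * Valued.v (t v) < 1 :=
    lt_of_le_of_lt (mul_le_of_le_one_right' (ht v)) hlt
  exact absurd h4 (lt_of_le_of_lt (mul_le_of_le_one_left' h1) h5).ne'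

/-- Every finite adele becomes integral after multiplication with a positive integer. -/
theorem exists_nat_mul_isIntegralAdele (x : Af) : ∃ n : ℕ, 0 < n ∧ IsIntegralAdele (n * x) := by
  classical
  choose n hn h using fun v : HeightOneSpectrum ℤ => exists_nat_mul_integral v (x v)
  have hfin : {v : HeightOneSpectrum ℤ | ¬ x v ∈ v.adicCompletionIntegers ℚ}.Finite := x.2
  refine ⟨∏ v ∈ hfin.toFinset, n v, Finset.prod_pos fun v _ => hn v, fun v => ?_⟩
  have e : ∀ m : ℕ, ((m : Af) * x) v = (m : v.adicCompletion ℚ) * x v := fun _ => rfl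
  rw [e]
  by_cases hv : x v ∈ v.adicCompletionIntegers ℚ
  · exact mul_mem (natCast_mem _ _) hv
  · have hv' : v ∈ hfin.toFinset := by
      rw [Set.Finite.mem_toFinset]
      exact hv
    rw [← Finset.prod_erase_mul _ _ hv']
    push_cast
    rw [mul_assoc]
    exact mul_mem (prod_mem fun _ _ => natCast_mem _ _) (h v)

end

section

open Function.Periodic (qParam)
open PowerSeries (coeff constantCoeff expand)

/-! ### Galois action on `ℚ^cycl` -/

/-- The root of unity `e(q)` as an element of `ℚ^cycl`. -/
def rootQ (q : ℚ) : Qcycl := ⟨ee q, ee_rat_mem_Qcycl q⟩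

theorem rootQ_coe (q : ℚ) : (rootQ q : ℂ) = ee q := rfl

theorem exists_int_of_pow_eq_one {n : ℕ} (hn : 0 < n) {z : ℂ} (hz : z ^ n = 1) :
    ∃ k : ℤ, z = ee ((k / n : ℚ) : ℂ) := by
  have : NeZero n := ⟨hn.ne'⟩
  obtain ⟨i, -, hi⟩ := (Complex.isPrimitiveRoot_exp n hn.ne').eq_pow_of_pow_eq_one hz
  refine ⟨i, ?_⟩
  rw [← hi, ← Complex.exp_nat_mul, ee]
  congr 1
  push_cast
  ring

theorem rootQ_int_div (N : ℕ) (k : ℤ) : rootQ (k / N) = rootQ (1 / N) ^ k := by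
  apply Subtype.ext
  have : ((rootQ (1 / N) ^ k : Qcycl) : ℂ) = (rootQ (1 / N) : ℂ) ^ k := rfl
  rw [this, rootQ_coe, rootQ_coe, ee, ee, ← Complex.exp_int_mul]
  congr 1
  push_cast
  ring

theorem isPrimitiveRoot_rootQ {N : ℕ} (hN : 0 < N) : IsPrimitiveRoot (rootQ (1 / N)) N := by
  have h := Complex.isPrimitiveRoot_exp N hN.ne'
  have h2 : (algebraMap Qcycl ℂ) (rootQ (1 / N)) = Complex.exp (2 * Real.pi * Complex.I / N) := by
    change ee _ = _
    rw [ee]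
    congr 1
    push_cast
    ring
  rw [← h2] at h
  exact h.of_map_of_injective (algebraMap Qcycl ℂ).injective

instance normal_Qcycl : Normal ℚ Qcycl := by
  have hint : ∀ x : Qcycl, IsIntegral ℚ x := fun x =>
    (isIntegral_algebraMap_iff (algebraMap Qcycl ℂ).injective).1
      (mem_algebraicClosure_iff'.1 (Qcycl_le_Qbar x.2))
  refine { isAlgebraic := fun x => (hint x).isAlgebraic, splits' := fun x => ?_ }
  have h1 : minpoly ℚ x = minpoly ℚ (x : ℂ) :=
    (minpoly.algebraMap_eq (algebraMap Qcycl ℂ).injective x).symm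
  rw [h1]
  refine IntermediateField.splits_of_mem_adjoin ℚ ℂ (L := Qcycl) ?_ x.2
  rintro z ⟨n, hn, hz⟩
  have hd : minpoly ℚ z ∣ Polynomial.X ^ n - 1 := minpoly.dvd _ _ (by simp [hz])
  have hn0 : (Polynomial.X ^ n - 1 : Polynomial ℚ) ≠ 0 := Polynomial.X_pow_sub_C_ne_zero hn 1
  refine ⟨?_, ?_⟩
  · exact ⟨Polynomial.X ^ n - 1, Polynomial.monic_X_pow_sub_C 1 hn.ne', by simp [hz]⟩
  · have h2 := Polynomial.X_pow_sub_one_splits (isPrimitiveRoot_rootQ hn)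
    refine Polynomial.Splits.of_dvd (g := (Polynomial.X ^ n - 1 : Polynomial ℚ).map
      (algebraMap ℚ Qcycl)) ?_ ?_ ?_
    · simpa using h2
    · exact (Polynomial.map_ne_zero_iff (algebraMap ℚ Qcycl).injective).2 hn0
    · exact Polynomial.map_dvd _ hd

instance isGalois_Qcycl : IsGalois ℚ Qcycl where

/-- An endomorphism of `ℚbar` restricts to an automorphism of `ℚ^cycl`. -/
theorem exists_restrict_Qcycl (s : Qbar →+* Qbar) :
    ∃ t : Qcycl ≃ₐ[ℚ] Qcycl, ∀ x : Qcycl,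
      (t x : ℂ) = s (IntermediateField.inclusion Qcycl_le_Qbar x) := by
  let φ : Qcycl →+* ℂ := (algebraMap Qbar ℂ).comp
    (s.comp (IntermediateField.inclusion Qcycl_le_Qbar : Qcycl →+* Qbar))
  have hφ : φ.comp (algebraMap ℚ Qcycl) = algebraMap ℚ ℂ := Subsingleton.elim _ _
  let f : Qcycl →ₐ[ℚ] ℂ :=
    { φ with
      commutes' := RingHom.congr_fun hφ }
  refine ⟨f.restrictNormal' Qcycl, fun x => ?_⟩
  exact f.restrictNormal_commutes Qcycl x

/-- A function whose expansion over `ℚ^cycl` is fixed by the Galois group has rational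
coefficients. -/
theorem hasLaurentOver_of_conj_self {f : ℍ → ℂ} (hf : HasLaurentOver Qcycl f)
    (h : ∀ t : Qcycl ≃ₐ[ℚ] Qcycl, Conj ((algebraMap Qcycl ℂ).comp (t : Qcycl →+* Qcycl)) f f) :
    HasLaurentOver Q0 f := by
  obtain ⟨w, m, p, hw, h1, -⟩ := hf.conj
  have key : ∀ (t : Qcycl ≃ₐ[ℚ] Qcycl) n, t (coeff n p) = coeff n p := by
    intro t n
    obtain ⟨w', m', p', hw', h2, h3⟩ := h t
    have r1 := hasPS_raise _ hw h1 hw' (m' * w)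
    have r2 := hasPS_raise _ hw' h2 hw (m * w')
    have r3 := hasPS_raise _ hw' h3 hw (m * w')
    rw [mul_comm w' w, add_comm] at r2 r3
    have hww : 0 < w * w' := Nat.mul_pos hw hw'
    have e1 := PowerSeries.map_injective _ (algebraMap Qcycl ℂ).injective (r1.eq_series hww r2)
    have e2 := r2.eq_series hww r3
    rw [← e1, map_mul, map_mul, map_pow, map_pow, PowerSeries.map_X, PowerSeries.map_X] at e2
    have e3 := mul_left_cancel₀ (pow_ne_zero _ PowerSeries.X_ne_zero) e2
    have e4 := congrArg (coeff (w' * n)) e3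
    rw [PowerSeries.coeff_map, PowerSeries.coeff_map, PowerSeries.coeff_expand_mul] at e4
    exact (algebraMap Qcycl ℂ).injective e4.symm
  refine ⟨w, m, fun n => (coeff n p : Qcycl), hw, fun n => ?_, ?_⟩
  · obtain ⟨q, hq⟩ := (InfiniteGalois.mem_bot_iff_fixed (coeff n p)).2 fun t => key t n
    dsimp only
    rw [← hq]
    exact rat_mem_Q0 q
  · rw [hasQExp_iff_hasPS]
    convert h1
    ext n
    simp

theorem Conj.injective {K : IntermediateField ℚ ℂ} {s : K →+* ℂ} {f f' g : ℍ → ℂ}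
    (h : Conj s f g) (h' : Conj s f' g) : f = f' := by
  have := (Conj.add h h'.neg).eq_zero_iff.2 (by simp)
  rwa [← sub_eq_add_neg, sub_eq_zero] at this

/-- If a finite set of functions is stable under the Galois group of `ℚ^cycl`, its symmetric
functions have rational coefficients. -/
theorem hasLaurentOver_orbitSymm {O : Finset (ℍ → ℂ)} (hO : ∀ G ∈ O, HasLaurentOver Qcycl G)
    (h : ∀ t : Qcycl ≃ₐ[ℚ] Qcycl, ∀ G ∈ O, ∃ G' ∈ O,
      Conj ((algebraMap Qcycl ℂ).comp (t : Qcycl →+* Qcycl)) G G') (i : ℕ) :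
    HasLaurentOver Q0 (orbitSymm O i) := by
  classical
  refine hasLaurentOver_of_conj_self ?_ fun t => ?_
  · refine (laurentRing Qcycl).sum_mem fun S hS => (laurentRing Qcycl).prod_mem fun G hG => ?_
    exact hO G ((Finset.mem_powersetCard.1 hS).1 hG)
  · set s := (algebraMap Qcycl ℂ).comp (t : Qcycl →+* Qcycl)
    choose! e he hc using h t
    have h1 := sum_powersetCard_map O i e (fun G hG G' hG' hGG => by
      have := hc G' hG'
      rw [← hGG] at this
      exact (hc G hG).injective this) he
    have h2 : (orbitSymm O i, ∑ S ∈ O.powersetCard i, ∏ G ∈ S, e G) ∈ conjRing s := by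
      have h3 : (orbitSymm O i, ∑ S ∈ O.powersetCard i, ∏ G ∈ S, e G) =
          ∑ S ∈ O.powersetCard i, ∏ G ∈ S, (G, e G) := by
        apply Prod.ext
        · simp [orbitSymm, Prod.fst_sum, Prod.fst_prod]
        · simp [Prod.snd_sum, Prod.snd_prod]
      rw [h3]
      refine Subring.sum_mem _ fun S hS => Subring.prod_mem _ fun G hG => ?_
      exact hc G ((Finset.mem_powersetCard.1 hS).1 hG)
    rw [h1] at h2
    exact h2

end

section

/-! ### Division values and automorphisms -/

section divX

variable {N : ℕ}

/-- The indices of the functions `divX`. -/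
abbrev DivIndex (N : ℕ) : Type := ZMod N × (Fin 2 → ZMod N)

/-- The function `e(k / N) x_{a / N}`, where `k` and `a` are given modulo `N`. -/
def divX (N : ℕ) (i : DivIndex N) : ℍ → ℂ :=
  fun τ => ee (((i.1.cast : ℤ) / N : ℚ) : ℂ) * xv (tors N fun j => (i.2 j).cast) τ

/-- Matrices act on indices by `(k, a) ↦ (k det g, a g)`. -/
def DivIndex.act (i : DivIndex N) (g : Matrix (Fin 2) (Fin 2) (ZMod N)) : DivIndex N :=
  (i.1 * g.det, Matrix.vecMul i.2 g)

/-- Reduction of integral matrices. -/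
abbrev redMat (N : ℕ) (A : Matrix (Fin 2) (Fin 2) ℤ) : Matrix (Fin 2) (Fin 2) (ZMod N) :=
  A.map (Int.castRingHom (ZMod N))

theorem redMat_mul (A B : Matrix (Fin 2) (Fin 2) ℤ) :
    redMat N (A * B) = redMat N A * redMat N B := Matrix.map_mul

theorem redMat_det (A : Matrix (Fin 2) (Fin 2) ℤ) : (redMat N A).det = (A.det : ZMod N) :=
  ((Int.castRingHom (ZMod N)).map_det A).symm

theorem DivIndex.act_mul (i : DivIndex N) (g h : Matrix (Fin 2) (Fin 2) (ZMod N)) :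
    (i.act g).act h = i.act (g * h) := by
  simp only [DivIndex.act, Matrix.det_mul, Matrix.vecMul_vecMul, mul_assoc]

theorem exists_redMat (g : Matrix (Fin 2) (Fin 2) (ZMod N)) : ∃ A, redMat N A = g := by
  refine ⟨g.map fun x => x.cast, ?_⟩
  ext i j
  simp [redMat]

/-- Index of an integral vector. -/
abbrev DivIndex.mk (N : ℕ) (k : ℤ) (a : Fin 2 → ℤ) : DivIndex N :=
  ((k : ZMod N), fun j => (a j : ZMod N))

theorem DivIndex.exists_mk (i : DivIndex N) : ∃ k a, i = DivIndex.mk N k a := by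
  refine ⟨i.1.cast, fun j => (i.2 j).cast, ?_⟩
  ext <;> simp

theorem DivIndex.mk_act (k : ℤ) (a : Fin 2 → ℤ) (A : Matrix (Fin 2) (Fin 2) ℤ) :
    (DivIndex.mk N k a).act (redMat N A) = DivIndex.mk N (k * A.det) (Matrix.vecMul a A) := by
  apply Prod.ext
  · simp only [DivIndex.act, redMat_det, Int.cast_mul]
  · funext j
    simp [DivIndex.act, Matrix.vecMul, dotProduct]



theorem divX_mk (hN : 0 < N) (k : ℤ) (a : Fin 2 → ℤ) :
    divX N (DivIndex.mk N k a) = fun τ => ee ((k / N : ℚ) : ℂ) * xv (tors N a) τ := by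
  have hd : ∀ z : ℤ, (N : ℤ) ∣ ((z : ZMod N).cast : ℤ) - z := fun z => by
    rw [← ZMod.intCast_zmod_eq_zero_iff_dvd]
    simp
  have h0 : (N : ℂ) ≠ 0 := by exact_mod_cast hN.ne'
  have h1 : ee ((((k : ZMod N).cast : ℤ) / N : ℚ) : ℂ) = ee ((k / N : ℚ) : ℂ) := by
    obtain ⟨c, hc⟩ := hd k
    rw [eq_add_of_sub_eq' hc]
    have : ((((k + N * c : ℤ) : ℚ) / N : ℚ) : ℂ) = ((k / N : ℚ) : ℂ) + (c : ℤ) := by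
      push_cast
      field_simp
    rw [this, ee_add_int]
  funext τ
  rw [divX, h1, xv_tors_congr hN fun i => hd (a i)]

theorem const_mul_slash (k : ℤ) (c : ℂ) (f : ℍ → ℂ) (δ : SL(2, ℤ)) :
    ((fun _ => c) * f) ∣[k] δ = (fun _ => c) * (f ∣[k] δ) :=
  ModularForm.SL_smul_slash k δ f c

theorem divX_slash (hN : 0 < N) (i : DivIndex N) (δ : SL(2, ℤ)) :
    divX N i ∣[(3 : ℤ)] δ = divX N (i.act (redMat N δ.1)) := by
  obtain ⟨k, a, rfl⟩ := i.exists_mk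
  rw [DivIndex.mk_act, divX_mk hN, divX_mk hN, δ.2, mul_one, ← vmul_tors, ← xv_slash]
  exact const_mul_slash _ _ _ _

theorem divX_holAtInfty (i : DivIndex N) : HolAtInfty (divX N i) :=
  holRing.mul_mem ⟨1, _, one_pos, HasPS.const 1 _⟩ (holAtInfty_xv _)

theorem divX_hasLaurentOver (i : DivIndex N) : HasLaurentOver Qcycl (divX N i) :=
  (HasLaurentOver.const (ee_rat_mem_Qcycl _)).mul (hasLaurentOver_xv _)

theorem isForm_xv_tors (hN : 0 < N) (a : Fin 2 → ℤ) :
    IsForm 3 (CongruenceSubgroup.Gamma N) (xv (tors N a)) := by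
  refine ⟨fun γ hγ => ?_, fun γ => ?_⟩
  · rw [CongruenceSubgroup.Gamma_mem] at hγ
    refine (xv_slash γ _).trans ?_
    rw [vmul_tors]
    refine xv_tors_congr hN fun i => ?_
    rw [← ZMod.intCast_eq_intCast_iff_dvd_sub]
    fin_cases i <;> simp [Matrix.vecMul, dotProduct, hγ]
  · have : xv (tors N a) ∣[((3 : ℕ) : ℤ)] γ = xv (vmul (tors N a) γ.1) := xv_slash γ _
    rw [this]
    exact holAtInfty_xv _

theorem xv_tors_mem_allModularForms (hN : 0 < N) (a : Fin 2 → ℤ) :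
    xv (tors N a) ∈ allModularForms 3 Qcycl :=
  have : NeZero N := ⟨hN.ne'⟩
  mem_allModularForms_iff.2 ⟨⟨CongruenceSubgroup.Gamma N, inferInstance, isForm_xv_tors hN a⟩,
    hasLaurentOver_xv _⟩

theorem allModularForms_le_Qbar {k : ℕ} {f : ℍ → ℂ} (hf : f ∈ allModularForms k Qcycl) :
    f ∈ allModularForms k Qbar := by
  rw [mem_allModularForms_iff] at hf ⊢
  exact ⟨hf.1, hf.2.mono Qcycl_le_Qbar⟩

/-- The function `x_{a / N}` as an element of the ring of modular forms. -/
def divForm (hN : 0 < N) (a : Fin 2 → ℤ) : modularFormRing Qbar :=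
  ⟨xv (tors N a), mem_modularFormRing_of_form
    (allModularForms_le_Qbar (xv_tors_mem_allModularForms hN a))⟩

theorem divX_mem (hN : 0 < N) (i : DivIndex N) : divX N i ∈ modularFormRing Qbar :=
  Subring.mul_mem _ (constForm Qbar ⟨_, Qcycl_le_Qbar (ee_rat_mem_Qcycl _)⟩).2 (divForm hN _).2

/-- The matrix `diag(1, j)`. -/
def diagOne (j : ℤ) : Matrix (Fin 2) (Fin 2) ℤ := !![1, 0; 0, j]

theorem det_diagOne (j : ℤ) : (diagOne j).det = j := by simp [diagOne, Matrix.det_fin_two]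

theorem vecMul_diagOne (a : Fin 2 → ℤ) (j : ℤ) : Matrix.vecMul a (diagOne j) = ![a 0, j * a 1] := by
  funext i
  fin_cases i <;> simp [diagOne, Matrix.vecMul, dotProduct, mul_comm]

theorem rootQ_map {t : Qcycl →+* ℂ} {j : ℤ} (ht : t (rootQ (1 / N)) = ee ((j / N : ℚ) : ℂ))
    (k : ℤ) : t (rootQ (k / N)) = ee (((j * k : ℤ) / N : ℚ) : ℂ) := by
  rw [rootQ_int_div, map_zpow₀, ht, ee, ee, ← Complex.exp_int_mul]
  congr 1
  push_cast
  ring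

theorem conj_xv_tors {t : Qcycl →+* ℂ} {j : ℤ} (ht : t (rootQ (1 / N)) = ee ((j / N : ℚ) : ℂ))
    (a : Fin 2 → ℤ) : Conj t (xv (tors N a)) (xv (tors N (Matrix.vecMul a (diagOne j)))) := by
  rw [vecMul_diagOne]
  have h : tors N a = ![(a 0 / N : ℚ), (a 1 / N : ℚ)] := by
    funext i
    fin_cases i <;> rfl
  rw [h, tors_eq]
  refine (conj_xv (ζ := rootQ (a 1 / N)) (rootQ_coe _) ?_).1
  rw [rootQ_map ht]

theorem divX_conj (hN : 0 < N) {t : Qcycl →+* ℂ} {j : ℤ}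
    (ht : t (rootQ (1 / N)) = ee ((j / N : ℚ) : ℂ)) (i : DivIndex N) :
    Conj t (divX N i) (divX N (i.act (redMat N (diagOne j)))) := by
  obtain ⟨k, a, rfl⟩ := i.exists_mk
  rw [DivIndex.mk_act, divX_mk hN, divX_mk hN, det_diagOne]
  have h := Conj.const (s := t) (rootQ (k / N))
  rw [rootQ_map ht, mul_comm j k] at h
  exact h.mul (conj_xv_tors ht a)

theorem exists_coprime_of_algEquiv (hN : 0 < N) (t : Qcycl ≃ₐ[ℚ] Qcycl) :
    ∃ j : ℕ, j.Coprime N ∧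
      ((algebraMap Qcycl ℂ).comp (t : Qcycl →+* Qcycl)) (rootQ (1 / N)) =
        ee (((j : ℤ) / N : ℚ) : ℂ) := by
  have : NeZero N := ⟨hN.ne'⟩
  have h1 := isPrimitiveRoot_rootQ hN
  have h2 : IsPrimitiveRoot (t (rootQ (1 / N))) N := h1.map_of_injective t.injective
  obtain ⟨j, -, hj, h3⟩ := h1.isPrimitiveRoot_iff.1 h2
  refine ⟨j, hj, ?_⟩
  have h4 := rootQ_int_div N j
  rw [zpow_natCast, h3] at h4
  exact (congrArg (algebraMap Qcycl ℂ) h4).symm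

theorem isUnit_redMat_iff (A : Matrix (Fin 2) (Fin 2) ℤ) :
    IsUnit (redMat N A) ↔ IsUnit (A.det : ZMod N) := by
  rw [Matrix.isUnit_iff_isUnit_det, redMat_det]

/-- Rational linear combinations of the functions `divX`, transformed by `g`. -/
def divComb (c : DivIndex N → ℚ) (g : Matrix (Fin 2) (Fin 2) (ZMod N)) [NeZero N] : ℍ → ℂ :=
  ∑ i, (fun _ => (c i : ℂ)) * divX N (i.act g)

section divComb

variable [NeZero N]

theorem divComb_slash (c : DivIndex N → ℚ) (g : Matrix (Fin 2) (Fin 2) (ZMod N)) (δ : SL(2, ℤ)) :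
    divComb c g ∣[(3 : ℤ)] δ = divComb c (g * redMat N δ.1) := by
  rw [divComb, sum_slash, divComb]
  refine Finset.sum_congr rfl fun i _ => ?_
  rw [← DivIndex.act_mul, ← divX_slash (NeZero.pos N), const_mul_slash]

theorem divComb_holAtInfty (c : DivIndex N → ℚ) (g : Matrix (Fin 2) (Fin 2) (ZMod N)) :
    HolAtInfty (divComb c g) :=
  holRing.sum_mem fun _ _ => holRing.mul_mem ⟨1, _, one_pos, HasPS.const 1 _⟩ (divX_holAtInfty _)

theorem rat_mem_Qcycl (q : ℚ) : (q : ℂ) ∈ Qcycl := (bot_le : Q0 ≤ Qcycl) (rat_mem_Q0 q)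

theorem divComb_hasLaurentOver (c : DivIndex N → ℚ) (g : Matrix (Fin 2) (Fin 2) (ZMod N)) :
    HasLaurentOver Qcycl (divComb c g) :=
  (laurentRing Qcycl).sum_mem fun _ _ => (laurentRing Qcycl).mul_mem
    (HasLaurentOver.const (rat_mem_Qcycl _)) (divX_hasLaurentOver _)

theorem divComb_conj (c : DivIndex N → ℚ) (g : Matrix (Fin 2) (Fin 2) (ZMod N)) {t : Qcycl →+* ℂ}
    {j : ℤ} (ht : t (rootQ (1 / N)) = ee ((j / N : ℚ) : ℂ)) :
    Conj t (divComb c g) (divComb c (g * redMat N (diagOne j))) := by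
  have h : (divComb c g, divComb c (g * redMat N (diagOne j))) =
      ∑ i, ((fun _ => (c i : ℂ)), (fun _ => (c i : ℂ))) *
        (divX N (i.act g), divX N ((i.act g).act (redMat N (diagOne j)))) := by
    apply Prod.ext
    · simp [divComb, Prod.fst_sum]
    · simp [divComb, Prod.snd_sum, DivIndex.act_mul]
  have h2 : (divComb c g, divComb c (g * redMat N (diagOne j))) ∈ conjRing t := by
    rw [h]
    refine Subring.sum_mem _ fun i _ => Subring.mul_mem _ ?_ (divX_conj (NeZero.pos N) ht _)
    have h3 := Conj.const (s := t) ⟨(c i : ℂ), rat_mem_Qcycl _⟩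
    have h4 : t ⟨(c i : ℂ), rat_mem_Qcycl _⟩ = c i := by
      have : (⟨(c i : ℂ), rat_mem_Qcycl _⟩ : Qcycl) = ((c i : ℚ) : Qcycl) :=
        Subtype.ext (by simp)
      rw [this, map_ratCast]
    rw [h4] at h3
    exact h3
  exact h2

theorem divComb_mem (c : DivIndex N → ℚ) (g : Matrix (Fin 2) (Fin 2) (ZMod N)) :
    divComb c g ∈ modularFormRing Qbar :=
  Subring.sum_mem _ fun _ _ => Subring.mul_mem _
    (constForm Qbar ⟨_, Qcycl_le_Qbar (rat_mem_Qcycl _)⟩).2 (divX_mem (NeZero.pos N) _)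

theorem exists_eq_zero_of_prod_eq_zero {K : IntermediateField ℚ ℂ} {ι : Type*} {O : Finset ι}
    {f : ι → ℍ → ℂ} (hO : ∀ G ∈ O, HasLaurentOver K (f G)) (h : ∏ G ∈ O, f G = 0) :
    ∃ G ∈ O, f G = 0 := by
  classical
  induction O using Finset.induction_on with
  | empty =>
    have := congrFun h UpperHalfPlane.I
    simp at this
  | insert a O ha ih =>
    rw [Finset.prod_insert ha] at h
    rcases (hO a (by simp)).eq_zero_or_eq_zero ((laurentRing K).prod_mem fun G hG =>
      hO G (by simp [hG])) h with h | h
    · exact ⟨a, by simp, h⟩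
    · obtain ⟨G, hG, h⟩ := ih (fun G hG => hO G (by simp [hG])) h
      exact ⟨G, by simp [hG], h⟩

/-- An element of `Π_ℚ` maps a rational combination of the functions `divX` to its transform by
some invertible matrix, because the elementary symmetric functions of these transforms are forms
of level one with rational coefficients. -/
theorem PiQ_divComb {σ : AutM} (hσ : σ ∈ PiQ) (c : DivIndex N → ℚ) :
    ∃ g : (Matrix (Fin 2) (Fin 2) (ZMod N))ˣ,
      (σ ⟨divComb c 1, divComb_mem c 1⟩ : ℍ → ℂ) = divComb c g := by
  classical
  set O : Finset (ℍ → ℂ) := Finset.univ.image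
    fun g : (Matrix (Fin 2) (Fin 2) (ZMod N))ˣ => divComb c g with hO
  have hmem : ∀ G ∈ O, ∃ g : (Matrix (Fin 2) (Fin 2) (ZMod N))ˣ, divComb c g = G := by
    intro G hG
    simpa [hO] using hG
  have hmem' : ∀ A : Matrix (Fin 2) (Fin 2) (ZMod N), IsUnit A → divComb c A ∈ O := by
    rintro _ ⟨g, rfl⟩
    exact Finset.mem_image_of_mem _ (Finset.mem_univ _)
  have hrat : ∀ i, IsRatForm (3 * i) (orbitSymm O i) := by
    intro i
    refine ⟨isForm_orbitSymm ?_ ?_ i, hasLaurentOver_orbitSymm ?_ ?_ i⟩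
    · intro G hG δ
      obtain ⟨g, rfl⟩ := hmem G hG
      have := divComb_slash c g.1 δ
      rw [Nat.cast_ofNat, this]
      refine hmem' _ (g.isUnit.mul ?_)
      rw [isUnit_redMat_iff, δ.2]
      simp
    · intro G hG
      obtain ⟨g, rfl⟩ := hmem G hG
      exact divComb_holAtInfty _ _
    · intro G hG
      obtain ⟨g, rfl⟩ := hmem G hG
      exact divComb_hasLaurentOver _ _
    · intro t G hG
      obtain ⟨g, rfl⟩ := hmem G hG
      obtain ⟨j, hj, ht⟩ := exists_coprime_of_algEquiv (NeZero.pos N) t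
      refine ⟨_, hmem' _ (g.isUnit.mul ?_), divComb_conj c g.1 ht⟩
      rw [isUnit_redMat_iff, det_diagOne]
      simpa using (ZMod.isUnit_iff_coprime j N).2 hj
  -- the value of the polynomial with roots `O` at an element of the ring of modular forms
  have hpoly : ∀ z : ℍ → ℂ, ∏ G ∈ O, (-G + z) =
      ∑ i ∈ Finset.range (O.card + 1), (-1) ^ i * orbitSymm O i * z ^ (O.card - i) :=
    fun z => prod_neg_add_eq_orbitSymm O z
  set E : ℕ → modularFormRing Qbar := fun i =>
    ⟨orbitSymm O i, mem_modularFormRing_of_form ((hrat i).mem_allModularForms Qbar)⟩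
  set Y : modularFormRing Qbar := ⟨divComb c 1, divComb_mem c 1⟩
  have h1 : ∑ i ∈ Finset.range (O.card + 1), (-1) ^ i * E i * Y ^ (O.card - i) = 0 := by
    apply Subtype.ext
    push_cast
    have h2 := hpoly (divComb c 1)
    rw [Finset.prod_eq_zero (hmem' 1 isUnit_one) (by simp)] at h2
    exact h2.symm
  have h2 := congrArg σ h1
  have hE : ∀ i, σ (E i) = E i := fun i => PiQ_rat hσ (hrat i) _ rfl
  simp only [map_sum, map_mul, map_pow, map_neg, map_one, hE, map_zero] at h2
  have h3 := congrArg Subtype.val h2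
  push_cast at h3
  have h4 := (hpoly (σ Y)).trans h3
  -- one of the factors vanishes
  obtain ⟨G, hG, h5⟩ := exists_eq_zero_of_prod_eq_zero (K := Qbar) (fun G hG => by
    obtain ⟨g, rfl⟩ := hmem G hG
    exact modularFormRing_hasLaurent (Subring.add_mem _ (Subring.neg_mem _ (divComb_mem c g))
      (σ Y).2)) h4
  obtain ⟨g, rfl⟩ := hmem G hG
  exact ⟨g, (neg_add_eq_zero.1 h5).symm⟩

/-- An element of `Π_ℚ` acts on the functions `divX` as an invertible matrix: a vector space over
`ℚ` is not a finite union of proper subspaces. -/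
theorem PiQ_divX {σ : AutM} (hσ : σ ∈ PiQ) :
    ∃ g : (Matrix (Fin 2) (Fin 2) (ZMod N))ˣ, ∀ i,
      (σ ⟨divX N i, divX_mem (NeZero.pos N) i⟩ : ℍ → ℂ) = divX N (i.act g) := by
  classical
  let V : (Matrix (Fin 2) (Fin 2) (ZMod N))ˣ → Subspace ℚ (DivIndex N → ℚ) := fun g =>
    { carrier := {c | (σ ⟨divComb c 1, divComb_mem c 1⟩ : ℍ → ℂ) = divComb c g}
      add_mem' := fun {c d} hc hd => by
        have h : ∀ A : Matrix (Fin 2) (Fin 2) (ZMod N),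
            divComb (c + d) A = divComb c A + divComb d A := fun A => by
          simp only [divComb, ← Finset.sum_add_distrib]
          refine Finset.sum_congr rfl fun i _ => ?_
          funext τ
          simp [add_mul]
        have h1 : (⟨divComb (c + d) 1, divComb_mem _ 1⟩ : modularFormRing Qbar) =
            ⟨divComb c 1, divComb_mem c 1⟩ + ⟨divComb d 1, divComb_mem d 1⟩ :=
          Subtype.ext (h 1)
        rw [Set.mem_ofPred_eq] at hc hd ⊢
        rw [h1, map_add, h, ← hc, ← hd]
        rfl
      zero_mem' := by
        have h : ∀ A : Matrix (Fin 2) (Fin 2) (ZMod N), divComb 0 A = 0 := fun A => by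
          refine Finset.sum_eq_zero fun i _ => ?_
          funext τ
          simp
        have h1 : (⟨divComb 0 1, divComb_mem _ 1⟩ : modularFormRing Qbar) = 0 :=
          Subtype.ext (h 1)
        rw [Set.mem_ofPred_eq, h1, map_zero, h]
        rfl
      smul_mem' := fun r {c} hc => by
        have h : ∀ A : Matrix (Fin 2) (Fin 2) (ZMod N),
            divComb (r • c) A = (fun _ => (r : ℂ)) * divComb c A := fun A => by
          simp only [divComb, Finset.mul_sum]
          refine Finset.sum_congr rfl fun i _ => ?_
          funext τ
          simp [mul_assoc]
        have h1 : (⟨divComb (r • c) 1, divComb_mem _ 1⟩ : modularFormRing Qbar) =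
            constForm Qbar (r : Qbar) * ⟨divComb c 1, divComb_mem c 1⟩ :=
          Subtype.ext ((h 1).trans (by
            funext τ
            simp [constForm]))
        have h2 : σ (constForm Qbar (r : Qbar)) = constForm Qbar (r : Qbar) := by
          obtain ⟨s, hs⟩ := exists_embedding σ
          rw [hs, map_ratCast]
        rw [Set.mem_ofPred_eq] at hc ⊢
        rw [h1, map_mul, h2, h, ← hc]
        funext τ
        simp [constForm] }
  obtain ⟨g, hg⟩ := Subspace.exists_eq_top_of_iUnion_eq_univ (p := V) (by
    rw [Set.eq_univ_iff_forall]
    intro c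
    obtain ⟨g, hg⟩ := PiQ_divComb hσ c
    exact Set.mem_iUnion.2 ⟨g, hg⟩)
  refine ⟨g, fun i => ?_⟩
  have h1 : (Pi.single i 1 : DivIndex N → ℚ) ∈ V g := hg ▸ trivial
  have h2 : ∀ A : Matrix (Fin 2) (Fin 2) (ZMod N),
      divComb (Pi.single i 1) A = divX N (i.act A) := fun A => by
    rw [divComb, Finset.sum_eq_single i]
    · funext τ
      simp
    · intro j _ hj
      funext τ
      simp [hj]
    · simp
  have h3 : (⟨divX N i, divX_mem (NeZero.pos N) i⟩ : modularFormRing Qbar) =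
      ⟨divComb (Pi.single i 1) 1, divComb_mem _ 1⟩ := Subtype.ext ((h2 1).trans (by
    simp [DivIndex.act])).symm
  rw [h3, ← h2]
  exact h1

end divComb

end divX

end

section

open Filter Topology

/-! ### The matrix of an automorphism over the forms of level one -/

/-- `σ` acts as the integral matrix `A` on the division values `x_v`, `N v ∈ ℤ²`, and as `det A` on
the `N`-th roots of unity. -/
structure DivAct (σ : AutM) (N : ℕ) (A : Matrix (Fin 2) (Fin 2) ℤ) : Prop where
  xv_eq : ∀ (a : Fin 2 → ℤ) (F : modularFormRing Qbar), (F : ℍ → ℂ) = xv (tors N a) →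
    (σ F : ℍ → ℂ) = xv (tors N (Matrix.vecMul a A))
  root_eq : ∀ F : modularFormRing Qbar, (F : ℍ → ℂ) = (fun _ => ee ((1 / N : ℚ) : ℂ)) →
    (σ F : ℍ → ℂ) = fun _ => ee ((A.det / N : ℚ) : ℂ)

theorem xv_tors_ne_zero {N : ℕ} (hN : 3 ≤ N) : xv (tors N ![1, 0]) ≠ 0 := by
  intro h
  have hN0 : 0 < N := by omega
  have hNQ : (0 : ℚ) < N := by exact_mod_cast hN0
  obtain ⟨m, ε, hε, hc, hα, hl⟩ := exists_hasLead_tors hN0 (a := 1) (b := 0) (by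
    rintro ⟨h1, -⟩
    have := Int.le_of_dvd (by norm_num) h1
    omega)
  rw [h] at hl
  have hε0 : (ε : ℂ) ≠ 0 := by rcases hε with rfl | rfl <;> norm_num
  have h2 : HasLead (0 : ℍ → ℂ) (ε * ((1 : ℤ) / N - m) + 1) 0 :=
    ⟨fun _ => 0, fun τ => by simp, tendsto_const_nhds⟩
  have := hl.le h2 (mul_ne_zero hε0 hc)
  linarith

theorem exists_divAct_of_three_le {σ : AutM} (hσ : σ ∈ PiQ) {N : ℕ} (hN : 3 ≤ N) :
    ∃ A, DivAct σ N A := by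
  have hN0 : 0 < N := by omega
  have : NeZero N := ⟨by omega⟩
  obtain ⟨g, hg⟩ := PiQ_divX (N := N) hσ
  obtain ⟨A, hA⟩ := exists_redMat g.1
  have hgA : ∀ (k : ℤ) (a : Fin 2 → ℤ) (F : modularFormRing Qbar),
      (F : ℍ → ℂ) = (fun τ => ee ((k / N : ℚ) : ℂ) * xv (tors N a) τ) →
      (σ F : ℍ → ℂ) = fun τ => ee (((k * A.det : ℤ) / N : ℚ) : ℂ) *
        xv (tors N (Matrix.vecMul a A)) τ := by
    intro k a F hF
    rw [← divX_mk hN0] at hF ⊢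
    rw [← DivIndex.mk_act, hA, ← hg]
    congr 2
    exact Subtype.ext hF
  have h1 : ∀ (a : Fin 2 → ℤ) (F : modularFormRing Qbar), (F : ℍ → ℂ) = xv (tors N a) →
      (σ F : ℍ → ℂ) = xv (tors N (Matrix.vecMul a A)) := by
    intro a F hF
    have := hgA 0 a F (by rw [hF]; funext τ; simp [ee_zero])
    rw [this]
    funext τ
    simp [ee_zero]
  refine ⟨A, h1, fun F hF => ?_⟩
  set X := divForm hN0 ![1, 0]
  have h2 := hgA 1 ![1, 0] (F * X) (by
    funext τ
    simp only [Subring.coe_mul, Pi.mul_apply, hF, Int.cast_one]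
    rfl)
  have h3 := h1 ![1, 0] X rfl
  have h4 : σ X ≠ 0 := by
    rw [Ne, map_eq_zero_iff _ σ.injective]
    exact fun h => xv_tors_ne_zero hN (congrArg Subtype.val h)
  rw [map_mul] at h2
  set C : modularFormRing Qbar := constForm Qbar ⟨ee ((A.det / N : ℚ) : ℂ),
    Qcycl_le_Qbar (ee_rat_mem_Qcycl _)⟩ with hC
  have h5 : σ F * σ X = C * σ X := by
    apply Subtype.ext
    rw [h2, Subring.coe_mul, h3, one_mul]
    rfl
  exact congrArg Subtype.val (mul_right_cancel₀ h4 h5)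

theorem DivAct.of_dvd {σ : AutM} {M N : ℕ} {A : Matrix (Fin 2) (Fin 2) ℤ} (h : DivAct σ M A)
    (hM : 0 < M) (hd : N ∣ M) : DivAct σ N A := by
  obtain ⟨d, rfl⟩ := hd
  have hd0 : (d : ℚ) ≠ 0 := by
    have := Nat.pos_of_mul_pos_left hM
    exact_mod_cast this.ne'
  have hN0 : (N : ℚ) ≠ 0 := by
    have := Nat.pos_of_mul_pos_right hM
    exact_mod_cast this.ne'
  have ht : ∀ a : Fin 2 → ℤ, tors N a = tors (N * d) ((d : ℤ) • a) := fun a => by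
    funext i
    simp only [tors, Pi.smul_apply, smul_eq_mul]
    push_cast
    field_simp
  have hq : ∀ z : ℤ, ee ((z / N : ℚ) : ℂ) = ee ((z / (N * d : ℕ) : ℚ) : ℂ) ^ d := fun z => by
    rw [← ee_nat_mul]
    congr 1
    have : (z / N : ℚ) = (d : ℚ) * (z / (N * d : ℕ) : ℚ) := by
      push_cast
      field_simp
    rw [this]
    push_cast
    ring
  refine ⟨fun a F hF => ?_, fun F hF => ?_⟩
  · rw [ht] at hF ⊢
    rw [h.xv_eq _ F hF, Matrix.smul_vecMul]
  · set C : modularFormRing Qbar := constForm Qbar ⟨ee ((1 / (N * d : ℕ) : ℚ) : ℂ),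
      Qcycl_le_Qbar (ee_rat_mem_Qcycl _)⟩ with hC
    have h1 := h.root_eq C rfl
    have h2 : F = C ^ d := by
      apply Subtype.ext
      rw [hF]
      have := hq 1
      rw [Int.cast_one] at this
      rw [this]
      rfl
    rw [h2, map_pow, Subring.coe_pow, h1, hq]
    rfl

theorem exists_divAct {σ : AutM} (hσ : σ ∈ PiQ) {N : ℕ} (hN : 0 < N) : ∃ A, DivAct σ N A := by
  obtain ⟨A, hA⟩ := exists_divAct_of_three_le hσ (N := N * 3) (by omega)
  exact ⟨A, hA.of_dvd (by omega) (Dvd.intro _ rfl)⟩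

theorem det_sub_det_dvd {N : ℤ} {A B : Matrix (Fin 2) (Fin 2) ℤ} (h : ∀ i j, N ∣ A i j - B i j) :
    N ∣ A.det - B.det := by
  rw [Matrix.det_fin_two, Matrix.det_fin_two]
  have e : A 0 0 * A 1 1 - A 0 1 * A 1 0 - (B 0 0 * B 1 1 - B 0 1 * B 1 0) =
      (A 0 0 - B 0 0) * A 1 1 + B 0 0 * (A 1 1 - B 1 1) -
        ((A 0 1 - B 0 1) * A 1 0 + B 0 1 * (A 1 0 - B 1 0)) := by ring
  rw [e]
  exact dvd_sub (dvd_add ((h 0 0).mul_right _) ((h 1 1).mul_left _))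
    (dvd_add ((h 0 1).mul_right _) ((h 1 0).mul_left _))

theorem DivAct.congr {σ : AutM} {N : ℕ} (hN : 0 < N) {A B : Matrix (Fin 2) (Fin 2) ℤ}
    (h : DivAct σ N A) (hAB : ∀ i j, (N : ℤ) ∣ A i j - B i j) : DivAct σ N B := by
  refine ⟨fun a F hF => ?_, fun F hF => ?_⟩
  · rw [h.xv_eq a F hF]
    refine xv_tors_congr hN fun j => ?_
    simp only [Matrix.vecMul, dotProduct, ← Finset.sum_sub_distrib, ← mul_sub]
    exact Finset.dvd_sum fun i _ => (hAB i j).mul_left _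
  · rw [h.root_eq F hF]
    obtain ⟨c, hc⟩ := det_sub_det_dvd hAB
    have h0 : (N : ℂ) ≠ 0 := by exact_mod_cast hN.ne'
    have : ((A.det / N : ℚ) : ℂ) = ((B.det / N : ℚ) : ℂ) + (c : ℤ) := by
      rw [eq_add_of_sub_eq' hc]
      push_cast
      field_simp
    rw [this, ee_add_int]

/-- Congruence of an integral matrix to an adelic matrix. -/
def MatCong (N : ℕ) (A : Matrix (Fin 2) (Fin 2) ℤ) (h : Matrix (Fin 2) (Fin 2) Af) : Prop :=
  ∀ i j, AdeleCong N (A i j : Af) (h i j)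

theorem exists_matCong {N : ℕ} (hN : 0 < N) {h : Matrix (Fin 2) (Fin 2) Af}
    (hh : ∀ i j, IsIntegralAdele (h i j)) : ∃ A, MatCong N A h := by
  choose A hA using fun i j => exists_int_approx hN (hh i j)
  exact ⟨Matrix.of A, fun i j => (hA i j).symm⟩

theorem MatCong.dvd_sub {N : ℕ} (hN : 0 < N) {A B : Matrix (Fin 2) (Fin 2) ℤ}
    {h : Matrix (Fin 2) (Fin 2) Af} (hA : MatCong N A h) (hB : MatCong N B h) (i j : Fin 2) :
    (N : ℤ) ∣ A i j - B i j :=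
  (adeleCong_int_iff hN).1 ((hA i j).trans (hB i j).symm)

theorem isOpen_adeleCong {N : ℕ} (hN : 0 < N) (y : Af) : IsOpen {x : Af | AdeleCong N x y} := by
  have hN0 : (N : ℚ) ≠ 0 := by exact_mod_cast hN.ne'
  have h1 : Continuous fun x : Af => algebraMap ℚ Af (N : ℚ)⁻¹ * (x - y) := by fun_prop
  convert isOpen_integralAdele.preimage h1 using 1
  ext x
  simp only [Set.mem_preimage, Set.mem_ofPred_eq]
  constructor
  · rintro ⟨t, ht, rfl⟩
    rwa [add_sub_cancel_left, ← mul_assoc, ← map_mul, inv_mul_cancel₀ hN0, map_one, one_mul]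
  · intro h
    refine ⟨_, h, ?_⟩
    rw [← mul_assoc, ← map_mul, mul_inv_cancel₀ hN0, map_one]
    ring

/-- An element of `Π_ℚ` acts on all division values as a matrix over `ℤ^`, by compactness. -/
theorem exists_adelic_matrix {σ : AutM} (hσ : σ ∈ PiQ) : ∃ h : Matrix (Fin 2) (Fin 2) Af,
    (∀ i j, IsIntegralAdele (h i j)) ∧
    ∀ (N : ℕ) (A : Matrix (Fin 2) (Fin 2) ℤ), 0 < N → MatCong N A h → DivAct σ N A := by
  choose A hA using fun n : ℕ => exists_divAct hσ (Nat.factorial_pos n)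
  have hcpt : IsCompact (Set.pi Set.univ fun _ : Fin 2 => Set.pi Set.univ fun _ : Fin 2 =>
      {x : Af | IsIntegralAdele x}) :=
    isCompact_univ_pi fun _ => isCompact_univ_pi fun _ => isCompact_integralAdele
  obtain ⟨h, hh, hclust⟩ := hcpt.exists_mapClusterPt (f := atTop)
    (u := fun n : ℕ => fun i j => ((A n i j : ℤ) : Af)) (by
      refine Filter.tendsto_principal.2 (Eventually.of_forall fun n => ?_)
      intro i _ j _
      exact isIntegralAdele_intCast _)
  have hint : ∀ i j, IsIntegralAdele (h i j) := fun i j => hh i trivial j trivial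
  refine ⟨Matrix.of h, hint, fun N B hN hB => ?_⟩
  have hopen : IsOpen {m : Fin 2 → Fin 2 → Af | ∀ i j, AdeleCong N (m i j) (h i j)} := by
    have : {m : Fin 2 → Fin 2 → Af | ∀ i j, AdeleCong N (m i j) (h i j)} =
        ⋂ i, ⋂ j, (fun m => m i j) ⁻¹' {x : Af | AdeleCong N x (h i j)} := by
      ext m
      simp
    rw [this]
    exact isOpen_iInter_of_finite fun i => isOpen_iInter_of_finite fun j =>
      (isOpen_adeleCong hN _).preimage (by fun_prop)
  have hfreq := hclust.frequently (hopen.mem_nhds (show h ∈ _ from fun i j => AdeleCong.refl _ _))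
  obtain ⟨n, hn, hcong⟩ := Filter.frequently_atTop.1 hfreq N
  refine ((hA n).of_dvd (Nat.factorial_pos n) (Nat.dvd_factorial hN hn)).congr hN fun i j => ?_
  exact MatCong.dvd_sub hN (h := Matrix.of h) (fun i j => hcong i j) hB i j

theorem matCong_mul {N : ℕ} {A B : Matrix (Fin 2) (Fin 2) ℤ} {h k : Matrix (Fin 2) (Fin 2) Af}
    (hA : MatCong N A h) (hB : MatCong N B k) (hk : ∀ i j, IsIntegralAdele (k i j)) :
    MatCong N (A * B) (h * k) := by
  intro i j
  simp only [Matrix.mul_apply, Fin.sum_univ_two]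
  push_cast
  exact ((hA i 0).mul (hB 0 j) (isIntegralAdele_intCast _) (hk 0 j)).add
    ((hA i 1).mul (hB 1 j) (isIntegralAdele_intCast _) (hk 1 j))

/-- An element of `Π_ℚ` acts on all division values as an element of `GL₂(ℤ^)`. -/
theorem exists_adelic_GL {σ : AutM} (hσ : σ ∈ PiQ) : ∃ h : GL (Fin 2) Af, IsIntegralGL h ∧
    ∀ (N : ℕ) (A : Matrix (Fin 2) (Fin 2) ℤ), 0 < N → MatCong N A h.1 → DivAct σ N A := by
  -- if `h`, `k` belong to an automorphism and its inverse, then `h k ≡ 1` modulo all `N`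
  have key : ∀ (σ : AutM) (h k : Matrix (Fin 2) (Fin 2) Af),
      (∀ i j, IsIntegralAdele (h i j)) → (∀ i j, IsIntegralAdele (k i j)) →
      (∀ (N : ℕ) (A : Matrix (Fin 2) (Fin 2) ℤ), 0 < N → MatCong N A h → DivAct σ N A) →
      (∀ (N : ℕ) (A : Matrix (Fin 2) (Fin 2) ℤ), 0 < N → MatCong N A k → DivAct σ⁻¹ N A) →
      h * k = 1 := by
    intro σ h k hh hk Hh Hk
    have hcong : ∀ N : ℕ, 3 ≤ N → MatCong N 1 (h * k) := by
      intro N hN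
      have hN0 : 0 < N := by omega
      obtain ⟨A, hA⟩ := exists_matCong hN0 hh
      obtain ⟨B, hB⟩ := exists_matCong hN0 hk
      have h1 := Hh N A hN0 hA
      have h2 := Hk N B hN0 hB
      have h3 := faithful_xv hN (A * B) (fun a => by
        rw [← Matrix.vecMul_vecMul]
        have e1 := h1.xv_eq a (divForm hN0 a) rfl
        have e2 := h2.xv_eq _ _ e1
        rw [← e2]
        exact congrArg Subtype.val (σ.symm_apply_apply _))
      have h4 := matCong_mul hA hB hk
      intro i j
      exact ((adeleCong_int_iff hN0).2 (h3 i j)).symm.trans (h4 i j)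
    refine Matrix.ext fun i j => ?_
    refine eq_of_adeleCong fun N hN => ?_
    have := (hcong (N * 3) (by omega) i j).of_dvd (Dvd.intro 3 rfl)
    refine this.symm.trans ?_
    fin_cases i <;> fin_cases j <;> simpa using AdeleCong.refl _ _
  obtain ⟨h, hh, Hh⟩ := exists_adelic_matrix hσ
  obtain ⟨k, hk, Hk⟩ := exists_adelic_matrix (PiQ.inv_mem hσ)
  refine ⟨⟨h, k, key σ h k hh hk Hh Hk, key σ⁻¹ k h hk hh Hk (by rwa [inv_inv])⟩, ⟨hh, hk⟩, Hh⟩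

/-! ### Lifting matrices of determinant one -/

theorem exists_isCoprime_add_mul {c d M : ℤ} (hM : M ≠ 0) (hc : c ≠ 0)
    (h : ∀ p : ℤ, p ∣ c → p ∣ d → p ∣ M → IsUnit p) : ∃ t : ℤ, IsCoprime c (d + t * M) := by
  set g : ℤ := ((Int.gcd d M : ℕ) : ℤ) with hg
  have hg0 : g ≠ 0 := by
    rw [hg]
    exact_mod_cast (Int.gcd_pos_of_ne_zero_right d hM).ne'
  obtain ⟨d', hd'⟩ : g ∣ d := Int.gcd_dvd_left _ _
  obtain ⟨M', hM'⟩ : g ∣ M := Int.gcd_dvd_right _ _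
  have hM0 : M' ≠ 0 := by
    rintro rfl
    rw [mul_zero] at hM'
    exact hM hM'
  have hcop : IsCoprime d' M' := by
    have := Int.gcd_eq_gcd_ab d M
    rw [← hg] at this
    refine ⟨d.gcdA M, d.gcdB M, ?_⟩
    refine mul_left_cancel₀ hg0 ?_
    rw [mul_one]
    conv_rhs => rw [this]
    linear_combination (-(d.gcdA M)) * hd' - (d.gcdB M) * hM'
  have hcg : IsCoprime c g := by
    rw [← isRelPrime_iff_isCoprime]
    intro p h1 h2
    exact h p h1 (h2.trans ⟨d', hd'⟩) (h2.trans ⟨M', hM'⟩)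
  -- lift the unit `d'` modulo `M'` to a unit modulo `c * M'`
  have hdvd : M'.natAbs ∣ (c * M').natAbs := by
    rw [Int.natAbs_mul]
    exact Dvd.intro_left _ rfl
  have : NeZero (c * M').natAbs := ⟨Int.natAbs_ne_zero.2 (mul_ne_zero hc hM0)⟩
  have hunit : IsUnit (d' : ZMod M'.natAbs) := by
    exact (ZMod.coe_int_isUnit_iff_isCoprime _ _).2 (by
      rw [Int.natCast_natAbs]
      exact (IsCoprime.abs_left hcop.symm))
  obtain ⟨u, hu⟩ := ZMod.unitsMap_surjective hdvd hunit.unit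
  have hu1 : ((u : ZMod (c * M').natAbs).cast : ZMod M'.natAbs) = d' := by
    have := congrArg Units.val hu
    rw [ZMod.unitsMap_val] at this
    exact this
  obtain ⟨z, hz⟩ := ZMod.intCast_surjective (u : ZMod (c * M').natAbs)
  have hzu : IsCoprime z (c * M') := by
    have h1 : IsUnit (z : ZMod (c * M').natAbs) := hz ▸ u.isUnit
    have h2 := (ZMod.coe_int_isUnit_iff_isCoprime _ _).1 h1
    rw [Int.natCast_natAbs] at h2
    exact ((IsCoprime.abs_left_iff _ _).1 h2).symm
  have hzd : M' ∣ z - d' := by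
    rw [← hz, ZMod.cast_intCast hdvd] at hu1
    have h1 := (ZMod.intCast_eq_intCast_iff_dvd_sub _ _ _).1 hu1.symm
    rwa [Int.natCast_natAbs, abs_dvd] at h1
  obtain ⟨t, ht⟩ := hzd
  refine ⟨t, ?_⟩
  have e : d + t * M = g * z := by
    rw [eq_add_of_sub_eq' ht]
    linear_combination hd' + t * hM'
  rw [e]
  exact hcg.mul_right hzu.of_mul_right_left.symm

/-- `SL₂(ℤ) → SL₂(ℤ / M)` is surjective. -/
theorem exists_SL_lift {M : ℕ} (hM : 0 < M) (A : Matrix (Fin 2) (Fin 2) ℤ)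
    (hA : (M : ℤ) ∣ A.det - 1) : ∃ γ : SL(2, ℤ), ∀ i j, (M : ℤ) ∣ γ i j - A i j := by
  have hM0 : (M : ℤ) ≠ 0 := by exact_mod_cast hM.ne'
  set a := A 0 0
  set b := A 0 1
  set d := A 1 1
  have hdet : A.det = a * d - b * A 1 0 := Matrix.det_fin_two A
  -- make the lower left entry nonzero
  obtain ⟨c, hc0, hc⟩ : ∃ c : ℤ, c ≠ 0 ∧ (M : ℤ) ∣ c - A 1 0 := by
    by_cases h : A 1 0 = 0
    · exact ⟨M, hM0, by simp [h]⟩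
    · exact ⟨_, h, by simp⟩
  have hdet' : (M : ℤ) ∣ a * d - b * c - 1 := by
    have e : a * d - b * c - 1 = (A.det - 1) - b * (c - A 1 0) := by
      rw [hdet]
      ring
    rw [e]
    exact dvd_sub hA (hc.mul_left _)
  obtain ⟨t, ht⟩ := exists_isCoprime_add_mul (c := c) (d := d) hM0 hc0 (fun p h1 h2 h3 => by
    have h4 : p ∣ (1 : ℤ) := by
      have e : (1 : ℤ) = a * d - b * c - (a * d - b * c - 1) := by ring
      rw [e]
      exact dvd_sub (dvd_sub (h2.mul_left _) (h1.mul_left _)) (h3.trans hdet')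
    exact isUnit_of_dvd_one h4)
  obtain ⟨x, y, hxy⟩ := ht
  set d' := d + t * M with hd'
  -- the first row is corrected by a multiple of the second one
  set s := y * b + x * a with hs
  refine ⟨⟨!![y + s * c, -x + s * d'; c, d'], ?_⟩, ?_⟩
  · rw [Matrix.det_fin_two_of]
    linear_combination hxy
  · have h1 : (M : ℤ) ∣ a * d' - b * c - 1 := by
      have e : a * d' - b * c - 1 = (a * d - b * c - 1) + a * t * M := by
        rw [hd']
        ring
      rw [e]
      exact dvd_add hdet' (Dvd.intro_left _ rfl)
    intro i j
    fin_cases i <;> fin_cases j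
    · have e : y + s * c - a = -(y * (a * d' - b * c - 1)) := by
        linear_combination a * hxy
      have := (h1.mul_left y).neg_right
      rw [← e] at this
      exact this
    · have e : -x + s * d' - b = x * (a * d' - b * c - 1) := by
        linear_combination b * hxy
      have := h1.mul_left x
      rw [← e] at this
      exact this
    · exact hc
    · change (M : ℤ) ∣ d' - d
      rw [hd']
      simp

/-! ### A form with a small stabilizer -/

/-- Some rational combination of the `e(k / M) x_{a / M}` is fixed by no element of `SL₂(ℤ)` outside
`Γ(M)`: by faithfulness the combinations fixed by a given class modulo `M` other than the identity
form a proper subspace, and a vector space over `ℚ` is not a finite union of proper subspaces. -/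
theorem exists_divComb_stabilizer {M : ℕ} [NeZero M] (hM : 3 ≤ M) :
    ∃ c : DivIndex M → ℚ, ∀ δ : SL(2, ℤ), divComb c 1 ∣[(3 : ℤ)] δ = divComb c 1 →
      δ ∈ CongruenceSubgroup.Gamma M := by
  classical
  let J : Type := {g : Matrix (Fin 2) (Fin 2) (ZMod M) //
    ∃ δ : SL(2, ℤ), redMat M δ.1 = g ∧ δ ∉ CongruenceSubgroup.Gamma M}
  let ℓ : Matrix (Fin 2) (Fin 2) (ZMod M) → ((DivIndex M → ℚ) →ₗ[ℚ] (ℍ → ℂ)) := fun g =>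
    { toFun := fun c => divComb c g
      map_add' := fun c d => by
        simp only [divComb, ← Finset.sum_add_distrib]
        refine Finset.sum_congr rfl fun i _ => ?_
        funext τ
        simp [add_mul]
      map_smul' := fun r c => by
        simp only [divComb, Finset.smul_sum]
        refine Finset.sum_congr rfl fun i _ => ?_
        funext τ
        simp [mul_assoc, Rat.smul_def] }
  let V : J → Subspace ℚ (DivIndex M → ℚ) := fun g => LinearMap.ker (ℓ g.1 - ℓ 1)
  by_contra! hcon
  obtain ⟨⟨g, δ, hδ, hnot⟩, hg⟩ := Subspace.exists_eq_top_of_iUnion_eq_univ (p := V) (by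
    rw [Set.eq_univ_iff_forall]
    intro c
    obtain ⟨δ, h1, h2⟩ := hcon c
    refine Set.mem_iUnion.2 ⟨⟨redMat M δ.1, δ, rfl, h2⟩, ?_⟩
    rw [divComb_slash, one_mul] at h1
    exact LinearMap.mem_ker.2 (sub_eq_zero.2 h1))
  refine hnot ?_
  have hfix : ∀ a : Fin 2 → ℤ, xv (tors M (Matrix.vecMul a δ.1)) = xv (tors M a) := by
    intro a
    have h1 : (Pi.single (DivIndex.mk M 0 a) 1 : DivIndex M → ℚ) ∈ V ⟨g, δ, hδ, hnot⟩ :=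
      hg ▸ trivial
    have h2 : ∀ A : Matrix (Fin 2) (Fin 2) ℤ,
        divComb (Pi.single (DivIndex.mk M 0 a) 1) (redMat M A) =
        xv (tors M (Matrix.vecMul a A)) := fun A => by
      rw [divComb, Finset.sum_eq_single (DivIndex.mk M 0 a)]
      · rw [DivIndex.mk_act, divX_mk (NeZero.pos M)]
        funext τ
        simp [ee_zero]
      · intro j _ hj
        funext τ
        simp [hj]
      · simp
    have h3 : divComb (Pi.single (DivIndex.mk M 0 a) 1) g =
        divComb (Pi.single (DivIndex.mk M 0 a) 1) 1 := sub_eq_zero.1 (LinearMap.mem_ker.1 h1)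
    have h4 : redMat M 1 = 1 := by simp [redMat]
    rw [← hδ, ← h4, h2, h2, Matrix.vecMul_one] at h3
    exact h3
  have h := faithful_xv hM δ.1 hfix
  rw [CongruenceSubgroup.Gamma_mem]
  have h' : ∀ i j, ((δ i j : ℤ) : ZMod M) = (((1 : Matrix (Fin 2) (Fin 2) ℤ) i j : ℤ) : ZMod M) :=
    fun i j => ((ZMod.intCast_eq_intCast_iff_dvd_sub _ _ _).2 (h i j)).symm
  refine ⟨?_, ?_, ?_, ?_⟩ <;> rw [h'] <;> simp

/-! ### Forms as combinations of powers of a form with small stabilizer -/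

theorem orbitSymm_slash {k : ℕ} (O : Finset (ℍ → ℂ)) (j : ℕ) (δ : SL(2, ℤ)) :
    orbitSymm O j ∣[((k * j : ℕ) : ℤ)] δ =
      orbitSymm (O.map ⟨fun G => G ∣[(k : ℤ)] δ, slash_injective _ δ⟩) j := by
  classical
  rw [orbitSymm, sum_slash, orbitSymm, Finset.powersetCard_map, Finset.sum_map]
  refine Finset.sum_congr rfl fun S hS => ?_
  rw [← (Finset.mem_powersetCard.1 hS).2, prod_slash]
  simp [Finset.mapEmbedding]

open Classical in
/-- If the stabilizer of `y` is contained in that of `F`, then the product of `F` with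
`∏ (y - y')`, over the conjugates `y' ≠ y` of `y`, is a polynomial in `y` whose coefficients are
forms of level one. -/
theorem exists_levelOne_coeffs {k l : ℕ} {F y : ℍ → ℂ} {O : Finset (ℍ → ℂ)}
    (hO : ∀ G, G ∈ O ↔ ∃ δ : SL(2, ℤ), y ∣[(l : ℤ)] δ = G)
    (hstab : ∀ δ : SL(2, ℤ), y ∣[(l : ℤ)] δ = y → F ∣[(k : ℤ)] δ = F)
    (hy : ∀ G ∈ O, HolAtInfty G) (hF : ∀ δ : SL(2, ℤ), HolAtInfty (F ∣[(k : ℤ)] δ)) :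
    ∃ C : ℕ → ℍ → ℂ, (∀ j, IsForm (k + l * j) ⊤ (C j)) ∧
      F * ∏ G ∈ O.erase y, (-G + y) =
        ∑ j ∈ Finset.range O.card, (-1) ^ j * C j * y ^ (O.card - 1 - j) := by
  choose! φ hφ using fun G hG => (hO G).1 hG
  set Φ : (ℍ → ℂ) → ℍ → ℂ := fun G => F ∣[(k : ℤ)] φ G with hΦ
  have hmem : ∀ G ∈ O, ∀ δ : SL(2, ℤ), (G ∣[(l : ℤ)] δ) ∈ O := fun G hG δ =>
    (hO _).2 ⟨φ G * δ, by rw [SlashAction.slash_mul, hφ G hG]⟩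
  have hΦs : ∀ G ∈ O, ∀ δ : SL(2, ℤ), Φ G ∣[(k : ℤ)] δ = Φ (G ∣[(l : ℤ)] δ) := by
    intro G hG δ
    have h1 : y ∣[(l : ℤ)] (φ G * δ * (φ (G ∣[(l : ℤ)] δ))⁻¹) = y := by
      rw [SlashAction.slash_mul, SlashAction.slash_mul, hφ G hG]
      conv_lhs => rw [← hφ _ (hmem G hG δ)]
      rw [← SlashAction.slash_mul, hφ _ (hmem G hG δ), mul_inv_cancel, SlashAction.slash_one]
    have h2 := hstab _ h1
    have h3 := congrArg (fun f : ℍ → ℂ => f ∣[(k : ℤ)] φ (G ∣[(l : ℤ)] δ)) h2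
    simp only [← SlashAction.slash_mul, inv_mul_cancel_right] at h3
    rw [SlashAction.slash_mul] at h3
    exact h3
  have hyO : y ∈ O := (hO y).2 ⟨1, SlashAction.slash_one _ _⟩
  have hΦy : Φ y = F := hstab _ (hφ y hyO)
  refine ⟨fun j => ∑ G ∈ O, Φ G * orbitSymm (O.erase G) j, fun j => ?_, ?_⟩
  · have hinv : ∀ δ : SL(2, ℤ),
        (∑ G ∈ O, Φ G * orbitSymm (O.erase G) j) ∣[((k + l * j : ℕ) : ℤ)] δ =
        ∑ G ∈ O, Φ G * orbitSymm (O.erase G) j := by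
      intro δ
      set e : (ℍ → ℂ) ↪ (ℍ → ℂ) := ⟨fun G => G ∣[(l : ℤ)] δ, slash_injective _ δ⟩ with he
      have hOe : O.map e = O := Finset.eq_of_subset_of_card_le (fun G hG => by
        obtain ⟨G', hG', rfl⟩ := Finset.mem_map.1 hG
        exact hmem _ hG' δ) (by rw [Finset.card_map])
      rw [sum_slash]
      conv_rhs => rw [← hOe, Finset.sum_map]
      refine Finset.sum_congr rfl fun G hG => ?_
      rw [Nat.cast_add, ModularForm.mul_slash_SL2, hΦs G hG, orbitSymm_slash, ← he,
        Finset.map_erase, hOe]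
      rfl
    refine ⟨fun δ _ => hinv δ, fun δ => ?_⟩
    rw [hinv]
    refine holRing.sum_mem fun G hG => holRing.mul_mem (hF _) (holRing.sum_mem fun S hS =>
      holRing.prod_mem fun G' hG' => hy G' ?_)
    exact Finset.mem_of_mem_erase ((Finset.mem_powersetCard.1 hS).1 hG')
  · have h1 : ∀ G ∈ O, ∏ G' ∈ O.erase G, (-G' + y) =
        ∑ j ∈ Finset.range O.card, (-1) ^ j * orbitSymm (O.erase G) j * y ^ (O.card - 1 - j) := by
      intro G hG
      rw [prod_neg_add_eq_orbitSymm, Finset.card_erase_of_mem hG,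
        Nat.sub_add_cancel (Finset.card_pos.2 ⟨G, hG⟩)]
    have h2 : ∑ G ∈ O, Φ G * ∏ G' ∈ O.erase G, (-G' + y) = F * ∏ G ∈ O.erase y, (-G + y) := by
      rw [Finset.sum_eq_single y, hΦy]
      · intro G hG hne
        rw [Finset.prod_eq_zero (Finset.mem_erase.2 ⟨Ne.symm hne, hyO⟩) (by simp), mul_zero]
      · exact fun h => absurd hyO h
    rw [← h2, Finset.sum_congr rfl fun G hG => by rw [h1 G hG, Finset.mul_sum]]
    rw [Finset.sum_comm]
    refine Finset.sum_congr rfl fun j _ => ?_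
    rw [Finset.mul_sum, Finset.sum_mul]
    exact Finset.sum_congr rfl fun G _ => by ring

end

section

open Filter Topology
open PowerSeries (coeff)

/-! ### The action on forms for congruence subgroups -/

theorem HasLaurentOver.conj_self {K : IntermediateField ℚ ℂ} {f : ℍ → ℂ} (hf : HasLaurentOver Q0 f)
    (s : K →+* ℂ) : Conj s f f := by
  obtain ⟨w, m, p, hw, h1, -⟩ := hf.conj
  set ι : Q0 →+* K :=
    ((IntermediateField.inclusion (bot_le : (⊥ : IntermediateField ℚ ℂ) ≤ K)) :
      Q0 →ₐ[ℚ] K).toRingHom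
  refine ⟨w, m, p.map ι, hw, ?_, ?_⟩
  · rw [← RingHom.comp_apply, ← PowerSeries.map_comp]
    exact h1
  · rw [← RingHom.comp_apply, ← PowerSeries.map_comp]
    have : s.comp ι = algebraMap Q0 ℂ := by
      refine RingHom.ext fun x => ?_
      obtain ⟨q, hq⟩ := IntermediateField.mem_bot.1 x.2
      have hx : x = algebraMap ℚ Q0 q := Subtype.ext hq.symm
      rw [hx]
      exact RingHom.congr_fun (Subsingleton.elim ((s.comp ι).comp (algebraMap ℚ Q0))
        ((algebraMap Q0 ℂ).comp (algebraMap ℚ Q0))) q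
    rw [this]
    exact h1

/-- The forms `F` for which `σ F` arises from `F | γ` by conjugation of the coefficients with
`s`. -/
def twistRing (σ : AutM) (s : Qcycl →+* ℂ) (γ : SL(2, ℤ)) : Subring (modularFormRing Qbar) where
  carrier := {F | ∃ f', ((F : ℍ → ℂ), f') ∈
    starPairs (fun τ => γ • τ) (fun τ => UpperHalfPlane.denom γ τ) ∧ Conj s f' (σ F)}
  mul_mem' := by
    rintro F G ⟨f, hf, hf'⟩ ⟨g, hg, hg'⟩
    refine ⟨f * g, Subring.mul_mem _ hf hg, ?_⟩
    rw [map_mul]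
    exact hf'.mul hg'
  add_mem' := by
    rintro F G ⟨f, hf, hf'⟩ ⟨g, hg, hg'⟩
    refine ⟨f + g, Subring.add_mem _ hf hg, ?_⟩
    rw [map_add]
    exact hf'.add hg'
  neg_mem' := by
    rintro F ⟨f, hf, hf'⟩
    refine ⟨-f, Subring.neg_mem _ hf, ?_⟩
    rw [map_neg]
    exact hf'.neg
  zero_mem' := ⟨0, Subring.zero_mem _, by
    rw [map_zero]
    exact (conjRing s).zero_mem⟩
  one_mem' := ⟨1, Subring.one_mem _, by
    rw [map_one]
    exact (conjRing s).one_mem⟩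

section twist

variable {σ : AutM} {s : Qcycl →+* ℂ} {γ : SL(2, ℤ)}

theorem rat_mem_twistRing (hσ : σ ∈ PiQ) {l : ℕ} {F : modularFormRing Qbar}
    (hF : IsRatForm l (F : ℍ → ℂ)) : F ∈ twistRing σ s γ := by
  refine ⟨F, ?_, ?_⟩
  · have := slash_mem_starPairs (hF.mem_allModularForms Qbar) γ
    rwa [hF.1.inv γ trivial] at this
  · rw [PiQ_rat hσ hF F rfl]
    exact hF.2.conj_self s

theorem const_mem_twistRing (hs : ∀ (c : Qcycl) (F : modularFormRing Qbar),
    (F : ℍ → ℂ) = (fun _ => (c : ℂ)) → (σ F : ℍ → ℂ) = fun _ => s c) (c : Qcycl)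
    {F : modularFormRing Qbar} (hF : (F : ℍ → ℂ) = fun _ => (c : ℂ)) : F ∈ twistRing σ s γ := by
  refine ⟨fun _ => c, ?_, ?_⟩
  · rw [hF]
    exact const_mem_starPairs _
  · rw [hs c F hF]
    exact Conj.const c

theorem divComb_mem_allModularForms {M : ℕ} [NeZero M] (c : DivIndex M → ℚ)
    (g : Matrix (Fin 2) (Fin 2) (ZMod M)) : divComb c g ∈ allModularForms 3 Qcycl := by
  refine (formsAddSubgroup 3 Qcycl).sum_mem fun i _ => ?_
  have h1 : divX M (i.act g) ∈ allModularForms (0 + 3) Qcycl :=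
    allModularForms_mul (const_mem_allModularForms (ee_rat_mem_Qcycl _))
      (xv_tors_mem_allModularForms (NeZero.pos M) _)
  have h2 := allModularForms_mul (const_mem_allModularForms (rat_mem_Qcycl (c i))) h1
  rw [zero_add, zero_add] at h2
  exact h2

theorem DivAct.divComb_eq {M : ℕ} [NeZero M] {A : Matrix (Fin 2) (Fin 2) ℤ} (hA : DivAct σ M A)
    (c : DivIndex M → ℚ) (g : Matrix (Fin 2) (Fin 2) (ZMod M)) :
    (σ ⟨divComb c g, divComb_mem c g⟩ : ℍ → ℂ) = divComb c (g * redMat M A) := by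
  have hM := NeZero.pos M
  obtain ⟨t, ht⟩ := exists_embedding σ
  have hX : ∀ i : DivIndex M, (σ ⟨divX M i, divX_mem hM i⟩ : ℍ → ℂ) =
      divX M (i.act (redMat M A)) := by
    intro i
    obtain ⟨n, a, rfl⟩ : ∃ (n : ℕ) (a : Fin 2 → ℤ), i = DivIndex.mk M n a := by
      obtain ⟨k, a, rfl⟩ := i.exists_mk
      refine ⟨(k : ZMod M).val, a, ?_⟩
      simp [DivIndex.mk]
    set C : modularFormRing Qbar := constForm Qbar ⟨ee ((1 / M : ℚ) : ℂ),
      Qcycl_le_Qbar (ee_rat_mem_Qcycl _)⟩ with hC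
    have hpow : ∀ (n : ℕ) (z : ℤ), ee (((n * z : ℤ) / M : ℚ) : ℂ) = ee ((z / M : ℚ) : ℂ) ^ n := by
      intro n z
      rw [← ee_nat_mul]
      congr 1
      push_cast
      ring
    have h1 : (⟨divX M (DivIndex.mk M n a), divX_mem hM _⟩ : modularFormRing Qbar) =
        C ^ n * divForm hM a := by
      refine Subtype.ext ((divX_mk hM _ _).trans ?_)
      funext τ
      have := hpow n 1
      rw [mul_one, Int.cast_one] at this
      rw [this]
      rfl
    rw [h1, map_mul, map_pow, Subring.coe_mul, Subring.coe_pow, hA.root_eq C rfl,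
      hA.xv_eq a _ rfl, DivIndex.mk_act, divX_mk hM]
    funext τ
    rw [hpow]
    rfl
  have h1 : (⟨divComb c g, divComb_mem c g⟩ : modularFormRing Qbar) =
      ∑ i, constForm Qbar (c i : Qbar) * ⟨divX M (i.act g), divX_mem hM _⟩ := by
    apply Subtype.ext
    push_cast
    refine Finset.sum_congr rfl fun i _ => ?_
    funext τ
    simp [constForm]
  rw [h1, map_sum]
  push_cast
  refine Finset.sum_congr rfl fun i _ => ?_
  rw [map_mul, ht, map_ratCast, Subring.coe_mul, hX, DivIndex.act_mul]
  funext τ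
  simp [constForm]

theorem divComb_mem_twistRing {M : ℕ} [NeZero M] {u : ℤ} (hA : DivAct σ M (γ.1 * diagOne u))
    (hs : s (rootQ (1 / M)) = ee ((u / M : ℚ) : ℂ)) (c : DivIndex M → ℚ)
    (g : Matrix (Fin 2) (Fin 2) (ZMod M)) :
    (⟨divComb c g, divComb_mem c g⟩ : modularFormRing Qbar) ∈ twistRing σ s γ := by
  refine ⟨divComb c (g * redMat M γ.1), ?_, ?_⟩
  · have := slash_mem_starPairs (divComb_mem_allModularForms c g) γ
    rw [Nat.cast_ofNat, divComb_slash] at this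
    exact this
  · rw [hA.divComb_eq, redMat_mul, ← mul_assoc]
    exact divComb_conj c _ hs

/-- The action of an element of `Π_ℚ` on the forms of level `M` is determined by its action on the
division values of level `M`: a multiple of such a form by a polynomial in division values is a
combination of such polynomials, with forms of level one as coefficients. -/
theorem conj_of_divAct {M : ℕ} (hM : 3 ≤ M) (hσ : σ ∈ PiQ) {u : ℤ}
    (hA : DivAct σ M (γ.1 * diagOne u)) (hs : s (rootQ (1 / M)) = ee ((u / M : ℚ) : ℂ))
    (hconst : ∀ (c : Qcycl) (F : modularFormRing Qbar),
      (F : ℍ → ℂ) = (fun _ => (c : ℂ)) → (σ F : ℍ → ℂ) = fun _ => s c)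
    {k : ℕ} (F : modularFormRing Qbar)
    (hF : IsForm k (CongruenceSubgroup.Gamma M) (F : ℍ → ℂ))
    (hFL : HasLaurentOver Qcycl (F : ℍ → ℂ)) :
    Conj s ((F : ℍ → ℂ) ∣[(k : ℤ)] γ) (σ F) := by
  classical
  have : NeZero M := ⟨by omega⟩
  obtain ⟨c, hc⟩ := exists_divComb_stabilizer hM
  set y := divComb c 1 with hy
  set O : Finset (ℍ → ℂ) := (Finset.univ.filter fun g => ∃ δ : SL(2, ℤ), redMat M δ.1 = g).image
    fun g => divComb c g with hO
  have hOmem : ∀ G, G ∈ O ↔ ∃ δ : SL(2, ℤ), y ∣[((3 : ℕ) : ℤ)] δ = G := by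
    intro G
    simp only [hO, Finset.mem_image, Finset.mem_filter, Finset.mem_univ, true_and,
      Nat.cast_ofNat]
    constructor
    · rintro ⟨_, ⟨δ, rfl⟩, rfl⟩
      exact ⟨δ, by rw [hy, divComb_slash, one_mul]⟩
    · rintro ⟨δ, rfl⟩
      exact ⟨_, ⟨δ, rfl⟩, by rw [hy, divComb_slash, one_mul]⟩
  have hOdiv : ∀ G ∈ O, ∃ g, divComb c g = G := by
    intro G hG
    obtain ⟨g, -, h⟩ := Finset.mem_image.1 hG
    exact ⟨g, h⟩
  obtain ⟨C, hC, hrel⟩ := exists_levelOne_coeffs (k := k) (l := 3) (F := F) hOmem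
    (fun δ hδ => hF.inv δ (hc δ hδ)) (fun G hG => by
      obtain ⟨g, rfl⟩ := hOdiv G hG
      exact divComb_holAtInfty _ _) hF.hol
  choose n e d he hd using fun j : Fin O.card => (hC j).exists_combination
  -- elements of the ring of modular forms
  set Y : modularFormRing Qbar := ⟨y, divComb_mem c 1⟩ with hY
  have hYtw : Y ∈ twistRing σ s γ := divComb_mem_twistRing hA hs c 1
  let E : (Σ j : Fin O.card, Fin (n j)) → modularFormRing Qbar := fun x =>
    ⟨e x.1 x.2, mem_modularFormRing_of_form ((he x.1 x.2).mem_allModularForms Qbar)⟩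
  have hEtw : ∀ x, E x ∈ twistRing σ s γ := fun x => rat_mem_twistRing hσ (he x.1 x.2)
  choose! D' hD' using fun G (hG : G ∈ O) =>
    (⟨_, rfl⟩ : ∃ D : modularFormRing Qbar, D = -⟨G, by
      obtain ⟨g, rfl⟩ := hOdiv G hG
      exact divComb_mem c g⟩ + Y)
  set D : modularFormRing Qbar := ∏ G ∈ O.erase y, D' G with hD
  have hDtw : D ∈ twistRing σ s γ := by
    refine Subring.prod_mem _ fun G hG => ?_
    have hG' := Finset.mem_of_mem_erase hG
    rw [hD' G hG']
    obtain ⟨g, rfl⟩ := hOdiv G hG'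
    exact Subring.add_mem _ (Subring.neg_mem _ (divComb_mem_twistRing hA hs c g)) hYtw
  have hDval : (D : ℍ → ℂ) = ∏ G ∈ O.erase y, (-G + y) := by
    rw [hD]
    push_cast
    refine Finset.prod_congr rfl fun G hG => ?_
    rw [hD' G (Finset.mem_of_mem_erase hG)]
    rfl
  have hD0 : D ≠ 0 := by
    rw [hD, Finset.prod_ne_zero_iff]
    intro G hG h0
    rw [hD' G (Finset.mem_of_mem_erase hG)] at h0
    have := congrArg Subtype.val h0
    exact Finset.ne_of_mem_erase hG (neg_add_eq_zero.1 this)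
  have hDL : HasLaurentOver Qcycl (D : ℍ → ℂ) := by
    rw [hDval]
    refine (laurentRing Qcycl).prod_mem fun G hG => ?_
    obtain ⟨g, rfl⟩ := hOdiv G (Finset.mem_of_mem_erase hG)
    exact (divComb_hasLaurentOver c g).neg.add (divComb_hasLaurentOver c 1)
  have hrel2 : ((F * D : modularFormRing Qbar) : ℍ → ℂ) =
      ∑ x : (Σ j : Fin O.card, Fin (n j)), ((-1) ^ (x.1 : ℕ) * d x.1 x.2 : ℂ) •
        ((E x * Y ^ (O.card - 1 - x.1) : modularFormRing Qbar) : ℍ → ℂ) := by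
    rw [Subring.coe_mul, hDval, hrel, Finset.sum_range, Fintype.sum_sigma]
    refine Finset.sum_congr rfl fun j _ => ?_
    rw [hd j, Finset.mul_sum, Finset.sum_mul]
    refine Finset.sum_congr rfl fun i _ => ?_
    funext τ
    simp only [Pi.mul_apply, Pi.neg_apply, Pi.pow_apply, Pi.one_apply, Pi.smul_apply, smul_eq_mul,
      Subring.coe_mul, Subring.coe_pow, E, hY]
    ring
  obtain ⟨d', hd'⟩ := exists_combination_over (K := Qcycl)
    (f := ((F * D : modularFormRing Qbar) : ℍ → ℂ))
    (g := fun x : (Σ j : Fin O.card, Fin (n j)) =>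
      ((E x * Y ^ (O.card - 1 - x.1) : modularFormRing Qbar) : ℍ → ℂ)) (hFL.mul hDL)
    (fun x => ((he x.1 x.2).2.mono bot_le).mul
      ((laurentRing Qcycl).pow_mem (divComb_hasLaurentOver c 1) _)) _ hrel2
  have hFD : F * D ∈ twistRing σ s γ := by
    have h1 : F * D = ∑ x : (Σ j : Fin O.card, Fin (n j)),
        constForm Qbar (IntermediateField.inclusion Qcycl_le_Qbar (d' x)) *
          (E x * Y ^ (O.card - 1 - x.1)) := by
      apply Subtype.ext
      rw [Subring.coe_mul]
      refine hd'.trans ?_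
      push_cast
      rfl
    rw [h1]
    refine Subring.sum_mem _ fun x _ => Subring.mul_mem _ ?_
      (Subring.mul_mem _ (hEtw x) (Subring.pow_mem _ hYtw _))
    exact const_mem_twistRing hconst (d' x) rfl
  -- division by `D`
  obtain ⟨p, hp, hp'⟩ := hFD
  obtain ⟨q, hq, hq'⟩ := hDtw
  have hFform : (F : ℍ → ℂ) ∈ allModularForms k Qbar :=
    mem_allModularForms_iff.2 ⟨⟨_, inferInstance, hF⟩, hFL.mono Qcycl_le_Qbar⟩
  have h1 := Subring.mul_mem _ (slash_mem_starPairs hFform γ) hq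
  have h2 := starPairs_unique hp h1
  rw [h2, map_mul, Subring.coe_mul] at hp'
  refine Conj.of_mul (hF.hol γ).hasLaurentOver ?_ hp' hq' ?_
  · exact (modularFormRing_hasLaurent (σ F).2).mono le_top
  · rw [Ne, hq'.eq_zero_iff]
    intro h0
    refine hD0 (σ.injective ?_)
    rw [map_zero]
    exact Subtype.ext h0

end twist

theorem slash_eq_of_dvd {N k : ℕ} {f : ℍ → ℂ} (hf : IsForm k (CongruenceSubgroup.Gamma N) f)
    {γ γ' : SL(2, ℤ)} (h : ∀ i j, (N : ℤ) ∣ γ i j - γ' i j) :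
    f ∣[(k : ℤ)] γ' = f ∣[(k : ℤ)] γ := by
  have hδ : γ' * γ⁻¹ ∈ CongruenceSubgroup.Gamma N := by
    rw [CongruenceSubgroup.Gamma_mem', map_mul, map_inv, mul_inv_eq_one]
    refine Matrix.SpecialLinearGroup.ext _ _ fun i j => ?_
    exact (ZMod.intCast_eq_intCast_iff_dvd_sub _ _ _).2 (h i j)
  have h1 := hf.inv _ hδ
  conv_rhs => rw [← h1, ← SlashAction.slash_mul, inv_mul_cancel_right]

theorem det_isIntegral {h : Matrix (Fin 2) (Fin 2) Af} (hh : ∀ i j, IsIntegralAdele (h i j)) :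
    IsIntegralAdele h.det := by
  rw [Matrix.det_fin_two]
  exact integralAdeles.sub_mem (integralAdeles.mul_mem (hh 0 0) (hh 1 1))
    (integralAdeles.mul_mem (hh 0 1) (hh 1 0))

theorem dvd_sub_of_adeleCong {N : ℕ} (hN : 0 < N) {h : Matrix (Fin 2) (Fin 2) Af}
    {γ γ' : SL(2, ℤ)} {A : Matrix (Fin 2) (Fin 2) ℤ} {u v : ℤ}
    (hγ : ∀ i j, AdeleCong N
      (((γ.1.map (Int.cast : ℤ → Af)) * Matrix.diagonal ![1, h.det]) i j) (h i j))
    (hA : MatCong N A h) (hu : AdeleCong N (u : Af) h.det) (hint : IsIntegralAdele h.det)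
    (hγ' : ∀ i j, (N : ℤ) ∣ A i j - !![γ' 0 0, γ' 0 1 * u; γ' 1 0, γ' 1 1 * u] i j)
    (hv : (N : ℤ) ∣ u * v - 1) (i j : Fin 2) : (N : ℤ) ∣ γ i j - γ' i j := by
  have h1 := hγ i j
  have h2 := hγ' i j
  rw [Matrix.mul_diagonal, Matrix.map_apply] at h1
  fin_cases j
  · have h0 : AdeleCong N (γ i 0 : Af) (h i 0) := by simpa using h1
    have h3 := (adeleCong_int_iff hN).1 (h0.trans (hA i 0).symm)
    have h4 : (N : ℤ) ∣ A i 0 - γ' i 0 := by fin_cases i <;> exact h2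
    have := dvd_add h3 h4
    rwa [sub_add_sub_cancel] at this
  · have h5 : AdeleCong N ((γ i 1 * u : ℤ) : Af) (γ i 1 * h.det) := by
      rw [Int.cast_mul]
      exact (AdeleCong.refl _ _).mul hu (isIntegralAdele_intCast _) hint
    have h0 : AdeleCong N (γ i 1 * h.det) (h i 1) := h1
    have h3 := (adeleCong_int_iff hN).1 ((h5.trans h0).trans (hA i 1).symm)
    have h4 : (N : ℤ) ∣ A i 1 - γ' i 1 * u := by fin_cases i <;> exact h2
    have e : γ i 1 - γ' i 1 = ((γ i 1 * u - A i 1) + (A i 1 - γ' i 1 * u)) * v -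
      (γ i 1 - γ' i 1) * (u * v - 1) := by ring
    change (N : ℤ) ∣ γ i 1 - γ' i 1
    rw [e]
    exact dvd_sub ((dvd_add h3 h4).mul_right _) (hv.mul_left _)

theorem mul_diagOne (B : Matrix (Fin 2) (Fin 2) ℤ) (w : ℤ) :
    B * diagOne w = !![B 0 0, B 0 1 * w; B 1 0, B 1 1 * w] := by
  ext i j
  fin_cases i <;> fin_cases j <;> simp [diagOne, Matrix.mul_apply]

section

variable {N : ℕ} {A : Matrix (Fin 2) (Fin 2) ℤ} {h : GL (Fin 2) Af}

theorem MatCong.det (hA : MatCong N A h.1) (hint : IsIntegralGL h) :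
    AdeleCong N (A.det : Af) h.1.det := by
  rw [Matrix.det_fin_two, Matrix.det_fin_two]
  push_cast
  exact ((hA 0 0).mul (hA 1 1) (isIntegralAdele_intCast _) (hint.1 1 1)).sub
    ((hA 0 1).mul (hA 1 0) (isIntegralAdele_intCast _) (hint.1 1 0))

theorem MatCong.exists_inv (hA : MatCong N A h.1) (hint : IsIntegralGL h) (hN : 0 < N) :
    ∃ B : Matrix (Fin 2) (Fin 2) ℤ, MatCong N B (h⁻¹).1 ∧
      ∀ i j, (N : ℤ) ∣ (A * B) i j - (1 : Matrix (Fin 2) (Fin 2) ℤ) i j := by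
  obtain ⟨B, hB⟩ := exists_matCong hN hint.2
  have h1 := matCong_mul hA hB hint.2
  rw [← Units.val_mul, mul_inv_cancel, Units.val_one] at h1
  exact ⟨B, hB, fun i j => (adeleCong_int_iff hN).1
    ((h1 i j).trans (by fin_cases i <;> fin_cases j <;> simpa using AdeleCong.refl _ _))⟩

theorem MatCong.exists_det_inv (hA : MatCong N A h.1) (hint : IsIntegralGL h) (hN : 0 < N) :
    ∃ v : ℤ, (N : ℤ) ∣ A.det * v - 1 := by
  obtain ⟨B, -, hB⟩ := hA.exists_inv hint hN
  refine ⟨B.det, ?_⟩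
  have h2 := det_sub_det_dvd (A := A * B) (B := 1) hB
  rwa [Matrix.det_mul, Matrix.det_one] at h2

theorem MatCong.exists_SL (hA : MatCong N A h.1) (hint : IsIntegralGL h) (hN : 0 < N) :
    ∃ γ : SL(2, ℤ), ∀ i j, (N : ℤ) ∣ A i j - (γ.1 * diagOne A.det) i j := by
  obtain ⟨v, hv⟩ := hA.exists_det_inv hint hN
  obtain ⟨γ, hγ⟩ := exists_SL_lift hN (A * diagOne v) (by
    rw [Matrix.det_mul, det_diagOne]
    exact hv)
  have e1 : ∀ i, (N : ℤ) ∣ A i 0 - γ i 0 := fun i => by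
    have := (hγ i 0).neg_right
    rw [mul_diagOne] at this
    fin_cases i <;> simpa using this
  have e2 : ∀ i, (N : ℤ) ∣ A i 1 - γ i 1 * A.det := fun i => by
    have h1 := hγ i 1
    have h2 : (A * diagOne v) i 1 = A i 1 * v := by
      rw [mul_diagOne]
      fin_cases i <;> rfl
    rw [h2] at h1
    have e : A i 1 - γ i 1 * A.det =
      -((γ i 1 - A i 1 * v) * A.det + A i 1 * (A.det * v - 1)) := by ring
    rw [e]
    exact (dvd_add (h1.mul_right _) (hv.mul_left _)).neg_right
  refine ⟨γ, fun i j => ?_⟩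
  rw [mul_diagOne]
  fin_cases i <;> fin_cases j
  · exact e1 0
  · exact e2 0
  · exact e1 1
  · exact e2 1

end

/-- Every element of `Π_ℚ` has an image in `GL₂(ℤ^)`. -/
theorem exists_actsAs {σ : AutM} (hσ : σ ∈ PiQ) : ∃ h : GL (Fin 2) Af, ActsAs σ h := by
  obtain ⟨h, hint, H⟩ := exists_adelic_GL hσ
  obtain ⟨s, hs⟩ := exists_embedding σ
  obtain ⟨t, ht⟩ := exists_restrict_Qcycl s
  have hconst : ∀ (c : Qcycl) (F : modularFormRing Qbar),
      (F : ℍ → ℂ) = (fun _ => (c : ℂ)) → (σ F : ℍ → ℂ) = fun _ => (t c : ℂ) := by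
    intro c F hF
    have h1 : F = constForm Qbar (IntermediateField.inclusion Qcycl_le_Qbar c) := Subtype.ext hF
    rw [h1, hs, ht]
    rfl
  have hroot : ∀ (N : ℕ) (A : Matrix (Fin 2) (Fin 2) ℤ), 0 < N → MatCong N A h.1 →
      (t (rootQ (1 / N)) : ℂ) = ee ((A.det / N : ℚ) : ℂ) := by
    intro N A hN hA
    set C : modularFormRing Qbar := constForm Qbar ⟨ee ((1 / N : ℚ) : ℂ),
      Qcycl_le_Qbar (ee_rat_mem_Qcycl _)⟩
    have h1 := (H N A hN hA).root_eq C rfl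
    have h2 := hconst (rootQ (1 / N)) C rfl
    rw [h2] at h1
    exact congrFun h1 UpperHalfPlane.I
  refine ⟨h, hint, t, ?_, ?_⟩
  · intro m j hm hj ζ hζ
    obtain ⟨A, hA⟩ := exists_matCong hm hint.1
    have h1 := hroot m A hm hA
    obtain ⟨k, hk⟩ := exists_int_of_pow_eq_one hm (congrArg Subtype.val hζ)
    have h2 : ζ = rootQ (1 / m) ^ k := by
      rw [← rootQ_int_div]
      exact Subtype.ext hk
    have h3 : t (rootQ (1 / m)) = rootQ (1 / m) ^ j := by
      rw [← rootQ_int_div]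
      refine Subtype.ext (h1.trans ?_)
      obtain ⟨z, hz⟩ := (adeleCong_int_iff hm).1 ((hA.det hint).trans hj)
      have h0 : (m : ℂ) ≠ 0 := by exact_mod_cast hm.ne'
      have : ((A.det / m : ℚ) : ℂ) = ((j / m : ℚ) : ℂ) + (z : ℤ) := by
        rw [eq_add_of_sub_eq' hz]
        push_cast
        field_simp
      rw [this, ee_add_int]
      rfl
    rw [h2, map_zpow₀, h3, ← zpow_mul, ← zpow_mul, mul_comm]
  · intro N γ hN hγ k F hF
    obtain ⟨hform, hlau⟩ := (mem_modularForms_iff (by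
      have : NeZero N := ⟨hN.ne'⟩
      infer_instance)).1 hF
    -- pass to a level `M ≥ 3`
    set M := N * 3 with hM
    have hM3 : 3 ≤ M := by omega
    have hM0 : 0 < M := by omega
    have hNM : (N : ℤ) ∣ M := ⟨3, by rw [hM]; push_cast; rfl⟩
    obtain ⟨A, hA⟩ := exists_matCong hM0 hint.1
    have hA' : MatCong N A h.1 := fun i j => (hA i j).of_dvd (Dvd.intro _ rfl)
    set u := A.det with hu
    obtain ⟨v, hv⟩ := hA.exists_det_inv hint hM0
    obtain ⟨γ', hγA⟩ := hA.exists_SL hint hM0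
    have hAct : DivAct σ M (γ'.1 * diagOne u) := (H M A hM0 hA).congr hM0 hγA
    have hconj := conj_of_divAct (s := (algebraMap Qcycl ℂ).comp (t : Qcycl →+* Qcycl)) (γ := γ')
      hM3 hσ hAct (hroot M A hM0 hA) hconst F
      (hform.mono fun δ hδ => by
        rw [CongruenceSubgroup.Gamma_mem] at hδ ⊢
        have hc : ∀ x : ℤ, ((x : ZMod M).cast : ZMod N) = x := fun x =>
          ZMod.cast_intCast (Dvd.intro _ rfl) x
        obtain ⟨h1, h2, h3, h4⟩ := hδ
        refine ⟨?_, ?_, ?_, ?_⟩ <;> rw [← hc]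
        · rw [h1, ZMod.cast_one (Dvd.intro _ rfl)]
        · rw [h2, ZMod.cast_zero]
        · rw [h3, ZMod.cast_zero]
        · rw [h4, ZMod.cast_one (Dvd.intro _ rfl)]) hlau
    -- `γ` and `γ'` are congruent modulo `N`
    have hslash : (F : ℍ → ℂ) ∣[(k : ℤ)] γ' = (F : ℍ → ℂ) ∣[(k : ℤ)] γ := by
      refine slash_eq_of_dvd hform (dvd_sub_of_adeleCong hN hγ hA' (hA'.det hint)
        (det_isIntegral hint.1)
        ?_ (hNM.trans hv))
      intro i j
      have := hNM.trans (hγA i j)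
      rwa [mul_diagOne] at this
    rw [hslash] at hconj
    obtain ⟨w, p, hw, h1, h2⟩ := hconj.exists_hasPS (hform.hol γ)
      (by
        obtain ⟨⟨Γ, hΓ, h1⟩, -⟩ := mem_allModularForms_iff.1 (PiQ_weight hσ F
          (mem_allModularForms_iff.2 ⟨⟨_, by
            have : NeZero N := ⟨hN.ne'⟩
            infer_instance, hform⟩, hlau.mono Qcycl_le_Qbar⟩))
        exact h1.holAtInfty)
    refine ⟨w, fun n => coeff n p, hw, ?_, ?_⟩
    · rw [hasQExp_zero_iff_hasPS]
      convert h1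
      ext n
      simp
    · rw [hasQExp_zero_iff_hasPS]
      convert h2
      ext n
      simp

end

section

open Function.Periodic (qParam)
open scoped Pointwise

/-! ### The action of rational matrices on forms -/

/-- The image of a rational matrix in `GL(2, ℝ)`, which acts on the upper half plane. -/
abbrev realMat (γ : GL(2, ℚ)⁺) : GL (Fin 2) ℝ :=
  Matrix.GeneralLinearGroup.map (algebraMap ℚ ℝ) (γ : GL (Fin 2) ℚ)

theorem realMat_mul (γ δ : GL(2, ℚ)⁺) : realMat (γ * δ) = realMat γ * realMat δ := by
  simp [realMat]

theorem realMat_inv (γ : GL(2, ℚ)⁺) : realMat γ⁻¹ = (realMat γ)⁻¹ := by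
  simp [realMat]

theorem realMat_det (γ : GL(2, ℚ)⁺) : (realMat γ).det.val =
    ((Matrix.GeneralLinearGroup.det (γ : GL (Fin 2) ℚ) : ℚ) : ℝ) := by
  rw [realMat, Matrix.GeneralLinearGroup.map_det]
  rfl

theorem realMat_det_pos (γ : GL(2, ℚ)⁺) : 0 < (realMat γ).det.val := by
  rw [realMat_det]
  exact_mod_cast γ.2

theorem starAction_apply (k : ℕ) (f : ℍ → ℂ) (γ : GL(2, ℚ)⁺) (τ : ℍ) : starAction k f γ τ =
    f (realMat γ • τ) * (UpperHalfPlane.denom (realMat γ) τ)⁻¹ ^ k := by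
  have hd : ((Matrix.GeneralLinearGroup.det (γ : GL (Fin 2) ℚ) : ℚ) : ℂ) ≠ 0 := by
    exact_mod_cast (Matrix.GeneralLinearGroup.det (γ : GL (Fin 2) ℚ)).ne_zero
  rw [starAction, Pi.smul_apply, ModularForm.slash_apply, UpperHalfPlane.σ,
    if_pos (realMat_det_pos γ), abs_of_pos (realMat_det_pos γ), realMat_det, smul_eq_mul,
    zpow_neg, zpow_natCast, inv_pow]
  push_cast
  rw [show (1 - (k : ℤ)) = -((k : ℤ) - 1) by ring, zpow_neg]
  simp only [ContinuousAlgEquiv.refl_apply]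
  have := zpow_ne_zero ((k : ℤ) - 1) hd
  field_simp

theorem exists_isForm_of_isArithmetic {k : ℕ} {Γ : Subgroup (GL (Fin 2) ℝ)} [Γ.IsArithmetic]
    (F : ModularForm Γ (k : ℤ)) : ∃ Γ' : Subgroup SL(2, ℤ), Γ'.FiniteIndex ∧ IsForm k Γ' F := by
  have hΓ : (Γ.comap (Matrix.SpecialLinearGroup.mapGL (R := ℤ) ℝ)).FiniteIndex := inferInstance
  have hle : (Γ.comap (Matrix.SpecialLinearGroup.mapGL (R := ℤ) ℝ)).map
      (Matrix.SpecialLinearGroup.mapGL ℝ) ≤ Γ := Subgroup.map_comap_le _ _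
  exact ⟨_, hΓ, ModularForm.isForm hΓ
    { toFun := F
      slash_action_eq' := fun g hg => F.slash_action_eq' g (hle hg)
      holo' := F.holo'
      bdd_at_cusps' := fun hc => F.bdd_at_cusps' (hc.mono hle) }⟩

theorem IsForm.exists_star {k : ℕ} {Γ : Subgroup SL(2, ℤ)} (hΓ : Γ.FiniteIndex) {f : ℍ → ℂ}
    (hf : IsForm k Γ f) (γ : GL(2, ℚ)⁺) :
    ∃ Γ' : Subgroup SL(2, ℤ), Γ'.FiniteIndex ∧ IsForm k Γ' (starAction k f γ) := by
  obtain ⟨⟨F, rfl⟩, -⟩ := (mem_modularForms_iff hΓ).2 ⟨hf, hf.holAtInfty.hasLaurentOver⟩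
  have : (ConjAct.toConjAct (realMat γ)⁻¹ •
      Γ.map (Matrix.SpecialLinearGroup.mapGL ℝ)).IsArithmetic := by
    have := Subgroup.IsArithmetic.conj (Γ.map (Matrix.SpecialLinearGroup.mapGL ℝ))
      (γ : GL (Fin 2) ℚ)⁻¹
    rwa [map_inv] at this
  obtain ⟨Γ', hΓ', h⟩ := exists_isForm_of_isArithmetic (ModularForm.translate F (realMat γ))
  exact ⟨Γ', hΓ', h.const_smul _⟩

/-! ### Modular functions as quotients of forms -/

theorem HasLaurentOver.inv {K : IntermediateField ℚ ℂ} {f : ℍ → ℂ} (hf : HasLaurentOver K f)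
    (h0 : ∀ τ, f τ ≠ 0) : HasLaurentOver K f⁻¹ := (hf.conj.inv h0 h0).hasLaurentOver

theorem HasLaurentOver.of_mul {K : IntermediateField ℚ ℂ} {f g : ℍ → ℂ} (hf : HasLaurentOver ⊤ f)
    (hfg : HasLaurentOver K (f * g)) (hg : HasLaurentOver K g) (h0 : g ≠ 0) :
    HasLaurentOver K f := (Conj.of_mul hf hf hfg.conj hg.conj h0).hasLaurentOver

theorem slash_div_slash (k : ℕ) (F G : ℍ → ℂ) (γ : SL(2, ℤ)) (τ : ℍ) :
    (F ∣[(k : ℤ)] γ) τ / (G ∣[(k : ℤ)] γ) τ = F (γ • τ) / G (γ • τ) := by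
  rw [ModularForm.SL_slash_apply, ModularForm.SL_slash_apply]
  exact mul_div_mul_right _ _ (zpow_ne_zero _ (UpperHalfPlane.denom_ne_zero _ _))

theorem isModularFunction_div {k : ℕ} {Γ Γ' : Subgroup SL(2, ℤ)} {F G : ℍ → ℂ}
    (hF : IsForm k Γ F) (hG : IsForm k Γ' G) (h0 : ∀ τ, G τ ≠ 0) :
    IsModularFunction (Γ ⊓ Γ') (fun τ => F τ / G τ) := by
  have hm : ∀ γ : SL(2, ℤ), HasLaurentOver ⊤ (fun τ => F (γ • τ) / G (γ • τ)) := by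
    intro γ
    have h1 : ∀ τ, (G ∣[(k : ℤ)] γ) τ ≠ 0 := fun τ => by
      rw [ModularForm.SL_slash_apply]
      exact mul_ne_zero (h0 _) (zpow_ne_zero _ (UpperHalfPlane.denom_ne_zero _ _))
    have := (hF.hol γ).hasLaurentOver.mul ((hG.hol γ).hasLaurentOver.inv h1)
    convert this using 1
    funext τ
    rw [← slash_div_slash k]
    rfl
  refine ⟨?_, fun γ hγ τ => ?_, hm⟩
  · simpa using (hm 1).mdifferentiable
  · rw [← slash_div_slash k, hF.inv γ hγ.1, hG.inv γ hγ.2]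

theorem holAtInfty_mul_discriminant_pow {f : ℍ → ℂ} (hf : HasLaurentOver ⊤ f) :
    ∃ m : ℕ, ∀ M ≥ m, HolAtInfty (f * ModularForm.discriminant ^ M) := by
  obtain ⟨w, m, p, hw, hp⟩ := hf.exists_hasPS
  have hW : HolAtInfty fun τ => W τ ((1 : ℚ) * τ + 0) :=
    (conjAt_W (algebraMap Qbar ℂ) (ζ := 1) (β' := 0) (zero_le_one (α := ℚ))
      (by simp [ee_zero]) (by simp [ee_zero])).holAtInfty
  refine ⟨m, fun M hM => ?_⟩
  obtain ⟨e, he⟩ := Nat.exists_eq_add_of_le (hM.trans (Nat.le_mul_of_pos_left M hw))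
  have h1 := holRing.mul_mem (mem_holRing.2 ⟨w, _, hw, hp.mul (HasPS.X_pow w e)⟩)
    (holRing.pow_mem (mem_holRing.2 hW) (24 * M))
  have h2 : ∀ τ : ℍ, ee ((1 : ℚ) * (τ : ℂ)) = qParam w τ ^ w := by
    intro τ
    have h := HasPS.qParam_mul_pow (w := 1) one_pos hw τ
    rw [one_mul] at h
    rw [h, qParam, ee]
    simp
  convert mem_holRing.1 h1 using 1
  funext τ
  simp only [Pi.mul_apply, Pi.pow_apply]
  rw [discriminant_eq, h2, mul_pow, ← pow_mul, ← pow_mul, he, pow_add]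
  ring

theorem mul_discriminant_pow_slash (f : ℍ → ℂ) (M : ℕ) (γ : SL(2, ℤ)) :
    (f * ModularForm.discriminant ^ M) ∣[((12 * M : ℕ) : ℤ)] γ =
      (fun τ => f (γ • τ)) * ModularForm.discriminant ^ M := by
  funext τ
  have h1 := congrFun (isForm_discriminant.inv γ trivial) τ
  rw [ModularForm.SL_slash_apply] at h1 ⊢
  simp only [Pi.mul_apply, Pi.pow_apply]
  rw [mul_assoc, ← h1, mul_pow]
  congr 2
  rw [← zpow_natCast, ← zpow_mul]
  congr 1

/-- Multiplication by a power of the discriminant turns a modular function into a form. -/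
theorem IsModularFunction.exists_isForm {Γ : Subgroup SL(2, ℤ)} (hΓ : Γ.FiniteIndex) {f : ℍ → ℂ}
    (hf : IsModularFunction Γ f) :
    ∃ m : ℕ, ∀ M ≥ m, IsForm (12 * M) Γ (f * ModularForm.discriminant ^ M) := by
  choose m hm using fun γ => holAtInfty_mul_discriminant_pow (hf.merom γ)
  have : Finite (SL(2, ℤ) ⧸ Γ) := Subgroup.finite_quotient_of_finiteIndex
  have := Fintype.ofFinite (SL(2, ℤ) ⧸ Γ)
  have hsl := mul_discriminant_pow_slash f
  refine ⟨Finset.univ.sup fun x : SL(2, ℤ) ⧸ Γ => m x.out⁻¹, fun M hM => ⟨fun γ hγ => ?_,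
    fun γ => ?_⟩⟩
  · rw [hsl]
    congr 1
    funext τ
    exact hf.invariant γ hγ τ
  · obtain ⟨δ, hδ⟩ := QuotientGroup.mk_out_eq_mul Γ γ⁻¹
    have h1 : (fun τ => f (γ • τ)) = fun τ => f (((γ⁻¹ : SL(2, ℤ)) : SL(2, ℤ) ⧸ Γ).out⁻¹ • τ) := by
      funext τ
      rw [hδ, mul_inv_rev, inv_inv, mul_smul]
      exact (hf.invariant _ (Γ.inv_mem δ.2) _).symm
    rw [hsl, h1]
    exact hm _ M ((Finset.le_sup (f := fun x : SL(2, ℤ) ⧸ Γ => m x.out⁻¹)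
      (Finset.mem_univ _)).trans hM)

theorem exists_mem_allModularForms_of_modularFunction {K : IntermediateField ℚ ℂ} {u : ℍ → ℂ}
    (hu : u ∈ modularFunctions K) :
    ∃ M : ℕ, u * ModularForm.discriminant ^ M ∈ allModularForms (12 * M) K := by
  obtain ⟨⟨Γ, hΓ, hf⟩, hK⟩ := hu
  obtain ⟨m, hm⟩ := hf.exists_isForm hΓ
  exact ⟨m, mem_allModularForms_iff.2 ⟨⟨Γ, hΓ, hm m le_rfl⟩, hK.mul
    ((laurentRing K).pow_mem (hasLaurentOver_discriminant.mono bot_le) _)⟩⟩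

theorem isRatForm_discriminant_pow (M : ℕ) :
    IsRatForm (12 * M) (ModularForm.discriminant ^ M) := by
  refine ⟨?_, (laurentRing Q0).pow_mem hasLaurentOver_discriminant M⟩
  induction M with
  | zero => exact IsForm.const 1
  | succ M ih => rw [pow_succ, Nat.mul_succ]; exact ih.mul isForm_discriminant

theorem discriminant_pow_ne_zero (M : ℕ) (τ : ℍ) : (ModularForm.discriminant ^ M : ℍ → ℂ) τ ≠ 0 :=
  pow_ne_zero _ (ModularForm.discriminant_ne_zero τ)

end

section

/-! ### Actions on modular units -/

/-- The automorphism `σ` acts on the ring of modular functions. -/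
def UnitActs (σ : AutM) : Prop :=
  ∀ u ∈ modularFunctions Qbar, ∃ u' ∈ modularFunctions Qbar, ∀ F G : modularFormRing Qbar,
    (F : ℍ → ℂ) = u * (G : ℍ → ℂ) → (σ F : ℍ → ℂ) = u' * (σ G : ℍ → ℂ)

/-- The action on a modular function is determined by one representation as a quotient. -/
theorem action_of_pair {σ : AutM} {u u' : ℍ → ℂ} (hu' : HasLaurentOver Qbar u')
    {F₀ G₀ : modularFormRing Qbar} (hG : G₀ ≠ 0) (h : (F₀ : ℍ → ℂ) = u * (G₀ : ℍ → ℂ))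
    (h' : (σ F₀ : ℍ → ℂ) = u' * (σ G₀ : ℍ → ℂ)) (F G : modularFormRing Qbar)
    (hF : (F : ℍ → ℂ) = u * (G : ℍ → ℂ)) : (σ F : ℍ → ℂ) = u' * (σ G : ℍ → ℂ) := by
  have h1 : F * G₀ = F₀ * G := by
    apply Subtype.ext
    rw [Subring.coe_mul, Subring.coe_mul, hF, h]
    ring
  have h2 : (σ F : ℍ → ℂ) * (σ G₀ : ℍ → ℂ) = (σ F₀ : ℍ → ℂ) * (σ G : ℍ → ℂ) := by
    rw [← Subring.coe_mul, ← Subring.coe_mul, ← map_mul, ← map_mul, h1]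
  rw [h'] at h2
  have h3 : (σ G₀ : ℍ → ℂ) * ((σ F : ℍ → ℂ) - u' * (σ G : ℍ → ℂ)) = 0 := by
    rw [mul_sub, mul_comm, h2]
    ring
  have hL : ∀ H : modularFormRing Qbar, (H : ℍ → ℂ) ∈ laurentRing Qbar := fun H =>
    modularFormRing_hasLaurent H.2
  rcases (hL (σ G₀)).eq_zero_or_eq_zero ((laurentRing Qbar).sub_mem (hL _)
    ((laurentRing Qbar).mul_mem hu' (hL _))) h3 with h4 | h4
  · refine absurd (σ.injective ?_) hG
    rw [map_zero]
    exact Subtype.ext h4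
  · exact sub_eq_zero.1 h4

/-- A modular function as a quotient of two forms, the denominator being a power of `Δ`. -/
theorem exists_pair {u : ℍ → ℂ} (hu : u ∈ modularFunctions Qbar) :
    ∃ (M : ℕ) (F G : modularFormRing Qbar), G ≠ 0 ∧ (F : ℍ → ℂ) = u * (G : ℍ → ℂ) ∧
      (F : ℍ → ℂ) ∈ allModularForms (12 * M) Qbar ∧
      (G : ℍ → ℂ) = ModularForm.discriminant ^ M := by
  obtain ⟨M, hM⟩ := exists_mem_allModularForms_of_modularFunction hu
  refine ⟨M, ⟨_, mem_modularFormRing_of_form hM⟩, ⟨_, mem_modularFormRing_of_form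
    ((isRatForm_discriminant_pow M).mem_allModularForms Qbar)⟩, fun h => ?_, rfl, hM, rfl⟩
  exact discriminant_pow_ne_zero M UpperHalfPlane.I (congrFun (congrArg Subtype.val h) _)

theorem UnitActs.unique {σ : AutM} {u u' u'' : ℍ → ℂ} (hu : u ∈ modularFunctions Qbar)
    (hu' : u' ∈ modularFunctions Qbar) (hu'' : u'' ∈ modularFunctions Qbar)
    (h' : ∀ F G : modularFormRing Qbar,
      (F : ℍ → ℂ) = u * (G : ℍ → ℂ) → (σ F : ℍ → ℂ) = u' * (σ G : ℍ → ℂ))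
    (h'' : ∀ F G : modularFormRing Qbar,
      (F : ℍ → ℂ) = u * (G : ℍ → ℂ) → (σ F : ℍ → ℂ) = u'' * (σ G : ℍ → ℂ)) : u' = u'' := by
  obtain ⟨M, F, G, hG, hF, -⟩ := exists_pair hu
  have h1 : (u' - u'') * (σ G : ℍ → ℂ) = 0 := by
    rw [sub_mul, ← h' F G hF, ← h'' F G hF, sub_self]
  rcases ((laurentRing Qbar).sub_mem hu'.2 hu''.2 : HasLaurentOver Qbar _).eq_zero_or_eq_zero
    (modularFormRing_hasLaurent (σ G).2) h1 with h2 | h2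
  · exact sub_eq_zero.1 h2
  · refine absurd (σ.injective ?_) hG
    rw [map_zero]
    exact Subtype.ext h2

theorem UnitActs.comp {σ ρ : AutM} (h : UnitActs σ) (h' : UnitActs ρ) : UnitActs (σ * ρ) := by
  intro u hu
  obtain ⟨u₁, hu₁, H₁⟩ := h' u hu
  obtain ⟨u₂, hu₂, H₂⟩ := h u₁ hu₁
  exact ⟨u₂, hu₂, fun F G hFG => H₂ _ _ (H₁ F G hFG)⟩

theorem unitActs_one : UnitActs 1 := fun u hu => ⟨u, hu, fun _ _ h => h⟩

/-- An automorphism acting on modular functions acts on modular units. -/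
theorem UnitActs.exists_isUnitAction {σ : AutM} (h : UnitActs σ) :
    ∃ A : ModularUnits Qbar →* ModularUnits Qbar, IsUnitAction σ A := by
  choose! A hA hA' using h
  have hone : A 1 = 1 := UnitActs.unique (modularFunctions Qbar).one_mem
    (hA _ (modularFunctions Qbar).one_mem) (modularFunctions Qbar).one_mem
    (hA' _ (modularFunctions Qbar).one_mem) fun F G hFG => by
      rw [one_mul] at hFG ⊢
      rw [Subtype.ext hFG]
  have hmul : ∀ u v, u ∈ modularFunctions Qbar → v ∈ modularFunctions Qbar →
      A (u * v) = A u * A v := by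
    intro u v hu hv
    have huv := (modularFunctions Qbar).mul_mem hu hv
    refine UnitActs.unique huv (hA _ huv) ((modularFunctions Qbar).mul_mem (hA _ hu) (hA _ hv))
      (hA' _ huv) fun F G hFG => ?_
    obtain ⟨M₁, F₁, G₁, hG₁, hF₁, -⟩ := exists_pair hu
    obtain ⟨M₂, F₂, G₂, hG₂, hF₂, -⟩ := exists_pair hv
    refine action_of_pair (F₀ := F₁ * F₂) (G₀ := G₁ * G₂) (u := u * v)
      ((laurentRing Qbar).mul_mem (hA _ hu).2 (hA _ hv).2) (mul_ne_zero hG₁ hG₂) ?_ ?_ F G hFG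
    · rw [Subring.coe_mul, Subring.coe_mul, hF₁, hF₂]
      ring
    · rw [map_mul, map_mul, Subring.coe_mul, Subring.coe_mul, hA' u hu _ _ hF₁, hA' v hv _ _ hF₂]
      ring
  let B : modularFunctions Qbar →* modularFunctions Qbar :=
    { toFun := fun u => ⟨A u, hA _ u.2⟩
      map_one' := Subtype.ext hone
      map_mul' := fun u v => Subtype.ext (hmul u v u.2 v.2) }
  exact ⟨Units.map B, fun u F G hFG => hA' _ (u : modularFunctions Qbar).2 F G hFG⟩

theorem unitActs_of_mem_PiQ {σ : AutM} (hσ : σ ∈ PiQ) : UnitActs σ := by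
  intro u hu
  obtain ⟨M, F, G, hG, hF, hM, hGΔ⟩ := exists_pair hu
  obtain ⟨⟨Γ, hΓ, h1⟩, h2⟩ := mem_allModularForms_iff.1 (PiQ_weight hσ F hM)
  have hσG : (σ G : ℍ → ℂ) = ModularForm.discriminant ^ M := by
    rw [PiQ_rat hσ (isRatForm_discriminant_pow M) G hGΔ, hGΔ]
  have hu' : (fun τ => (σ F : ℍ → ℂ) τ / (ModularForm.discriminant ^ M : ℍ → ℂ) τ) ∈
      modularFunctions Qbar :=
    ⟨⟨_, inferInstance, isModularFunction_div h1 (isRatForm_discriminant_pow M).1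
      (discriminant_pow_ne_zero M)⟩, by
      have := h2.mul ((((isRatForm_discriminant_pow M).2.mono
        (bot_le : Q0 ≤ Qbar)).inv (discriminant_pow_ne_zero M)))
      exact this⟩
  refine ⟨_, hu', action_of_pair hu'.2 hG hF ?_⟩
  rw [hσG]
  funext τ
  exact (div_mul_cancel₀ _ (discriminant_pow_ne_zero M τ)).symm

/-- The composition of a modular function with a rational matrix. -/
theorem modularFunctions_comp {K : IntermediateField ℚ ℂ} {u : ℍ → ℂ}
    (hu : u ∈ modularFunctions K) (γ : GL(2, ℚ)⁺) :
    (fun τ => u (realMat γ • τ)) ∈ modularFunctions ⊤ := by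
  obtain ⟨M, hM⟩ := exists_mem_allModularForms_of_modularFunction hu
  obtain ⟨⟨Γ, hΓ, h1⟩, -⟩ := mem_allModularForms_iff.1 hM
  obtain ⟨Γ', hΓ', h1'⟩ := h1.exists_star hΓ γ
  have h2 := (isRatForm_discriminant_pow M).1
  obtain ⟨Γ'', hΓ'', h2'⟩ := h2.exists_star inferInstance γ
  have hd : ∀ τ : ℍ, (UpperHalfPlane.denom (realMat γ) τ)⁻¹ ^ (12 * M) ≠ 0 := fun τ =>
    pow_ne_zero _ (inv_ne_zero (UpperHalfPlane.denom_ne_zero _ _))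
  have hH := isModularFunction_div h1' h2' fun τ => by
    rw [starAction_apply]
    exact mul_ne_zero (discriminant_pow_ne_zero M _) (hd τ)
  have he : (fun τ => u (realMat γ • τ)) = fun τ =>
      starAction (12 * M) (u * ModularForm.discriminant ^ M) γ τ /
        starAction (12 * M) (ModularForm.discriminant ^ M) γ τ := by
    funext τ
    rw [starAction_apply, starAction_apply, mul_div_mul_right _ _ (hd τ), Pi.mul_apply,
      mul_div_cancel_right₀ _ (discriminant_pow_ne_zero M _)]
  rw [he]
  refine ⟨⟨_, inferInstance, hH⟩, ?_⟩
  simpa using hH.merom 1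

theorem IsStarAction.weight {σ : AutM} {γ : GL(2, ℚ)⁺} (h : IsStarAction σ γ) {k : ℕ}
    {F : modularFormRing Qbar} (hF : (F : ℍ → ℂ) ∈ allModularForms k Qbar) :
    (σ F : ℍ → ℂ) ∈ allModularForms k Qbar := by
  obtain ⟨⟨Γ, hΓ, h1⟩, -⟩ := mem_allModularForms_iff.1 hF
  refine mem_allModularForms_iff.2 ⟨?_, modularFormRing_hasLaurent (σ F).2⟩
  rw [h k F hF]
  exact h1.exists_star hΓ γ

theorem IsStarAction.apply {σ : AutM} {γ : GL(2, ℚ)⁺} (h : IsStarAction σ γ) {k : ℕ}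
    {F : modularFormRing Qbar} (hF : (F : ℍ → ℂ) ∈ allModularForms k Qbar) (τ : ℍ) :
    (σ F : ℍ → ℂ) τ = (F : ℍ → ℂ) (realMat γ • τ) *
      (UpperHalfPlane.denom (realMat γ) τ)⁻¹ ^ k := by
  rw [h k F hF, starAction_apply]

/-- If `σ` is the action of `γ`, then `σ` acts on modular functions by composition with `γ`. -/
theorem IsStarAction.exists_unit {σ : AutM} {γ : GL(2, ℚ)⁺} (h : IsStarAction σ γ) {u : ℍ → ℂ}
    (hu : u ∈ modularFunctions Qbar) :
    (fun τ => u (realMat γ • τ)) ∈ modularFunctions Qbar ∧ ∀ F G : modularFormRing Qbar,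
      (F : ℍ → ℂ) = u * (G : ℍ → ℂ) →
      (σ F : ℍ → ℂ) = (fun τ => u (realMat γ • τ)) * (σ G : ℍ → ℂ) := by
  obtain ⟨M, F, G, hG, hF, hM, hGΔ⟩ := exists_pair hu
  have hGM : (G : ℍ → ℂ) ∈ allModularForms (12 * M) Qbar := by
    rw [hGΔ]
    exact (isRatForm_discriminant_pow M).mem_allModularForms Qbar
  have h1 : (σ F : ℍ → ℂ) = (fun τ => u (realMat γ • τ)) * (σ G : ℍ → ℂ) := by
    funext τ
    rw [Pi.mul_apply, h.apply hM, h.apply hGM, hF, Pi.mul_apply, mul_assoc]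
  have h2 := modularFunctions_comp hu γ
  have h3 : HasLaurentOver Qbar fun τ => u (realMat γ • τ) := by
    refine h2.2.of_mul (h1 ▸ modularFormRing_hasLaurent (σ F).2)
      (modularFormRing_hasLaurent (σ G).2) fun h0 => hG (σ.injective ?_)
    rw [map_zero]
    exact Subtype.ext h0
  exact ⟨⟨h2.1, h3⟩, action_of_pair h3 hG hF h1⟩

/-- The inverse of the action of `γ` is the action of `γ⁻¹`. -/
theorem IsStarAction.inv {σ : AutM} {γ : GL(2, ℚ)⁺} (h : IsStarAction σ γ) :
    IsStarAction σ⁻¹ γ⁻¹ := by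
  intro k F hF
  obtain ⟨H, rfl⟩ := σ.surjective F
  have hinv : σ⁻¹ (σ H) = H := σ.symm_apply_apply H
  rw [hinv]
  obtain ⟨P, hP, hPH⟩ := exists_graded_of_mem H.2
  have hmem : ∀ j, P.coeff j ∈ modularFormRing Qbar := fun j => mem_modularFormRing_of_form (hP j)
  -- compare the components of `σ H` of all weights
  have hsum : H = ∑ j ∈ P.support, ⟨P.coeff j, hmem j⟩ := by
    apply Subtype.ext
    push_cast
    rw [← hPH, Polynomial.eval_eq_sum, Polynomial.sum]
    simp
  have h0 : (∑ j ∈ P.support, Polynomial.monomial j (σ ⟨P.coeff j, hmem j⟩ : ℍ → ℂ)) -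
      Polynomial.monomial k (σ H : ℍ → ℂ) = 0 := by
    refine eq_zero_of_eval_one_eq_zero (K := Qbar) ((gradedRing Qbar).sub_mem
      ((gradedRing Qbar).sum_mem fun j _ => monomial_mem_gradedRing (h.weight (hP j)))
      (monomial_mem_gradedRing hF)) ?_
    rw [Polynomial.eval_sub, Polynomial.eval_finsetSum, hsum, map_sum]
    push_cast
    simp [Polynomial.eval_finsetSum]
  have hc : ∀ j ≠ k, P.coeff j = 0 := by
    intro j hj
    by_cases hjs : j ∈ P.support
    · have := congrArg (fun Q => Polynomial.coeff Q j) h0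
      simp only [Polynomial.coeff_sub, Polynomial.finsetSum_coeff, Polynomial.coeff_monomial,
        Polynomial.coeff_zero, if_neg hj.symm, sub_zero, Finset.sum_ite_eq', if_pos hjs] at this
      have h2 : σ ⟨P.coeff j, hmem j⟩ = 0 := Subtype.ext this
      exact congrArg Subtype.val (σ.injective (h2.trans (map_zero σ).symm))
    · exact Polynomial.notMem_support_iff.1 hjs
  have hHk : (H : ℍ → ℂ) = P.coeff k := by
    rw [← hPH, Polynomial.eval_eq_sum, Polynomial.sum, Finset.sum_eq_single k]
    · simp
    · intro j _ hj
      rw [hc j hj, zero_mul]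
    · intro hk
      rw [Polynomial.notMem_support_iff.1 hk, zero_mul]
  have hHF : (H : ℍ → ℂ) ∈ allModularForms k Qbar := hHk ▸ hP k
  funext τ
  rw [starAction_apply, h.apply hHF, realMat_inv, smul_inv_smul, mul_assoc, ← mul_pow,
    ← mul_inv]
  have := UpperHalfPlane.denom_cocycle_σ (realMat γ) (realMat γ)⁻¹ τ
  rw [mul_inv_cancel, ← realMat_inv, UpperHalfPlane.σ, if_pos (realMat_det_pos _), realMat_inv,
    ContinuousAlgEquiv.refl_apply] at this
  rw [← this]
  simp [UpperHalfPlane.denom]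

theorem IsStarAction.unitActs {σ : AutM} {γ : GL(2, ℚ)⁺} (h : IsStarAction σ γ) : UnitActs σ :=
  fun _ hu => ⟨_, h.exists_unit hu⟩

/-- The elements of `Π'_ℚ` act on the ring of modular functions. -/
theorem unitActs_of_mem_PiQ' {σ : AutM} (hσ : σ ∈ PiQ') : UnitActs σ := by
  let S : Subgroup AutM :=
    { carrier := {σ | UnitActs σ ∧ UnitActs σ⁻¹}
      mul_mem' := fun ha hb => ⟨ha.1.comp hb.1, by
        rw [mul_inv_rev]
        exact hb.2.comp ha.2⟩
      one_mem' := ⟨unitActs_one, by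
        rw [inv_one]
        exact unitActs_one⟩
      inv_mem' := fun ha => ⟨ha.2, by
        rw [inv_inv]
        exact ha.1⟩ }
  have hle : PiQ' ≤ S := by
    refine (Subgroup.closure_le S).2 ?_
    rintro σ (hσ | ⟨γ, hγ⟩)
    · exact ⟨unitActs_of_mem_PiQ hσ, unitActs_of_mem_PiQ (PiQ.inv_mem hσ)⟩
    · exact ⟨hγ.unitActs, hγ.inv.unitActs⟩
  exact (hle hσ).1

/-- The action on modular units is unique. -/
theorem IsUnitAction.unique {σ : AutM} {A B : ModularUnits Qbar →* ModularUnits Qbar}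
    (hA : IsUnitAction σ A) (hB : IsUnitAction σ B) : A = B :=
  MonoidHom.ext fun u => Units.ext <| Subtype.ext <|
    UnitActs.unique (u : modularFunctions Qbar).2 (A u : modularFunctions Qbar).2
      (B u : modularFunctions Qbar).2 (hA u) (hB u)

theorem IsUnitAction.comp {σ ρ : AutM} {A B : ModularUnits Qbar →* ModularUnits Qbar}
    (hA : IsUnitAction σ A) (hB : IsUnitAction ρ B) : IsUnitAction (σ * ρ) (A.comp B) :=
  fun u F G h => hA (B u) _ _ (hB u F G h)

theorem isUnitAction_one : IsUnitAction 1 (MonoidHom.id _) := fun _ _ _ h => h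

end

section

open Complex (I)

/-! ### Siegel functions -/

theorem theta_add_nat (τ : ℍ) (z : ℂ) (n : ℕ) : theta τ (z + n) = (-1) ^ n * theta τ z := by
  induction n with
  | zero => simp
  | succ n ih =>
    push_cast
    rw [← add_assoc, theta_add_one, ih]
    ring

theorem theta_add_nat_mul_tau (τ : ℍ) (z : ℂ) (n : ℕ) : theta τ (z + n * τ) =
    (-1) ^ n * (ee (-(n ^ 2 * τ / 2)) * ee (-(n * z))) * theta τ z := by
  induction n with
  | zero => simp [ee_zero]
  | succ n ih =>
    push_cast
    rw [show z + (n + 1) * (τ : ℂ) = z + n * τ + τ by ring, theta_add_tau, ih]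
    have : ee (-(((n : ℂ) + 1) ^ 2 * τ / 2)) * ee (-((n + 1) * z)) = ee (-((τ : ℂ) / 2)) *
        ee (-(z + n * τ)) * (ee (-((n : ℂ) ^ 2 * τ / 2)) * ee (-(n * z))) := by
      rw [← ee_add, ← ee_add, ← ee_add, ← ee_add]
      congr 1
      ring
    rw [this]
    ring

/-- `24` divides `c² - 1` if `c` is prime to `6`. -/
theorem exists_sq_eq {c : ℕ} (h6 : c.Coprime 6) : ∃ k, c ^ 2 = 24 * k + 1 := by
  have h2 : c % 2 = 1 := by
    have := Nat.Coprime.coprime_dvd_right (by norm_num : 2 ∣ 6) h6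
    exact Nat.odd_iff.1 (Nat.coprime_two_right.1 this)
  have h3 : ¬ 3 ∣ c := by
    intro h
    have := Nat.Coprime.coprime_dvd_right (by norm_num : 3 ∣ 6) h6
    have h4 := Nat.dvd_gcd h (dvd_refl 3)
    rw [this] at h4
    omega
  have h24 : c % 24 = 1 ∨ c % 24 = 5 ∨ c % 24 = 7 ∨ c % 24 = 11 ∨ c % 24 = 13 ∨ c % 24 = 17 ∨
      c % 24 = 19 ∨ c % 24 = 23 := by omega
  have h5 : c ^ 2 % 24 = 1 := by
    rw [Nat.pow_mod]
    rcases h24 with h | h | h | h | h | h | h | h <;> rw [h]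
  exact ⟨c ^ 2 / 24, by omega⟩

theorem odd_of_coprime_six {c : ℕ} (h6 : c.Coprime 6) : Odd c :=
  Nat.coprime_two_right.1 (Nat.Coprime.coprime_dvd_right (by norm_num : 2 ∣ 6) h6)

/-- The function `g_{c, v}` for a row vector `v`. -/
abbrev siegelFun (c : ℕ) (v : Fin 2 → ℚ) : ℍ → ℂ := siegelFunction c (v 0) (v 1)

section

variable {c : ℕ}

theorem siegelFun_add_int (h6 : c.Coprime 6) (v : Fin 2 → ℚ) (a : Fin 2 → ℤ) :
    siegelFun c (fun i => v i + (a i : ℚ)) = siegelFun c v := by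
  have hodd := odd_of_coprime_six h6
  have h0 : Function.Periodic (siegelFun c) ![1, 0] := by
    intro v
    funext τ
    simp only [siegelFun, siegelFunction, Pi.add_apply, Matrix.cons_val_zero, Matrix.cons_val_one,
      Rat.cast_add, Rat.cast_one, add_zero]
    set z : ℂ := v 0 * τ + v 1 with hz
    rw [show ((v 0 : ℂ) + 1) * τ + v 1 = z + τ by rw [hz]; ring, theta_add_tau,
      show (c : ℂ) * (z + τ) = c * z + c * τ by ring, theta_add_nat_mul_tau, hodd.neg_one_pow,
      mul_pow, neg_pow, (hodd.pow (n := 2)).neg_one_pow]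
    have : (ee (-((τ : ℂ) / 2)) * ee (-z)) ^ c ^ 2 =
        ee (-((c : ℂ) ^ 2 * τ / 2)) * ee (-(c * (c * z))) := by
      rw [mul_pow, ← ee_nat_mul, ← ee_nat_mul]
      congr 2 <;> push_cast <;> ring
    rw [this, mul_div_mul_left]
    exact mul_ne_zero (by norm_num) (mul_ne_zero (ee_ne_zero _) (ee_ne_zero _))
  have h1 : Function.Periodic (siegelFun c) ![0, 1] := by
    intro v
    funext τ
    simp only [siegelFun, siegelFunction, Pi.add_apply, Matrix.cons_val_zero, Matrix.cons_val_one,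
      Rat.cast_add, Rat.cast_one, add_zero]
    rw [← add_assoc, theta_add_one, mul_add, mul_one, theta_add_nat, hodd.neg_one_pow, neg_pow,
      (hodd.pow (n := 2)).neg_one_pow, mul_div_mul_left _ _ (by norm_num)]
  rw [add_int_eq, ← add_assoc]
  rw [(h1.zsmul _), (h0.zsmul _)]

theorem siegelFun_smul (h6 : c.Coprime 6) (γ : SL(2, ℤ)) (v : Fin 2 → ℚ) (τ : ℍ) :
    siegelFun c v (γ • τ) = siegelFun c (vmul v γ.1) τ := by
  obtain ⟨k, hk⟩ := exists_sq_eq h6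
  suffices H : ∀ γ ∈ Subgroup.closure {ModularGroup.S, ModularGroup.T},
      ∀ v τ, siegelFun c v (γ • τ) = siegelFun c (vmul v γ.1) τ from
    H γ (by rw [SpecialLinearGroup.SL2Z_generators]; trivial) v τ
  intro γ hγ
  induction hγ using Subgroup.closure_induction with
  | mem γ hγ =>
    intro v τ
    rcases hγ with rfl | hγ
    · have hτ : (τ : ℂ) ≠ 0 := τ.ne_zero
      have e0 : vmul v ModularGroup.S.1 0 = v 1 := by simp [vmul_zero_apply, ModularGroup.S]
      have e1 : vmul v ModularGroup.S.1 1 = -v 0 := by simp [vmul_one_apply, ModularGroup.S]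
      simp only [siegelFun, siegelFunction, e0, e1, Rat.cast_neg]
      set z : ℂ := v 1 * τ + -v 0 with hz
      have hz' : (v 0 : ℂ) * ((ModularGroup.S • τ : ℍ) : ℂ) + v 1 = z / τ := by
        rw [coe_S_smul, hz]
        field_simp
        ring
      rw [hz', show (c : ℂ) * (z / τ) = c * z / τ by ring, theta_S, theta_S, mul_pow, mul_pow]
      have h1 : (-I) ^ c ^ 2 = -I := by
        rw [hk, pow_succ, show 24 * k = 4 * (6 * k) by ring, pow_mul, neg_pow, Complex.I_pow_four]
        norm_num
      have h2 : ee (z ^ 2 / (2 * τ)) ^ c ^ 2 = ee ((c * z) ^ 2 / (2 * τ)) := by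
        rw [← ee_nat_mul]
        congr 1
        push_cast
        ring
      rw [h1, h2, mul_div_mul_left]
      exact mul_ne_zero (neg_ne_zero.2 Complex.I_ne_zero) (ee_ne_zero _)
    · rw [Set.mem_singleton_iff.1 hγ]
      have e0 : vmul v ModularGroup.T.1 0 = v 0 := by simp [vmul_zero_apply, ModularGroup.T]
      have e1 : vmul v ModularGroup.T.1 1 = v 0 + v 1 := by simp [vmul_one_apply, ModularGroup.T]
      simp only [siegelFun, siegelFunction, e0, e1, Rat.cast_add]
      rw [coe_T_smul, theta_T, theta_T, show (v 0 : ℂ) * (τ + 1) + v 1 = v 0 * τ + (v 0 + v 1) by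
        ring, mul_pow]
      have h1 : ee (1 / 12) ^ c ^ 2 = ee (1 / 12) := by
        rw [← ee_nat_mul, hk]
        rw [show ((24 * k + 1 : ℕ) : ℂ) * (1 / 12) = 1 / 12 + ((2 * k : ℤ) : ℂ) by
          push_cast; ring, ee_add_int]
      rw [h1, mul_div_mul_left _ _ (ee_ne_zero _)]
  | one => intro v τ; simp [vmul_one]
  | mul γ δ _ _ hγ hδ =>
    intro v τ
    rw [mul_smul, hγ, hδ, ← vmul_mul]
    rfl
  | inv γ _ hγ =>
    intro v τ
    have := hγ (vmul v (γ⁻¹).1) (γ⁻¹ • τ)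
    rw [smul_inv_smul, ← vmul_mul, ← Matrix.SpecialLinearGroup.coe_mul, inv_mul_cancel] at this
    rw [this]
    simp [vmul_one]

/-- `v` is not an integral vector. -/
def NonInt (v : Fin 2 → ℚ) : Prop := ∀ m n : ℤ, ¬ (v 0 = m ∧ v 1 = n)

theorem sv_ne_zero {v : Fin 2 → ℚ} (hv : NonInt v) (τ : ℍ) : sv v τ ≠ 0 :=
  mul_ne_zero (ee_ne_zero _) (theta_division_ne_zero hv τ)

theorem siegelFun_eq (c : ℕ) (v : Fin 2 → ℚ) (τ : ℍ) :
    siegelFun c v τ = sv v τ ^ c ^ 2 / sv (fun i => c * v i) τ := by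
  simp only [siegelFun, siegelFunction, sv]
  rw [mul_pow, ← ee_nat_mul]
  push_cast
  rw [show (c : ℂ) ^ 2 * ((v 0 : ℂ) ^ 2 * τ / 2) = (c * v 0) ^ 2 * τ / 2 by ring,
    mul_div_mul_left _ _ (ee_ne_zero _),
    show (c : ℂ) * v 0 * τ + c * v 1 = c * (v 0 * τ + v 1) by ring]

/-- If `(c - 1) v` is integral, then `g_{c, v}` is `s_v ^ (c² - 1)` up to a root of unity. -/
theorem siegelFun_rootEquiv (hc : 2 < c) {v : Fin 2 → ℚ} (hv : NonInt v) {a : Fin 2 → ℤ}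
    (ha : ∀ i, ((c : ℚ) - 1) * v i = a i) :
    RootEquiv (siegelFun c v) (sv v ^ (c ^ 2 - 1)) := by
  have h1 : (fun i => (c : ℚ) * v i) = fun i => v i + (a i : ℚ) := by
    funext i
    rw [← ha i]
    ring
  obtain ⟨ζ, n, hn, hζ, h⟩ := (sv_add_int v a).symm
  refine ⟨ζ, n, hn, hζ, fun τ => ?_⟩
  have h2 := sv_ne_zero hv τ
  rw [siegelFun_eq, h1, Pi.pow_apply]
  have h3 := h τ
  have h4 : sv (fun i => v i + (a i : ℚ)) τ ≠ 0 := fun h0 => h2 (by rw [h3, h0, mul_zero])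
  rw [div_eq_iff h4]
  calc sv v τ ^ c ^ 2 = sv v τ * sv v τ ^ (c ^ 2 - 1) := by
        rw [← pow_succ', Nat.sub_add_cancel (Nat.one_le_pow _ _ (by omega))]
    _ = _ := by
        conv_lhs => rw [h3]
        conv_rhs => rw [h3]
        ring

end

/-! ### Conjugation of the coefficients of Siegel functions -/

section

variable {s : Qcycl →+* ℂ}

theorem root_mem_Qcycl {ζ : ℂ} {n : ℕ} (hn : 0 < n) (hζ : ζ ^ n = 1) : ζ ∈ Qcycl :=
  IntermediateField.subset_adjoin _ _ ⟨n, hn, hζ⟩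

theorem conj_rootEquiv {f f' g : ℍ → ℂ} (h : Conj s f f') (hg : RootEquiv g f) :
    ∃ g', Conj s g g' ∧ RootEquiv g' f' := by
  obtain ⟨ζ, n, hn, hζ, h1⟩ := hg
  set z : Qcycl := ⟨ζ, root_mem_Qcycl hn hζ⟩ with hz
  refine ⟨_, ?_, s z, n, hn, ?_, fun τ => rfl⟩
  · have := (Conj.const (s := s) z).mul h
    convert this using 1
    · funext τ
      exact h1 τ
    · rfl
  · rw [← map_pow, show z ^ n = 1 from Subtype.ext hζ, map_one]

theorem conj_ee_mul (s : Qcycl →+* ℂ) (r : ℚ) :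
    Conj s (fun τ : ℍ => ee (r * τ)) (fun τ : ℍ => ee (r * τ)) := by
  rcases le_total 0 r with hr | hr
  · exact (conjAt_ee_mul s hr).conj
  · have := (conjAt_ee_mul s (neg_nonneg.2 hr)).conj.inv (fun _ => ee_ne_zero _)
      (fun _ => ee_ne_zero _)
    convert this using 1 <;>
    · funext τ
      simp [ee_neg]

theorem sv_eq (v : Fin 2 → ℚ) (τ : ℍ) : sv v τ = ee ((1 / 2 - v 1 / 2 : ℚ) : ℂ) *
    (ee ((v 0 ^ 2 / 2 + 1 / 12 - v 0 / 2 : ℚ) * τ) * (W τ (v 0 * τ + v 1) *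
      W τ ((1 - v 0 : ℚ) * τ + -(v 1 : ℂ)))) := by
  simp only [sv, theta_eq]
  have e1 : ee ((1 / 2 - v 1 / 2 : ℚ) : ℂ) * ee ((v 0 ^ 2 / 2 + 1 / 12 - v 0 / 2 : ℚ) * τ) =
      -(ee ((v 0 : ℂ) ^ 2 * τ / 2) * (ee (τ / 12) * ee (-((v 0 * τ + v 1) / 2)))) := by
    rw [neg_eq_neg_one_mul, ← ee_half, ← ee_add, ← ee_add, ← ee_add, ← ee_add]
    congr 1
    push_cast
    ring
  rw [show (τ : ℂ) - (v 0 * τ + v 1) = ((1 - v 0 : ℚ) : ℂ) * τ + -(v 1 : ℂ) by push_cast; ring]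
  linear_combination (-(W τ (v 0 * τ + v 1) *
    W τ (((1 - v 0 : ℚ) : ℂ) * τ + -(v 1 : ℂ)))) * e1

theorem conj_sv_of_lt {v : Fin 2 → ℚ} (h0 : 0 ≤ v 0) (h1 : v 0 < 1) {j : ℤ}
    (hs : s (rootQ (v 1)) = ee ((j * v 1 : ℚ) : ℂ)) :
    ∃ f', Conj s (sv v) f' ∧ RootEquiv f' (sv ![v 0, j * v 1]) := by
  have hs' : s (rootQ (v 1))⁻¹ = ee (-((j * v 1 : ℚ) : ℂ)) := by rw [map_inv₀, hs, ee_neg]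
  have hW1 := (conjAt_W s h0 (rootQ_coe _) hs).conj
  have hW2 := (conjAt_W s (sub_nonneg.2 h1.le) (ζ := (rootQ (v 1))⁻¹) (β := -(v 1 : ℂ)) (by
    rw [ee_neg, ← rootQ_coe]
    rfl) hs').conj
  have H := (conj_ee_mul s (v 0 ^ 2 / 2 + 1 / 12 - v 0 / 2)).mul (hW1.mul hW2)
  have key : ∀ b : ℚ, RootEquiv (sv ![v 0, b]) ((fun τ : ℍ =>
      ee ((v 0 ^ 2 / 2 + 1 / 12 - v 0 / 2 : ℚ) * τ)) * ((fun τ : ℍ => W τ (v 0 * τ + b)) *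
        fun τ : ℍ => W τ ((1 - v 0 : ℚ) * τ + -(b : ℂ)))) := by
    intro b
    exact RootEquiv.of_ee (1 / 2 - b / 2) fun τ => sv_eq ![v 0, b] τ
  have hv : sv v = sv ![v 0, v 1] := by
    congr 1
    funext i
    fin_cases i <;> rfl
  obtain ⟨f', hf, hf'⟩ := conj_rootEquiv H (key (v 1))
  exact ⟨f', hv ▸ hf, hf'.trans (key (j * v 1)).symm⟩

/-- Conjugation of the coefficients maps `s_v` to `s_{v diag(1, j)}`, up to a root of unity. -/
theorem conj_sv (v : Fin 2 → ℚ) {j : ℤ} (hs : s (rootQ (v 1)) = ee ((j * v 1 : ℚ) : ℂ)) :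
    ∃ f', Conj s (sv v) f' ∧ RootEquiv f' (sv (vmul v (diagOne j))) := by
  have h1 := sv_add_int v ![-⌊v 0⌋, 0]
  obtain ⟨f', hf, hf'⟩ := conj_sv_of_lt (s := s) (v := fun i => v i + ((![-⌊v 0⌋, 0] i : ℤ) : ℚ))
    (j := j) (by simpa using Int.floor_le (v 0))
    (by
      have := Int.lt_floor_add_one (v 0)
      simp
      linarith) (by simpa using hs)
  obtain ⟨g', hg, hg'⟩ := conj_rootEquiv hf h1.symm
  refine ⟨g', hg, (hg'.trans hf').trans ?_⟩
  have h2 := sv_add_int (vmul v (diagOne j)) ![-⌊v 0⌋, 0]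
  convert h2 using 2
  funext i
  fin_cases i
  · simp [vmul_zero_apply, diagOne]
  · simp [vmul_one_apply, diagOne, mul_comm]

theorem conj_siegelFun {c : ℕ} (hc : 2 < c) {v : Fin 2 → ℚ} (hv : NonInt v) {a : Fin 2 → ℤ}
    (ha : ∀ i, ((c : ℚ) - 1) * v i = a i) {j : ℤ}
    (hs : s (rootQ (v 1)) = ee ((j * v 1 : ℚ) : ℂ)) : ∃ f', Conj s (siegelFun c v) f' ∧
      RootEquiv f' (sv (vmul v (diagOne j)) ^ (c ^ 2 - 1)) := by
  obtain ⟨f', hf, hf'⟩ := conj_sv v hs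
  obtain ⟨g', hg, hg'⟩ := conj_rootEquiv (hf.pow (c ^ 2 - 1)) (siegelFun_rootEquiv hc hv ha)
  exact ⟨g', hg, hg'.trans (hf'.pow _)⟩

end

end

section

open Filter Topology

/-! ### Products of Siegel functions -/

@[to_additive sum_range_mul_eq]
theorem prod_range_mul_eq {M : Type*} [CommMonoid M] (f : ℕ → M) (d m : ℕ) :
    ∏ n ∈ Finset.range (d * m), f n =
      ∏ j ∈ Finset.range d, ∏ i ∈ Finset.range m, f (d * i + j) := by
  induction m with
  | zero => simp
  | succ m ih =>
    rw [Nat.mul_succ, Finset.prod_range_add, ih, ← Finset.prod_mul_distrib]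
    exact Finset.prod_congr rfl fun j _ => (Finset.prod_range_succ _ _).symm

theorem prod_W_mul {t : ℂ} (ht : 0 < t.im) {d : ℕ} (hd : 0 < d) (z : ℂ) :
    ∏ j ∈ Finset.range d, W (d * t) (z + j * t) = W t z := by
  have hdt : 0 < ((d : ℂ) * t).im := by
    rw [← Complex.ofReal_natCast, Complex.im_ofReal_mul]
    positivity
  have h1 := (hasProd_W ht z).tendsto_prod_nat.comp
    (tendsto_id.const_mul_atTop' hd : Tendsto (fun m : ℕ => d * m) atTop atTop)
  have h2 := tendsto_finsetProd (Finset.range d) fun j _ =>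
    (hasProd_W hdt (z + j * t)).tendsto_prod_nat
  refine tendsto_nhds_unique h2 (h1.congr fun m => ?_)
  rw [Function.comp_apply, prod_range_mul_eq]
  refine Finset.prod_congr rfl fun j _ => Finset.prod_congr rfl fun i _ => ?_
  congr 2
  push_cast
  ring

theorem prod_one_sub_ee {d : ℕ} (hd : 0 < d) (y : ℂ) :
    ∏ j ∈ Finset.range d, (1 - ee (y + j / d)) = 1 - ee (d * y) := by
  have hd0 : (d : ℂ) ≠ 0 := by exact_mod_cast hd.ne'
  have hζ : IsPrimitiveRoot (ee (1 / d)) d := by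
    have := Complex.isPrimitiveRoot_exp d hd.ne'
    rwa [ee, mul_one_div]
  have h := congrArg (Polynomial.eval 1) (X_pow_sub_C_eq_prod hζ hd (ee_nat_mul d y).symm)
  rw [Polynomial.eval_prod] at h
  simp only [Polynomial.eval_sub, Polynomial.eval_pow, Polynomial.eval_X, Polynomial.eval_C,
    one_pow] at h
  rw [h]
  refine Finset.prod_congr rfl fun j _ => ?_
  rw [← ee_nat_mul, ← ee_add]
  congr 2
  ring

theorem prod_W_add_div {t : ℂ} (ht : 0 < t.im) {d : ℕ} (hd : 0 < d) (x : ℂ) :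
    ∏ j ∈ Finset.range d, W t (x + j / d) = W (d * t) (d * x) := by
  have hdt : 0 < ((d : ℂ) * t).im := by
    rw [← Complex.ofReal_natCast, Complex.im_ofReal_mul]
    positivity
  have h1 := hasProd_prod (s := Finset.range d) fun j _ => hasProd_W ht (x + j / d)
  have h2 : (fun n : ℕ => ∏ j ∈ Finset.range d, (1 - ee (n * t + (x + j / d)))) =
      fun n : ℕ => 1 - ee (n * (d * t) + d * x) := by
    funext n
    have h3 := prod_one_sub_ee hd (n * t + x)
    rw [show (d : ℂ) * (n * t + x) = n * (d * t) + d * x by ring] at h3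
    rw [← h3]
    exact Finset.prod_congr rfl fun j _ => by rw [add_assoc]
  rw [h2] at h1
  exact h1.unique (hasProd_W hdt (d * x))

theorem prod_W_sub_div {t : ℂ} (ht : 0 < t.im) {d : ℕ} (hd : 0 < d) (x : ℂ) :
    ∏ j ∈ Finset.range d, W t (x - j / d) = W (d * t) (d * x) := by
  have hd0 : (d : ℂ) ≠ 0 := by exact_mod_cast hd.ne'
  rw [← Finset.prod_range_reflect]
  have h := prod_W_add_div ht hd (x - (d - 1 : ℕ) / d)
  rw [mul_sub, mul_div_cancel₀ _ hd0, ← W_add_int _ _ ((d - 1 : ℕ) : ℤ), Int.cast_natCast,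
    sub_add_cancel] at h
  rw [← h]
  refine Finset.prod_congr rfl fun j hj => ?_
  congr 1
  rw [Nat.cast_sub (by have := Finset.mem_range.1 hj; omega)]
  ring

theorem ee_sum {ι : Type*} (s : Finset ι) (f : ι → ℂ) : ee (∑ i ∈ s, f i) = ∏ i ∈ s, ee (f i) := by
  classical
  induction s using Finset.induction_on with
  | empty => simp [ee_zero]
  | insert i s hi ih => rw [Finset.sum_insert hi, Finset.prod_insert hi, ee_add, ih]

variable {d : ℕ} {δ : ℍ → ℍ}

/-- The distribution relation of the second Bernoulli polynomial. -/
theorem sum_bernoulli (hd : 0 < d) (x : ℚ) : ∑ j ∈ Finset.range d,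
    (d * (((x + j) / d) ^ 2 / 2 + 1 / 12 - ((x + j) / d) / 2)) = x ^ 2 / 2 + 1 / 12 - x / 2 := by
  have hd0 : (d : ℚ) ≠ 0 := by exact_mod_cast hd.ne'
  have h : ∀ n : ℕ, ∑ j ∈ Finset.range n,
      (d * (((x + j) / d) ^ 2 / 2 + 1 / 12 - ((x + j) / d) / 2)) =
      (n * x ^ 2 + n * (n - 1) * x + n * (n - 1) * (2 * n - 1) / 6) / (2 * d) + n * d / 12 -
        (n * x + n * (n - 1) / 2) / 2 := by
    intro n
    induction n with
    | zero => simp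
    | succ n ih =>
      rw [Finset.sum_range_succ, ih]
      push_cast
      field_simp
      ring
  rw [h]
  field_simp
  ring

/-- The relation behind the invariance of the Siegel distribution under `diag(d, 1)`: the factors
`q^n q_z` of the functions at `d τ` run through those of the function at `τ`. -/
theorem prod_sv_scale (hd : 0 < d) (hδ : ∀ τ, (δ τ : ℂ) = d * τ) (x y : ℚ) :
    RootEquiv (fun τ => ∏ j ∈ Finset.range d, sv ![(x + j) / d, y] (δ τ)) (sv ![x, y]) := by
  have hd0 : (d : ℂ) ≠ 0 := by exact_mod_cast hd.ne'
  refine RootEquiv.of_ee ((d - 1) * (1 / 2 - y / 2)) fun τ => ?_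
  simp only [sv_eq, hδ, Matrix.cons_val_zero, Matrix.cons_val_one]
  rw [Finset.prod_mul_distrib, Finset.prod_mul_distrib, Finset.prod_mul_distrib, ← ee_sum,
    ← ee_sum]
  have h1 : ∏ j ∈ Finset.range d, W (d * τ) (((x + j) / d : ℚ) * (d * τ) + y) =
      W τ (x * τ + y) := by
    rw [← prod_W_mul τ.im_pos hd]
    refine Finset.prod_congr rfl fun j _ => ?_
    congr 1
    push_cast
    field_simp
    ring
  have h2 : ∏ j ∈ Finset.range d, W (d * τ) ((1 - (x + j) / d : ℚ) * (d * τ) + -(y : ℂ)) =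
      W τ ((1 - x : ℚ) * τ + -(y : ℂ)) := by
    rw [← prod_W_mul τ.im_pos hd, ← Finset.prod_range_reflect]
    refine Finset.prod_congr rfl fun j hj => ?_
    congr 1
    rw [Nat.sub_sub, Nat.cast_sub (by have := Finset.mem_range.1 hj; omega)]
    push_cast
    field_simp
    ring
  rw [h1, h2]
  have h3 : ∑ j ∈ Finset.range d, ((((x + j) / d) ^ 2 / 2 + 1 / 12 - (x + j) / d / 2 : ℚ) : ℂ) *
      (d * τ) = ((x ^ 2 / 2 + 1 / 12 - x / 2 : ℚ) : ℂ) * τ := by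
    rw [← sum_bernoulli hd x, Rat.cast_sum, Finset.sum_mul]
    refine Finset.sum_congr rfl fun j _ => ?_
    push_cast
    ring
  have h4 : ee (d * ((1 / 2 - y / 2 : ℚ) : ℂ)) =
      ee (((d - 1) * (1 / 2 - y / 2) : ℚ) : ℂ) * ee ((1 / 2 - y / 2 : ℚ) : ℂ) := by
    rw [← ee_add]
    congr 1
    push_cast
    ring
  rw [h3, Finset.sum_const, Finset.card_range, nsmul_eq_mul, h4]
  ring

/-- The relation in the second coordinate, from `∏ (1 - ζ X) = 1 - X ^ d` over the `d`-th roots of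
unity `ζ`. -/
theorem prod_sv_div (hd : 0 < d) (hδ : ∀ τ, (δ τ : ℂ) = d * τ) (x y : ℚ) :
    RootEquiv (fun τ => ∏ j ∈ Finset.range d, sv ![x, (y + j) / d] τ)
      (fun τ => sv ![x, y] (δ τ)) := by
  have hd0 : (d : ℂ) ≠ 0 := by exact_mod_cast hd.ne'
  refine RootEquiv.of_ee (∑ j ∈ Finset.range d, (1 / 2 - (y + j) / d / 2) - (1 / 2 - y / 2))
    fun τ => ?_
  simp only [sv_eq, hδ, Matrix.cons_val_zero, Matrix.cons_val_one]
  rw [Finset.prod_mul_distrib, Finset.prod_mul_distrib, Finset.prod_mul_distrib, ← ee_sum,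
    ← ee_sum]
  have h1 : ∏ j ∈ Finset.range d, W τ (x * τ + ((y + j) / d : ℚ)) =
      W (d * τ) (x * (d * τ) + y) := by
    rw [show (x : ℂ) * (d * τ) + y = d * (x * τ + y / d) by field_simp,
      ← prod_W_add_div τ.im_pos hd]
    refine Finset.prod_congr rfl fun j _ => ?_
    congr 1
    push_cast
    ring
  have h2 : ∏ j ∈ Finset.range d, W τ ((1 - x : ℚ) * τ + -(((y + j) / d : ℚ) : ℂ)) =
      W (d * τ) ((1 - x : ℚ) * (d * τ) + -(y : ℂ)) := by
    rw [show ((1 - x : ℚ) : ℂ) * (d * τ) + -(y : ℂ) =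
        d * ((1 - x : ℚ) * τ - y / d) by field_simp; ring,
      ← prod_W_sub_div τ.im_pos hd]
    refine Finset.prod_congr rfl fun j _ => ?_
    congr 1
    push_cast
    ring
  have h3 : ee (∑ j ∈ Finset.range d, ((1 / 2 - (y + j) / d / 2 : ℚ) : ℂ)) =
      ee ((∑ j ∈ Finset.range d, (1 / 2 - (y + j) / d / 2) - (1 / 2 - y / 2) : ℚ) : ℂ) *
        ee ((1 / 2 - y / 2 : ℚ) : ℂ) := by
    rw [← ee_add, ← Rat.cast_add, sub_add_cancel, Rat.cast_sum]
  have h4 : (d : ℂ) * (((x ^ 2 / 2 + 1 / 12 - x / 2 : ℚ) : ℂ) * τ) =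
      ((x ^ 2 / 2 + 1 / 12 - x / 2 : ℚ) : ℂ) * (d * τ) := by ring
  rw [h1, h2, h3, Finset.sum_const, Finset.card_range, nsmul_eq_mul, h4]
  ring

/-- The distribution relation, a combination of the relations for the two coordinates. -/
theorem prod_prod_sv (hd : 0 < d) (x y : ℚ) :
    RootEquiv (fun τ => ∏ j ∈ Finset.range d, ∏ k ∈ Finset.range d,
      sv ![(x + j) / d, (y + k) / d] τ) (sv ![x, y]) := by
  let δ : ℍ → ℍ := fun τ => ⟨d * τ, by
    have := τ.im_pos
    rw [← Complex.ofReal_natCast, Complex.im_ofReal_mul]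
    exact mul_pos (by exact_mod_cast hd) this⟩
  have hδ : ∀ τ, (δ τ : ℂ) = d * τ := fun τ => rfl
  have h1 := RootEquiv.prod (Finset.range d) fun j _ => prod_sv_div hd hδ ((x + j) / d) y
  have h2 := prod_sv_scale hd hδ x y
  have e1 : (fun τ => ∏ j ∈ Finset.range d, sv ![(x + j) / d, y] (δ τ)) =
      ∏ j ∈ Finset.range d, fun τ => sv ![(x + j) / d, y] (δ τ) := by
    funext τ
    rw [Finset.prod_apply]
  have e2 : (fun τ => ∏ j ∈ Finset.range d, ∏ k ∈ Finset.range d,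
      sv ![(x + j) / d, (y + k) / d] τ) = ∏ j ∈ Finset.range d, fun τ =>
        ∏ k ∈ Finset.range d, sv ![(x + j) / d, (y + k) / d] τ := by
    funext τ
    rw [Finset.prod_apply]
  rw [e2]
  exact h1.trans (e1 ▸ h2)

end

section

/-! ### Siegel units -/

/-- `N v` is integral. -/
def HasDen (N : ℕ) (v : Fin 2 → ℚ) : Prop := ∃ a : Fin 2 → ℤ, ∀ i, (N : ℚ) * v i = a i

section

variable {N : ℕ} {v : Fin 2 → ℚ}

theorem HasDen.vmul (h : HasDen N v) (A : Matrix (Fin 2) (Fin 2) ℤ) : HasDen N (vmul v A) := by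
  obtain ⟨a, ha⟩ := h
  refine ⟨Matrix.vecMul a A, fun i => ?_⟩
  have h0 := ha 0
  have h1 := ha 1
  fin_cases i
  · simp only [Fin.zero_eta, vmul_zero_apply, Matrix.vecMul, dotProduct, Fin.sum_univ_two]
    push_cast
    linear_combination (A 0 0 : ℚ) * h0 + (A 1 0 : ℚ) * h1
  · simp only [Fin.mk_one, vmul_one_apply, Matrix.vecMul, dotProduct, Fin.sum_univ_two]
    push_cast
    linear_combination (A 0 1 : ℚ) * h0 + (A 1 1 : ℚ) * h1

/-- Matrices which are congruent modulo `N` map a vector of denominator `N` to vectors with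
integral difference. -/
theorem HasDen.vmul_congr (h : HasDen N v) {A B : Matrix (Fin 2) (Fin 2) ℤ}
    (hAB : ∀ i j, (N : ℤ) ∣ A i j - B i j) :
    ∃ b : Fin 2 → ℤ, SiegelDistribution.vmul v A =
      fun i => SiegelDistribution.vmul v B i + (b i : ℚ) := by
  obtain ⟨a, ha⟩ := h
  choose e he using hAB
  have he' : ∀ i j, (A i j : ℚ) = B i j + N * e i j := fun i j => by
    have := he i j
    have h2 : A i j = B i j + N * e i j := by linarith
    exact_mod_cast h2
  have h0 := ha 0
  have h1 := ha 1
  refine ⟨fun i => a 0 * e 0 i + a 1 * e 1 i, ?_⟩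
  funext i
  fin_cases i
  · simp only [Fin.zero_eta, vmul_zero_apply, he']
    push_cast
    linear_combination (e 0 0 : ℚ) * h0 + (e 1 0 : ℚ) * h1
  · simp only [Fin.mk_one, vmul_one_apply, he']
    push_cast
    linear_combination (e 0 1 : ℚ) * h0 + (e 1 1 : ℚ) * h1

theorem NonInt.add_int (hv : NonInt v) (a : Fin 2 → ℤ) : NonInt fun i => v i + (a i : ℚ) := by
  rintro m n ⟨h1, h2⟩
  refine hv (m - a 0) (n - a 1) ⟨?_, ?_⟩
  · push_cast
    linarith
  · push_cast
    linarith

theorem NonInt.vmul (hv : NonInt v) {A B : Matrix (Fin 2) (Fin 2) ℤ} (hN : HasDen N v)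
    (hAB : ∀ i j, (N : ℤ) ∣ (A * B) i j - (1 : Matrix (Fin 2) (Fin 2) ℤ) i j) :
    NonInt (SiegelDistribution.vmul v A) := by
  rintro m n ⟨h0, h1⟩
  obtain ⟨b, hb⟩ := hN.vmul_congr hAB
  rw [vmul_mul, vmul_one] at hb
  have e0 := congrFun hb 0
  have e1 := congrFun hb 1
  rw [vmul_zero_apply, h0, h1] at e0
  rw [vmul_one_apply, h0, h1] at e1
  refine hv (m * B 0 0 + n * B 1 0 - b 0) (m * B 0 1 + n * B 1 1 - b 1) ⟨?_, ?_⟩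
  · push_cast
    linarith
  · push_cast
    linarith

theorem NonInt.vmul_SL (hv : NonInt v) (hN : HasDen N v) (γ : SL(2, ℤ)) :
    NonInt (SiegelDistribution.vmul v γ.1) :=
  hv.vmul (B := (γ⁻¹).1) hN fun i j => by
    rw [← Matrix.SpecialLinearGroup.coe_mul, mul_inv_cancel]
    simp

end

/-- The conditions on `c` and `v` under which `g_{c, v}` is a modular unit. -/
structure IsSiegelPair (c : ℕ) (v : Fin 2 → ℚ) : Prop where
  two_lt : 2 < c
  coprime : c.Coprime 6
  nonInt : NonInt v
  hasDen : HasDen (c - 1) v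

namespace IsSiegelPair

variable {c : ℕ} {v : Fin 2 → ℚ}

theorem exists_int (h : IsSiegelPair c v) :
    ∃ a : Fin 2 → ℤ, ∀ i, ((c : ℚ) - 1) * v i = a i := by
  obtain ⟨a, ha⟩ := h.hasDen
  refine ⟨a, fun i => ?_⟩
  rw [← ha i, Nat.cast_sub (by have := h.two_lt; omega)]
  simp

theorem vmul_SL (h : IsSiegelPair c v) (γ : SL(2, ℤ)) : IsSiegelPair c (vmul v γ.1) :=
  ⟨h.two_lt, h.coprime, h.nonInt.vmul_SL h.hasDen γ, h.hasDen.vmul _⟩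

theorem rootEquiv (h : IsSiegelPair c v) : RootEquiv (siegelFun c v) (sv v ^ (c ^ 2 - 1)) := by
  obtain ⟨a, ha⟩ := h.exists_int
  exact siegelFun_rootEquiv h.two_lt h.nonInt ha

theorem ne_zero (h : IsSiegelPair c v) (τ : ℍ) : siegelFun c v τ ≠ 0 := by
  obtain ⟨ζ, n, hn, hζ, H⟩ := h.rootEquiv
  rw [H]
  refine mul_ne_zero ?_ (pow_ne_zero _ (sv_ne_zero h.nonInt τ))
  rintro rfl
  rw [zero_pow hn.ne'] at hζ
  exact zero_ne_one hζ

theorem conj (h : IsSiegelPair c v) {s : Qcycl →+* ℂ} {j : ℤ}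
    (hs : s (rootQ (v 1)) = ee ((j * v 1 : ℚ) : ℂ)) : ∃ f', Conj s (siegelFun c v) f' ∧
      RootEquiv f' (sv (vmul v (diagOne j)) ^ (c ^ 2 - 1)) := by
  obtain ⟨a, ha⟩ := h.exists_int
  exact conj_siegelFun h.two_lt h.nonInt ha hs

theorem hasLaurentOver (h : IsSiegelPair c v) : HasLaurentOver Qcycl (siegelFun c v) := by
  obtain ⟨f', hf, -⟩ := h.conj (s := algebraMap Qcycl ℂ) (j := 1) (by
    rw [Int.cast_one, one_mul]
    exact rootQ_coe _)
  exact hf.hasLaurentOver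

theorem neZero (h : IsSiegelPair c v) : NeZero (c - 1) := ⟨by have := h.two_lt; omega⟩

theorem smul_eq (h : IsSiegelPair c v) {γ : SL(2, ℤ)}
    (hγ : γ ∈ CongruenceSubgroup.Gamma (c - 1)) (τ : ℍ) :
    siegelFun c v (γ • τ) = siegelFun c v τ := by
  obtain ⟨b, hb⟩ := h.hasDen.vmul_congr (A := γ.1) (B := 1) fun i j => by
    rw [CongruenceSubgroup.Gamma_mem'] at hγ
    have := congrArg (fun δ : SL(2, ZMod (c - 1)) => δ i j) hγ
    rw [← ZMod.intCast_eq_intCast_iff_dvd_sub]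
    refine (Eq.trans ?_ this.symm)
    fin_cases i <;> fin_cases j <;> simp
  rw [siegelFun_smul h.coprime, hb, vmul_one, siegelFun_add_int h.coprime]

theorem isModularFunction (h : IsSiegelPair c v) :
    IsModularFunction (CongruenceSubgroup.Gamma (c - 1)) (siegelFun c v) where
  holo := h.hasLaurentOver.mdifferentiable
  invariant _ hγ τ := h.smul_eq hγ τ
  merom γ := by
    have := ((h.vmul_SL γ).hasLaurentOver).mono le_top
    exact (funext fun τ => siegelFun_smul h.coprime γ v τ) ▸ this

theorem isModularFunction_inv (h : IsSiegelPair c v) :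
    IsModularFunction (CongruenceSubgroup.Gamma (c - 1)) (siegelFun c v)⁻¹ where
  holo := (h.hasLaurentOver.inv h.ne_zero).mdifferentiable
  invariant _ hγ τ := congrArg Inv.inv (h.smul_eq hγ τ)
  merom γ := by
    have := ((h.vmul_SL γ).hasLaurentOver.inv (h.vmul_SL γ).ne_zero).mono le_top
    exact (funext fun τ => congrArg Inv.inv (siegelFun_smul h.coprime γ v τ)) ▸ this

/-- The function `g_{c, v}` as a modular unit. -/
def unit (h : IsSiegelPair c v) : ModularUnits Qcycl :=
  have := h.neZero
  { val := ⟨siegelFun c v, ⟨_, inferInstance, h.isModularFunction⟩, h.hasLaurentOver⟩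
    inv := ⟨(siegelFun c v)⁻¹, ⟨_, inferInstance, h.isModularFunction_inv⟩,
      h.hasLaurentOver.inv h.ne_zero⟩
    val_inv := Subtype.ext (funext fun τ => mul_inv_cancel₀ (h.ne_zero τ))
    inv_val := Subtype.ext (funext fun τ => inv_mul_cancel₀ (h.ne_zero τ)) }

end IsSiegelPair

/-! ### Elements of `ℚ ⊗ 𝒰` represented by functions -/

/-- The function underlying a modular unit. -/
abbrev unitFun {K : IntermediateField ℚ ℂ} (u : ModularUnits K) : ℍ → ℂ :=
  (u : modularFunctions K).1

/-- The element `x` of `ℚ ⊗ 𝒰(K)` is represented by the function `f`: it is of the form `u / n`,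
and some power of the modular unit `u` is a power of `f ^ n`. For example `f` can be the function
`s_v`, which is not a modular unit. -/
def Rep {K : IntermediateField ℚ ℂ} (x : QModularUnits K) (f : ℍ → ℂ) : Prop :=
  ∃ (n m : ℕ) (u : ModularUnits K), 0 < n ∧ 0 < m ∧
    x = (1 / (n : ℚ)) ⊗ₜ[ℤ] Additive.ofMul u ∧ unitFun u ^ m = f ^ (n * m)

section

variable {K L : IntermediateField ℚ ℂ}

theorem unitFun_pow (u : ModularUnits K) (n : ℕ) : unitFun (u ^ n) = unitFun u ^ n := by
  simp [unitFun]

theorem unitFun_mul (u v : ModularUnits K) : unitFun (u * v) = unitFun u * unitFun v := by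
  simp [unitFun]

theorem unitFun_injective : Function.Injective (unitFun : ModularUnits K → ℍ → ℂ) :=
  fun _ _ h => Units.ext (Subtype.ext h)

theorem tmul_pow (n : ℕ) {k : ℕ} (hk : 0 < k) (u : ModularUnits K) :
    (1 / (n : ℚ)) ⊗ₜ[ℤ] Additive.ofMul u =
      (1 / ((n * k : ℕ) : ℚ)) ⊗ₜ[ℤ] Additive.ofMul (u ^ k) := by
  have hk0 : (k : ℚ) ≠ 0 := by exact_mod_cast hk.ne'
  have h1 : Additive.ofMul (u ^ k) = (k : ℤ) • Additive.ofMul u := by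
    rw [natCast_zsmul]
    rfl
  rw [h1]
  refine Eq.trans ?_ (TensorProduct.smul_tmul (k : ℤ) (1 / ((n * k : ℕ) : ℚ)) (Additive.ofMul u))
  congr 1
  rw [zsmul_eq_mul]
  push_cast
  field_simp

theorem Rep.unique {x y : QModularUnits K} {f : ℍ → ℂ} (hx : Rep x f) (hy : Rep y f) : x = y := by
  obtain ⟨n, m, u, hn, hm, rfl, h⟩ := hx
  obtain ⟨n', m', u', hn', hm', rfl, h'⟩ := hy
  have e1 : n * (m * n' * m') = n' * (m' * n * m) := by ring
  have e2 : u ^ (m * n' * m') = u' ^ (m' * n * m) := by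
    apply unitFun_injective
    rw [unitFun_pow, unitFun_pow, mul_assoc m, mul_assoc m', pow_mul, h, pow_mul (unitFun u'), h',
      ← pow_mul, ← pow_mul]
    congr 1
    ring
  rw [tmul_pow n (k := m * n' * m') (by positivity), tmul_pow n' (k := m' * n * m) (by positivity),
    e1, e2]

theorem Rep.add {x y : QModularUnits K} {f g : ℍ → ℂ} (hx : Rep x f) (hy : Rep y g) :
    Rep (x + y) (f * g) := by
  obtain ⟨n, m, u, hn, hm, rfl, h⟩ := hx
  obtain ⟨n', m', u', hn', hm', rfl, h'⟩ := hy
  refine ⟨n * n', m * m', u ^ n' * u' ^ n, by positivity, by positivity, ?_, ?_⟩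
  · rw [tmul_pow n hn' u, tmul_pow n' hn u', mul_comm n' n, ← TensorProduct.tmul_add]
    rfl
  · rw [unitFun_mul, unitFun_pow, unitFun_pow, mul_pow, mul_pow]
    have e1 : (unitFun u ^ n') ^ (m * m') = (unitFun u ^ m) ^ (n' * m') := by
      rw [← pow_mul, ← pow_mul]
      congr 1
      ring
    have e2 : (unitFun u' ^ n) ^ (m * m') = (unitFun u' ^ m') ^ (n * m) := by
      rw [← pow_mul, ← pow_mul]
      congr 1
      ring
    rw [e1, e2, h, h', ← pow_mul, ← pow_mul]
    congr 2 <;> ring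

theorem Rep.zero : Rep (0 : QModularUnits K) 1 :=
  ⟨1, 1, 1, one_pos, one_pos, by
    rw [ofMul_one, TensorProduct.tmul_zero], by simp [unitFun]⟩

theorem Rep.sum {ι : Type*} (s : Finset ι) {x : ι → QModularUnits K} {f : ι → ℍ → ℂ}
    (h : ∀ i ∈ s, Rep (x i) (f i)) : Rep (∑ i ∈ s, x i) (∏ i ∈ s, f i) := by
  classical
  induction s using Finset.induction_on with
  | empty => exact Rep.zero
  | insert i s hi ih =>
    rw [Finset.sum_insert hi, Finset.prod_insert hi]
    exact (h i (Finset.mem_insert_self i s)).add (ih fun j hj => h j (Finset.mem_insert_of_mem hj))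

theorem Rep.rootEquiv {x : QModularUnits K} {f g : ℍ → ℂ} (hx : Rep x f) (h : RootEquiv f g) :
    Rep x g := by
  obtain ⟨n, m, u, hn, hm, rfl, hu⟩ := hx
  obtain ⟨ζ, k, hk, hζ, H⟩ := h
  refine ⟨n, m * k, u, hn, by positivity, rfl, ?_⟩
  rw [pow_mul, hu]
  funext τ
  simp only [Pi.pow_apply]
  rw [H, mul_pow, mul_pow, ← pow_mul, show n * m * k = k * (n * m) by ring, pow_mul ζ, hζ, one_pow,
    one_mul,
    ← pow_mul]
  congr 1
  ring

/-- A homomorphism given by composition of functions preserves representation. -/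
theorem Rep.map {x : QModularUnits K} {f : ℍ → ℂ} (hx : Rep x f)
    (A : ModularUnits K →* ModularUnits L) (δ : ℍ → ℍ)
    (hA : ∀ u τ, unitFun (A u) τ = unitFun u (δ τ)) :
    Rep (QModularUnits.map A x) (fun τ => f (δ τ)) := by
  obtain ⟨n, m, u, hn, hm, rfl, hu⟩ := hx
  refine ⟨n, m, A u, hn, hm, rfl, ?_⟩
  funext τ
  have := congrFun hu (δ τ)
  simp only [Pi.pow_apply] at this ⊢
  rw [hA, this]

theorem Rep.of_rootEquiv {n : ℕ} (hn : 0 < n) {u : ModularUnits K} {f : ℍ → ℂ}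
    (h : RootEquiv (unitFun u) (f ^ n)) : Rep ((1 / (n : ℚ)) ⊗ₜ[ℤ] Additive.ofMul u) f := by
  obtain ⟨ζ, k, hk, hζ, H⟩ := h
  refine ⟨n, k, u, hn, hk, rfl, ?_⟩
  funext τ
  simp only [Pi.pow_apply]
  rw [H, mul_pow, hζ, one_mul, Pi.pow_apply, ← pow_mul]

end

/-! ### The elements `g_v` of `ℚ ⊗ 𝒰(ℚ^cycl)` -/

theorem isSiegelPair_den {v : Fin 2 → ℚ} (hv : NonInt v) :
    IsSiegelPair (6 * ((v 0).den * (v 1).den) + 1) v := by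
  have h0 := (v 0).den_pos
  have h1 := (v 1).den_pos
  have hpos := Nat.mul_pos h0 h1
  refine ⟨by omega, ?_, hv, ![6 * ((v 0).num * (v 1).den), 6 * ((v 1).num * (v 0).den)], ?_⟩
  · rw [Nat.coprime_mul_left_add_left]
    exact Nat.coprime_one_left 6
  · have e0 := Rat.mul_den_eq_num (v 0)
    have e1 := Rat.mul_den_eq_num (v 1)
    intro i
    rw [Nat.add_sub_cancel]
    fin_cases i
    · simp
      rw [← e0]
      ring
    · simp
      rw [← e1]
      ring

open Classical in
/-- The element `g_v` of `ℚ ⊗ 𝒰(ℚ^cycl)`; it is `0` by convention for `v ∈ ℤ²`. -/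
def siegelG (v : Fin 2 → ℚ) : QModularUnits Qcycl :=
  if hv : NonInt v then
    (1 / (((6 * ((v 0).den * (v 1).den) + 1) ^ 2 - 1 : ℕ) : ℚ)) ⊗ₜ[ℤ]
      Additive.ofMul (isSiegelPair_den hv).unit
  else 0

theorem sq_sub_one_pos {c : ℕ} (hc : 2 < c) : 0 < c ^ 2 - 1 := by
  have : 2 ^ 2 ≤ c ^ 2 := Nat.pow_le_pow_left hc.le 2
  omega

theorem IsSiegelPair.rep {c : ℕ} {v : Fin 2 → ℚ} (h : IsSiegelPair c v) :
    Rep ((1 / ((c ^ 2 - 1 : ℕ) : ℚ)) ⊗ₜ[ℤ] Additive.ofMul h.unit) (sv v) :=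
  Rep.of_rootEquiv (sq_sub_one_pos h.two_lt) h.rootEquiv

/-- In `ℚ ⊗ 𝒰(ℚ^cycl)`, the elements `g_v` obey every multiplicative relation which holds between
the functions `s_v` up to roots of unity. -/
theorem rep_siegelG {v : Fin 2 → ℚ} (hv : NonInt v) : Rep (siegelG v) (sv v) := by
  rw [siegelG, dif_pos hv]
  exact (isSiegelPair_den hv).rep

theorem siegelG_eq {c : ℕ} {v : Fin 2 → ℚ} (h : IsSiegelPair c v) :
    siegelG v = (1 / ((c ^ 2 - 1 : ℕ) : ℚ)) ⊗ₜ[ℤ] Additive.ofMul h.unit :=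
  (rep_siegelG h.nonInt).unique h.rep

theorem isSiegelUnit_siegelG {v : Fin 2 → ℚ} (hv : NonInt v) :
    IsSiegelUnit (v 0) (v 1) (siegelG v) := by
  rintro N c hN ⟨a, ha⟩ ⟨b, hb⟩ hc h6 hcN
  obtain ⟨k, hk⟩ := (Nat.modEq_iff_dvd' (by omega)).1 hcN.symm
  have h : IsSiegelPair c v := by
    refine ⟨hc, h6, hv, ![k * a, k * b], fun i => ?_⟩
    rw [hk]
    push_cast
    fin_cases i
    · simp
      rw [← ha]
      ring
    · simp
      rw [← hb]
      ring
  refine ⟨h.unit, fun τ => rfl, ?_⟩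
  rw [siegelG_eq h, Nat.cast_sub (Nat.one_le_pow _ _ (by omega))]
  push_cast
  rfl

theorem siegelG_of_rootEquiv {v w : Fin 2 → ℚ} (hv : NonInt v) (hw : NonInt w)
    (h : RootEquiv (sv v) (sv w)) : siegelG v = siegelG w :=
  ((rep_siegelG hv).rootEquiv h).unique (rep_siegelG hw)

theorem siegelG_add_int (v : Fin 2 → ℚ) (a : Fin 2 → ℤ) :
    siegelG (fun i => v i + (a i : ℚ)) = siegelG v := by
  by_cases hv : NonInt v
  · exact siegelG_of_rootEquiv (hv.add_int a) hv (sv_add_int v a)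
  · have : ¬ NonInt fun i => v i + (a i : ℚ) := fun h => hv (by
      have := h.add_int (-a)
      simpa using this)
    rw [siegelG, siegelG, dif_neg hv, dif_neg this]

theorem siegelG_neg {v : Fin 2 → ℚ} (hv : NonInt v) : siegelG (-v) = siegelG v :=
  siegelG_of_rootEquiv (fun m n h => hv (-m) (-n) (by
    have h0 := h.1
    have h1 := h.2
    simp only [Pi.neg_apply] at h0 h1
    constructor <;> push_cast <;> linarith)) hv (sv_neg v)

/-! ### The action of `Π_ℚ` on Siegel units -/

theorem HasDen.isSiegelPair {N : ℕ} {v : Fin 2 → ℚ} (h : HasDen N v) (hN : 0 < N)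
    (hv : NonInt v) : IsSiegelPair (6 * N + 1) v := by
  obtain ⟨a, ha⟩ := h
  refine ⟨by omega, ?_, hv, fun i => 6 * a i, fun i => ?_⟩
  · rw [Nat.coprime_mul_left_add_left]
    exact Nat.coprime_one_left 6
  · rw [Nat.add_sub_cancel]
    push_cast
    rw [← ha i, mul_assoc]

theorem rootQ_zpow_of_hasDen {N : ℕ} (hN : 0 < N) {v : Fin 2 → ℚ} (hv : HasDen N v) (i : Fin 2)
    (j : ℤ) : rootQ (v i) ^ j = rootQ (j * v i) := by
  obtain ⟨a, ha⟩ := hv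
  have h0 : (N : ℚ) ≠ 0 := by exact_mod_cast hN.ne'
  have e : v i = a i / N := by rw [← ha i]; field_simp
  rw [e, rootQ_int_div, ← zpow_mul, ← rootQ_int_div]
  congr 1
  push_cast
  ring

/-- An element of `Π_ℚ` which acts as `h` maps `g_v` to `g_{v h}`. Indeed `g_v` is a quotient of
forms for a congruence subgroup, the denominator being a power of the discriminant, which is fixed,
so the assertion follows from the action of `SL(2, ℤ)` and of cyclotomic automorphisms. -/
theorem rep_map_siegelG {σ : AutM} (hσ : σ ∈ PiQ) {h : GL (Fin 2) Af} (hh : ActsAs σ h)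
    {A : ModularUnits Qbar →* ModularUnits Qbar} (hA : IsUnitAction σ A) {v : Fin 2 → ℚ}
    (hv : NonInt v) {N : ℕ} (hN : 0 < N) (hvN : HasDen N v) {B : Matrix (Fin 2) (Fin 2) ℤ}
    (hB : MatCong N B h.1) :
    Rep (QModularUnits.map A (QModularUnits.map unitsInclusion (siegelG v))) (sv (vmul v B)) := by
  obtain ⟨hint, s, hs, hact⟩ := hh
  have hp := hvN.isSiegelPair hN hv
  generalize hc : 6 * N + 1 = c at hp
  have hM : 0 < c - 1 := by omega
  obtain ⟨C, hC⟩ := exists_matCong hM hint.1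
  obtain ⟨γ, hγ⟩ := hC.exists_SL hint hM
  have hp' := hp.vmul_SL γ
  set j := C.det
  set t : Qcycl →+* ℂ := (algebraMap Qcycl ℂ).comp (s : Qcycl →+* Qcycl)
  have hroot : t (rootQ (vmul v γ.1 1)) = ee ((j * vmul v γ.1 1 : ℚ) : ℂ) := by
    have h1 := hs (c - 1) j hM (hC.det hint).symm (rootQ (vmul v γ.1 1)) (by
      rw [← zpow_natCast, rootQ_zpow_of_hasDen hM hp'.hasDen]
      obtain ⟨a, ha⟩ := hp'.hasDen
      rw [Int.cast_natCast, ha 1]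
      refine Subtype.ext ?_
      rw [rootQ_coe, Rat.cast_intCast, ← zero_add (a 1 : ℂ), ee_add_int, ee_zero]
      rfl)
    rw [rootQ_zpow_of_hasDen hM hp'.hasDen] at h1
    exact congrArg Subtype.val h1
  have := hp.neZero
  obtain ⟨m, hm⟩ := hp.isModularFunction.exists_isForm inferInstance
  have hmem : siegelFun c v * ModularForm.discriminant ^ m ∈
      modularForms (12 * m) (CongruenceSubgroup.Gamma (c - 1)) Qcycl :=
    (mem_modularForms_iff inferInstance).2 ⟨hm m le_rfl,
      hp.hasLaurentOver.mul ((isRatForm_discriminant_pow m).2.mono bot_le)⟩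
  let F : modularFormRing Qbar := ⟨siegelFun c v * ModularForm.discriminant ^ m,
    Subring.subset_closure ⟨12 * m, allModularForms_le_Qbar ⟨_, inferInstance, hmem⟩⟩⟩
  let G : modularFormRing Qbar := ⟨ModularForm.discriminant ^ m,
    Subring.subset_closure ⟨12 * m, (isRatForm_discriminant_pow m).mem_allModularForms Qbar⟩⟩
  have h1 := hA (unitsInclusion hp.unit) F G rfl
  rw [PiQ_rat hσ (isRatForm_discriminant_pow m) G rfl] at h1
  obtain ⟨w, a, hw, ha1, ha2⟩ := hact (c - 1) γ hM (fun i j' => by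
    refine AdeleCong.trans ?_ (hC i j')
    have h2 := (adeleCong_int_iff hM).2 (hγ i j')
    refine AdeleCong.trans ?_ h2.symm
    rw [mul_diagOne, Matrix.mul_diagonal]
    have h3 : ∀ i,
        AdeleCong ((c - 1 : ℕ) : ℚ) ((γ.1 i 1 : Af) * h.1.det) ((γ.1 i 1 * j : ℤ) : Af) :=
      fun i => by
        rw [Int.cast_mul]
        exact (AdeleCong.refl _ _).mul (hC.det hint).symm (isIntegralAdele_intCast _)
          (isIntegralAdele_intCast _)
    fin_cases i <;> fin_cases j'
    · simpa using AdeleCong.refl _ _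
    · exact h3 0
    · simpa using AdeleCong.refl _ _
    · exact h3 1) (12 * m) F hmem
  have hconj : Conj t ((F : ℍ → ℂ) ∣[((12 * m : ℕ) : ℤ)] γ) (σ F : ℍ → ℂ) := by
    refine ⟨w, 0, PowerSeries.mk a, hw, ?_, ?_⟩
    · rw [hasQExp_zero_iff_hasPS] at ha1
      simp only [pow_zero, one_mul]
      convert ha1
      ext n
      simp
    · rw [hasQExp_zero_iff_hasPS] at ha2
      simp only [pow_zero, one_mul]
      convert ha2
      ext n
      simp [t]
  have hslash : (F : ℍ → ℂ) ∣[((12 * m : ℕ) : ℤ)] γ =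
      siegelFun c (vmul v γ.1) * ModularForm.discriminant ^ m := by
    rw [show (F : ℍ → ℂ) = siegelFun c v * ModularForm.discriminant ^ m from rfl,
      mul_discriminant_pow_slash]
    congr 1
    funext τ
    exact siegelFun_smul hp.coprime γ v τ
  obtain ⟨f', hf', hr⟩ := hp'.conj hroot
  rw [hslash] at hconj
  have h2 := hconj.unique (hf'.mul ((isRatForm_discriminant_pow m).2.conj_self t))
  have h3 : unitFun (A (unitsInclusion hp.unit)) = f' := by
    funext τ
    exact mul_right_cancel₀ (discriminant_pow_ne_zero m τ) (congrFun (h1.symm.trans h2) τ)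
  rw [siegelG_eq hp]
  refine Rep.rootEquiv (Rep.of_rootEquiv (u := A (unitsInclusion hp.unit))
    (sq_sub_one_pos hp.two_lt) (h3 ▸ hr)) ?_
  have hNc : (N : ℤ) ∣ ((c - 1 : ℕ) : ℤ) := by
    rw [← hc, Nat.add_sub_cancel]
    exact ⟨6, by push_cast; ring⟩
  have hdiv : ∀ i j', (N : ℤ) ∣ (γ.1 * diagOne j) i j' - B i j' := fun i j' => by
    have h4 := (adeleCong_int_iff hN).1
      ((AdeleCong.of_dvd (Int.natCast_dvd_natCast.1 hNc) (hC i j')).trans (hB i j').symm)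
    have h5 := hNc.trans (hγ i j')
    have := dvd_sub h4 h5
    rwa [sub_sub_sub_cancel_left] at this
  obtain ⟨b, hb⟩ := hvN.vmul_congr hdiv
  rw [← vmul_mul, hb]
  exact sv_add_int _ _

theorem NonInt.vmul_matCong {v : Fin 2 → ℚ} (hv : NonInt v) {N : ℕ} (hN : 0 < N)
    (hvN : HasDen N v) {h : GL (Fin 2) Af} (hint : IsIntegralGL h) {B : Matrix (Fin 2) (Fin 2) ℤ}
    (hB : MatCong N B h.1) : NonInt (SiegelDistribution.vmul v B) := by
  obtain ⟨C, -, hC⟩ := hB.exists_inv hint hN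
  exact hv.vmul hvN hC

theorem map_siegelG {σ : AutM} (hσ : σ ∈ PiQ) {h : GL (Fin 2) Af} (hh : ActsAs σ h)
    {A : ModularUnits Qbar →* ModularUnits Qbar} (hA : IsUnitAction σ A) {v : Fin 2 → ℚ}
    (hv : NonInt v) {N : ℕ} (hN : 0 < N) (hvN : HasDen N v) {B : Matrix (Fin 2) (Fin 2) ℤ}
    (hB : MatCong N B h.1) :
    QModularUnits.map A (QModularUnits.map unitsInclusion (siegelG v)) =
      QModularUnits.map unitsInclusion (siegelG (vmul v B)) :=
  (rep_map_siegelG hσ hh hA hv hN hvN hB).unique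
    ((rep_siegelG (hv.vmul_matCong hN hvN hh.1 hB)).map unitsInclusion id fun _ _ => rfl)

end

section

open Finset

/-! ### Sums over `(ℤ / K)²` -/

/-- The sum of `F` over the representatives `0 ≤ a₀, a₁ < K` of `(ℤ / K)²`. -/
def latticeSum {V : Type*} [AddCommMonoid V] (K : ℕ) (F : (Fin 2 → ℤ) → V) : V :=
  ∑ i ∈ range K, ∑ j ∈ range K, F ![i, j]

theorem exists_of_periodic {V : Type*} {K : ℕ} [NeZero K] {F : (Fin 2 → ℤ) → V}
    (hF : ∀ a b, (∀ i, (K : ℤ) ∣ a i - b i) → F a = F b) :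
    ∃ G : (Fin 2 → ZMod K) → V, ∀ a, F a = G fun i => (a i : ZMod K) :=
  ⟨fun x => F fun i => (x i).val, fun a => hF _ _ fun i => by
    rw [← ZMod.intCast_eq_intCast_iff_dvd_sub]
    simp⟩

section

variable {V : Type*} [AddCommMonoid V]

theorem latticeSum_congr {K : ℕ} {F G : (Fin 2 → ℤ) → V} (h : ∀ a, F a = G a) :
    latticeSum K F = latticeSum K G := by
  rw [funext h]

theorem map_latticeSum {W : Type*} [AddCommMonoid W] {T : Type*} [FunLike T V W]
    [AddMonoidHomClass T V W] (f : T) (K : ℕ) (F : (Fin 2 → ℤ) → V) :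
    f (latticeSum K F) = latticeSum K fun a => f (F a) := by
  simp only [latticeSum, map_sum]

theorem latticeSum_mul (K d : ℕ) (F : (Fin 2 → ℤ) → V) : latticeSum (K * d) F =
    latticeSum K fun a => latticeSum d fun b => F fun i => a i + K * b i := by
  simp only [latticeSum]
  rw [sum_range_mul_eq]
  refine sum_congr rfl fun i _ => ?_
  refine Eq.trans (sum_congr rfl fun k _ => sum_range_mul_eq _ K d) ?_
  rw [sum_comm]
  refine sum_congr rfl fun j _ => sum_congr rfl fun k _ => sum_congr rfl fun l _ => ?_
  congr 1
  funext t
  fin_cases t <;> simp [add_comm]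

theorem latticeSum_eq_sum {K : ℕ} [NeZero K] (F : (Fin 2 → ℤ) → V) :
    latticeSum K F = ∑ x : Fin 2 → ZMod K, F fun i => (x i).val := by
  have h1 : ∀ f : ℕ → V, ∑ i ∈ range K, f i = ∑ x : ZMod K, f x.val := by
    obtain ⟨n, rfl⟩ := Nat.exists_eq_succ_of_ne_zero (NeZero.ne K)
    exact fun f => sum_range f
  rw [latticeSum, h1, ← (finTwoArrowEquiv (ZMod K)).symm.sum_comp, Fintype.sum_prod_type]
  refine sum_congr rfl fun x _ => ?_
  rw [h1]
  refine sum_congr rfl fun y _ => ?_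
  congr 1
  funext t
  fin_cases t <;> rfl

theorem latticeSum_eq_sum_of_periodic {K : ℕ} [NeZero K] {F : (Fin 2 → ℤ) → V}
    (G : (Fin 2 → ZMod K) → V) (hF : ∀ a, F a = G fun i => (a i : ZMod K)) :
    latticeSum K F = ∑ x, G x := by
  rw [latticeSum_eq_sum]
  refine sum_congr rfl fun x _ => ?_
  rw [hF]
  congr 1
  funext i
  simp

/-- Invariance of sums over `(ℤ / K)²` under invertible matrices. -/
theorem latticeSum_vecMul {K : ℕ} (hK : 0 < K) {F : (Fin 2 → ℤ) → V}
    (hF : ∀ a b, (∀ i, (K : ℤ) ∣ a i - b i) → F a = F b) {A B : Matrix (Fin 2) (Fin 2) ℤ}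
    (hAB : ∀ i j, (K : ℤ) ∣ (A * B) i j - (1 : Matrix (Fin 2) (Fin 2) ℤ) i j) :
    latticeSum K (fun a => F (Matrix.vecMul a A)) = latticeSum K F := by
  have : NeZero K := ⟨hK.ne'⟩
  obtain ⟨G, hG⟩ := exists_of_periodic hF
  set r := Int.castRingHom (ZMod K)
  have hinv : A.map r * B.map r = 1 := by
    rw [← Matrix.map_mul]
    refine Matrix.ext fun i j => ?_
    have h1 := ((ZMod.intCast_eq_intCast_iff_dvd_sub _ _ _).2 (hAB i j)).symm
    rw [Matrix.map_apply]
    refine Eq.trans h1 ?_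
    fin_cases i <;> fin_cases j <;> simp
  rw [latticeSum_eq_sum_of_periodic G hG,
    latticeSum_eq_sum_of_periodic (fun x => G (Matrix.vecMul x (A.map r))) fun a => by
      rw [hG]
      congr 1
      funext i
      simp [Matrix.vecMul, dotProduct, r]]
  refine Function.Bijective.sum_comp (Finite.injective_iff_bijective.1 fun x y hxy => ?_) G
  have := congrArg (fun z => Matrix.vecMul z (B.map r)) hxy
  simpa only [Matrix.vecMul_vecMul, hinv, Matrix.vecMul_one] using this

end

/-! ### Distribution relations -/

theorem NonInt.div_add {d : ℕ} {v w : Fin 2 → ℚ} (hv : NonInt v) (k : Fin 2 → ℤ)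
    (hw : ∀ i, v i = d * w i ∨ (v i + k i = d * w i) ∨ v i = w i) : NonInt w := by
  rintro a b ⟨h0, h1⟩
  have : ∀ i, ∀ n : ℤ, w i = n → ∃ n' : ℤ, v i = n' := by
    intro i n hn
    rcases hw i with h | h | h
    · exact ⟨d * n, by rw [h, hn]; push_cast; rfl⟩
    · exact ⟨d * n - k i, by push_cast; rw [← hn, ← h]; ring⟩
    · exact ⟨n, h.trans hn⟩
  obtain ⟨a', ha'⟩ := this 0 a h0
  obtain ⟨b', hb'⟩ := this 1 b h1
  exact hv a' b' ⟨ha', hb'⟩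

theorem sum_sum_siegelG {d : ℕ} (hd : 0 < d) {x y : ℚ} (h : NonInt ![x, y]) :
    ∑ j ∈ range d, ∑ k ∈ range d, siegelG ![(x + j) / d, (y + k) / d] = siegelG ![x, y] := by
  have h0 : (d : ℚ) ≠ 0 := by exact_mod_cast hd.ne'
  have h1 : Rep (∑ j ∈ range d, ∑ k ∈ range d, siegelG ![(x + j) / d, (y + k) / d])
      (∏ j ∈ range d, ∏ k ∈ range d, sv ![(x + j) / d, (y + k) / d]) :=
    Rep.sum _ fun j _ => Rep.sum _ fun k _ => rep_siegelG <|
      h.div_add (d := d) ![j, k] fun i => by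
        right; left
        fin_cases i <;> simp <;> field_simp
  refine (h1.rootEquiv ?_).unique (rep_siegelG h)
  convert prod_prod_sv hd x y using 1
  funext τ
  simp only [Finset.prod_apply]

/-! ### Siegel distributions on rational vectors -/

/-- The function `χ` on `ℚ²` is supported in `(1 / m) ℤ² - (0, 0)` and periodic
modulo `(K / m) ℤ²`. -/
structure IsGood (m K : ℕ) (χ : (Fin 2 → ℚ) → ℤ) : Prop where
  m_pos : 0 < m
  K_pos : 0 < K
  zero : χ 0 = 0
  supp : ∀ q, χ q ≠ 0 → HasDen m q
  per : ∀ (q : Fin 2 → ℚ) (b : Fin 2 → ℤ), χ (fun i => q i + K / m * b i) = χ q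

/-- The value `∑_a χ(a / m) g_{a / K}` of the Siegel distribution on `χ`, where `a` runs over
`(ℤ / K)²`; the box `a / m + (K / m) ℤ^²` contributes `g_{a / K}`. -/
def siegelSum (m K : ℕ) (χ : (Fin 2 → ℚ) → ℤ) : QModularUnits Qcycl :=
  latticeSum K fun a => χ (fun i => a i / m) • siegelG fun i => a i / K

namespace IsGood

variable {m K : ℕ} {χ : (Fin 2 → ℚ) → ℤ}

theorem periodic (h : IsGood m K χ) {a b : Fin 2 → ℤ} (hab : ∀ i, (K : ℤ) ∣ a i - b i) :
    χ (fun i => a i / m) = χ (fun i => b i / m) := by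
  choose c hc using hab
  rw [← h.per (fun i => b i / m) c]
  congr 1
  funext i
  have : (a i : ℚ) = b i + K * c i := by
    rw [← sub_eq_iff_eq_add']
    exact_mod_cast hc i
  rw [this]
  ring

theorem nonInt (h : IsGood m K χ) {a : Fin 2 → ℤ} (ha : χ (fun i => a i / m) ≠ 0) :
    NonInt fun i => (a i / K : ℚ) := by
  rintro s t ⟨hs, ht⟩
  have hK : (K : ℚ) ≠ 0 := by exact_mod_cast h.K_pos.ne'
  refine ha ?_
  rw [h.periodic (b := 0) (fun i => ?_)]
  · refine Eq.trans ?_ h.zero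
    congr 1
    funext i
    simp
  · have : ∀ (x n : ℤ), (x / K : ℚ) = n → (K : ℤ) ∣ x - 0 := fun x n hx => by
      rw [div_eq_iff hK] at hx
      exact ⟨n, by rw [sub_zero, mul_comm]; exact_mod_cast hx⟩
    fin_cases i
    · exact this _ s hs
    · exact this _ t ht

theorem mul_right (h : IsGood m K χ) {d : ℕ} (hd : 0 < d) : IsGood m (K * d) χ where
  m_pos := h.m_pos
  K_pos := Nat.mul_pos h.K_pos hd
  zero := h.zero
  supp := h.supp
  per q b := by
    rw [← h.per q fun i => d * b i]
    congr 1
    funext i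
    push_cast
    ring

theorem mul_mul (h : IsGood m K χ) {d : ℕ} (hd : 0 < d) : IsGood (m * d) (K * d) χ where
  m_pos := Nat.mul_pos h.m_pos hd
  K_pos := Nat.mul_pos h.K_pos hd
  zero := h.zero
  supp q hq := by
    obtain ⟨a, ha⟩ := h.supp q hq
    refine ⟨fun i => d * a i, fun i => ?_⟩
    push_cast
    rw [← ha i]
    ring
  per q b := by
    have hd0 : (d : ℚ) ≠ 0 := by exact_mod_cast hd.ne'
    rw [← h.per q b]
    congr 1
    funext i
    push_cast
    rw [mul_div_mul_right _ _ hd0]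

theorem siegelSum_mul_right (h : IsGood m K χ) {d : ℕ} (hd : 0 < d) :
    siegelSum m (K * d) χ = siegelSum m K χ := by
  have hd0 : (d : ℚ) ≠ 0 := by exact_mod_cast hd.ne'
  have hK0 : (K : ℚ) ≠ 0 := by exact_mod_cast h.K_pos.ne'
  rw [siegelSum, latticeSum_mul, siegelSum]
  refine latticeSum_congr fun a => ?_
  have h1 : ∀ b : Fin 2 → ℤ, χ (fun i => ((a i + K * b i : ℤ) : ℚ) / m) = χ fun i => a i / m :=
    fun b => h.periodic fun i => ⟨b i, by ring⟩
  simp only [h1]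
  by_cases h0 : χ (fun i => a i / m) = 0
  · simp [h0, latticeSum]
  · simp only [latticeSum, ← smul_sum]
    congr 1
    have h2 : (fun i => (a i / K : ℚ)) = ![(a 0 / K : ℚ), (a 1 / K : ℚ)] := by
      funext i
      fin_cases i <;> rfl
    have h3 := h.nonInt h0
    rw [h2] at h3 ⊢
    rw [← sum_sum_siegelG hd h3]
    refine sum_congr rfl fun j _ => sum_congr rfl fun k _ => ?_
    congr 1
    funext i
    fin_cases i <;> simp <;> field_simp

theorem siegelSum_mul_mul (h : IsGood m K χ) {d : ℕ} (hd : 0 < d) :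
    siegelSum (m * d) (K * d) χ = siegelSum m K χ := by
  have hd0 : (d : ℚ) ≠ 0 := by exact_mod_cast hd.ne'
  have hm0 : (m : ℚ) ≠ 0 := by exact_mod_cast h.m_pos.ne'
  have h1 : ∀ a : Fin 2 → ℤ, χ (fun i => a i / (m * d : ℕ)) ≠ 0 → ∀ i, (d : ℤ) ∣ a i := by
    intro a ha i
    obtain ⟨c, hc⟩ := h.supp _ ha
    refine ⟨c i, ?_⟩
    have := hc i
    push_cast at this
    field_simp at this
    exact_mod_cast this
  rw [siegelSum, mul_comm K d, latticeSum_mul, latticeSum, sum_eq_single 0, sum_eq_single 0,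
    siegelSum]
  · refine latticeSum_congr fun a => ?_
    congr 2 <;> funext i
    · fin_cases i <;> simp <;> field_simp
    · fin_cases i <;> simp <;> field_simp
  · intro k hk hk0
    refine sum_eq_zero fun i _ => sum_eq_zero fun j _ => ?_
    refine smul_eq_zero_of_left ?_ _
    by_contra hne
    obtain ⟨c, hc⟩ := h1 _ hne 1
    have : (d : ℤ) ∣ k := ⟨c - j, by simp at hc; linarith⟩
    exact hk0 (Nat.eq_zero_of_dvd_of_lt (Int.natCast_dvd_natCast.1 this) (mem_range.1 hk))
  · intro h2
    exact absurd (mem_range.2 hd) h2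
  · intro k hk hk0
    refine sum_eq_zero fun l _ => sum_eq_zero fun i _ => sum_eq_zero fun j _ => ?_
    refine smul_eq_zero_of_left ?_ _
    by_contra hne
    obtain ⟨c, hc⟩ := h1 _ hne 0
    have : (d : ℤ) ∣ k := ⟨c - i, by simp at hc; linarith⟩
    exact hk0 (Nat.eq_zero_of_dvd_of_lt (Int.natCast_dvd_natCast.1 this) (mem_range.1 hk))
  · intro h2
    exact absurd (mem_range.2 hd) h2

/-- Two functions have a common denominator and a common period. -/
theorem exists_common {χ' : (Fin 2 → ℚ) → ℤ} {m' K' : ℕ} (h : IsGood m K χ)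
    (h' : IsGood m' K' χ') : ∃ M L, IsGood M L χ ∧ IsGood M L χ' ∧
      siegelSum M L χ = siegelSum m K χ ∧ siegelSum M L χ' = siegelSum m' K' χ' := by
  have e1 : m' * m = m * m' := mul_comm _ _
  have e2 : K' * m * (K * m') = K * m' * (K' * m) := mul_comm _ _
  have g := h.mul_mul h'.m_pos
  have g' := h'.mul_mul h.m_pos
  have p := Nat.mul_pos h.K_pos h'.m_pos
  have p' := Nat.mul_pos h'.K_pos h.m_pos
  refine ⟨m * m', K * m' * (K' * m), g.mul_right p', ?_, ?_, ?_⟩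
  · rw [← e1, ← e2]
    exact g'.mul_right p
  · rw [g.siegelSum_mul_right p', h.siegelSum_mul_mul h'.m_pos]
  · rw [← e1, ← e2, g'.siegelSum_mul_right p, h'.siegelSum_mul_mul h.m_pos]

theorem siegelSum_eq {m' K' : ℕ} (h : IsGood m K χ) (h' : IsGood m' K' χ) :
    siegelSum m K χ = siegelSum m' K' χ := by
  obtain ⟨M, L, -, -, h1, h2⟩ := h.exists_common h'
  rw [← h1, h2]

theorem add {χ' : (Fin 2 → ℚ) → ℤ} (h : IsGood m K χ) (h' : IsGood m K χ') :
    IsGood m K (χ + χ') where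
  m_pos := h.m_pos
  K_pos := h.K_pos
  zero := by rw [Pi.add_apply, h.zero, h'.zero, add_zero]
  supp q hq := by
    by_cases h0 : χ q = 0
    · exact h'.supp q fun h1 => hq (by rw [Pi.add_apply, h0, h1, add_zero])
    · exact h.supp q h0
  per q b := by rw [Pi.add_apply, h.per, h'.per, Pi.add_apply]

end IsGood

theorem siegelSum_add (m K : ℕ) (χ χ' : (Fin 2 → ℚ) → ℤ) :
    siegelSum m K (χ + χ') = siegelSum m K χ + siegelSum m K χ' := by
  simp only [siegelSum, latticeSum, Pi.add_apply, add_smul, sum_add_distrib]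

open Classical in
/-- The value of the Siegel distribution on `χ`; it does not depend on the choice of a denominator
and of a period of `χ`. -/
def siegelValue (χ : (Fin 2 → ℚ) → ℤ) : QModularUnits Qcycl :=
  if h : ∃ m K, IsGood m K χ then siegelSum h.choose h.choose_spec.choose χ else 0

theorem IsGood.siegelValue_eq {m K : ℕ} {χ : (Fin 2 → ℚ) → ℤ} (h : IsGood m K χ) :
    siegelValue χ = siegelSum m K χ := by
  have h' : ∃ m K, IsGood m K χ := ⟨m, K, h⟩
  rw [siegelValue, dif_pos h']
  exact h'.choose_spec.choose_spec.siegelSum_eq h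

end

section

open Topology

/-! ### Test functions on adelic vectors and their restriction to rational vectors -/

theorem t2Space_Af : T2Space Af := inferInstanceAs (T2Space (RestrictedProduct
  (fun v : IsDedekindDomain.HeightOneSpectrum ℤ => v.adicCompletion ℚ)
  (fun v => (v.adicCompletionIntegers ℚ : Set (v.adicCompletion ℚ))) Filter.cofinite))

open Classical in
/-- The extension by zero of a test function to all vectors. -/
def extendZero (φ : LCc X1) (x : Fin 2 → Af) : ℤ := if h : x ≠ 0 then φ.1 ⟨x, h⟩ else 0

theorem extendZero_comp (φ : LCc X1) (g : GL (Fin 2) Af) (x : Fin 2 → Af) :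
    extendZero (LCc.comp (rightMul g) φ) x = extendZero φ (Matrix.vecMul x g.1) := by
  by_cases h : x ≠ 0
  · rw [extendZero, extendZero, dif_pos h, dif_pos (vecMul_ne_zero g h)]
    rfl
  · rw [not_not] at h
    simp [extendZero, h]

theorem isOpen_cong {N : ℕ} (hN : 0 < N) (x : Fin 2 → Af) :
    IsOpen {y : Fin 2 → Af | ∀ i, AdeleCong N (y i) (x i)} := by
  have : {y : Fin 2 → Af | ∀ i, AdeleCong N (y i) (x i)} =
      ⋂ i, (fun y : Fin 2 → Af => y i) ⁻¹' {y | AdeleCong N y (x i)} := by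
    ext y
    simp
  rw [this]
  exact isOpen_iInter_of_finite fun i => (isOpen_adeleCong hN _).preimage (continuous_apply i)

theorem isCompact_cong (N : ℕ) (x : Fin 2 → Af) :
    IsCompact {y : Fin 2 → Af | ∀ i, AdeleCong N (y i) (x i)} := by
  have h1 : IsCompact (Set.pi Set.univ fun _ : Fin 2 => {t : Af | IsIntegralAdele t}) :=
    isCompact_univ_pi fun _ => isCompact_integralAdele
  have h2 : Continuous fun (t : Fin 2 → Af) i => x i + algebraMap ℚ Af N * t i := by fun_prop
  convert h1.image h2 using 1
  ext y
  constructor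
  · intro h
    choose t ht hy using h
    exact ⟨t, fun i _ => ht i, (funext hy).symm⟩
  · rintro ⟨t, ht, rfl⟩ i
    exact ⟨t i, ht i trivial, rfl⟩

theorem cong_factorial_mono {a b : ℕ} (hab : a ≤ b) {x y : Af}
    (h : AdeleCong (b.factorial : ℕ) x y) : AdeleCong (a.factorial : ℕ) x y :=
  h.of_dvd (Nat.factorial_dvd_factorial hab)

/-- The congruence classes form a basis of neighbourhoods. -/
theorem exists_cong_subset {x : Fin 2 → Af} {U : Set (Fin 2 → Af)} (hU : U ∈ 𝓝 x) :
    ∃ n : ℕ, {y : Fin 2 → Af | ∀ i, AdeleCong (n.factorial : ℕ) (y i) (x i)} ⊆ U := by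
  have := t2Space_Af
  refine exists_subset_nhds_of_isCompact'
    (V := fun n : ℕ => {y : Fin 2 → Af | ∀ i, AdeleCong (n.factorial : ℕ) (y i) (x i)}) ?_
    (fun n => isCompact_cong _ x) (fun n => (isCompact_cong _ x).isClosed) ?_
  · exact directed_of_isDirected_le fun a b hab y hy i => cong_factorial_mono hab (hy i)
  · intro y hy
    have : y = x := funext fun i => eq_of_adeleCong fun N hN => by
      have := Set.mem_iInter.1 hy N i
      exact this.of_dvd (Nat.dvd_factorial hN le_rfl)
    rwa [this]

theorem extendZero_eventually_eq (φ : LCc X1) (x : Fin 2 → Af) :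
    ∀ᶠ y in 𝓝 x, extendZero φ y = extendZero φ x := by
  have := t2Space_Af
  by_cases hx : x ≠ 0
  · rw [← map_nhds_subtype_coe_eq_nhds (p := fun y => y ≠ 0) hx (isOpen_ne.mem_nhds hx),
      Filter.eventually_map]
    filter_upwards [φ.2.1.eventually_eq ⟨x, hx⟩] with y hy
    rw [extendZero, extendZero, dif_pos y.2, dif_pos hx]
    exact hy
  · rw [not_not] at hx
    have hc : IsClosed (Subtype.val '' tsupport φ.1 : Set (Fin 2 → Af)) :=
      (φ.2.2.isCompact.image continuous_subtype_val).isClosed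
    have h0 : x ∈ (Subtype.val '' tsupport φ.1 : Set (Fin 2 → Af))ᶜ := by
      rintro ⟨y, -, hy⟩
      exact y.2 (hy.trans hx)
    filter_upwards [hc.isOpen_compl.mem_nhds h0] with y hy
    rw [extendZero, extendZero, dif_neg (not_not.2 hx)]
    split_ifs with h
    · exact image_eq_zero_of_notMem_tsupport fun h1 => hy ⟨_, h1, rfl⟩
    · rfl

/-- Test functions have a denominator and a period. -/
theorem exists_level (φ : LCc X1) : ∃ m P : ℕ, 0 < m ∧ 0 < P ∧
    (∀ x, extendZero φ x ≠ 0 → ∀ i, IsIntegralAdele (m * x i)) ∧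
    ∀ x y, (∀ i, AdeleCong P (x i) (y i)) → extendZero φ x = extendZero φ y := by
  have hcpt : IsCompact (Subtype.val '' tsupport φ.1 : Set (Fin 2 → Af)) :=
    φ.2.2.isCompact.image continuous_subtype_val
  have hsupp : ∀ x, extendZero φ x ≠ 0 → x ∈ (Subtype.val '' tsupport φ.1 : Set (Fin 2 → Af)) := by
    intro x hx
    rw [extendZero] at hx
    split_ifs at hx with h
    · exact ⟨⟨x, h⟩, subset_tsupport _ hx, rfl⟩
    · exact absurd rfl hx
  obtain ⟨m, hm⟩ := hcpt.elim_directed_cover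
    (fun n : ℕ => {x : Fin 2 → Af | ∀ i, IsIntegralAdele ((n.factorial : ℕ) * x i)})
    (fun n => by
      have : {x : Fin 2 → Af | ∀ i, IsIntegralAdele ((n.factorial : ℕ) * x i)} =
          ⋂ i, (fun x : Fin 2 → Af => ((n.factorial : ℕ) : Af) * x i) ⁻¹'
            {y | IsIntegralAdele y} := by
        ext y
        simp
      rw [this]
      exact isOpen_iInter_of_finite fun i => isOpen_integralAdele.preimage (by fun_prop))
    (fun x _ => by
      choose n hn h using fun i => exists_nat_mul_isIntegralAdele (x i)
      refine Set.mem_iUnion.2 ⟨n 0 + n 1, fun i => ?_⟩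
      obtain ⟨k, hk⟩ : n i ∣ (n 0 + n 1).factorial := Nat.dvd_factorial (hn i) (by
        fin_cases i <;> simp)
      rw [hk, mul_comm (n i), Nat.cast_mul, mul_assoc]
      exact integralAdeles.mul_mem (natCast_mem integralAdeles k) (h i))
    (directed_of_isDirected_le fun a b hab x hx i => by
      obtain ⟨k, hk⟩ := Nat.factorial_dvd_factorial hab
      rw [hk, mul_comm a.factorial, Nat.cast_mul, mul_assoc]
      exact integralAdeles.mul_mem (natCast_mem integralAdeles k) (hx i))
  obtain ⟨P, hP⟩ := hcpt.elim_directed_cover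
    (fun n : ℕ => {x : Fin 2 → Af | ∀ y : Fin 2 → Af,
      (∀ i, AdeleCong (n.factorial : ℕ) (y i) (x i)) → extendZero φ y = extendZero φ x})
    (fun n => by
      rw [isOpen_iff_mem_nhds]
      intro x hx
      filter_upwards [(isOpen_cong n.factorial_pos x).mem_nhds fun i => AdeleCong.refl _ _]
        with y hy z hz
      rw [hx y hy, hx z fun i => (hz i).trans (hy i)])
    (fun x _ => by
      obtain ⟨n, hn⟩ := exists_cong_subset (extendZero_eventually_eq φ x)
      exact Set.mem_iUnion.2 ⟨n, fun y hy => hn hy⟩)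
    (directed_of_isDirected_le fun a b hab x hx y hy => hx y fun i => by
      exact cong_factorial_mono hab (hy i))
  refine ⟨m.factorial, P.factorial, m.factorial_pos, P.factorial_pos,
    fun x hx => hm (hsupp x hx), fun x y hxy => ?_⟩
  by_cases hy : extendZero φ y = 0
  · by_cases hx : extendZero φ x = 0
    · rw [hx, hy]
    · exact (hP (hsupp x hx) y fun i => (hxy i).symm).symm
  · exact hP (hsupp y hy) x hxy

/-- A rational vector as an adelic vector. -/
def ratPoint (q : Fin 2 → ℚ) : Fin 2 → Af := fun i => algebraMap ℚ Af (q i)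

/-- The restriction of a test function to rational vectors. -/
def ratFun (φ : LCc X1) (q : Fin 2 → ℚ) : ℤ := extendZero φ (ratPoint q)

theorem hasDen_of_isIntegralAdele {m : ℕ} {q : Fin 2 → ℚ}
    (h : ∀ i, IsIntegralAdele (m * ratPoint q i)) : HasDen m q := by
  have : ∀ i, ∃ a : ℤ, (m : ℚ) * q i = a := fun i => by
    refine exists_int_of_isIntegralAdele ?_
    rw [map_mul, map_natCast]
    exact h i
  choose a ha using this
  exact ⟨a, ha⟩

theorem isGood_of_extendZero {φ : LCc X1} {m P : ℕ} (hm : 0 < m) (hP : 0 < P)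
    (h1 : ∀ x, extendZero φ x ≠ 0 → ∀ i, IsIntegralAdele (m * x i))
    (h2 : ∀ x y, (∀ i, AdeleCong P (x i) (y i)) → extendZero φ x = extendZero φ y) :
    IsGood m (m * P) (ratFun φ) where
  m_pos := hm
  K_pos := Nat.mul_pos hm hP
  zero := by
    have : ratPoint 0 = 0 := funext fun i => map_zero _
    simp [ratFun, extendZero, this]
  supp q hq := hasDen_of_isIntegralAdele (h1 _ hq)
  per q b := by
    have hm0 : (m : ℚ) ≠ 0 := by exact_mod_cast hm.ne'
    refine h2 _ _ fun i => ⟨(b i : Af), isIntegralAdele_intCast _, ?_⟩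
    have e : ((m * P : ℕ) : ℚ) / m = P := by
      push_cast
      field_simp
    rw [ratPoint, ratPoint, e, map_add, map_mul, map_intCast]

theorem exists_isGood (φ : LCc X1) : ∃ m K, IsGood m K (ratFun φ) := by
  obtain ⟨m, P, hm, hP, h1, h2⟩ := exists_level φ
  exact ⟨m, _, isGood_of_extendZero hm hP h1 h2⟩

theorem ratFun_add (φ ψ : LCc X1) : ratFun (φ + ψ) = ratFun φ + ratFun ψ := by
  funext q
  simp only [ratFun, extendZero, Pi.add_apply]
  split_ifs
  · rfl
  · rfl

/-- The Siegel distribution: for `φ` whose restriction to `ℚ²` is supported in `(1 / m) ℤ²` and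
periodic modulo `(K / m) ℤ²`, its value is the sum of `φ(a / m) g_{a / K}` over `a` in
`(ℤ / K)²`, which does not depend on `m` and `K`. -/
def siegelDistribution : AlgDistribution X1 (QModularUnits Qcycl) :=
  (AddMonoidHom.mk' (fun φ : LCc X1 => siegelValue (ratFun φ)) fun φ ψ => by
    obtain ⟨m, K, h⟩ := exists_isGood φ
    obtain ⟨m', K', h'⟩ := exists_isGood ψ
    obtain ⟨M, L, g, g', -, -⟩ := h.exists_common h'
    rw [ratFun_add, (g.add g').siegelValue_eq, g.siegelValue_eq, g'.siegelValue_eq,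
      siegelSum_add]).toIntLinearMap

theorem siegelDistribution_apply (φ : LCc X1) :
    siegelDistribution φ = siegelValue (ratFun φ) := rfl

/-! ### Values on boxes -/

theorem mem_coset_rat_iff {a r q : ℚ} (hr : r ≠ 0) :
    algebraMap ℚ Af q ∈ coset a r ↔ ∃ s : ℤ, q = a + r * s := by
  constructor
  · rintro ⟨t, ht, h⟩
    have : algebraMap ℚ Af ((q - a) / r) = t := by
      rw [div_eq_inv_mul, map_mul, map_sub, h, add_sub_cancel_left, ← mul_assoc, ← map_mul,
        inv_mul_cancel₀ hr, map_one, one_mul]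
    obtain ⟨s, hs⟩ := exists_int_of_isIntegralAdele (this ▸ ht)
    refine ⟨s, ?_⟩
    rw [← hs]
    field_simp
    ring
  · rintro ⟨s, rfl⟩
    refine ⟨(s : Af), isIntegralAdele_intCast s, ?_⟩
    rw [map_add, map_mul, map_intCast]

theorem ratFun_boxIndicator {r a b : ℚ} (hr : r ≠ 0)
    (hab : ¬ ((∃ m : ℤ, a = r * m) ∧ ∃ m : ℤ, b = r * m)) (q : Fin 2 → ℚ)
    [Decidable ((∃ s : ℤ, q 0 = a + r * s) ∧ ∃ s : ℤ, q 1 = b + r * s)] :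
    ratFun (boxIndicator r a b hr hab) q =
      if (∃ s : ℤ, q 0 = a + r * s) ∧ ∃ s : ℤ, q 1 = b + r * s then 1 else 0 := by
  have hmem : ratPoint q ∈ box r a b ↔
      (∃ s : ℤ, q 0 = a + r * s) ∧ ∃ s : ℤ, q 1 = b + r * s :=
    and_congr (mem_coset_rat_iff hr) (mem_coset_rat_iff hr)
  rw [ratFun, extendZero]
  split_ifs with h1 h2 h2
  · exact Set.indicator_of_mem (s := Subtype.val ⁻¹' box r a b) (hmem.2 h2) _
  · exact Set.indicator_of_notMem (s := Subtype.val ⁻¹' box r a b) (fun h => h2 (hmem.1 h)) _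
  · rw [not_not] at h1
    refine absurd (hmem.2 h2) fun h => hab ?_
    rw [h1] at h
    exact ⟨exists_int_of_zero_mem_coset hr h.1, exists_int_of_zero_mem_coset hr h.2⟩
  · rfl

theorem siegelDistribution_box_of_pos {r a b : ℚ} (hr : 0 < r)
    (hab : ¬ ((∃ m : ℤ, a = r * m) ∧ ∃ m : ℤ, b = r * m)) :
    siegelDistribution (boxIndicator r a b hr.ne' hab) = siegelG ![r⁻¹ * a, r⁻¹ * b] := by
  classical
  have hr0 := hr.ne'
  set v : Fin 2 → ℚ := ![r⁻¹ * a, r⁻¹ * b]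
  have hv : NonInt v := fun m n h => hab ⟨⟨m, by rw [← h.1]; simp [v]; field_simp⟩,
    ⟨n, by rw [← h.2]; simp [v]; field_simp⟩⟩
  have hden := (isSiegelPair_den hv).hasDen
  rw [Nat.add_sub_cancel] at hden
  set n := 6 * ((v 0).den * (v 1).den)
  have hn : 0 < n := by
    have h0 := (v 0).den_pos
    have h1 := (v 1).den_pos
    positivity
  obtain ⟨c, hc⟩ := hden
  have hnum : 0 < r.num := Rat.num_pos.2 hr
  obtain ⟨p, hp⟩ := Int.eq_ofNat_of_zero_le hnum.le
  have hp0 : 0 < p := by omega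
  -- `r = K / m`, where `K` is a denominator of `v`
  set K := n * p with hK
  set m := n * r.den with hm
  have hKpos : 0 < K := Nat.mul_pos hn hp0
  have hmpos : 0 < m := Nat.mul_pos hn r.den_pos
  have hK0 : (K : ℚ) ≠ 0 := by exact_mod_cast hKpos.ne'
  have hm0 : (m : ℚ) ≠ 0 := by exact_mod_cast hmpos.ne'
  have hrm : r * m = K := by
    have h1 : r * r.den = p := by
      rw [Rat.mul_den_eq_num, hp]
      rfl
    rw [hK, hm]
    push_cast
    rw [← h1]
    ring
  have hKv : ∀ i, (K : ℚ) * v i = (p * c i : ℤ) := fun i => by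
    rw [hK]
    push_cast
    rw [← hc i]
    ring
  set χ := ratFun (boxIndicator r a b hr.ne' hab) with hχdef
  have hχ : ∀ q : Fin 2 → ℚ, χ q = if ∀ i, ∃ s : ℤ, q i = r * (v i + s) then 1 else 0 := by
    intro q
    rw [hχdef, ratFun_boxIndicator]
    refine if_congr ?_ rfl rfl
    rw [Fin.forall_fin_two]
    have e : ∀ x y : ℚ, ∀ s : ℤ, x = y + r * s ↔ x = r * (r⁻¹ * y + s) := fun x y s => by
      rw [mul_add, mul_inv_cancel_left₀ hr0]
    simp only [v, e, Matrix.cons_val_zero, Matrix.cons_val_one]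
  have hgood : IsGood m K χ := by
    refine ⟨hmpos, hKpos, ?_, fun q hq => ?_, fun q b => ?_⟩
    · rw [hχ, if_neg]
      intro h
      obtain ⟨s, hs⟩ := h 0
      obtain ⟨t, ht⟩ := h 1
      refine hv (-s) (-t) ⟨?_, ?_⟩ <;> push_cast
      · linarith [(mul_eq_zero.1 hs.symm).resolve_left hr0]
      · linarith [(mul_eq_zero.1 ht.symm).resolve_left hr0]
    · rw [hχ] at hq
      have h : ∀ i, ∃ s : ℤ, q i = r * (v i + s) := by
        by_contra h
        exact hq (if_neg h)
      choose s hs using h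
      refine ⟨fun i => p * c i + K * s i, fun i => ?_⟩
      rw [hs]
      have := hKv i
      push_cast at this ⊢
      rw [← this, ← hrm]
      ring
    · rw [hχ, hχ]
      refine if_congr (forall_congr' fun i => ?_) rfl rfl
      have hr' : (K : ℚ) / m = r := by rw [← hrm]; field_simp
      rw [hr']
      constructor
      · rintro ⟨s, hs⟩
        exact ⟨s - b i, by push_cast; linarith⟩
      · rintro ⟨s, hs⟩
        exact ⟨s + b i, by push_cast; linarith⟩
  have hχa : ∀ x : Fin 2 → ℤ, χ (fun i => x i / m) =
      if (fun i => (x i : ZMod K)) = fun i => ((p * c i : ℤ) : ZMod K) then 1 else 0 := by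
    intro x
    rw [hχ]
    refine if_congr ?_ rfl rfl
    rw [funext_iff]
    refine forall_congr' fun i => ?_
    rw [eq_comm (a := (x i : ZMod K)), ZMod.intCast_eq_intCast_iff_dvd_sub]
    have e : ∀ s : ℤ, (x i / m : ℚ) = r * (v i + s) ↔ (x i : ℚ) = p * c i + K * s := fun s => by
      have := hKv i
      push_cast at this
      rw [div_eq_iff hm0, ← this, ← hrm]
      ring_nf
    simp only [e]
    constructor
    · rintro ⟨s, hs⟩
      exact ⟨s, sub_eq_of_eq_add' (by exact_mod_cast hs)⟩
    · rintro ⟨s, hs⟩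
      exact ⟨s, by exact_mod_cast eq_add_of_sub_eq' hs⟩
  have : NeZero K := ⟨hKpos.ne'⟩
  rw [siegelDistribution_apply, hgood.siegelValue_eq, siegelSum,
    latticeSum_eq_sum_of_periodic
      (fun y => if y = fun i => ((p * c i : ℤ) : ZMod K) then siegelG v else 0) fun x => ?_,
    Finset.sum_ite_eq' Finset.univ, if_pos (Finset.mem_univ _)]
  rw [hχa]
  split_ifs with h
  · rw [one_smul]
    have h1 : ∀ i, ∃ s : ℤ, x i = p * c i + K * s := fun i => by
      obtain ⟨s, hs⟩ := (ZMod.intCast_eq_intCast_iff_dvd_sub _ _ _).1 (congrFun h i).symm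
      exact ⟨s, eq_add_of_sub_eq' hs⟩
    choose s hs using h1
    rw [← siegelG_add_int v s]
    congr 1
    funext i
    have := hKv i
    rw [hs i]
    push_cast at this ⊢
    rw [← this]
    field_simp
  · rw [zero_smul]

theorem siegelDistribution_box {r a b : ℚ} (hr : r ≠ 0)
    (hab : ¬ ((∃ m : ℤ, a = r * m) ∧ ∃ m : ℤ, b = r * m)) :
    IsSiegelUnit (r⁻¹ * a) (r⁻¹ * b) (siegelDistribution (boxIndicator r a b hr hab)) := by
  have hv : NonInt ![r⁻¹ * a, r⁻¹ * b] := fun m n h => hab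
    ⟨⟨m, by rw [← h.1]; simp; field_simp⟩, ⟨n, by rw [← h.2]; simp; field_simp⟩⟩
  suffices h : siegelDistribution (boxIndicator r a b hr hab) = siegelG ![r⁻¹ * a, r⁻¹ * b] by
    rw [h]
    exact isSiegelUnit_siegelG hv
  rcases lt_or_gt_of_ne hr with h | h
  · -- the boxes for `r` and `-r` coincide
    have hneg : ∀ x : ℚ, (∃ m : ℤ, x = -r * m) ↔ ∃ m : ℤ, x = r * m := fun x =>
      ⟨fun ⟨m, hm⟩ => ⟨-m, by rw [hm]; push_cast; ring⟩,
        fun ⟨m, hm⟩ => ⟨-m, by rw [hm]; push_cast; ring⟩⟩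
    have hab' : ¬ ((∃ m : ℤ, a = -r * m) ∧ ∃ m : ℤ, b = -r * m) := by
      rwa [hneg, hneg]
    have hcoset : ∀ x, coset x (-r) = coset x r := fun x => by
      ext y
      constructor
      · rintro ⟨t, ht, rfl⟩
        exact ⟨-t, integralAdeles.neg_mem ht, by rw [map_neg]; ring⟩
      · rintro ⟨t, ht, rfl⟩
        exact ⟨-t, integralAdeles.neg_mem ht, by rw [map_neg]; ring⟩
    have e : boxIndicator r a b hr hab = boxIndicator (-r) a b (neg_ne_zero.2 hr) hab' := by
      refine Subtype.ext ?_
      simp only [boxIndicator, box, hcoset]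
    rw [e, siegelDistribution_box_of_pos (neg_pos.2 h) hab', ← siegelG_neg hv]
    congr 1
    funext i
    fin_cases i <;> simp [inv_neg]
  · exact siegelDistribution_box_of_pos h hab

end

section

open Finset

/-! ### Invariance under `Π_ℚ` -/

theorem vmul_div (a : Fin 2 → ℤ) (K : ℕ) (B : Matrix (Fin 2) (Fin 2) ℤ) :
    vmul (fun i => (a i / K : ℚ)) B = fun i => (Matrix.vecMul a B i / K : ℚ) := by
  funext i
  simp only [vmul, Matrix.vecMul, dotProduct, Fin.sum_univ_two, Matrix.map_apply]
  push_cast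
  ring

/-- If `T` maps `g_v` to `g_{v B}` for `v ∈ (1 / K) ℤ²`, where `B` is invertible modulo `K`, then
`T` maps the value of the Siegel distribution on `χ(· B)` to its value on `χ`. -/
theorem IsGood.map_siegelSum {V : Type*} [AddCommGroup V] {T T' : QModularUnits Qcycl →ₗ[ℤ] V}
    {m K : ℕ} {χ χ' : (Fin 2 → ℚ) → ℤ} (h : IsGood m K χ) {B C : Matrix (Fin 2) (Fin 2) ℤ}
    (hBC : ∀ i j, (K : ℤ) ∣ (B * C) i j - (1 : Matrix (Fin 2) (Fin 2) ℤ) i j)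
    (hχ : ∀ a : Fin 2 → ℤ, χ' (fun i => a i / m) = χ fun i => Matrix.vecMul a B i / m)
    (hT : ∀ v, NonInt v → HasDen K v → T (siegelG v) = T' (siegelG (vmul v B))) :
    T (siegelSum m K χ') = T' (siegelSum m K χ) := by
  have hK0 : (K : ℚ) ≠ 0 := by exact_mod_cast h.K_pos.ne'
  rw [siegelSum, siegelSum, map_latticeSum, map_latticeSum]
  refine Eq.trans ?_ (latticeSum_vecMul h.K_pos (fun a b hab => ?_) hBC)
  · refine latticeSum_congr fun a => ?_
    rw [hχ]
    by_cases h0 : (χ fun i => Matrix.vecMul a B i / m) = 0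
    · simp [h0]
    · have h1 := h.nonInt h0
      rw [← vmul_div a K B] at h1
      simp only [← vmul_div a K B]
      rw [map_zsmul, map_zsmul, hT _ _ ⟨a, fun i => mul_div_cancel₀ _ hK0⟩]
      rintro s t ⟨hs, ht⟩
      beta_reduce at hs ht
      refine h1 (s * B 0 0 + t * B 1 0) (s * B 0 1 + t * B 1 1) ⟨?_, ?_⟩
      · rw [vmul_zero_apply, hs, ht]
        push_cast
        rfl
      · rw [vmul_one_apply, hs, ht]
        push_cast
        rfl
  · rw [h.periodic hab]
    choose c hc using hab
    rw [← siegelG_add_int (fun i => (b i / K : ℚ)) c]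
    congr 3
    funext i
    rw [eq_add_of_sub_eq' (hc i)]
    push_cast
    field_simp

theorem siegelDistribution_actsAs {σ : AutM} (hσ : σ ∈ PiQ) {h : GL (Fin 2) Af} (hh : ActsAs σ h)
    {A : ModularUnits Qbar →* ModularUnits Qbar} (hA : IsUnitAction σ A) (φ : LCc X1) :
    QModularUnits.map A (QModularUnits.map unitsInclusion
      (siegelDistribution (LCc.comp (rightMul h) φ))) =
        QModularUnits.map unitsInclusion (siegelDistribution φ) := by
  obtain ⟨m, P, hm, hP, h1, h2⟩ := exists_level φ
  have hint := hh.1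
  have hm0 : (m : ℚ) ≠ 0 := by exact_mod_cast hm.ne'
  have hvec : ∀ (x : Fin 2 → Af) (g : GL (Fin 2) Af), (∀ i j, IsIntegralAdele (g.1 i j)) →
      (∀ i, IsIntegralAdele (x i)) → ∀ i, IsIntegralAdele (Matrix.vecMul x g.1 i) := by
    intro x g hg hx i
    simp only [Matrix.vecMul, dotProduct, Fin.sum_univ_two]
    exact integralAdeles.add_mem (integralAdeles.mul_mem (hx 0) (hg 0 i))
      (integralAdeles.mul_mem (hx 1) (hg 1 i))
  -- `φ(· h)` has the same denominator and period as `φ`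
  have hgood' := isGood_of_extendZero (φ := LCc.comp (rightMul h) φ) hm hP
    (fun x hx => by
      rw [extendZero_comp] at hx
      have h3 := hvec ((m : Af) • Matrix.vecMul x h.1) h⁻¹ hint.2 (h1 _ hx)
      rwa [Matrix.smul_vecMul, vecMul_vecMul_inv] at h3)
    (fun x y hxy => by
      rw [extendZero_comp, extendZero_comp]
      choose t ht hxt using hxy
      refine h2 _ _ fun i => ⟨_, hvec t h hint.1 ht i, ?_⟩
      have : x = y + algebraMap ℚ Af P • t := funext hxt
      rw [this, Matrix.add_vecMul, Matrix.smul_vecMul]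
      rfl)
  have hgood := isGood_of_extendZero hm hP h1 h2
  have hK := hgood.K_pos
  obtain ⟨B, hB⟩ := exists_matCong hK hint.1
  obtain ⟨C, -, hBC⟩ := hB.exists_inv hint hK
  rw [siegelDistribution_apply, siegelDistribution_apply, hgood'.siegelValue_eq,
    hgood.siegelValue_eq]
  refine hgood.map_siegelSum
    (T := (QModularUnits.map A).comp (QModularUnits.map unitsInclusion)) hBC (fun a => ?_)
    fun v hv hvK => map_siegelG hσ hh hA hv hK hvK hB
  rw [ratFun, ratFun, extendZero_comp]
  -- `(a / m) h ≡ (a / m) B` modulo `P`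
  refine h2 _ _ fun i => ?_
  have e : ∀ x y : Af, AdeleCong ((m * P : ℕ) : ℚ) x y → ∀ b : ℤ, ∃ t, IsIntegralAdele t ∧
      algebraMap ℚ Af (b / m) * y = algebraMap ℚ Af (b / m) * x + algebraMap ℚ Af P * t := by
    intro x y hxy b
    obtain ⟨t, ht, rfl⟩ := hxy
    refine ⟨-((b : Af) * t), integralAdeles.neg_mem
      (integralAdeles.mul_mem (isIntegralAdele_intCast b) ht), ?_⟩
    have : algebraMap ℚ Af (b / m) * algebraMap ℚ Af ((m * P : ℕ) : ℚ) =
        algebraMap ℚ Af P * (b : Af) := by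
      rw [← map_mul, ← map_intCast (algebraMap ℚ Af) b, ← map_mul]
      congr 1
      push_cast
      field_simp
    linear_combination -t * this
  obtain ⟨t0, ht0, e0⟩ := e _ _ (hB 0 i) (a 0)
  obtain ⟨t1, ht1, e1⟩ := e _ _ (hB 1 i) (a 1)
  refine ⟨t0 + t1, integralAdeles.add_mem ht0 ht1, ?_⟩
  simp only [ratPoint, Matrix.vecMul, dotProduct, Fin.sum_univ_two]
  rw [e0, e1]
  have : algebraMap ℚ Af (((a 0 * B 0 i + a 1 * B 1 i : ℤ) : ℚ) / m) =
      algebraMap ℚ Af (a 0 / m) * (B 0 i : Af) + algebraMap ℚ Af (a 1 / m) * (B 1 i : Af) := by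
    rw [← map_intCast (algebraMap ℚ Af) (B 0 i), ← map_intCast (algebraMap ℚ Af) (B 1 i),
      ← map_mul, ← map_mul, ← map_add]
    congr 1
    push_cast
    ring
  rw [this]
  ring

/-! ### Modular units over `ℂ` and composition with rational matrices -/

/-- The inclusion of `𝒰(K)` in the group of all modular units. -/
def inclTop (K : IntermediateField ℚ ℂ) : ModularUnits K →* ModularUnits ⊤ :=
  Units.map (Subring.inclusion (modularFunctions_mono (le_top : K ≤ ⊤))).toMonoidHom

/-- Relations between elements of `ℚ ⊗ 𝒰(K)` can be checked over `ℂ`, since `ℚ` is flat over `ℤ`. -/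
theorem map_inclTop_injective (K : IntermediateField ℚ ℂ) :
    Function.Injective (QModularUnits.map (inclTop K)) := by
  have : Module.Flat ℤ ℚ := IsLocalization.flat ℚ (nonZeroDivisors ℤ)
  exact Module.Flat.lTensor_preserves_injective_linearMap _ fun u v h =>
    unitFun_injective (congrArg (unitFun (K := ⊤)) h :)

/-- Composition of modular functions with the action of a rational matrix. -/
def compRingHom (γ : GL(2, ℚ)⁺) : modularFunctions ⊤ →+* modularFunctions ⊤ where
  toFun u := ⟨fun τ => u.1 (realMat γ • τ), modularFunctions_comp u.2 γ⟩
  map_one' := rfl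
  map_mul' _ _ := rfl
  map_zero' := rfl
  map_add' _ _ := rfl

/-- Composition of modular units with the action of a rational matrix. -/
def compUnit (γ : GL(2, ℚ)⁺) : ModularUnits ⊤ →* ModularUnits ⊤ :=
  Units.map (compRingHom γ).toMonoidHom

theorem compUnit_apply (γ : GL(2, ℚ)⁺) (u : ModularUnits ⊤) (τ : ℍ) :
    unitFun (compUnit γ u) τ = unitFun u (realMat γ • τ) := rfl

theorem QModularUnits.map_map {K L M : IntermediateField ℚ ℂ}
    (A : ModularUnits L →* ModularUnits M) (B : ModularUnits K →* ModularUnits L)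
    (x : QModularUnits K) :
    QModularUnits.map A (QModularUnits.map B x) = QModularUnits.map (A.comp B) x :=
  (LinearMap.lTensor_comp_apply ℚ (MonoidHom.toAdditive A).toIntLinearMap
    (MonoidHom.toAdditive B).toIntLinearMap x).symm

theorem QModularUnits.map_id {K : IntermediateField ℚ ℂ} (x : QModularUnits K) :
    QModularUnits.map (MonoidHom.id _) x = x :=
  LinearMap.lTensor_id_apply ℚ _ x

theorem compUnit_mul (γ δ : GL(2, ℚ)⁺) :
    compUnit (γ * δ) = (compUnit δ).comp (compUnit γ) := by
  refine MonoidHom.ext fun u => unitFun_injective (funext fun τ => ?_)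
  rw [MonoidHom.comp_apply, compUnit_apply, compUnit_apply, compUnit_apply, realMat_mul, mul_smul]

theorem compUnit_eq_id {γ : GL(2, ℚ)⁺} (h : ∀ τ : ℍ, realMat γ • τ = τ) :
    compUnit γ = MonoidHom.id _ :=
  MonoidHom.ext fun u => unitFun_injective (funext fun τ => by
    rw [compUnit_apply, h, MonoidHom.id_apply])

theorem rep_comp_siegelG {v : Fin 2 → ℚ} (hv : NonInt v) (γ : GL(2, ℚ)⁺) :
    Rep (QModularUnits.map (compUnit γ) (QModularUnits.map (inclTop Qcycl) (siegelG v)))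
      fun τ => sv v (realMat γ • τ) :=
  ((rep_siegelG hv).map (inclTop Qcycl) id fun _ _ => rfl).map (compUnit γ) _ (compUnit_apply γ)

theorem rep_top_siegelG {v : Fin 2 → ℚ} (hv : NonInt v) :
    Rep (QModularUnits.map (inclTop Qcycl) (siegelG v)) (sv v) :=
  (rep_siegelG hv).map (inclTop Qcycl) id fun _ _ => rfl

theorem coe_realMat_smul (γ : GL(2, ℚ)⁺) (τ : ℍ) : ((realMat γ • τ : ℍ) : ℂ) =
    ((γ.1.1 0 0 : ℂ) * τ + (γ.1.1 0 1 : ℂ)) / ((γ.1.1 1 0 : ℂ) * τ + (γ.1.1 1 1 : ℂ)) := by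
  rw [UpperHalfPlane.coe_smul_of_det_pos (realMat_det_pos γ)]
  simp [UpperHalfPlane.num, UpperHalfPlane.denom, realMat]

/-! ### Invariance under `GL₂(ℚ)⁺` -/

theorem exists_nat_mul_matrix (M : Matrix (Fin 2) (Fin 2) ℚ) :
    ∃ D : ℕ, 0 < D ∧ ∃ A : Matrix (Fin 2) (Fin 2) ℤ, ∀ i j, (D : ℚ) * M i j = A i j := by
  refine ⟨∏ p : Fin 2 × Fin 2, (M p.1 p.2).den, prod_pos fun p _ => (M p.1 p.2).den_pos, ?_⟩
  have : ∀ i j, ∃ a : ℤ, ((∏ p : Fin 2 × Fin 2, (M p.1 p.2).den : ℕ) : ℚ) * M i j = a := by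
    intro i j
    obtain ⟨k, hk⟩ := dvd_prod_of_mem (fun p : Fin 2 × Fin 2 => (M p.1 p.2).den) (mem_univ (i, j))
    refine ⟨k * (M i j).num, ?_⟩
    rw [hk]
    push_cast
    rw [← Rat.mul_den_eq_num (M i j)]
    ring
  choose A hA using this
  exact ⟨Matrix.of A, hA⟩

theorem IsGood.exists_comp {m K : ℕ} {χ : (Fin 2 → ℚ) → ℤ} (h : IsGood m K χ)
    (γ : GL(2, ℚ)⁺) : ∃ m' K', IsGood m' K' fun q => χ (Matrix.vecMul q γ.1.1) := by
  obtain ⟨D, hD, A, hA⟩ := exists_nat_mul_matrix (γ.1⁻¹).1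
  obtain ⟨E, hE, B, hB⟩ := exists_nat_mul_matrix γ.1.1
  refine ⟨m * D, K * E * D, Nat.mul_pos h.m_pos hD,
    Nat.mul_pos (Nat.mul_pos h.K_pos hE) hD, ?_, fun q hq => ?_, fun q b => ?_⟩
  · rw [Matrix.zero_vecMul, h.zero]
  · obtain ⟨a, ha⟩ := h.supp _ hq
    refine ⟨Matrix.vecMul a A, fun j => ?_⟩
    have hq' : Matrix.vecMul (Matrix.vecMul q γ.1.1) (γ.1⁻¹).1 = q := by
      rw [Matrix.vecMul_vecMul, ← Units.val_mul, mul_inv_cancel, Units.val_one, Matrix.vecMul_one]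
    have e : Matrix.vecMul (Matrix.vecMul q γ.1.1) (γ.1⁻¹).1 j =
        Matrix.vecMul q γ.1.1 0 * (γ.1⁻¹).1 0 j + Matrix.vecMul q γ.1.1 1 * (γ.1⁻¹).1 1 j := by
      simp only [Matrix.vecMul, dotProduct, Fin.sum_univ_two]
    rw [hq'] at e
    generalize (γ.1⁻¹).1 = G at hA e
    rw [e]
    simp only [Matrix.vecMul, dotProduct, Fin.sum_univ_two] at ha ⊢
    push_cast
    rw [← hA 0 j, ← hA 1 j, ← ha 0, ← ha 1]
    ring
  · have hD0 : (D : ℚ) ≠ 0 := by exact_mod_cast hD.ne'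
    rw [← h.per (Matrix.vecMul q γ.1.1) (Matrix.vecMul b B)]
    congr 1
    funext j
    simp only [Matrix.vecMul, dotProduct, Fin.sum_univ_two]
    push_cast
    rw [← hB 0 j, ← hB 1 j, mul_div_mul_right _ _ hD0]
    ring

/-- The value of the Siegel distribution in the group of all modular units. -/
def siegelTop (χ : (Fin 2 → ℚ) → ℤ) : QModularUnits ⊤ :=
  QModularUnits.map (inclTop Qcycl) (siegelValue χ)

theorem IsGood.siegelTop_eq {m K : ℕ} {χ : (Fin 2 → ℚ) → ℤ} (h : IsGood m K χ) : siegelTop χ =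
    latticeSum K fun a => χ (fun i => a i / m) •
      QModularUnits.map (inclTop Qcycl) (siegelG fun i => a i / K) := by
  rw [siegelTop, h.siegelValue_eq, siegelSum, map_latticeSum]
  exact latticeSum_congr fun a => map_zsmul _ _ _

/-- The elements of `GL₂(ℚ)⁺` which fix the Siegel distribution, seen as a function of the
restrictions of test functions to `ℚ²` and with values in `ℚ ⊗ 𝒰(ℂ)`. -/
def siegelStabilizer : Subgroup GL(2, ℚ)⁺ where
  carrier := {γ | ∀ χ, (∃ m K, IsGood m K χ) →
    QModularUnits.map (compUnit γ) (siegelTop fun q => χ (Matrix.vecMul q γ.1.1)) = siegelTop χ}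
  mul_mem' := by
    intro γ δ hγ hδ χ ⟨m, K, h⟩
    rw [← hδ χ ⟨m, K, h⟩, ← hγ _ (h.exists_comp δ), compUnit_mul, ← QModularUnits.map_map]
    simp only [Matrix.vecMul_vecMul]
    rfl
  one_mem' := by
    intro χ _
    rw [compUnit_eq_id fun τ => by
      rw [show realMat 1 = 1 from by simp [realMat], one_smul], QModularUnits.map_id]
    simp
  inv_mem' := by
    intro γ hγ χ ⟨m, K, h⟩
    rw [← hγ _ (h.exists_comp γ⁻¹), QModularUnits.map_map, ← compUnit_mul, mul_inv_cancel,
      compUnit_eq_id fun τ => by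
        rw [show realMat 1 = 1 from by simp [realMat], one_smul], QModularUnits.map_id]
    congr 1
    funext q
    rw [Matrix.vecMul_vecMul, ← Units.val_mul]
    have : γ.1 * (γ⁻¹ : GL(2, ℚ)⁺).1 = 1 := mul_inv_cancel γ.1
    rw [this, Units.val_one, Matrix.vecMul_one]

theorem mem_siegelStabilizer_of_SL {γ : GL(2, ℚ)⁺} (δ : SL(2, ℤ))
    (h : ∀ i j, γ.1.1 i j = δ i j) : γ ∈ siegelStabilizer := by
  intro χ ⟨m, K, hχ⟩
  obtain ⟨m', K', hχ'⟩ := hχ.exists_comp γ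
  obtain ⟨M, L, g, g', -, -⟩ := hχ.exists_common hχ'
  have hsmul : ∀ τ : ℍ, realMat γ • τ = δ • τ := fun τ => by
    apply UpperHalfPlane.ext
    rw [coe_realMat_smul, UpperHalfPlane.specialLinearGroup_apply]
    simp [h]
  rw [siegelTop, siegelTop, g'.siegelValue_eq, g.siegelValue_eq]
  refine g.map_siegelSum (T := (QModularUnits.map (compUnit γ)).comp
    (QModularUnits.map (inclTop Qcycl))) (B := δ.1) (C := (δ⁻¹).1) (fun i j => ?_) (fun a => ?_)
    fun v hv hvK => ?_
  · rw [← Matrix.SpecialLinearGroup.coe_mul, mul_inv_cancel]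
    simp
  · congr 1
    funext i
    simp only [Matrix.vecMul, dotProduct, Fin.sum_univ_two, h]
    push_cast
    ring
  · refine ((rep_comp_siegelG hv γ).rootEquiv ?_).unique
      (rep_top_siegelG (hv.vmul_SL hvK δ))
    simp only [hsmul]
    exact sv_smul δ v

theorem mem_siegelStabilizer_of_scalar {γ : GL(2, ℚ)⁺} {n : ℕ} (hn : 0 < n)
    (h : γ.1.1 = Matrix.diagonal fun _ => (n : ℚ)) : γ ∈ siegelStabilizer := by
  intro χ ⟨m, K, hχ⟩
  have hn0 : (n : ℚ) ≠ 0 := by exact_mod_cast hn.ne'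
  have hnC : (n : ℂ) ≠ 0 := by exact_mod_cast hn.ne'
  have hmul : ∀ q : Fin 2 → ℚ, Matrix.vecMul q γ.1.1 = fun i => n * q i := fun q => by
    funext i
    rw [h, Matrix.vecMul_diagonal, mul_comm]
  rw [compUnit_eq_id fun τ => UpperHalfPlane.ext (by
    rw [coe_realMat_smul, h]
    simp [hnC]), QModularUnits.map_id]
  simp only [hmul]
  have hχ' : IsGood (m * n) K fun q => χ fun i => n * q i := by
    refine ⟨Nat.mul_pos hχ.m_pos hn, hχ.K_pos, ?_, fun q hq => ?_, fun q b => ?_⟩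
    · refine Eq.trans ?_ hχ.zero
      congr 1
      funext i
      simp
    · obtain ⟨a, ha⟩ := hχ.supp _ hq
      refine ⟨a, fun i => ?_⟩
      rw [← ha i]
      push_cast
      ring
    · rw [← hχ.per (fun i => n * q i) b]
      congr 1
      funext i
      push_cast
      field_simp
  rw [hχ'.siegelTop_eq, hχ.siegelTop_eq]
  refine latticeSum_congr fun a => ?_
  congr 2
  funext i
  push_cast
  field_simp

/-- The matrix `diag(d, 1)` fixes the Siegel distribution, by the relation between the functions
`s_{((x + j) / d, y)}(d τ)` and `s_{(x, y)}(τ)`. -/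
theorem mem_siegelStabilizer_of_diagonal {γ : GL(2, ℚ)⁺} {d : ℕ} (hd : 0 < d)
    (h : γ.1.1 = Matrix.diagonal ![(d : ℚ), 1]) : γ ∈ siegelStabilizer := by
  intro χ ⟨m, K, hχ⟩
  have hd0 : (d : ℚ) ≠ 0 := by exact_mod_cast hd.ne'
  have hm0 : (m : ℚ) ≠ 0 := by exact_mod_cast hχ.m_pos.ne'
  have hK0 : (K : ℚ) ≠ 0 := by exact_mod_cast hχ.K_pos.ne'
  have hmul : ∀ q : Fin 2 → ℚ, Matrix.vecMul q γ.1.1 = ![d * q 0, q 1] := fun q => by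
    funext i
    rw [h, Matrix.vecMul_diagonal]
    fin_cases i
    · simp [mul_comm]
    · simp
  have hδ : ∀ τ : ℍ, ((realMat γ • τ : ℍ) : ℂ) = d * τ := fun τ => by
    rw [coe_realMat_smul, h]
    simp
  simp only [hmul]
  have hχ' : IsGood (m * d) (K * d) fun q => χ ![d * q 0, q 1] := by
    refine ⟨Nat.mul_pos hχ.m_pos hd, Nat.mul_pos hχ.K_pos hd, ?_, fun q hq => ?_, fun q b => ?_⟩
    · refine Eq.trans ?_ hχ.zero
      congr 1
      funext i
      fin_cases i <;> simp
    · obtain ⟨a, ha⟩ := hχ.supp _ hq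
      have h0 := ha 0
      have h1 := ha 1
      simp only [Matrix.cons_val_zero, Matrix.cons_val_one] at h0 h1
      refine ⟨![a 0, d * a 1], fun i => ?_⟩
      fin_cases i
      · simp [← h0]
        ring
      · simp [← h1]
        ring
    · rw [← hχ.per ![d * q 0, q 1] ![d * b 0, b 1]]
      congr 1
      funext i
      push_cast
      rw [mul_div_mul_right _ _ hd0]
      fin_cases i
      · simp
        ring
      · simp
  have key : ∀ x y : ℚ, NonInt ![x, y] → ∑ l ∈ range d, QModularUnits.map (compUnit γ)
      (QModularUnits.map (inclTop Qcycl) (siegelG ![(x + l) / d, y])) =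
        QModularUnits.map (inclTop Qcycl) (siegelG ![x, y]) := fun x y hxy => by
    refine Rep.unique (Rep.rootEquiv (Rep.sum _ fun l _ => rep_comp_siegelG (hxy.div_add (d := d)
      ![l, 0] fun i => ?_) γ) ?_) (rep_top_siegelG hxy)
    · fin_cases i
      · right; left
        simp
        field_simp
      · right; right
        simp
    · convert prod_sv_scale hd hδ x y using 1
      funext τ
      simp only [Finset.prod_apply]
  rw [hχ'.siegelTop_eq, hχ.siegelTop_eq, map_latticeSum, latticeSum, latticeSum, sum_range_mul_eq]
  refine sum_congr rfl fun k _ => ?_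
  have hinner : ∀ l : ℕ, ∑ j ∈ range (K * d), QModularUnits.map (compUnit γ)
      ((χ ![d * ((![((K * l + k : ℕ) : ℤ), (j : ℤ)] 0 : ℤ) / ((m * d : ℕ) : ℚ)),
        (![((K * l + k : ℕ) : ℤ), (j : ℤ)] 1 : ℤ) / ((m * d : ℕ) : ℚ)]) •
        QModularUnits.map (inclTop Qcycl)
          (siegelG fun i => (![((K * l + k : ℕ) : ℤ), (j : ℤ)] i : ℚ) / ((K * d : ℕ) : ℚ))) =
      ∑ j ∈ range K, χ (fun i => (![(k : ℤ), (j : ℤ)] i : ℚ) / m) •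
        QModularUnits.map (compUnit γ) (QModularUnits.map (inclTop Qcycl)
          (siegelG ![((k / K : ℚ) + l) / d, j / K])) := by
    intro l
    rw [mul_comm K d, sum_range_mul_eq, sum_eq_single 0]
    · refine sum_congr rfl fun j _ => ?_
      rw [map_zsmul, ← hχ.periodic (a := ![((K * l + k : ℕ) : ℤ), (j : ℤ)]) fun i => by
        fin_cases i <;> simp]
      congr 2
      · funext i
        fin_cases i <;> simp <;> field_simp
      · congr 2
        funext i
        fin_cases i <;> simp <;> field_simp
        ring
    · intro j' hj' hj0
      refine sum_eq_zero fun j _ => ?_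
      rw [map_zsmul]
      refine smul_eq_zero_of_left ?_ _
      by_contra hne
      obtain ⟨a, ha⟩ := hχ.supp _ hne
      have h1 := ha 1
      simp at h1
      field_simp at h1
      have h2 : (d * j + j' : ℤ) = d * a 1 := by exact_mod_cast h1
      have : (d : ℤ) ∣ j' := ⟨a 1 - j, by linarith⟩
      exact hj0 (Nat.eq_zero_of_dvd_of_lt (Int.natCast_dvd_natCast.1 this) (mem_range.1 hj'))
    · intro h2
      exact absurd (mem_range.2 hd) h2
  refine Eq.trans (sum_congr rfl fun l _ => hinner l) ?_
  rw [sum_comm]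
  refine sum_congr rfl fun j _ => ?_
  rw [← smul_sum]
  by_cases h0 : χ (fun i => (![(k : ℤ), (j : ℤ)] i : ℚ) / m) = 0
  · rw [h0, zero_smul, zero_smul]
  · have h1 := hχ.nonInt h0
    have e : (fun i => (![(k : ℤ), (j : ℤ)] i : ℚ) / K) = ![(k / K : ℚ), j / K] := by
      funext i
      fin_cases i <;> simp
    rw [e] at h1 ⊢
    rw [key _ _ h1]

end

section

/-! ### Generation of `GL₂(ℚ)⁺` -/

/-- The element of `GL₂(ℚ)⁺` with given matrix. -/
def glPos (M : Matrix (Fin 2) (Fin 2) ℚ) (hM : 0 < M.det) : GL(2, ℚ)⁺ :=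
  ⟨Matrix.GeneralLinearGroup.mkOfDetNeZero M hM.ne', hM⟩

theorem glPos_mul {M M' M'' : Matrix (Fin 2) (Fin 2) ℚ} (hM : 0 < M.det) (hM' : 0 < M'.det)
    (hM'' : 0 < M''.det) (h : M * M' = M'') : glPos M hM * glPos M' hM' = glPos M'' hM'' :=
  Subtype.ext (Units.ext h)

theorem upper_mem_siegelStabilizer {a b e : ℤ} (ha : 0 < a) (he : 0 < e)
    (h : 0 < (!![(a : ℚ), b; 0, e]).det) : glPos !![(a : ℚ), b; 0, e] h ∈ siegelStabilizer := by
  lift a to ℕ using ha.le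
  lift e to ℕ using he.le
  have ha' : 0 < a := by omega
  have he' : 0 < e := by omega
  have haQ : (0 : ℚ) < a := by exact_mod_cast ha'
  have heQ : (0 : ℚ) < e := by exact_mod_cast he'
  have d1 : ∀ x : ℚ, 0 < x → 0 < (Matrix.diagonal ![x, 1]).det := fun x hx => by simpa using hx
  have d2 : 0 < (Matrix.diagonal fun _ : Fin 2 => (e : ℚ)).det := by simp; positivity
  have d3 : 0 < (!![(1 : ℚ), b; 0, 1]).det := by simp
  have d4 : 0 < (!![(1 : ℚ), 0; 0, e]).det := by simpa using heQ
  have d5 : 0 < (!![(a : ℚ), b; 0, 1]).det := by simpa using haQ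
  have h1 := mem_siegelStabilizer_of_diagonal (γ := glPos _ (d1 a haQ)) ha' rfl
  have h2 := mem_siegelStabilizer_of_diagonal (γ := glPos _ (d1 e heQ)) he' rfl
  have h3 := mem_siegelStabilizer_of_scalar (γ := glPos _ d2) he' rfl
  have h4 := mem_siegelStabilizer_of_SL (γ := glPos _ d3) (ModularGroup.T ^ b) fun i j => by
    rw [ModularGroup.coe_T_zpow]
    fin_cases i <;> fin_cases j <;> simp [glPos, Matrix.GeneralLinearGroup.mkOfDetNeZero]
  have h5 : glPos _ d4 ∈ siegelStabilizer := by
    refine (siegelStabilizer.mul_mem_cancel_left h2).1 ?_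
    rwa [glPos_mul _ _ d2]
    ext i j
    fin_cases i <;> fin_cases j <;> simp [Matrix.mul_apply]
  have h6 : glPos _ d5 ∈ siegelStabilizer := by
    rw [← glPos_mul d3 (d1 a haQ) d5]
    · exact siegelStabilizer.mul_mem h4 h1
    · ext i j
      fin_cases i <;> fin_cases j <;> simp [Matrix.mul_apply]
  have h7 := siegelStabilizer.mul_mem h5 h6
  rwa [glPos_mul d4 d5 h] at h7
  ext i j
  fin_cases i <;> fin_cases j <;> simp [Matrix.mul_apply]

theorem upper_mem_siegelStabilizer' {a b e : ℤ} (hae : 0 < a * e)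
    (h : 0 < (!![(a : ℚ), b; 0, e]).det) : glPos !![(a : ℚ), b; 0, e] h ∈ siegelStabilizer := by
  rcases pos_and_pos_or_neg_and_neg_of_mul_pos hae with ⟨ha, he⟩ | ⟨ha, he⟩
  · exact upper_mem_siegelStabilizer ha he h
  · have d1 : 0 < (-1 : Matrix (Fin 2) (Fin 2) ℚ).det := by simp [Matrix.det_fin_two]
    have d2 : 0 < (!![((-a : ℤ) : ℚ), (-b : ℤ); 0, (-e : ℤ)]).det := by simpa using h
    have h1 := mem_siegelStabilizer_of_SL (γ := glPos _ d1) (-1) fun i j => by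
      fin_cases i <;> fin_cases j <;> simp [glPos, Matrix.GeneralLinearGroup.mkOfDetNeZero]
    refine (siegelStabilizer.mul_mem_cancel_left h1).1 ?_
    rw [glPos_mul d1 h d2]
    · exact upper_mem_siegelStabilizer (by omega) (by omega) d2
    · ext i j
      fin_cases i <;> fin_cases j <;> simp

/-- `GL₂(ℚ)⁺` is generated by `SL₂(ℤ)`, the scalars and the matrices `diag(d, 1)`. -/
theorem siegelStabilizer_eq_top : siegelStabilizer = ⊤ := by
  refine eq_top_iff.2 fun γ _ => ?_
  obtain ⟨D, hD, A, hA⟩ := exists_nat_mul_matrix γ.1.1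
  have hDQ : (0 : ℚ) < D := by exact_mod_cast hD
  have hγ : 0 < γ.1.1.det := γ.2
  have hdet : 0 < A.det := by
    have : ((A.det : ℤ) : ℚ) = D ^ 2 * γ.1.1.det := by
      rw [Matrix.det_fin_two, Matrix.det_fin_two]
      push_cast
      simp only [← hA]
      ring
    have h2 : (0 : ℚ) < (A.det : ℤ) := by
      rw [this]
      positivity
    exact_mod_cast h2
  rw [Matrix.det_fin_two] at hdet
  -- a unimodular matrix with `δ A` upper triangular
  have hg : 0 < Int.gcd (A 0 0) (A 1 0) := by
    rw [Nat.pos_iff_ne_zero]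
    intro h0
    rw [Int.gcd_eq_zero_iff] at h0
    rw [h0.1, h0.2] at hdet
    simp at hdet
  obtain ⟨g, x, z, hg0, hxz, hx, hz⟩ := Int.exists_gcd_one' hg
  obtain ⟨δ, hδ⟩ := (Int.isCoprime_iff_gcd_eq_one.2 hxz).symm.neg_left.exists_SL2_row 1
  have hδ0 : δ 1 0 = -z := hδ.1
  have hδ1 : δ 1 1 = x := hδ.2
  have hδdet := δ.det_coe
  rw [Matrix.det_fin_two] at hδdet
  set a := δ 0 0 * A 0 0 + δ 0 1 * A 1 0
  set b := δ 0 0 * A 0 1 + δ 0 1 * A 1 1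
  set e := δ 1 0 * A 0 1 + δ 1 1 * A 1 1
  have hzero : δ 1 0 * A 0 0 + δ 1 1 * A 1 0 = 0 := by
    rw [hδ0, hδ1, hx, hz]
    ring
  have hae : 0 < a * e := by
    have : a * e = A 0 0 * A 1 1 - A 0 1 * A 1 0 := by
      linear_combination (A 0 0 * A 1 1 - A 0 1 * A 1 0) * hδdet + b * hzero
    rwa [this]
  have d1 : 0 < (Matrix.diagonal fun _ : Fin 2 => (D : ℚ)).det := by simp; positivity
  have d2 : 0 < (δ.1.map (Int.cast : ℤ → ℚ)).det := by
    rw [Matrix.det_fin_two]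
    simp only [Matrix.map_apply]
    have : (0 : ℤ) < δ.1 0 0 * δ.1 1 1 - δ.1 0 1 * δ.1 1 0 := by
      rw [hδdet]
      exact one_pos
    exact_mod_cast this
  have d3 : 0 < (!![(a : ℚ), b; 0, e]).det := by
    rw [Matrix.det_fin_two_of, mul_zero, sub_zero]
    exact_mod_cast hae
  have h1 := mem_siegelStabilizer_of_scalar (γ := glPos _ d1) hD rfl
  have h2 := mem_siegelStabilizer_of_SL (γ := glPos _ d2) δ fun i j => rfl
  have h3 : glPos _ d2 * (glPos _ d1 * γ) = glPos _ d3 := by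
    refine Subtype.ext (Units.ext ?_)
    change δ.1.map (Int.cast : ℤ → ℚ) * (Matrix.diagonal (fun _ : Fin 2 => (D : ℚ)) * γ.1.1) = _
    have : Matrix.diagonal (fun _ : Fin 2 => (D : ℚ)) * γ.1.1 = A.map (Int.cast : ℤ → ℚ) := by
      refine Matrix.ext fun i j => ?_
      rw [Matrix.diagonal_mul, hA, Matrix.map_apply]
    rw [this]
    refine Matrix.ext fun i j => ?_
    rw [Matrix.mul_apply, Fin.sum_univ_two]
    simp only [Matrix.map_apply]
    fin_cases i <;> fin_cases j
    · change ((δ.1 0 0 : ℤ) : ℚ) * (A 0 0 : ℤ) + (δ.1 0 1 : ℤ) * (A 1 0 : ℤ) = (a : ℚ)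
      exact_mod_cast rfl
    · change ((δ.1 0 0 : ℤ) : ℚ) * (A 0 1 : ℤ) + (δ.1 0 1 : ℤ) * (A 1 1 : ℤ) = (b : ℚ)
      exact_mod_cast rfl
    · change ((δ.1 1 0 : ℤ) : ℚ) * (A 0 0 : ℤ) + (δ.1 1 1 : ℤ) * (A 1 0 : ℤ) = 0
      exact_mod_cast hzero
    · change ((δ.1 1 0 : ℤ) : ℚ) * (A 0 1 : ℤ) + (δ.1 1 1 : ℤ) * (A 1 1 : ℤ) = (e : ℚ)
      exact_mod_cast rfl
  refine (siegelStabilizer.mul_mem_cancel_left h1).1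
    ((siegelStabilizer.mul_mem_cancel_left h2).1 ?_)
  rw [h3]
  exact upper_mem_siegelStabilizer' hae d3

/-! ### Invariance under `Π'_ℚ` -/

theorem ratFun_comp_map (φ : LCc X1) (γ : GL(2, ℚ)⁺) (q : Fin 2 → ℚ) :
    ratFun (LCc.comp (rightMul (Matrix.GeneralLinearGroup.map (algebraMap ℚ Af) γ.1)) φ) q =
      ratFun φ (Matrix.vecMul q γ.1.1) := by
  rw [ratFun, ratFun, extendZero_comp]
  congr 1
  funext i
  simp [ratPoint, Matrix.vecMul, dotProduct]

theorem siegelDistribution_star {σ : AutM} {γ : GL(2, ℚ)⁺} (hσ : IsStarAction σ γ)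
    {A : ModularUnits Qbar →* ModularUnits Qbar} (hA : IsUnitAction σ A) (φ : LCc X1) :
    QModularUnits.map A (QModularUnits.map unitsInclusion (siegelDistribution
      (LCc.comp (rightMul (Matrix.GeneralLinearGroup.map (algebraMap ℚ Af) γ.1)) φ))) =
        QModularUnits.map unitsInclusion (siegelDistribution φ) := by
  apply map_inclTop_injective Qbar
  have h1 : (inclTop Qbar).comp A = (compUnit γ).comp (inclTop Qbar) := by
    refine MonoidHom.ext fun u => unitFun_injective ?_
    obtain ⟨h2, h3⟩ := hσ.exists_unit (u : modularFunctions Qbar).2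
    exact UnitActs.unique (u : modularFunctions Qbar).2 (A u : modularFunctions Qbar).2 h2
      (hA u) h3
  have h2 : (inclTop Qbar).comp unitsInclusion = inclTop Qcycl := rfl
  have h3 : γ ∈ siegelStabilizer := siegelStabilizer_eq_top ▸ Subgroup.mem_top γ
  rw [QModularUnits.map_map, h1, ← QModularUnits.map_map, QModularUnits.map_map _ unitsInclusion,
    QModularUnits.map_map _ unitsInclusion, h2, siegelDistribution_apply,
    siegelDistribution_apply, funext (ratFun_comp_map φ γ)]
  exact h3 _ (exists_isGood φ)

/-- The pairs `(σ, g)` for which the Siegel distribution is invariant. -/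
def invariantPairs : Subgroup (AutM × (GL (Fin 2) Af)ᵐᵒᵖ) where
  carrier := {p | (∃ A, IsUnitAction p.1 A) ∧ (∃ A, IsUnitAction p.1⁻¹ A) ∧
    ∀ A, IsUnitAction p.1 A → ∀ φ : LCc X1, QModularUnits.map A (QModularUnits.map unitsInclusion
      (siegelDistribution (LCc.comp (rightMul p.2.unop) φ))) =
        QModularUnits.map unitsInclusion (siegelDistribution φ)}
  mul_mem' := by
    rintro ⟨σ, g⟩ ⟨ρ, k⟩ ⟨⟨A, hA⟩, ⟨A', hA'⟩, h⟩ ⟨⟨B, hB⟩, ⟨B', hB'⟩, h'⟩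
    refine ⟨⟨_, hA.comp hB⟩, ⟨B'.comp A', ?_⟩, fun C hC φ => ?_⟩
    · change IsUnitAction (σ * ρ)⁻¹ _
      rw [mul_inv_rev]
      exact hB'.comp hA'
    · rw [hC.unique (hA.comp hB), ← QModularUnits.map_map, ← h A hA φ,
        ← h' B hB (LCc.comp (rightMul g.unop) φ)]
      refine congrArg (fun ψ => QModularUnits.map A (QModularUnits.map B
        (QModularUnits.map unitsInclusion (siegelDistribution ψ)))) ?_
      refine Subtype.ext (funext fun x => congrArg φ.1 (Subtype.ext ?_))
      change Matrix.vecMul x.1 (k.unop * g.unop).1 =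
        Matrix.vecMul (Matrix.vecMul x.1 k.unop.1) g.unop.1
      rw [Units.val_mul, Matrix.vecMul_vecMul]
  one_mem' := by
    refine ⟨⟨_, isUnitAction_one⟩, ⟨_, isUnitAction_one⟩, fun A hA φ => ?_⟩
    rw [hA.unique isUnitAction_one, QModularUnits.map_id]
    congr 2
    refine Subtype.ext (funext fun x => congrArg φ.1 (Subtype.ext ?_))
    exact Matrix.vecMul_one x.1
  inv_mem' := by
    rintro ⟨σ, g⟩ ⟨⟨A, hA⟩, ⟨A', hA'⟩, h⟩
    refine ⟨⟨A', hA'⟩, ⟨A, ?_⟩, fun C hC φ => ?_⟩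
    · change IsUnitAction σ⁻¹⁻¹ A
      rwa [inv_inv]
    · have h1 : C.comp A = MonoidHom.id _ := by
        refine IsUnitAction.unique (σ := σ⁻¹ * σ) (hC.comp hA) ?_
        rw [inv_mul_cancel]
        exact isUnitAction_one
      change QModularUnits.map C (QModularUnits.map unitsInclusion
        (siegelDistribution (LCc.comp (rightMul g.unop⁻¹) φ))) = _
      rw [← h A hA, QModularUnits.map_map, h1, QModularUnits.map_id]
      congr 2
      refine Subtype.ext (funext fun x => congrArg φ.1 (Subtype.ext ?_))
      exact vecMul_vecMul_inv g.unop x.1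

theorem adelicGraph_le_invariantPairs : adelicGraph ≤ invariantPairs := by
  refine (Subgroup.closure_le _).2 ?_
  rintro ⟨σ, g⟩ (⟨γ, hγ, hg⟩ | ⟨hσ, hh⟩)
  · obtain rfl : g = MulOpposite.op _ := hg
    exact ⟨hγ.unitActs.exists_isUnitAction, hγ.inv.unitActs.exists_isUnitAction,
      fun A hA φ => siegelDistribution_star hγ hA φ⟩
  · exact ⟨(unitActs_of_mem_PiQ hσ).exists_isUnitAction,
      (unitActs_of_mem_PiQ (PiQ.inv_mem hσ)).exists_isUnitAction,
      fun A hA φ => siegelDistribution_actsAs hσ hh hA φ⟩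

/-- Every element of `Π'_ℚ` has an image in `GL₂(ℚ ⊗ ℤ^)`. -/
theorem exists_mem_adelicGraph {σ : AutM} (hσ : σ ∈ PiQ') :
    ∃ g : GL (Fin 2) Af, (σ, MulOpposite.op g) ∈ adelicGraph := by
  have hle : PiQ' ≤ adelicGraph.map (MonoidHom.fst _ _) := by
    refine (Subgroup.closure_le _).2 ?_
    rintro σ (hσ | ⟨γ, hγ⟩)
    · obtain ⟨h, hh⟩ := exists_actsAs hσ
      exact ⟨(σ, MulOpposite.op h), Subgroup.subset_closure (Or.inr ⟨hσ, hh⟩), rfl⟩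
    · exact ⟨(σ, _), Subgroup.subset_closure (Or.inl ⟨γ, hγ, rfl⟩), rfl⟩
  obtain ⟨⟨ρ, g⟩, h, rfl⟩ := hle hσ
  exact ⟨g.unop, h⟩

end

end SiegelDistribution

end

open SiegelDistribution in
theorem mainTheorem10 :
    ∃ z : AlgDistribution X1 (QModularUnits Qcycl),
      (∀ (r a b : ℚ) (hr : r ≠ 0)
        (hab : ¬ ((∃ m : ℤ, a = r * m) ∧ ∃ m : ℤ, b = r * m)),
        IsSiegelUnit (r⁻¹ * a) (r⁻¹ * b) (z (boxIndicator r a b hr hab))) ∧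
      ∀ σ ∈ PiQ',
        (∃ A : ModularUnits Qbar →* ModularUnits Qbar, IsUnitAction σ A) ∧
        (∃ g : GL (Fin 2) Af, (σ, MulOpposite.op g) ∈ adelicGraph) ∧
        ∀ (A : ModularUnits Qbar →* ModularUnits Qbar) (g : GL (Fin 2) Af),
          IsUnitAction σ A → (σ, MulOpposite.op g) ∈ adelicGraph →
          AlgDistribution.act (QModularUnits.map unitsInclusion ∘ₗ z) g (QModularUnits.map A) =
            QModularUnits.map unitsInclusion ∘ₗ z := by
  refine ⟨siegelDistribution, fun r a b hr hab => siegelDistribution_box hr hab, fun σ hσ =>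
    ⟨(unitActs_of_mem_PiQ' hσ).exists_isUnitAction, exists_mem_adelicGraph hσ,
      fun A g hA hg => LinearMap.ext fun φ => ?_⟩⟩
  have h := (adelicGraph_le_invariantPairs hg).2.2 A hA φ
  refine Eq.trans ?_ h
  change QModularUnits.map A (QModularUnits.map unitsInclusion
    (siegelDistribution (LCc.comp (rightMul g⁻¹⁻¹) φ))) = _
  rw [inv_inv]
  rfl
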